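/- Let $q\in\mathbb{C}^\times$ not be a root of unity, fix a square root $q^{1/2}$, put $\hat q=q-q^{-1}$, and let all indices run over $\{1,2\}$ (repeated indices are summed). Let $\hat R^{ij}_{kl}=\delta^i_l\delta^j_k\,q^{\delta_{ij}-1/2}+q^{-1/2}\hat q\,\delta^i_1\delta^k_1\delta^j_2\delta^l_2$, let $\check C^{12}=q^{-1/2}$, $\check C^{21}=-q^{1/2}$, $\check C^{11}=\check C^{22}=0$, and let $\mathcal A=\mathcal O(SL_q(2))$ be the algebra with generators $u^i_j$ and relations $\hat R^{ij}_{kl}u^k_mu^l_n=u^i_ku^j_l\hat R^{kl}_{mn}$, $u^1_1u^2_2-q\,u^1_2u^2_1=1$, with coproduct $\Delta u^i_j=u^i_k\otimes u^k_j$. For a sign $\epsilon=\pm1$ let $(\Gamma,\mathrm d)$ be the bicovariant $4D_\epsilon$-calculus: $\Gamma$ is the $\mathcal A$-bimodule that is free as a left module on $\theta_{ij}$, with $\theta_{ij}u^k_l=\epsilon\,\hat R^{mr}_{it}(\hat R^{-1})^{ts}_{jl}\,u^k_m\theta_{rs}$, with coactions determined by $\Delta_L(\theta_{ij})=1\otimes\theta_{ij}$,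 $\Delta_R(\theta_{ij})=\theta_{kl}\otimes u^k_iu^l_j$, and $\mathrm da=\theta a-a\theta$ where $\theta=\frac{q^{1/2}}{\hat q}\check C^{ij}\theta_{ij}$. For a matrix $T$ we also write $T$ for the left $\mathcal A$-linear map of $\Gamma\otimes_{\mathcal A}\Gamma$ with $T(\theta_{kl}\otimes\theta_{mn})=T^{rstx}_{klmn}\,\theta_{rs}\otimes\theta_{tx}$. Let $\sigma=\hat R_{23}\hat R_{12}\hat R^{-1}_{34}\hat R^{-1}_{23}$ (leg numbering) be the canonical braiding of $\Gamma$. Let $g:\Gamma\otimes_{\mathcal A}\Gamma\to\mathcal A$ be a bicovariant $\sigma$-metric, i.e. a non-degenerate homomorphism of bicovariant $\mathcal A$-bimodules with $g\sigma=g$ and $g_{12}\sigma^{\pm1}_{23}\sigma^{\pm1}_{12}=g_{23}$ (no compatibility with an involution is required). Let $\mathrm{Cl}(\Gamma,\sigma,g)$ be the quotient of the tensor algebra $\Gamma^{\otimes_{\mathcal A}}$ of the bimodule $\Gamma$ by the two-sided ideal generated by all $\rho_2-g(\rho_2)$, $\rho_2\in\ker(\mathrm{id}-\sigma)$. A left connection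 on an $\mathcal A$-bimodule $\mathcal C$ is an additive map $\nabla:\mathcal C\to\Gamma\otimes_{\mathcal A}\mathcal C$ with $\nabla(a\rho)=\mathrm da\otimes\rho+a\nabla(\rho)$. It is linear if there is a bimodule homomorphism $\tilde\sigma:\mathcal C\otimes_{\mathcal A}\Gamma\to\Gamma\otimes_{\mathcal A}\mathcal C$ with $\tilde\sigma(\rho\otimes\mathrm da)=\nabla(\rho a)-\nabla(\rho)a$ for all $\rho\in\mathcal C$, $a\in\mathcal A$. A linear left connection $\nabla$ on $\Gamma$ is compatible with the multiplication of $\mathrm{Cl}(\Gamma,\sigma,g)$ if its extension to the tensor algebra by the product rule descends to $\mathrm{Cl}=\mathrm{Cl}(\Gamma,\sigma,g)$; that is, if there is a linear left connection $\nabla'$ on the bimodule $\mathrm{Cl}$ with associated $\tilde\sigma'$ such that $\nabla'(xy)=(\mathrm{id}\otimes\cdot)\bigl(\nabla'(x)\otimes y+(\tilde\sigma'\otimes\mathrm{id})(x\otimes\nabla'(y))\bigr)$ for $x,y\in\mathrm{Cl}$, and such that $\nabla'(a)=\mathrm da\otimes1$ for $a\in\mathcal A$ and $\nabla'(\rho)$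 is the image of $\nabla(\rho)$ for $\rho\in\Gamma$. **Proposition.** There are exactly $8$ linear left connections $\nabla$ on $\Gamma$ that are compatible with the multiplication of $\mathrm{Cl}(\Gamma,\sigma,g)$. They are precisely the maps $$\nabla(\rho)=\theta\otimes\rho-\tilde\sigma(\rho\otimes\theta),\qquad \tilde\sigma=\nu\,\hat R_{23}\,\hat R^{\eta}_{12}\,\hat R^{\eta'}_{34}\,\hat R^{-1}_{23},\qquad \nu,\eta,\eta'\in\{1,-1\},$$ and each such $\tilde\sigma$ is a bimodule homomorphism with $\tilde\sigma(\rho\otimes\mathrm da)=\nabla(\rho a)-\nabla(\rho)a$. -/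

import Mathlib

open scoped TensorProduct
open MulOpposite

noncomputable section

set_option linter.unusedSectionVars false

/-! ### Bimodules over a noncommutative ring and their balanced tensor product -/

namespace QClifford

section Balanced

variable (A : Type*) [Ring A]
variable (M : Type*) [AddCommGroup M] [Module A M] [Module Aᵐᵒᵖ M] [SMulCommClass A Aᵐᵒᵖ M]
variable (N : Type*) [AddCommGroup N] [Module A N] [Module Aᵐᵒᵖ N] [SMulCommClass A Aᵐᵒᵖ N]

/-- The subgroup of `M ⊗ N` generated by all `(m · a) ⊗ n - m ⊗ (a · n)`. -/
def balRel : Submodule ℤ (M ⊗[ℤ] N) :=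
  Submodule.span ℤ {x | ∃ (m : M) (a : A) (n : N), x = (op a • m) ⊗ₜ[ℤ] n - m ⊗ₜ[ℤ] (a • n)}

/-- The tensor product `M ⊗_A N` of two `A`-bimodules over the (noncommutative) ring `A`. -/
def BalTensor : Type _ := (M ⊗[ℤ] N) ⧸ balRel A M N

instance : AddCommGroup (BalTensor A M N) :=
  inferInstanceAs (AddCommGroup ((M ⊗[ℤ] N) ⧸ balRel A M N))

variable {M N}

/-- The quotient map. -/
def balMk : M ⊗[ℤ] N →+ BalTensor A M N := (balRel A M N).mkQ.toAddMonoidHom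

/-- The elementary tensor `m ⊗_A n`. -/
def btmul (m : M) (n : N) : BalTensor A M N := balMk A (m ⊗ₜ[ℤ] n)

variable {A}

theorem btmul_add_left (m m' : M) (n : N) :
    btmul A (m + m') n = btmul A m n + btmul A m' n := by
  unfold btmul
  rw [TensorProduct.add_tmul, map_add]

theorem btmul_add_right (m : M) (n n' : N) :
    btmul A m (n + n') = btmul A m n + btmul A m n' := by
  unfold btmul
  rw [TensorProduct.tmul_add, map_add]

theorem btmul_balance (m : M) (a : A) (n : N) :
    btmul A (op a • m) n = btmul A m (a • n) := by
  unfold btmul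
  rw [← sub_eq_zero, ← map_sub]
  exact (Submodule.Quotient.mk_eq_zero _).2 (Submodule.subset_span ⟨m, a, n, rfl⟩)

/-- `M ⊗_A N` is generated by the elementary tensors. -/
theorem bal_induction {p : BalTensor A M N → Prop} (h0 : p 0)
    (ht : ∀ m n, p (btmul A m n)) (ha : ∀ x y, p x → p y → p (x + y)) (x) : p x := by
  obtain ⟨y, rfl⟩ : ∃ y, balMk A y = x := Submodule.mkQ_surjective _ x
  induction y using TensorProduct.induction_on with
  | zero => rw [map_zero]; exact h0
  | tmul m n => exact ht m n
  | add y z hy hz => rw [map_add]; exact ha _ _ hy hz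

/-- The universal property: an `A`-balanced biadditive map factors through `M ⊗_A N`. -/
def balLift {P : Type*} [AddCommGroup P] (f : M →+ N →+ P)
    (hf : ∀ m (a : A) n, f (op a • m) n = f m (a • n)) : BalTensor A M N →+ P :=
  ((balRel A M N).liftQ
    (AddMonoidHom.toIntLinearMap
      (TensorProduct.liftAddHom (R := ℤ) f (fun r m n => by simp) : M ⊗[ℤ] N →+ P)) (by
      rw [balRel, Submodule.span_le]
      rintro x ⟨m, a, n, rfl⟩
      simp [hf])).toAddMonoidHom

@[simp] theorem balLift_btmul {P : Type*} [AddCommGroup P] (f : M →+ N →+ P)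
    (hf : ∀ m (a : A) n, f (op a • m) n = f m (a • n)) (m : M) (n : N) :
    balLift f hf (btmul A m n) = f m n := rfl

/-- Biadditive maps as iterated additive homomorphisms. -/
def biadd {P Q R : Type*} [AddCommGroup P] [AddCommGroup Q] [AddCommGroup R] (f : P → Q → R)
    (h1 : ∀ p p' q, f (p + p') q = f p q + f p' q)
    (h2 : ∀ p q q', f p (q + q') = f p q + f p q') : P →+ Q →+ R :=
  AddMonoidHom.mk' (fun p => AddMonoidHom.mk' (f p) (h2 p)) (fun p p' => by
    ext q; exact h1 p p' q)

@[simp] theorem biadd_apply {P Q R : Type*} [AddCommGroup P] [AddCommGroup Q] [AddCommGroup R]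
    (f : P → Q → R) (h1 : ∀ p p' q, f (p + p') q = f p q + f p' q)
    (h2 : ∀ p q q', f p (q + q') = f p q + f p q') (p : P) (q : Q) :
    biadd f h1 h2 p q = f p q := rfl

theorem bal_hom_ext {P : Type*} [AddCommGroup P] {f g : BalTensor A M N →+ P}
    (h : ∀ m n, f (btmul A m n) = g (btmul A m n)) : f = g := by
  ext x
  induction x using bal_induction with
  | h0 => simp
  | ht m n => exact h m n
  | ha x y hx hy => rw [map_add, map_add, hx, hy]

/-- Left multiplication by `a` on the first tensor factor. -/
def lmulHom (a : A) : BalTensor A M N →+ BalTensor A M N :=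
  balLift (biadd (fun m n => btmul A (a • m) n)
    (fun p p' q => by rw [smul_add, btmul_add_left]) (fun p q q' => btmul_add_right _ _ _))
    (fun m b n => by simp [← btmul_balance, smul_comm a (op b) m])

/-- Right multiplication by `a` on the second tensor factor. -/
def rmulHom (a : Aᵐᵒᵖ) : BalTensor A M N →+ BalTensor A M N :=
  balLift (biadd (fun m n => btmul A m (a • n))
    (fun p p' q => btmul_add_left _ _ _) (fun p q q' => by rw [smul_add, btmul_add_right]))
    (fun m b n => by simp [btmul_balance, smul_comm b a n])

@[simp] theorem lmulHom_btmul (a : A) (m : M) (n : N) :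
    lmulHom a (btmul A m n) = btmul A (a • m) n := rfl

@[simp] theorem rmulHom_btmul (a : Aᵐᵒᵖ) (m : M) (n : N) :
    rmulHom a (btmul A m n) = btmul A m (a • n) := rfl

instance : Module A (BalTensor A M N) where
  smul a x := lmulHom a x
  one_smul x := DFunLike.congr_fun (show lmulHom (1 : A) = AddMonoidHom.id (BalTensor A M N) from
    bal_hom_ext fun m n => by simp) x
  mul_smul a b x := DFunLike.congr_fun
    (show lmulHom (a * b) = (lmulHom a).comp (lmulHom b : BalTensor A M N →+ _) from
      bal_hom_ext fun m n => by simp [mul_smul]) x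
  smul_zero a := map_zero (lmulHom a)
  smul_add a := map_add (lmulHom a)
  add_smul a b x := DFunLike.congr_fun
    (show lmulHom (a + b) = lmulHom a + (lmulHom b : BalTensor A M N →+ _) from
      bal_hom_ext fun m n => by simp [add_smul, btmul_add_left]) x
  zero_smul x := DFunLike.congr_fun (show lmulHom (0 : A) = (0 : BalTensor A M N →+ _) from
    bal_hom_ext fun m n => by
      have h : btmul A (0 : M) n + btmul A (0 : M) n = btmul A (0 : M) n := by
        rw [← btmul_add_left, add_zero]
      simpa using h) x

instance : Module Aᵐᵒᵖ (BalTensor A M N) where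
  smul a x := rmulHom a x
  one_smul x := DFunLike.congr_fun
    (show rmulHom (1 : Aᵐᵒᵖ) = AddMonoidHom.id (BalTensor A M N) from
      bal_hom_ext fun m n => by simp) x
  mul_smul a b x := DFunLike.congr_fun
    (show rmulHom (a * b) = (rmulHom a).comp (rmulHom b : BalTensor A M N →+ _) from
      bal_hom_ext fun m n => by simp [mul_smul]) x
  smul_zero a := map_zero (rmulHom a)
  smul_add a := map_add (rmulHom a)
  add_smul a b x := DFunLike.congr_fun
    (show rmulHom (a + b) = rmulHom a + (rmulHom b : BalTensor A M N →+ _) from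
      bal_hom_ext fun m n => by simp [add_smul, btmul_add_right]) x
  zero_smul x := DFunLike.congr_fun (show rmulHom (0 : Aᵐᵒᵖ) = (0 : BalTensor A M N →+ _) from
    bal_hom_ext fun m n => by
      have h : btmul A m (0 : N) + btmul A m (0 : N) = btmul A m (0 : N) := by
        rw [← btmul_add_right, add_zero]
      simpa using h) x

theorem smul_btmul (a : A) (m : M) (n : N) : a • btmul A m n = btmul A (a • m) n :=
  balLift_btmul _ _ m n

theorem op_smul_btmul (a : Aᵐᵒᵖ) (m : M) (n : N) : a • btmul A m n = btmul A m (a • n) :=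
  balLift_btmul _ _ m n

instance : SMulCommClass A Aᵐᵒᵖ (BalTensor A M N) where
  smul_comm a b x := by
    induction x using bal_induction with
    | h0 => simp
    | ht m n => simp only [smul_btmul, op_smul_btmul]
    | ha x y hx hy => simp only [smul_add, hx, hy]

end Balanced

/-- Homomorphisms of `A`-bimodules. -/
structure BimodHom (A : Type*) [Ring A] (M : Type*) [AddCommGroup M] [Module A M] [Module Aᵐᵒᵖ M]
    (N : Type*) [AddCommGroup N] [Module A N] [Module Aᵐᵒᵖ N] where
  toFun : M →+ N
  map_left : ∀ (a : A) (m : M), toFun (a • m) = a • toFun m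
  map_right : ∀ (a : A) (m : M), toFun (op a • m) = op a • toFun m

instance (A : Type*) [Ring A] (M : Type*) [AddCommGroup M] [Module A M] [Module Aᵐᵒᵖ M]
    (N : Type*) [AddCommGroup N] [Module A N] [Module Aᵐᵒᵖ N] :
    CoeFun (BimodHom A M N) (fun _ => M → N) := ⟨fun f => f.toFun⟩

/-! ### Left connections and linear left connections on bimodules -/

section Connections

variable {A : Type*} [Ring A]
variable {Γ : Type*} [AddCommGroup Γ] [Module A Γ] [Module Aᵐᵒᵖ Γ] [SMulCommClass A Aᵐᵒᵖ Γ]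
variable {C : Type*} [AddCommGroup C] [Module A C] [Module Aᵐᵒᵖ C] [SMulCommClass A Aᵐᵒᵖ C]

/-- `∇ : C → Γ ⊗_A C` is a left connection: `∇(a ρ) = da ⊗ ρ + a ∇ρ`. -/
def IsLeftConnection (d : A →+ Γ) (nabla : C →+ BalTensor A Γ C) : Prop :=
  ∀ (a : A) (ρ : C), nabla (a • ρ) = btmul A (d a) ρ + a • nabla ρ

/-- The bimodule homomorphism `τ : C ⊗_A Γ → Γ ⊗_A C` satisfies
`τ(ρ ⊗ da) = ∇(ρ a) - (∇ρ) a`. -/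
def IsConnectionFlip (d : A →+ Γ) (nabla : C →+ BalTensor A Γ C)
    (τ : BimodHom A (BalTensor A C Γ) (BalTensor A Γ C)) : Prop :=
  ∀ (a : A) (ρ : C), τ (btmul A ρ (d a)) = nabla (op a • ρ) - op a • nabla ρ

/-- A linear left connection on the bimodule `C`. -/
def IsLinearLeftConnection (d : A →+ Γ) (nabla : C →+ BalTensor A Γ C) : Prop :=
  IsLeftConnection d nabla ∧ ∃ τ, IsConnectionFlip d nabla τ

end Connections

/-! ### The tensor algebra of a bimodule and quantum Clifford algebras -/

section Clifford

variable (A : Type*) [Ring A]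
variable (Γ : Type*) [AddCommGroup Γ] [Module A Γ] [Module Aᵐᵒᵖ Γ] [SMulCommClass A Aᵐᵒᵖ Γ]

/-- The relations which turn the free ring on the abelian group `A × Γ` into the tensor algebra
`A ⊕ Γ ⊕ (Γ ⊗_A Γ) ⊕ ⋯` of the bimodule `Γ`. -/
inductive TensRel : TensorAlgebra ℤ (A × Γ) → TensorAlgebra ℤ (A × Γ) → Prop
  | one : TensRel (TensorAlgebra.ι ℤ ((1 : A), (0 : Γ))) 1
  | mul (a b : A) : TensRel
      (TensorAlgebra.ι ℤ (a, (0 : Γ)) * TensorAlgebra.ι ℤ (b, (0 : Γ)))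
      (TensorAlgebra.ι ℤ (a * b, (0 : Γ)))
  | left (a : A) (γ : Γ) : TensRel
      (TensorAlgebra.ι ℤ (a, (0 : Γ)) * TensorAlgebra.ι ℤ ((0 : A), γ))
      (TensorAlgebra.ι ℤ ((0 : A), a • γ))
  | right (a : A) (γ : Γ) : TensRel
      (TensorAlgebra.ι ℤ ((0 : A), γ) * TensorAlgebra.ι ℤ (a, (0 : Γ)))
      (TensorAlgebra.ι ℤ ((0 : A), op a • γ))

/-- The tensor algebra `Γ^⊗` of the `A`-bimodule `Γ`. -/
def BimodTensorAlgebra : Type _ := RingQuot (TensRel A Γ)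

instance : Ring (BimodTensorAlgebra A Γ) := inferInstanceAs (Ring (RingQuot (TensRel A Γ)))

variable {A Γ}

theorem tens_eq {x y : TensorAlgebra ℤ (A × Γ)} (h : TensRel A Γ x y) :
    RingQuot.mkRingHom (TensRel A Γ) x = RingQuot.mkRingHom (TensRel A Γ) y :=
  RingQuot.mkRingHom_rel h

/-- The embedding of `Γ` as the degree one part of the tensor algebra. -/
def tensGam : Γ →+ BimodTensorAlgebra A Γ :=
  AddMonoidHom.mk' (fun γ => RingQuot.mkRingHom (TensRel A Γ) (TensorAlgebra.ι ℤ ((0 : A), γ)))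
    (fun γ γ' => by
      have h : ((0 : A), γ + γ') = ((0 : A), γ) + ((0 : A), γ') := by simp
      rw [h, map_add, map_add]
      rfl)

/-- The embedding of `A` as the degree zero part of the tensor algebra. -/
def tensAlg : A →+* BimodTensorAlgebra A Γ where
  toFun a := RingQuot.mkRingHom (TensRel A Γ) (TensorAlgebra.ι ℤ (a, (0 : Γ)))
  map_one' := (tens_eq TensRel.one).trans (map_one _)
  map_mul' a b := (tens_eq (TensRel.mul a b)).symm.trans (map_mul _ _ _)
  map_zero' := by
    have h : ((0 : A), (0 : Γ)) = 0 := rfl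
    rw [h, map_zero, map_zero]
    rfl
  map_add' a b := by
    have h : (a + b, (0 : Γ)) = (a, (0 : Γ)) + (b, (0 : Γ)) := by simp
    rw [h, map_add, map_add]
    rfl

theorem tensAlg_mul_tensGam (a : A) (γ : Γ) : tensAlg a * tensGam γ = tensGam (A := A) (a • γ) :=
  (map_mul _ _ _).symm.trans (tens_eq (TensRel.left a γ))

theorem tensGam_mul_tensAlg (a : A) (γ : Γ) :
    tensGam γ * tensAlg a = tensGam (A := A) (op a • γ) :=
  (map_mul _ _ _).symm.trans (tens_eq (TensRel.right a γ))

/-- The canonical map of `Γ ⊗_A Γ` into the tensor algebra, `γ ⊗ γ' ↦ γ γ'`. -/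
def tensTwo : BalTensor A Γ Γ →+ BimodTensorAlgebra A Γ :=
  balLift (biadd (fun γ γ' => tensGam γ * tensGam γ')
    (fun p p' q => by rw [map_add, add_mul]) (fun p q q' => by rw [map_add, mul_add]))
    (fun m a n => by
      simp only [biadd_apply]
      rw [← tensGam_mul_tensAlg, ← tensAlg_mul_tensGam, mul_assoc])

/-- The relations `ρ₂ = g(ρ₂)` for `ρ₂ ∈ ker (id - σ)`. -/
inductive CliffordRel (σ : BalTensor A Γ Γ →+ BalTensor A Γ Γ) (g : BimodHom A (BalTensor A Γ Γ) A) :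
    BimodTensorAlgebra A Γ → BimodTensorAlgebra A Γ → Prop
  | of (x : BalTensor A Γ Γ) (hx : σ x = x) : CliffordRel σ g (tensTwo x) (tensAlg (g x))

/-- The quantum Clifford algebra `Cl(Γ, σ, g)`. -/
def QCl (σ : BalTensor A Γ Γ →+ BalTensor A Γ Γ) (g : BimodHom A (BalTensor A Γ Γ) A) : Type _ :=
  RingQuot (CliffordRel σ g)

variable (σ : BalTensor A Γ Γ →+ BalTensor A Γ Γ) (g : BimodHom A (BalTensor A Γ Γ) A)

instance : Ring (QCl σ g) := inferInstanceAs (Ring (RingQuot (CliffordRel σ g)))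

/-- The quotient map of the tensor algebra onto the quantum Clifford algebra. -/
def clMk : BimodTensorAlgebra A Γ →+* QCl σ g := RingQuot.mkRingHom (CliffordRel σ g)

/-- The canonical map `A → Cl(Γ, σ, g)`. -/
def clAlg : A →+* QCl σ g := (clMk σ g).comp tensAlg

/-- The canonical map `Γ → Cl(Γ, σ, g)`. -/
def clGam : Γ →+ QCl σ g := (clMk σ g).toAddMonoidHom.comp tensGam

instance : Module A (QCl σ g) := Module.compHom (QCl σ g) (clAlg σ g)

instance : Module Aᵐᵒᵖ (QCl σ g) := Module.compHom (QCl σ g) (clAlg σ g).op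

theorem smul_cl (a : A) (x : QCl σ g) : a • x = clAlg σ g a * x := rfl

theorem op_smul_cl (a : A) (x : QCl σ g) : op a • x = x * clAlg σ g a := rfl

instance : SMulCommClass A Aᵐᵒᵖ (QCl σ g) where
  smul_comm a b x := by
    obtain ⟨b, rfl⟩ := op_surjective b
    simp only [smul_cl, op_smul_cl, mul_assoc]

variable {σ g}

theorem clGam_left (a : A) (γ : Γ) : clGam σ g (a • γ) = a • clGam σ g γ := by
  change clMk σ g (tensGam (a • γ)) = clMk σ g (tensAlg a) * clMk σ g (tensGam γ)
  rw [← tensAlg_mul_tensGam, map_mul]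

/-- The map `id ⊗ ι : Γ ⊗_A Γ → Γ ⊗_A Cl`. -/
def idTensorCl : BalTensor A Γ Γ →+ BalTensor A Γ (QCl σ g) :=
  balLift (biadd (fun γ γ' => btmul A γ (clGam σ g γ'))
    (fun p p' q => btmul_add_left _ _ _) (fun p q q' => by rw [map_add, btmul_add_right]))
    (fun m a n => by simp only [biadd_apply, clGam_left, btmul_balance])

/-- The map `y ↦ (id ⊗ ∘)(y ⊗ x)` on `Γ ⊗_A Cl`: multiplication of the Clifford factor by `x`
from the right. -/
def mulCl (x : QCl σ g) : BalTensor A Γ (QCl σ g) →+ BalTensor A Γ (QCl σ g) :=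
  balLift (biadd (fun γ y => btmul A γ (y * x))
    (fun p p' q => btmul_add_left _ _ _) (fun p q q' => by rw [add_mul, btmul_add_right]))
    (fun m a n => by simp only [biadd_apply, btmul_balance, smul_cl, mul_assoc])

@[simp] theorem mulCl_btmul (x : QCl σ g) (γ : Γ) (y : QCl σ g) :
    mulCl x (btmul A γ y) = btmul A γ (y * x) := balLift_btmul _ _ _ _

theorem mulCl_add (x x' : QCl σ g) (z : BalTensor A Γ (QCl σ g)) :
    mulCl (x + x') z = mulCl x z + mulCl x' z :=
  DFunLike.congr_fun (show mulCl (x + x') = mulCl x + mulCl x' from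
    bal_hom_ext fun m n => by simp [mul_add, btmul_add_right]) z

theorem mulCl_smul (a : A) (x : QCl σ g) (z : BalTensor A Γ (QCl σ g)) :
    mulCl x (op a • z) = mulCl (a • x) z := by
  induction z using bal_induction with
  | h0 => simp
  | ht m n => simp only [op_smul_btmul, mulCl_btmul, smul_cl, op_smul_cl, mul_assoc]
  | ha y z hy hz => rw [smul_add, map_add, map_add, hy, hz]

/-- The map `y ↦ (id ⊗ ∘)(τ ⊗ id)(ρ ⊗ y)` on `Γ ⊗_A Cl`, that is,
`γ ⊗ x ↦ τ(ρ ⊗ γ) x`. -/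
def flipMulCl (τ : BimodHom A (BalTensor A (QCl σ g) Γ) (BalTensor A Γ (QCl σ g)))
    (ρ : QCl σ g) : BalTensor A Γ (QCl σ g) →+ BalTensor A Γ (QCl σ g) :=
  balLift (biadd (fun γ x => mulCl x (τ (btmul A ρ γ)))
    (fun p p' q => by rw [btmul_add_right, map_add, map_add]) (fun p q q' => mulCl_add _ _ _))
    (fun m a n => by
      simp only [biadd_apply]
      rw [← op_smul_btmul, τ.map_right, mulCl_smul])

/-- A linear left connection on the bimodule algebra `Cl(Γ, σ, g)`. -/
def IsLinearLeftConnectionCl (d : A →+ Γ) (nabla : QCl σ g →+ BalTensor A Γ (QCl σ g)) : Prop :=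
  IsLeftConnection d nabla ∧
  ∃ τ : BimodHom A (BalTensor A (QCl σ g) Γ) (BalTensor A Γ (QCl σ g)),
    IsConnectionFlip d nabla τ ∧
    ∀ ρ ρ' : QCl σ g, nabla (ρ * ρ') = mulCl ρ' (nabla ρ) + flipMulCl τ ρ (nabla ρ')

variable (σ g) in
/-- The linear left connection `∇` on `Γ` is compatible with the multiplication of `Cl(Γ, σ, g)`:
its extension to the tensor algebra, which is `d` on `A` and `∇` on `Γ` and obeys the product rule,
descends to a linear left connection on the bimodule algebra `Cl(Γ, σ, g)`. -/
def IsCliffordCompatible (d : A →+ Γ) (nabla : Γ →+ BalTensor A Γ Γ) : Prop :=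
  ∃ nablaCl : QCl σ g →+ BalTensor A Γ (QCl σ g),
    IsLinearLeftConnectionCl d nablaCl ∧
    (∀ a : A, nablaCl (clAlg σ g a) = btmul A (d a) 1) ∧
    ∀ ρ : Γ, nablaCl (clGam σ g ρ) = idTensorCl (nabla ρ)

end Clifford

/-! ### The coordinate algebra of the quantum group `SL_q(2)` -/

section SLq

open scoped Matrix

/-- The index set of the basis `θ_{ij}`, `i, j = 1, 2`. -/
abbrev Idx : Type := Fin 2 × Fin 2

variable (s : ℂˣ)

/-- The matrix `R̂`, with `s = q^{1/2}`; row index `(i, j)`, column index `(k, l)`. -/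
def Rhat : Matrix Idx Idx ℂ := Matrix.of fun a b =>
  (if a.1 = b.2 ∧ a.2 = b.1 then (if a.1 = a.2 then (s : ℂ) else (s : ℂ)⁻¹) else 0) +
  (if a = (0, 1) ∧ b = (0, 1) then (s : ℂ)⁻¹ * ((s : ℂ) ^ 2 - ((s : ℂ) ^ 2)⁻¹) else 0)

/-- The matrix `Č^{ij}`. -/
def Ccheck (i j : Fin 2) : ℂ :=
  if i = 0 ∧ j = 1 then (s : ℂ)⁻¹ else if i = 1 ∧ j = 0 then -(s : ℂ) else 0

/-- The inverse of `R̂`. -/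
def RhatInv : Matrix Idx Idx ℂ := Matrix.of fun a b =>
  (s : ℂ)⁻¹ * (if a = b then 1 else 0) - (s : ℂ) * Ccheck s a.1 a.2 * Ccheck s b.1 b.2

theorem Rhat_mul_RhatInv : Rhat s * RhatInv s = 1 := by
  have hs : (s : ℂ) ≠ 0 := s.ne_zero
  ext ⟨i, j⟩ ⟨k, l⟩
  fin_cases i <;> fin_cases j <;> fin_cases k <;> fin_cases l <;>
    simp [Matrix.mul_apply, Rhat, RhatInv, Ccheck, Fintype.sum_prod_type] <;> (try field_simp) <;> ring

theorem Rhat_entries :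
    Rhat s (0, 0) (0, 0) = s ∧ Rhat s (1, 1) (1, 1) = s ∧
    Rhat s (0, 1) (1, 0) = (s : ℂ)⁻¹ ∧ Rhat s (1, 0) (0, 1) = (s : ℂ)⁻¹ ∧
    Rhat s (0, 1) (0, 1) = (s : ℂ)⁻¹ * ((s : ℂ) ^ 2 - ((s : ℂ) ^ 2)⁻¹) ∧
    Rhat s (1, 0) (1, 0) = 0 ∧
    Rhat s (0, 0) (0, 1) = 0 ∧ Rhat s (0, 0) (1, 0) = 0 ∧ Rhat s (0, 0) (1, 1) = 0 ∧
    Rhat s (0, 1) (0, 0) = 0 ∧ Rhat s (0, 1) (1, 1) = 0 ∧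
    Rhat s (1, 0) (0, 0) = 0 ∧ Rhat s (1, 0) (1, 1) = 0 ∧
    Rhat s (1, 1) (0, 0) = 0 ∧ Rhat s (1, 1) (0, 1) = 0 ∧ Rhat s (1, 1) (1, 0) = 0 := by
  simp [Rhat]

/-- `R̂^η` for a sign `η`. -/
def RhatPow (η : ℤˣ) : Matrix Idx Idx ℂ := if η = 1 then Rhat s else RhatInv s

/-- The defining relations of `O(SL_q(2))` in the generators `u^i_j`. -/
inductive SLqRel : FreeAlgebra ℂ (Fin 2 × Fin 2) → FreeAlgebra ℂ (Fin 2 × Fin 2) → Prop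
  | rtt (i j m n : Fin 2) : SLqRel
      (∑ k, ∑ l, Rhat s (i, j) (k, l) • (FreeAlgebra.ι ℂ (k, m) * FreeAlgebra.ι ℂ (l, n)))
      (∑ k, ∑ l, Rhat s (k, l) (m, n) • (FreeAlgebra.ι ℂ (i, k) * FreeAlgebra.ι ℂ (j, l)))
  | det : SLqRel
      (FreeAlgebra.ι ℂ (0, 0) * FreeAlgebra.ι ℂ (1, 1) -
        (s : ℂ) ^ 2 • (FreeAlgebra.ι ℂ (0, 1) * FreeAlgebra.ι ℂ (1, 0))) 1

/-- The coordinate algebra `O(SL_q(2))`, `q = s²`. -/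
def OSLq : Type := RingQuot (SLqRel s)

instance : Ring (OSLq s) := inferInstanceAs (Ring (RingQuot (SLqRel s)))

instance : Algebra ℂ (OSLq s) := inferInstanceAs (Algebra ℂ (RingQuot (SLqRel s)))

/-- The quotient map from the free algebra. -/
def slqMk : FreeAlgebra ℂ (Fin 2 × Fin 2) →ₐ[ℂ] OSLq s := RingQuot.mkAlgHom ℂ (SLqRel s)

/-- The generators `u^i_j`. -/
def u (i j : Fin 2) : OSLq s := slqMk s (FreeAlgebra.ι ℂ (i, j))

theorem u_rtt (i j m n : Fin 2) :
    ∑ k, ∑ l, Rhat s (i, j) (k, l) • (u s k m * u s l n) =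
      ∑ k, ∑ l, Rhat s (k, l) (m, n) • (u s i k * u s j l) := by
  have h : slqMk s _ = slqMk s _ := RingQuot.mkAlgHom_rel ℂ (SLqRel.rtt i j m n)
  simp only [map_sum, map_smul, map_mul] at h
  exact h

theorem u_det : u s 0 0 * u s 1 1 - (s : ℂ) ^ 2 • (u s 0 1 * u s 1 0) = 1 := by
  have h : slqMk s _ = slqMk s _ := RingQuot.mkAlgHom_rel ℂ (SLqRel.det (s := s))
  simp only [map_sub, map_smul, map_mul, map_one] at h
  exact h

variable {s} in
/-- The universal property of `O(SL_q(2))`. -/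
def slqLift {B : Type*} [Ring B] [Algebra ℂ B] (v : Fin 2 → Fin 2 → B)
    (hr : ∀ i j m n, ∑ k, ∑ l, Rhat s (i, j) (k, l) • (v k m * v l n) =
      ∑ k, ∑ l, Rhat s (k, l) (m, n) • (v i k * v j l))
    (hd : v 0 0 * v 1 1 - (s : ℂ) ^ 2 • (v 0 1 * v 1 0) = 1) : OSLq s →ₐ[ℂ] B :=
  RingQuot.liftAlgHom ℂ ⟨FreeAlgebra.lift ℂ (fun p : Fin 2 × Fin 2 => v p.1 p.2), by
    intro x y h
    cases h with
    | rtt i j m n => simpa only [map_sum, map_smul, map_mul, FreeAlgebra.lift_ι_apply] using hr i j m n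
    | det => simpa only [map_sub, map_smul, map_mul, map_one, FreeAlgebra.lift_ι_apply] using hd⟩

@[simp] theorem slqLift_u {B : Type*} [Ring B] [Algebra ℂ B] (v : Fin 2 → Fin 2 → B)
    (hr : ∀ i j m n, ∑ k, ∑ l, Rhat s (i, j) (k, l) • (v k m * v l n) =
      ∑ k, ∑ l, Rhat s (k, l) (m, n) • (v i k * v j l))
    (hd : v 0 0 * v 1 1 - (s : ℂ) ^ 2 • (v 0 1 * v 1 0) = 1) (i j : Fin 2) :
    slqLift v hr hd (u s i j) = v i j := by
  unfold slqLift u slqMk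
  exact (RingQuot.liftAlgHom_mkAlgHom_apply ℂ _ _ _).trans (FreeAlgebra.lift_ι_apply _ _)

variable {s} in
theorem rtt_map {B C : Type*} [Ring B] [Algebra ℂ B] [Ring C] [Algebra ℂ C] (φ : B →ₐ[ℂ] C)
    (v : Fin 2 → Fin 2 → B)
    (hv : ∀ i j m n, ∑ k, ∑ l, Rhat s (i, j) (k, l) • (v k m * v l n) =
      ∑ k, ∑ l, Rhat s (k, l) (m, n) • (v i k * v j l)) (i j m n : Fin 2) :
    ∑ k, ∑ l, Rhat s (i, j) (k, l) • (φ (v k m) * φ (v l n)) =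
      ∑ k, ∑ l, Rhat s (k, l) (m, n) • (φ (v i k) * φ (v j l)) := by
  have h := congrArg φ (hv i j m n)
  simpa only [map_sum, map_smul, map_mul] using h

variable {s} in
theorem det_map {B C : Type*} [Ring B] [Algebra ℂ B] [Ring C] [Algebra ℂ C] (φ : B →ₐ[ℂ] C)
    (v : Fin 2 → Fin 2 → B) (hv : v 0 0 * v 1 1 - (s : ℂ) ^ 2 • (v 0 1 * v 1 0) = 1) :
    φ (v 0 0) * φ (v 1 1) - (s : ℂ) ^ 2 • (φ (v 0 1) * φ (v 1 0)) = 1 := by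
  have h := congrArg φ hv
  simpa only [map_sub, map_smul, map_mul, map_one] using h

theorem prod_sums {B : Type*} [Ring B] (v w : Fin 2 → Fin 2 → B)
    (hc : ∀ i j k l, Commute (v i j) (w k l)) (k l m n : Fin 2) :
    (∑ a, v k a * w a m) * (∑ b, v l b * w b n) =
      ∑ a, ∑ b, (v k a * v l b) * (w a m * w b n) := by
  rw [Finset.sum_mul_sum]
  refine Finset.sum_congr rfl fun a _ => Finset.sum_congr rfl fun b _ => ?_
  rw [mul_assoc, ← mul_assoc (w a m), ← (hc l b a m).eq, mul_assoc, mul_assoc]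

variable {s} in
theorem rtt_mul {B : Type*} [Ring B] [Algebra ℂ B] (v w : Fin 2 → Fin 2 → B)
    (hc : ∀ i j k l, Commute (v i j) (w k l))
    (hv : ∀ i j m n, ∑ k, ∑ l, Rhat s (i, j) (k, l) • (v k m * v l n) =
      ∑ k, ∑ l, Rhat s (k, l) (m, n) • (v i k * v j l))
    (hw : ∀ i j m n, ∑ k, ∑ l, Rhat s (i, j) (k, l) • (w k m * w l n) =
      ∑ k, ∑ l, Rhat s (k, l) (m, n) • (w i k * w j l)) (i j m n : Fin 2) :
    ∑ k, ∑ l, Rhat s (i, j) (k, l) • ((∑ a, v k a * w a m) * (∑ b, v l b * w b n)) =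
      ∑ k, ∑ l, Rhat s (k, l) (m, n) • ((∑ a, v i a * w a k) * (∑ b, v j b * w b l)) := by
  simp only [prod_sums v w hc]
  calc _ = ∑ a, ∑ b, (∑ k, ∑ l, Rhat s (i, j) (k, l) • (v k a * v l b)) * (w a m * w b n) := by
        simp only [Fin.sum_univ_two, smul_add, add_mul, smul_mul_assoc]
        abel
    _ = ∑ k, ∑ l, (v i k * v j l) * ∑ a, ∑ b, Rhat s (k, l) (a, b) • (w a m * w b n) := by
        simp only [hv]
        simp only [Fin.sum_univ_two, add_mul, mul_add, smul_mul_assoc, mul_smul_comm]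
        abel
    _ = _ := by
        simp only [hw]
        simp only [Fin.sum_univ_two, smul_add, mul_add, mul_smul_comm]
        abel

variable {s} in
theorem det_mul {B : Type*} [Ring B] [Algebra ℂ B] (v w : Fin 2 → Fin 2 → B)
    (hc : ∀ i j k l, Commute (v i j) (w k l))
    (hv : v 0 0 * v 1 1 - (s : ℂ) ^ 2 • (v 0 1 * v 1 0) = 1)
    (hr : ∀ i j m n, ∑ k, ∑ l, Rhat s (i, j) (k, l) • (w k m * w l n) =
      ∑ k, ∑ l, Rhat s (k, l) (m, n) • (w i k * w j l))
    (hw : w 0 0 * w 1 1 - (s : ℂ) ^ 2 • (w 0 1 * w 1 0) = 1) :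
    (∑ a, v 0 a * w a 0) * (∑ b, v 1 b * w b 1) -
      (s : ℂ) ^ 2 • ((∑ a, v 0 a * w a 1) * (∑ b, v 1 b * w b 0)) = 1 := by
  have hs : (s : ℂ) ≠ 0 := s.ne_zero
  have h00 : w 0 0 * w 0 1 = (s : ℂ) ^ 2 • (w 0 1 * w 0 0) := by
    have h := hr 0 0 0 1
    simp only [Fin.sum_univ_two, Rhat_entries, zero_smul, add_zero, zero_add] at h
    linear_combination (norm := skip) ((s : ℂ) ^ 3) • h
    match_scalars <;> field_simp <;> ring
  have h11 : w 1 0 * w 1 1 = (s : ℂ) ^ 2 • (w 1 1 * w 1 0) := by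
    have h := hr 1 1 0 1
    simp only [Fin.sum_univ_two, Rhat_entries, zero_smul, add_zero, zero_add] at h
    linear_combination (norm := skip) ((s : ℂ) ^ 3) • h
    match_scalars <;> field_simp <;> ring
  have h10 : w 1 0 * w 0 1 = (s : ℂ) ^ 2 • (w 1 1 * w 0 0) - (s : ℂ) ^ 2 • (1 : B) := by
    have h := hr 1 0 0 1
    have h3 := hr 0 1 0 1
    simp only [Fin.sum_univ_two, Rhat_entries, zero_smul, add_zero, zero_add] at h h3
    linear_combination (norm := skip)
      ((s : ℂ) ^ 3) • h - ((s : ℂ) ^ 2) • hw + ((s : ℂ) ^ 5) • h3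
    match_scalars <;> field_simp <;> ring
  have h01 : w 0 0 * w 1 1 = 1 + (s : ℂ) ^ 2 • (w 0 1 * w 1 0) := by
    rw [← hw]; abel
  rw [prod_sums v w hc, prod_sums v w hc, ← hv]
  simp only [Fin.sum_univ_two, h00, h11, h10, h01]
  simp only [mul_add, mul_sub, smul_add, mul_smul_comm, mul_one]
  abel

/-- `u^i_j ⊗ 1` -/
def uLeft (i j : Fin 2) : OSLq s ⊗[ℂ] OSLq s :=
  (Algebra.TensorProduct.includeLeft : OSLq s →ₐ[ℂ] OSLq s ⊗[ℂ] OSLq s) (u s i j)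

/-- `1 ⊗ u^i_j` -/
def uRight (i j : Fin 2) : OSLq s ⊗[ℂ] OSLq s :=
  (Algebra.TensorProduct.includeRight : OSLq s →ₐ[ℂ] OSLq s ⊗[ℂ] OSLq s) (u s i j)

theorem uLeft_commute (i j k l : Fin 2) : Commute (uLeft s i j) (uRight s k l) := by
  simp [Commute, SemiconjBy, uLeft, uRight]

/-- The coproduct `Δ u^i_j = ∑ u^i_k ⊗ u^k_j`. -/
def comul : OSLq s →ₐ[ℂ] OSLq s ⊗[ℂ] OSLq s :=
  slqLift (fun i j => ∑ k, uLeft s i k * uRight s k j)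
    (rtt_mul (uLeft s) (uRight s) (uLeft_commute s)
      (rtt_map _ _ (u_rtt s)) (rtt_map _ _ (u_rtt s)))
    (det_mul (uLeft s) (uRight s) (uLeft_commute s)
      (det_map _ _ (u_det s)) (rtt_map _ _ (u_rtt s)) (det_map _ _ (u_det s)))

theorem comul_u (i j : Fin 2) : comul s (u s i j) = ∑ k, u s i k ⊗ₜ[ℂ] u s k j := by
  simp [comul, uLeft, uRight]

/-- The `L`-operator matrices `(R̂^{kr}_{it})`, rows `i`, columns `r`. -/
def Lplus (k t : Fin 2) : Matrix (Fin 2) (Fin 2) ℂ := Matrix.of fun i r => Rhat s (k, r) (i, t)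

/-- The `L`-operator matrices `(R̂⁻¹)^{ts}_{jl}`, rows `j`, columns `s`. -/
def Lminus (t l : Fin 2) : Matrix (Fin 2) (Fin 2) ℂ := Matrix.of fun j r => RhatInv s (t, r) (j, l)

theorem Lplus_eq : Lplus s 0 0 = !![(s : ℂ), 0; 0, (s : ℂ)⁻¹] ∧
    Lplus s 0 1 = !![0, (s : ℂ)⁻¹ * ((s : ℂ) ^ 2 - ((s : ℂ) ^ 2)⁻¹); 0, 0] ∧
    Lplus s 1 0 = 0 ∧ Lplus s 1 1 = !![(s : ℂ)⁻¹, 0; 0, (s : ℂ)] := by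
  refine ⟨?_, ?_, ?_, ?_⟩ <;> ext a b <;> fin_cases a <;> fin_cases b <;> simp [Lplus, Rhat]

theorem Lplus_rtt (i j m n : Fin 2) :
    ∑ k, ∑ l, Rhat s (i, j) (k, l) • (Lplus s k m * Lplus s l n) =
      ∑ k, ∑ l, Rhat s (k, l) (m, n) • (Lplus s i k * Lplus s j l) := by
  have hs : (s : ℂ) ≠ 0 := s.ne_zero
  simp only [Fin.sum_univ_two]
  ext a b
  fin_cases i <;> fin_cases j <;> fin_cases m <;> fin_cases n <;>
    simp only [Fin.zero_eta, Fin.mk_one, Rhat_entries, Lplus_eq] <;>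
    fin_cases a <;> fin_cases b <;> simp <;> field_simp <;> ring

theorem Lplus_det : Lplus s 0 0 * Lplus s 1 1 - (s : ℂ) ^ 2 • (Lplus s 0 1 * Lplus s 1 0) = 1 := by
  have hs : (s : ℂ) ≠ 0 := s.ne_zero
  ext a b
  fin_cases a <;> fin_cases b <;> simp [Lplus_eq, hs]

theorem Lminus_eq : Lminus s 0 0 = !![(s : ℂ)⁻¹, 0; 0, (s : ℂ)] ∧
    Lminus s 0 1 = 0 ∧
    Lminus s 1 0 = !![0, 0; (s : ℂ)⁻¹ - (s : ℂ) ^ 3, 0] ∧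
    Lminus s 1 1 = !![(s : ℂ), 0; 0, (s : ℂ)⁻¹] := by
  have hs : (s : ℂ) ≠ 0 := s.ne_zero
  refine ⟨?_, ?_, ?_, ?_⟩ <;> ext a b <;> fin_cases a <;> fin_cases b <;>
    simp [Lminus, RhatInv, Ccheck, hs] <;> ring

theorem Lminus_rtt (i j m n : Fin 2) :
    ∑ k, ∑ l, Rhat s (i, j) (k, l) • (Lminus s k m * Lminus s l n) =
      ∑ k, ∑ l, Rhat s (k, l) (m, n) • (Lminus s i k * Lminus s j l) := by
  have hs : (s : ℂ) ≠ 0 := s.ne_zero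
  simp only [Fin.sum_univ_two]
  ext a b
  fin_cases i <;> fin_cases j <;> fin_cases m <;> fin_cases n <;>
    simp only [Fin.zero_eta, Fin.mk_one, Rhat_entries, Lminus_eq] <;>
    fin_cases a <;> fin_cases b <;> simp <;> field_simp <;> ring

theorem Lminus_det : Lminus s 0 0 * Lminus s 1 1 - (s : ℂ) ^ 2 • (Lminus s 0 1 * Lminus s 1 0) = 1 := by
  have hs : (s : ℂ) ≠ 0 := s.ne_zero
  ext a b
  fin_cases a <;> fin_cases b <;> simp [Lminus_eq, hs]

/-- `f^{ij}_{kl}` on generators: `f^{ij}_{rs}(u^k_l) = ε ∑_t R̂^{kr}_{it} (R̂⁻¹)^{ts}_{jl}`;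
row index `(i, j)`, column index `(r, s)`. -/
def fGen (ε : ℤˣ) (k l : Fin 2) : Matrix Idx Idx ℂ := Matrix.of fun a b =>
  ((ε : ℤ) : ℂ) * ∑ t, Rhat s (k, b.1) (a.1, t) * RhatInv s (t, b.2) (a.2, l)

open Kronecker in
/-- `x ↦ x ⊗ 1` -/
def kronLeft : Matrix (Fin 2) (Fin 2) ℂ →ₐ[ℂ] Matrix Idx Idx ℂ where
  toFun x := x ⊗ₖ (1 : Matrix (Fin 2) (Fin 2) ℂ)
  map_one' := by simp
  map_mul' x y := by simp [← Matrix.mul_kronecker_mul]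
  map_zero' := by simp
  map_add' x y := by simp [Matrix.add_kronecker]
  commutes' c := by simp [Algebra.algebraMap_eq_smul_one, Matrix.smul_kronecker]

open Kronecker in
/-- `x ↦ 1 ⊗ x` -/
def kronRight : Matrix (Fin 2) (Fin 2) ℂ →ₐ[ℂ] Matrix Idx Idx ℂ where
  toFun x := (1 : Matrix (Fin 2) (Fin 2) ℂ) ⊗ₖ x
  map_one' := by simp
  map_mul' x y := by simp [← Matrix.mul_kronecker_mul]
  map_zero' := by simp
  map_add' x y := by simp [Matrix.kronecker_add]
  commutes' c := by simp [Algebra.algebraMap_eq_smul_one, Matrix.kronecker_smul]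

theorem kron_commute (x y : Matrix (Fin 2) (Fin 2) ℂ) : Commute (kronLeft x) (kronRight y) := by
  simp [Commute, SemiconjBy, kronLeft, kronRight, ← Matrix.mul_kronecker_mul]

theorem fGen_eq (ε : ℤˣ) (k l : Fin 2) :
    fGen s ε k l =
      ∑ t, kronLeft (Lplus s k t) * kronRight (((ε : ℤ) : ℂ) • Lminus s t l) := by
  ext ⟨i, j⟩ ⟨r, x⟩
  simp only [fGen, kronLeft, kronRight, Matrix.of_apply, Matrix.sum_apply, AlgHom.coe_mk,
    RingHom.coe_mk, MonoidHom.coe_mk, OneHom.coe_mk, ← Matrix.mul_kronecker_mul, Matrix.mul_one,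
    Matrix.one_mul, Matrix.kroneckerMap_apply, Matrix.smul_apply, smul_eq_mul, Finset.mul_sum,
    Lplus, Lminus]
  exact Finset.sum_congr rfl fun t _ => by ring

theorem fGen_rtt (ε : ℤˣ) (i j m n : Fin 2) :
    ∑ k, ∑ l, Rhat s (i, j) (k, l) • (fGen s ε k m * fGen s ε l n) =
      ∑ k, ∑ l, Rhat s (k, l) (m, n) • (fGen s ε i k * fGen s ε j l) := by
  simp only [fGen_eq]
  refine rtt_mul (fun k t => kronLeft (Lplus s k t))
    (fun t l => kronRight (((ε : ℤ) : ℂ) • Lminus s t l)) (fun _ _ _ _ => kron_commute _ _)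
    (rtt_map kronLeft (Lplus s) (Lplus_rtt s))
    (rtt_map kronRight (fun t l => ((ε : ℤ) : ℂ) • Lminus s t l) ?_) i j m n
  intro i j m n
  rcases Int.units_eq_one_or ε with rfl | rfl
  · simp only [Units.val_one, Int.cast_one, one_smul]
    exact Lminus_rtt s i j m n
  · simp only [Units.val_neg, Units.val_one, Int.cast_neg, Int.cast_one, neg_smul, one_smul,
      neg_mul_neg]
    exact Lminus_rtt s i j m n

theorem fGen_det (ε : ℤˣ) :
    fGen s ε 0 0 * fGen s ε 1 1 - (s : ℂ) ^ 2 • (fGen s ε 0 1 * fGen s ε 1 0) = 1 := by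
  simp only [fGen_eq]
  refine det_mul (fun k t => kronLeft (Lplus s k t))
    (fun t l => kronRight (((ε : ℤ) : ℂ) • Lminus s t l)) (fun _ _ _ _ => kron_commute _ _)
    (det_map kronLeft (Lplus s) (Lplus_det s))
    (rtt_map kronRight (fun t l => ((ε : ℤ) : ℂ) • Lminus s t l) ?_)
    (det_map kronRight (fun t l => ((ε : ℤ) : ℂ) • Lminus s t l) ?_)
  · intro i j m n
    rcases Int.units_eq_one_or ε with rfl | rfl
    · simp only [Units.val_one, Int.cast_one, one_smul]
      exact Lminus_rtt s i j m n
    · simp only [Units.val_neg, Units.val_one, Int.cast_neg, Int.cast_one, neg_smul, one_smul,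
        neg_mul_neg]
      exact Lminus_rtt s i j m n
  · rcases Int.units_eq_one_or ε with rfl | rfl
    · simp only [Units.val_one, Int.cast_one, one_smul]
      exact Lminus_det s
    · simp only [Units.val_neg, Units.val_one, Int.cast_neg, Int.cast_one, neg_smul, one_smul,
        neg_mul_neg]
      exact Lminus_det s

/-- The algebra homomorphism `f = (f^{ij}_{kl}) : O(SL_q(2)) → M₄(ℂ)`. -/
def fHom (ε : ℤˣ) : OSLq s →ₐ[ℂ] Matrix Idx Idx ℂ := slqLift (fGen s ε) (fGen_rtt s ε) (fGen_det s ε)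

theorem fHom_u (ε : ℤˣ) (k l : Fin 2) : fHom s ε (u s k l) = fGen s ε k l := by
  simp [fHom]

/-! ### The `4D_±`-calculus -/

/-- The algebra homomorphism `a ↦ (a_{(1)} f^{ij}_{kl}(a_{(2)}))` into matrices over `O(SL_q(2))`. -/
def phi (ε : ℤˣ) : OSLq s →ₐ[ℂ] Matrix Idx Idx (OSLq s) :=
  ((matrixEquivTensor Idx ℂ (OSLq s)).symm : _ →ₐ[ℂ] Matrix Idx Idx (OSLq s)).comp
    ((Algebra.TensorProduct.map (AlgHom.id ℂ (OSLq s)) (fHom s ε)).comp (comul s))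

theorem phi_u (ε : ℤˣ) (k l : Fin 2) (I J : Idx) :
    phi s ε (u s k l) I J = ∑ m, fGen s ε m l I J • u s k m := by
  simp [phi, comul_u, fHom_u, Algebra.smul_def, Algebra.commutes]

/-- The bimodule `Γ` of the `4D_±`-calculus (`ε` is the sign): the free left module with basis
`θ_{ij}`; elements are given by their coordinates with respect to this basis. -/
def Gam (_ : ℤˣ) : Type := Idx → OSLq s

variable (ε : ℤˣ)

instance : AddCommGroup (Gam s ε) := inferInstanceAs (AddCommGroup (Idx → OSLq s))

instance : Module (OSLq s) (Gam s ε) := inferInstanceAs (Module (OSLq s) (Idx → OSLq s))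

instance : Module ℂ (Gam s ε) := inferInstanceAs (Module ℂ (Idx → OSLq s))

instance : IsScalarTower ℂ (OSLq s) (Gam s ε) :=
  inferInstanceAs (IsScalarTower ℂ (OSLq s) (Idx → OSLq s))

/-- Right multiplication, `θ_{ij} a = a_{(1)} f^{ij}_{kl}(a_{(2)}) θ_{kl}`. -/
def gamRight (x : Gam s ε) (a : OSLq s) : Gam s ε := fun J => ∑ I, x I * phi s ε a I J

theorem smul_gam (a : OSLq s) (x : Gam s ε) (J : Idx) : (a • x : Gam s ε) J = a * x J := rfl

theorem gam_add (x y : Gam s ε) (J : Idx) : (x + y) J = x J + y J := rfl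

theorem gam_sum {ι : Type*} (t : Finset ι) (x : ι → Gam s ε) (J : Idx) :
    (∑ i ∈ t, x i) J = ∑ i ∈ t, x i J :=
  Finset.sum_apply (M := fun _ => OSLq s) J t x

theorem gam_zero (J : Idx) : (0 : Gam s ε) J = 0 := rfl

instance : Module (OSLq s)ᵐᵒᵖ (Gam s ε) where
  smul a x := gamRight s ε x (unop a)
  one_smul x := by
    funext J
    change ∑ I, x I * phi s ε 1 I J = x J
    rw [map_one, Fintype.sum_eq_single J fun I hI => by rw [Matrix.one_apply_ne hI, mul_zero],
      Matrix.one_apply_eq, mul_one]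
  mul_smul a b x := by
    funext J
    change ∑ I, x I * phi s ε (unop b * unop a) I J =
      ∑ K, (∑ I, x I * phi s ε (unop b) I K) * phi s ε (unop a) K J
    simp only [map_mul, Matrix.mul_apply, Finset.mul_sum, Finset.sum_mul, mul_assoc]
    exact Finset.sum_comm
  smul_zero a := by
    funext J
    change ∑ I, (0 : Gam s ε) I * phi s ε (unop a) I J = 0
    simp [gam_zero]
  smul_add a x y := by
    funext J
    change ∑ I, (x + y) I * phi s ε (unop a) I J =
      ∑ I, x I * phi s ε (unop a) I J + ∑ I, y I * phi s ε (unop a) I J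
    simp only [gam_add, add_mul, Finset.sum_add_distrib]
  add_smul a b x := by
    funext J
    change ∑ I, x I * phi s ε (unop a + unop b) I J =
      ∑ I, x I * phi s ε (unop a) I J + ∑ I, x I * phi s ε (unop b) I J
    simp only [map_add, Matrix.add_apply, mul_add, Finset.sum_add_distrib]
  zero_smul x := by
    funext J
    change ∑ I, x I * phi s ε 0 I J = 0
    simp

theorem op_smul_gam (a : OSLq s) (x : Gam s ε) (J : Idx) :
    (op a • x : Gam s ε) J = ∑ I, x I * phi s ε a I J := rfl

instance : SMulCommClass (OSLq s) (OSLq s)ᵐᵒᵖ (Gam s ε) where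
  smul_comm a b x := by
    obtain ⟨b, rfl⟩ := op_surjective b
    funext J
    simp only [smul_gam, op_smul_gam, Finset.mul_sum, mul_assoc]

/-- The basis element `θ_{ij}`. -/
def theta (I : Idx) : Gam s ε := fun J => if J = I then 1 else 0

/-- The relation `θ_{ij} u^k_l = ε R̂^{mr}_{it} (R̂⁻¹)^{ts}_{jl} u^k_m θ_{rs}`. -/
theorem theta_mul_u (i j k l : Fin 2) :
    (op (u s k l) • theta s ε (i, j) : Gam s ε) =
      ∑ m, ∑ r, ∑ x, (algebraMap ℂ (OSLq s) (((ε : ℤ) : ℂ) *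
        ∑ t, Rhat s (m, r) (i, t) * RhatInv s (t, x) (j, l)) * u s k m) • theta s ε (r, x) := by
  funext ⟨r', x'⟩
  rw [op_smul_gam, Fintype.sum_eq_single (i, j) fun I hI => by rw [theta, if_neg hI, zero_mul]]
  simp only [gam_sum, smul_gam, theta, if_true, one_mul, phi_u, Algebra.smul_def]
  refine Finset.sum_congr rfl fun m _ => ?_
  rw [Fintype.sum_eq_single r' fun r hr => Finset.sum_eq_zero fun x _ => by
      rw [if_neg fun h => hr (Prod.mk.inj h).1.symm, mul_zero],
    Fintype.sum_eq_single x' fun x hx => by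
      rw [if_neg fun h => hx (Prod.mk.inj h).2.symm, mul_zero]]
  simp [fGen]

/-- The biinvariant element `θ = q^{1/2} Č^{ij} / q̂ · θ_{ij}`, where `q̂ = q - q⁻¹`. -/
def thetaInv : Gam s ε :=
  ∑ i, ∑ j, algebraMap ℂ (OSLq s)
    ((s : ℂ) * Ccheck s i j / ((s : ℂ) ^ 2 - ((s : ℂ) ^ 2)⁻¹)) • theta s ε (i, j)

/-- The differential `da = θ a - a θ`. -/
def diff : OSLq s →+ Gam s ε :=
  AddMonoidHom.mk' (fun a => op a • thetaInv s ε - a • thetaInv s ε) (fun a b => by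
    rw [op_add, add_smul, add_smul]; abel)

/-! ### Left-linear maps of `Γ ⊗_A Γ`, the braiding and the maps `σ̃` -/

/-- `Γ ⊗_A Γ` for the `4D_±`-calculus. -/
abbrev GamTwo : Type := BalTensor (OSLq s) (Gam s ε) (Gam s ε)

/-- The coordinates of an element of `Γ ⊗_A Γ` with respect to the left basis `θ_I ⊗ θ_J`:
`ρ ⊗ ∑_J b_J θ_J = ∑_J (ρ b_J) ⊗ θ_J`. -/
def coords : GamTwo s ε →+ (Idx × Idx → OSLq s) :=
  balLift (biadd (fun x y p => (op (y p.2) • x : Gam s ε) p.1)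
    (fun x x' y => by funext p; simp only [smul_add, gam_add, Pi.add_apply])
    (fun x y y' => by funext p; simp only [op_add, add_smul, gam_add, Pi.add_apply]))
    (fun x a y => by
      funext p
      simp only [biadd_apply, smul_gam, op_mul, mul_smul])

/-- The left-linear map of `Γ ⊗_A Γ` with `θ_I ⊗ θ_J ↦ ∑ T^{KL}_{IJ} θ_K ⊗ θ_L`. -/
def leftLinear (T : Matrix (Idx × Idx) (Idx × Idx) ℂ) : GamTwo s ε →+ GamTwo s ε :=
  AddMonoidHom.mk' (fun x => ∑ p : Idx × Idx, (∑ p', coords s ε x p' * algebraMap ℂ _ (T p p')) •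
    btmul (OSLq s) (theta s ε p.1) (theta s ε p.2)) (fun x y => by
      simp only [map_add, Pi.add_apply, add_mul, Finset.sum_add_distrib, add_smul])

theorem leftLinear_apply (T : Matrix (Idx × Idx) (Idx × Idx) ℂ) (x : GamTwo s ε) :
    leftLinear s ε T x =
      ∑ p : Idx × Idx, (∑ p', coords s ε x p' * algebraMap ℂ (OSLq s) (T p p')) •
        btmul (OSLq s) (theta s ε p.1) (theta s ε p.2) := rfl

theorem coords_btmul (x y : Gam s ε) (p : Idx × Idx) :
    coords s ε (btmul (OSLq s) x y) p = (op (y p.2) • x : Gam s ε) p.1 := rfl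

theorem coords_smul (a : OSLq s) (x : GamTwo s ε) (p : Idx × Idx) :
    coords s ε (a • x) p = a * coords s ε x p := by
  induction x using bal_induction with
  | h0 => simp
  | ht x y => rw [smul_btmul, coords_btmul, coords_btmul, ← smul_gam, smul_comm a]
  | ha x y hx hy =>
    rw [smul_add, map_add, map_add, Pi.add_apply, Pi.add_apply, hx, hy, mul_add]

theorem leftLinear_smul (T : Matrix (Idx × Idx) (Idx × Idx) ℂ) (a : OSLq s) (x : GamTwo s ε) :
    leftLinear s ε T (a • x) = a • leftLinear s ε T x := by
  simp only [leftLinear_apply, coords_smul, Finset.smul_sum, mul_assoc, ← Finset.mul_sum, mul_smul]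

theorem leftLinear_theta (T : Matrix (Idx × Idx) (Idx × Idx) ℂ) (p' : Idx × Idx) :
    leftLinear s ε T (btmul (OSLq s) (theta s ε p'.1) (theta s ε p'.2)) =
      ∑ p : Idx × Idx, algebraMap ℂ (OSLq s) (T p p') •
        btmul (OSLq s) (theta s ε p.1) (theta s ε p.2) := by
  have hc : ∀ p : Idx × Idx,
      coords s ε (btmul (OSLq s) (theta s ε p'.1) (theta s ε p'.2)) p = if p = p' then 1 else 0 := by
    intro p
    rw [coords_btmul]
    by_cases h2 : p.2 = p'.2
    · by_cases h1 : p.1 = p'.1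
      · rw [if_pos (Prod.ext h1 h2), theta, if_pos h2, op_one, one_smul, theta, if_pos h1]
      · rw [if_neg fun h => h1 (congrArg Prod.fst h), theta, if_pos h2, op_one, one_smul, theta,
          if_neg h1]
    · rw [if_neg fun h => h2 (congrArg Prod.snd h), theta, if_neg h2, op_zero, zero_smul, gam_zero]
  rw [leftLinear_apply]
  refine Finset.sum_congr rfl fun p _ => ?_
  rw [Fintype.sum_eq_single p' fun q hq => by rw [hc, if_neg hq, zero_mul], hc, if_pos rfl, one_mul]

/-- `M_{12}` in leg numbering. -/
def leg12 (M : Matrix Idx Idx ℂ) : Matrix (Idx × Idx) (Idx × Idx) ℂ := Matrix.of fun p p' =>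
  if p.2 = p'.2 then M p.1 p'.1 else 0

/-- `M_{34}` in leg numbering. -/
def leg34 (M : Matrix Idx Idx ℂ) : Matrix (Idx × Idx) (Idx × Idx) ℂ := Matrix.of fun p p' =>
  if p.1 = p'.1 then M p.2 p'.2 else 0

/-- `M_{23}` in leg numbering. -/
def leg23 (M : Matrix Idx Idx ℂ) : Matrix (Idx × Idx) (Idx × Idx) ℂ := Matrix.of fun p p' =>
  if p.1.1 = p'.1.1 ∧ p.2.2 = p'.2.2 then M (p.1.2, p.2.1) (p'.1.2, p'.2.1) else 0

/-- The matrix `R̂_{23} R̂^η_{12} R̂^{η'}_{34} R̂⁻¹_{23}`. -/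
def flipMatrix (η η' : ℤˣ) : Matrix (Idx × Idx) (Idx × Idx) ℂ :=
  leg23 (Rhat s) * leg12 (RhatPow s η) * leg34 (RhatPow s η') * leg23 (RhatInv s)

/-- The left-linear map `σ̃_{(η, η')}` of `Γ ⊗_A Γ`. -/
def sigmaTilde (η η' : ℤˣ) : GamTwo s ε →+ GamTwo s ε := leftLinear s ε (flipMatrix s η η')

/-- The matrix `R̂_{23} R̂_{12} R̂⁻¹_{34} R̂⁻¹_{23}`. -/
def braidingMatrix : Matrix (Idx × Idx) (Idx × Idx) ℂ :=
  leg23 (Rhat s) * leg12 (Rhat s) * leg34 (RhatInv s) * leg23 (RhatInv s)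

/-- The inverse `R̂_{23} R̂⁻¹_{12} R̂_{34} R̂⁻¹_{23}` of the matrix above. -/
def braidingInvMatrix : Matrix (Idx × Idx) (Idx × Idx) ℂ :=
  leg23 (Rhat s) * leg12 (RhatInv s) * leg34 (Rhat s) * leg23 (RhatInv s)

/-- The canonical braiding `σ` of `Γ`. -/
def braiding : GamTwo s ε →+ GamTwo s ε := leftLinear s ε (braidingMatrix s)

/-- The inverse of the braiding. -/
def braidingInv : GamTwo s ε →+ GamTwo s ε := leftLinear s ε (braidingInvMatrix s)

/-! ### Bicovariant `σ`-metrics and their quantum Clifford algebras -/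

/-- The `I`-th coordinate of an element of `Γ`. -/
def gamCoord (I : Idx) : Gam s ε →ₗ[ℂ] OSLq s where
  toFun x := x I
  map_add' _ _ := rfl
  map_smul' _ _ := rfl

/-- The map `a ↦ a θ_I`. -/
def mulTheta (I : Idx) : OSLq s →ₗ[ℂ] Gam s ε where
  toFun a := a • theta s ε I
  map_add' a b := add_smul a b _
  map_smul' c a := smul_assoc c a _

/-- The left coaction `Δ_L(∑ a_I θ_I) = ∑ Δ(a_I) (1 ⊗ θ_I)`. -/
def coactL : Gam s ε →ₗ[ℂ] OSLq s ⊗[ℂ] Gam s ε :=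
  ∑ I : Idx, TensorProduct.map LinearMap.id (mulTheta s ε I) ∘ₗ
    (comul s).toLinearMap ∘ₗ gamCoord s ε I

/-- The right coaction `Δ_R(∑ a_{ij} θ_{ij}) = ∑ Δ(a_{ij}) (θ_{kl} ⊗ u^k_i u^l_j)`. -/
def coactR : Gam s ε →ₗ[ℂ] Gam s ε ⊗[ℂ] OSLq s :=
  ∑ I : Idx, ∑ k : Fin 2, ∑ l : Fin 2,
    TensorProduct.map (mulTheta s ε (k, l))
        (LinearMap.mulRight ℂ (u s k I.1 * u s l I.2)) ∘ₗ
      (comul s).toLinearMap ∘ₗ gamCoord s ε I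

theorem op_algebraMap_smul (c : ℂ) (x : Gam s ε) :
    (op (algebraMap ℂ (OSLq s) c) • x : Gam s ε) = c • x := by
  funext J
  rw [op_smul_gam, AlgHom.commutes, Fintype.sum_eq_single J fun I hI => by
    rw [Matrix.algebraMap_matrix_apply, if_neg hI, mul_zero], Matrix.algebraMap_matrix_apply,
    if_pos rfl, ← Algebra.commutes, ← Algebra.smul_def]
  rfl

section Metric

variable {s ε}
variable (g : BimodHom (OSLq s) (GamTwo s ε) (OSLq s))

/-- The complex bilinear map `ρ ⊗ ρ' ↦ g(ρ ⊗_A ρ')`. -/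
def metricLin : Gam s ε ⊗[ℂ] Gam s ε →ₗ[ℂ] OSLq s :=
  TensorProduct.lift (LinearMap.mk₂ ℂ (fun x y => g (btmul (OSLq s) x y))
    (fun x x' y => by rw [btmul_add_left, map_add])
    (fun c x y => by
      rw [← algebraMap_smul (OSLq s) c x, ← smul_btmul, g.map_left, smul_eq_mul,
        ← Algebra.smul_def])
    (fun x y y' => by rw [btmul_add_right, map_add])
    (fun c x y => by
      rw [← algebraMap_smul (OSLq s) c y, ← btmul_balance, op_algebraMap_smul,
        ← algebraMap_smul (OSLq s) c x, ← smul_btmul, g.map_left, smul_eq_mul,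
        ← Algebra.smul_def]))

/-- The map `γ ⊗ δ ↦ g(α ⊗ γ) δ`, that is, `g_{12}(α ⊗ ·)`. -/
def metric12 (α : Gam s ε) : GamTwo s ε →+ Gam s ε :=
  balLift (biadd (fun γ δ => g (btmul (OSLq s) α γ) • δ)
    (fun p p' q => by rw [btmul_add_right, map_add, add_smul]) (fun p q q' => smul_add _ _ _))
    (fun m a n => by
      simp only [biadd_apply]
      rw [← op_smul_btmul, g.map_right, op_smul_eq_mul, mul_smul])

@[simp] theorem metric12_btmul (α γ δ : Gam s ε) :
    metric12 g α (btmul (OSLq s) γ δ) = g (btmul (OSLq s) α γ) • δ := rfl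

theorem metric12_add (α α' : Gam s ε) (z : GamTwo s ε) :
    metric12 g (α + α') z = metric12 g α z + metric12 g α' z :=
  DFunLike.congr_fun (show metric12 g (α + α') = metric12 g α + metric12 g α' from
    bal_hom_ext fun m n => by simp [btmul_add_left, add_smul]) z

theorem metric12_smul (a : OSLq s) (α : Gam s ε) (z : GamTwo s ε) :
    metric12 g (op a • α) z = metric12 g α (a • z) := by
  induction z using bal_induction with
  | h0 => simp
  | ht m n => simp only [smul_btmul, metric12_btmul, btmul_balance]
  | ha y z hy hz => rw [smul_add, map_add, map_add, hy, hz]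

/-- The map `α ⊗ β ↦ g_{12} T_{23} (α ⊗ β ⊗ ρ)` for the left-linear map `T` of `Γ ⊗_A Γ`. -/
def metric12Flip23 (T : Matrix (Idx × Idx) (Idx × Idx) ℂ) (ρ : Gam s ε) : GamTwo s ε →+ Gam s ε :=
  balLift (biadd (fun α β => metric12 g α (leftLinear s ε T (btmul (OSLq s) β ρ)))
    (fun p p' q => metric12_add _ _ _ _)
    (fun p q q' => by rw [btmul_add_left, map_add, map_add]))
    (fun m a n => by
      simp only [biadd_apply]
      rw [metric12_smul, ← leftLinear_smul, smul_btmul])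

/-- `g` is a bicovariant `σ`-metric of `Γ`: a non-degenerate homomorphism of bicovariant bimodules
`Γ ⊗_A Γ → A` with `g σ = g` and `g_{12} σ^{±1}_{23} σ^{±1}_{12} = g_{23}`. -/
structure IsBicovariantSigmaMetric : Prop where
  left_covariant : ∀ ρ ρ' : Gam s ε, comul s (g (btmul (OSLq s) ρ ρ')) =
    TensorProduct.map (LinearMap.mul' ℂ (OSLq s)) (metricLin g)
      (TensorProduct.tensorTensorTensorComm ℂ (OSLq s) (Gam s ε) (OSLq s) (Gam s ε)
        (coactL s ε ρ ⊗ₜ[ℂ] coactL s ε ρ'))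
  right_covariant : ∀ ρ ρ' : Gam s ε, comul s (g (btmul (OSLq s) ρ ρ')) =
    TensorProduct.map (metricLin g) (LinearMap.mul' ℂ (OSLq s))
      (TensorProduct.tensorTensorTensorComm ℂ (Gam s ε) (OSLq s) (Gam s ε) (OSLq s)
        (coactR s ε ρ ⊗ₜ[ℂ] coactR s ε ρ'))
  nondegenerate_left : ∀ ρ : Gam s ε, (∀ ρ', g (btmul (OSLq s) ρ ρ') = 0) → ρ = 0
  nondegenerate_right : ∀ ρ' : Gam s ε, (∀ ρ, g (btmul (OSLq s) ρ ρ') = 0) → ρ' = 0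
  comp_braiding : ∀ x : GamTwo s ε, g (braiding s ε x) = g x
  braid : ∀ ρ ρ' ρ'' : Gam s ε,
    metric12Flip23 g (braidingMatrix s) ρ'' (braiding s ε (btmul (OSLq s) ρ ρ')) =
      op (g (btmul (OSLq s) ρ' ρ'')) • ρ
  braid_inv : ∀ ρ ρ' ρ'' : Gam s ε,
    metric12Flip23 g (braidingInvMatrix s) ρ'' (braidingInv s ε (btmul (OSLq s) ρ ρ')) =
      op (g (btmul (OSLq s) ρ' ρ'')) • ρ

end Metric

end SLq

end QClifford

namespace QClifford

section CoordinateAlgebra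

variable (s : ℂˣ)

theorem slq_induction {p : OSLq s → Prop} (hc : ∀ c, p (algebraMap ℂ (OSLq s) c))
    (hu : ∀ i j, p (u s i j)) (ha : ∀ x y, p x → p y → p (x + y))
    (hm : ∀ x y, p x → p y → p (x * y)) (x : OSLq s) : p x := by
  obtain ⟨y, rfl⟩ : ∃ y, slqMk s y = x := RingQuot.mkAlgHom_surjective ℂ (SLqRel s) x
  induction y using FreeAlgebra.induction with
  | grade0 r => rw [AlgHom.commutes]; exact hc r
  | grade1 x => exact hu x.1 x.2
  | mul a b ha' hb' => rw [map_mul]; exact hm _ _ ha' hb'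
  | add a b ha' hb' => rw [map_add]; exact ha _ _ ha' hb'

/-- The commutation relations between four elements satisfied by the generators of
`O(SL_q(2))`, `q = s²`. -/
structure SLqTuple {B : Type*} [Ring B] [Algebra ℂ B] (a b c d : B) : Prop where
  ab : b * a = ((s : ℂ) ^ 2)⁻¹ • (a * b)
  ac : c * a = ((s : ℂ) ^ 2)⁻¹ • (a * c)
  bd : b * d = (s : ℂ) ^ 2 • (d * b)
  cd : c * d = (s : ℂ) ^ 2 • (d * c)
  bc : c * b = b * c
  ad : a * d = 1 + (s : ℂ) ^ 2 • (b * c)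
  da : d * a = 1 + ((s : ℂ) ^ 2)⁻¹ • (b * c)

theorem slqTuple_u : SLqTuple s (u s 0 0) (u s 0 1) (u s 1 0) (u s 1 1) := by
  have hs : (s : ℂ) ≠ 0 := s.ne_zero
  have hr := u_rtt s
  have hd := u_det s
  have h1 := hr 0 0 0 1
  have h2 := hr 1 1 0 1
  have h3 := hr 0 1 0 0
  have h4 := hr 0 1 1 1
  have h5 := hr 0 1 0 1
  have h6 := hr 0 1 1 0
  simp only [Fin.sum_univ_two, Rhat_entries, zero_smul, add_zero, zero_add] at h1 h2 h3 h4 h5 h6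
  generalize u s 0 0 = a at *
  generalize u s 0 1 = b at *
  generalize u s 1 0 = c at *
  generalize u s 1 1 = d at *
  constructor
  · linear_combination (norm := skip) (-(s : ℂ)) • h1
    match_scalars <;> field_simp <;> ring
  · linear_combination (norm := skip) (s : ℂ) • h3
    match_scalars <;> field_simp <;> ring
  · linear_combination (norm := skip) (-(s : ℂ) ^ 3) • h4
    match_scalars <;> field_simp <;> ring
  · linear_combination (norm := skip) ((s : ℂ) ^ 3) • h2
    match_scalars <;> field_simp <;> ring
  · linear_combination (norm := skip) (s : ℂ) • h5
    match_scalars <;> field_simp <;> ring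
  · linear_combination (norm := skip) hd
    match_scalars <;> ring
  · linear_combination (norm := skip) (s : ℂ) • h6 + hd
    match_scalars <;> field_simp <;> ring

theorem rtt_of_tuple {B : Type*} [Ring B] [Algebra ℂ B] (v : Fin 2 → Fin 2 → B)
    (h : SLqTuple s (v 0 0) (v 0 1) (v 1 0) (v 1 1)) (i j m n : Fin 2) :
    ∑ k, ∑ l, Rhat s (i, j) (k, l) • (v k m * v l n) =
      ∑ k, ∑ l, Rhat s (k, l) (m, n) • (v i k * v j l) := by
  have hs : (s : ℂ) ≠ 0 := s.ne_zero
  obtain ⟨ab, ac, bd, cd, bc, ad, da⟩ := h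
  fin_cases i <;> fin_cases j <;> fin_cases m <;> fin_cases n <;>
    simp only [Fin.zero_eta, Fin.mk_one, Fin.sum_univ_two, Rhat_entries, zero_smul, add_zero,
      zero_add, ab, ac, bd, cd, bc, ad, da] <;>
    first | done | (match_scalars <;> field_simp <;> ring)


/-- The vector space with basis `e(i, j, k)`, which stands for `a^i b^j c^k` if `0 ≤ i` and for
`d^{-i} b^j c^k` if `i < 0`. -/
abbrev PBW : Type := (ℤ × ℕ × ℕ) →₀ ℂ

/-- The basis vector `e(i, j, k)`. -/
def pbw (i : ℤ) (j k : ℕ) : PBW := Finsupp.single (i, j, k) 1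

/-- The linear map with given values on the basis. -/
def pbwMap {N : Type*} [AddCommGroup N] [Module ℂ N] (f : ℤ → ℕ → ℕ → N) : PBW →ₗ[ℂ] N :=
  Finsupp.linearCombination ℂ fun p => f p.1 p.2.1 p.2.2

@[simp] theorem pbwMap_pbw {N : Type*} [AddCommGroup N] [Module ℂ N] (f : ℤ → ℕ → ℕ → N) (i : ℤ)
    (j k : ℕ) : pbwMap f (pbw i j k) = f i j k := by
  simp [pbwMap, pbw]

theorem pbw_ext {N : Type*} [AddCommGroup N] [Module ℂ N] {f g : PBW →ₗ[ℂ] N}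
    (h : ∀ i j k, f (pbw i j k) = g (pbw i j k)) : f = g := by
  refine Finsupp.lhom_ext' fun p => LinearMap.ext_ring ?_
  exact h p.1 p.2.1 p.2.2

/-- Left multiplication by `a`. -/
def pbwA : Module.End ℂ PBW := pbwMap fun i j k =>
  pbw (i + 1) j k + (if i < 0 then ((s : ℂ) ^ 2) ^ (-2 * i - 1) else 0) • pbw (i + 1) (j + 1) (k + 1)

/-- Left multiplication by `b`. -/
def pbwB : Module.End ℂ PBW := pbwMap fun i j k => ((s : ℂ) ^ 2) ^ (-i) • pbw i (j + 1) k

/-- Left multiplication by `c`. -/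
def pbwC : Module.End ℂ PBW := pbwMap fun i j k => ((s : ℂ) ^ 2) ^ (-i) • pbw i j (k + 1)

/-- Left multiplication by `d`. -/
def pbwD : Module.End ℂ PBW := pbwMap fun i j k =>
  pbw (i - 1) j k + (if 0 < i then ((s : ℂ) ^ 2) ^ (1 - 2 * i) else 0) • pbw (i - 1) (j + 1) (k + 1)

theorem slqTuple_pbw : SLqTuple s (pbwA s) (pbwB s) (pbwC s) (pbwD s) := by
  have hs : (s : ℂ) ^ 2 ≠ 0 := pow_ne_zero 2 s.ne_zero
  generalize hq : (s : ℂ) ^ 2 = q at hs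
  constructor <;> refine pbw_ext fun i j k => ?_
  · simp only [pbwA, pbwB, hq, Module.End.mul_apply, pbwMap_pbw, map_add, map_smul,
      LinearMap.smul_apply]
    match_scalars <;> simp [zpow_add₀ hs, zpow_neg] <;> field_simp
  · simp only [pbwA, pbwC, hq, Module.End.mul_apply, pbwMap_pbw, map_add, map_smul,
      LinearMap.smul_apply]
    match_scalars <;> simp [zpow_add₀ hs, zpow_neg] <;> field_simp
  · simp only [pbwB, pbwD, hq, Module.End.mul_apply, pbwMap_pbw, map_add, map_smul,
      LinearMap.smul_apply]
    match_scalars <;> simp [zpow_sub₀ hs, zpow_neg] <;> field_simp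
  · simp only [pbwC, pbwD, hq, Module.End.mul_apply, pbwMap_pbw, map_add, map_smul,
      LinearMap.smul_apply]
    match_scalars <;> simp [zpow_sub₀ hs, zpow_neg] <;> field_simp
  · simp only [pbwC, pbwB, hq, Module.End.mul_apply, pbwMap_pbw, map_smul]
  · simp only [pbwA, pbwB, pbwC, pbwD, hq, Module.End.mul_apply, pbwMap_pbw, map_add, map_smul,
      LinearMap.smul_apply, LinearMap.add_apply, Module.End.one_apply, sub_add_cancel]
    rcases lt_or_ge 0 i with hi | hi
    · rw [if_neg (by omega), if_pos hi]
      match_scalars <;> simp [zpow_sub₀ hs, zpow_neg, two_mul, zpow_add₀ hs] <;> field_simp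
    · rw [if_pos (by omega), if_neg (by omega)]
      match_scalars <;> simp [zpow_sub₀ hs, zpow_neg, two_mul, zpow_add₀ hs, mul_sub] <;> field_simp
  · simp only [pbwA, pbwB, pbwC, pbwD, hq, Module.End.mul_apply, pbwMap_pbw, map_add, map_smul,
      LinearMap.smul_apply, LinearMap.add_apply, Module.End.one_apply, add_sub_cancel_right]
    rcases lt_or_ge i 0 with hi | hi
    · rw [if_neg (by omega), if_pos hi]
      match_scalars <;> simp [zpow_sub₀ hs, zpow_neg, two_mul, zpow_add₀ hs] <;> field_simp
    · rw [if_pos (by omega), if_neg (by omega)]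
      match_scalars <;> simp [zpow_sub₀ hs, zpow_neg, two_mul, zpow_add₀ hs, mul_add] <;> field_simp

/-- The generators acting on `PBW`. -/
def pbwGen : Fin 2 → Fin 2 → Module.End ℂ PBW := fun i j =>
  (!![pbwA s, pbwB s; pbwC s, pbwD s] : Matrix (Fin 2) (Fin 2) (Module.End ℂ PBW)) i j

/-- The left regular representation in the basis `e(i, j, k)`. -/
def pbwRep : OSLq s →ₐ[ℂ] Module.End ℂ PBW :=
  slqLift (pbwGen s) (rtt_of_tuple s (pbwGen s) (slqTuple_pbw s)) (by
    have h := (slqTuple_pbw s).ad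
    change pbwA s * pbwD s - _ • (pbwB s * pbwC s) = 1
    rw [h]; abel)

theorem pbwRep_u (i j : Fin 2) : pbwRep s (u s i j) = pbwGen s i j := slqLift_u s _ _ _ i j

/-- The power `a^i` if `0 ≤ i` and `d^{-i}` if `i < 0`. -/
def diagPow (i : ℤ) : OSLq s := u s 0 0 ^ i.toNat * u s 1 1 ^ (-i).toNat

/-- The element `a^i b^j c^k` or `d^{-i} b^j c^k`. -/
def pbwMono : PBW →ₗ[ℂ] OSLq s := pbwMap fun i j k => diagPow s i * u s 0 1 ^ j * u s 1 0 ^ k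

theorem pbwMono_zero : pbwMono s (pbw 0 0 0) = 1 := by
  simp [pbwMono, diagPow]

/-- The coordinates of an element of `O(SL_q(2))`. -/
def pbwEv : OSLq s →ₗ[ℂ] PBW where
  toFun x := pbwRep s x (pbw 0 0 0)
  map_add' x y := by simp
  map_smul' c x := by simp

theorem mul_pow_of_qcomm {B : Type*} [Ring B] [Algebra ℂ B] {x y : B} {r : ℂ}
    (h : x * y = r • (y * x)) (n : ℕ) : x * y ^ n = r ^ n • (y ^ n * x) := by
  induction n with
  | zero => simp
  | succ n ih =>
    rw [pow_succ, ← mul_assoc, ih, smul_mul_assoc, mul_assoc, h, mul_smul_comm, smul_smul,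
      ← pow_succ, mul_assoc]

theorem diagPow_natCast (n : ℕ) : diagPow s n = u s 0 0 ^ n := by simp [diagPow]

theorem diagPow_neg_natCast (n : ℕ) : diagPow s (-n) = u s 1 1 ^ n := by simp [diagPow]

theorem b_mul_diagPow (i : ℤ) :
    u s 0 1 * diagPow s i = ((s : ℂ) ^ 2) ^ (-i) • (diagPow s i * u s 0 1) := by
  obtain ⟨n, rfl | rfl⟩ := i.eq_nat_or_neg
  · rw [diagPow_natCast, mul_pow_of_qcomm (slqTuple_u s).ab, zpow_neg, zpow_natCast, inv_pow]
  · rw [diagPow_neg_natCast, mul_pow_of_qcomm (slqTuple_u s).bd, neg_neg, zpow_natCast]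

theorem c_mul_diagPow (i : ℤ) :
    u s 1 0 * diagPow s i = ((s : ℂ) ^ 2) ^ (-i) • (diagPow s i * u s 1 0) := by
  obtain ⟨n, rfl | rfl⟩ := i.eq_nat_or_neg
  · rw [diagPow_natCast, mul_pow_of_qcomm (slqTuple_u s).ac, zpow_neg, zpow_natCast, inv_pow]
  · rw [diagPow_neg_natCast, mul_pow_of_qcomm (slqTuple_u s).cd, neg_neg, zpow_natCast]

theorem bc_mul_diagPow (i : ℤ) : u s 0 1 * u s 1 0 * diagPow s i =
    ((s : ℂ) ^ 2) ^ (-2 * i) • (diagPow s i * (u s 0 1 * u s 1 0)) := by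
  have hs : (s : ℂ) ^ 2 ≠ 0 := pow_ne_zero 2 s.ne_zero
  rw [mul_assoc, c_mul_diagPow, mul_smul_comm, ← mul_assoc, b_mul_diagPow, smul_mul_assoc,
    smul_smul, ← zpow_add₀ hs, mul_assoc]
  ring_nf

theorem a_mul_diagPow (i : ℤ) : u s 0 0 * diagPow s i = diagPow s (i + 1) +
    (if i < 0 then ((s : ℂ) ^ 2) ^ (-2 * i - 1) else 0) •
      (diagPow s (i + 1) * (u s 0 1 * u s 1 0)) := by
  have hs : (s : ℂ) ^ 2 ≠ 0 := pow_ne_zero 2 s.ne_zero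
  obtain hi | hi := lt_or_ge i 0
  · obtain ⟨n, rfl⟩ : ∃ n : ℕ, i = -(n + 1 : ℕ) := ⟨(-i).toNat - 1, by omega⟩
    have h1 : -((n + 1 : ℕ) : ℤ) + 1 = -(n : ℤ) := by push_cast; ring
    rw [h1, diagPow_neg_natCast, pow_succ', ← mul_assoc, (slqTuple_u s).ad, add_mul, one_mul,
      if_pos hi, smul_mul_assoc, ← diagPow_neg_natCast, bc_mul_diagPow, smul_smul,
      ← zpow_one_add₀ hs]
    congr 3
    push_cast; ring
  · obtain ⟨n, rfl⟩ : ∃ n : ℕ, i = n := ⟨i.toNat, by omega⟩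
    rw [if_neg (by omega), zero_smul, add_zero, ← Nat.cast_succ, diagPow_natCast, diagPow_natCast,
      pow_succ']

theorem d_mul_diagPow (i : ℤ) : u s 1 1 * diagPow s i = diagPow s (i - 1) +
    (if 0 < i then ((s : ℂ) ^ 2) ^ (1 - 2 * i) else 0) •
      (diagPow s (i - 1) * (u s 0 1 * u s 1 0)) := by
  have hs : (s : ℂ) ^ 2 ≠ 0 := pow_ne_zero 2 s.ne_zero
  obtain hi | hi := lt_or_ge 0 i
  · obtain ⟨n, rfl⟩ : ∃ n : ℕ, i = (n + 1 : ℕ) := ⟨i.toNat - 1, by omega⟩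
    have h1 : ((n + 1 : ℕ) : ℤ) - 1 = (n : ℤ) := by push_cast; ring
    rw [h1, diagPow_natCast, pow_succ', ← mul_assoc, (slqTuple_u s).da, add_mul, one_mul,
      if_pos hi, smul_mul_assoc, ← diagPow_natCast, bc_mul_diagPow, smul_smul,
      ← zpow_neg_one, ← zpow_add₀ hs]
    congr 3
    push_cast; ring
  · obtain ⟨n, rfl⟩ : ∃ n : ℕ, i = -n := ⟨(-i).toNat, by omega⟩
    have h1 : -(n : ℤ) - 1 = -((n + 1 : ℕ) : ℤ) := by push_cast; ring
    rw [if_neg (by omega), zero_smul, add_zero, h1, diagPow_neg_natCast, diagPow_neg_natCast,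
      pow_succ']

theorem pbwMono_gen (i j : Fin 2) (m : PBW) :
    pbwMono s (pbwGen s i j m) = u s i j * pbwMono s m := by
  have hbc : Commute (u s 0 1) (u s 1 0) := (slqTuple_u s).bc.symm
  have hm : ∀ (x : OSLq s) (j k : ℕ), x * u s 0 1 * u s 1 0 * u s 0 1 ^ j * u s 1 0 ^ k =
      x * u s 0 1 ^ (j + 1) * u s 1 0 ^ (k + 1) := fun x j k => by
    rw [pow_succ', pow_succ']
    simp only [mul_assoc]
    rw [(hbc.symm.pow_right j).left_comm]
  suffices h : pbwMono s ∘ₗ pbwGen s i j = LinearMap.mulLeft ℂ (u s i j) ∘ₗ pbwMono s from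
    LinearMap.congr_fun h m
  refine pbw_ext fun n k l => ?_
  fin_cases i <;> fin_cases j
  · simp [pbwGen, pbwA, pbwMono, ← mul_assoc, a_mul_diagPow, add_mul]
    split_ifs <;> simp [hm]
  · simp [pbwGen, pbwB, pbwMono, ← mul_assoc, b_mul_diagPow, pow_succ']
  · have h2 : ∀ x : OSLq s, x * u s 1 0 * u s 0 1 ^ k = x * u s 0 1 ^ k * u s 1 0 := fun x => by
      rw [mul_assoc, mul_assoc, (hbc.symm.pow_right k).eq]
    simp [pbwGen, pbwC, pbwMono, ← mul_assoc, c_mul_diagPow, pow_succ', h2]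
  · simp [pbwGen, pbwD, pbwMono, ← mul_assoc, d_mul_diagPow, add_mul]
    split_ifs <;> simp [hm]

theorem pbwMono_rep (x : OSLq s) : ∀ m, pbwMono s (pbwRep s x m) = x * pbwMono s m := by
  induction x using slq_induction with
  | hc c => intro m; simp [Algebra.smul_def, AlgHom.commutes, Module.algebraMap_end_apply]
  | hu i j => intro m; rw [pbwRep_u, pbwMono_gen]
  | ha x y hx hy => intro m; simp [hx, hy, add_mul]
  | hm x y hx hy => intro m; simp [hx, hy, mul_assoc]

theorem pbwMono_ev (x : OSLq s) : pbwMono s (pbwEv s x) = x := by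
  change pbwMono s (pbwRep s x (pbw 0 0 0)) = x
  rw [pbwMono_rep, pbwMono_zero, mul_one]

theorem pbwEv_injective : Function.Injective (pbwEv s) :=
  Function.LeftInverse.injective (pbwMono_ev s)

/-- Right multiplication by `b`. -/
def pbwRightB : Module.End ℂ PBW := pbwMap fun i j k => pbw i (j + 1) k

/-- Right multiplication by `c`. -/
def pbwRightC : Module.End ℂ PBW := pbwMap fun i j k => pbw i j (k + 1)

/-- Right multiplication by `a`. -/
def pbwRightA : Module.End ℂ PBW := pbwMap fun i j k => ((s : ℂ) ^ 2) ^ (-(j : ℤ) - k) •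
  (pbw (i + 1) j k + (if i < 0 then ((s : ℂ) ^ 2)⁻¹ else 0) • pbw (i + 1) (j + 1) (k + 1))

theorem pbwEv_mul {y : OSLq s} {f : Module.End ℂ PBW}
    (hf : ∀ i j, Commute f (pbwGen s i j)) (h0 : f (pbw 0 0 0) = pbwEv s y) (x : OSLq s) :
    pbwEv s (x * y) = f (pbwEv s x) := by
  have hc : ∀ x, Commute f (pbwRep s x) := fun x => by
    induction x using slq_induction with
    | hc c => rw [AlgHom.commutes]; exact Algebra.commute_algebraMap_right c f
    | hu i j => rw [pbwRep_u]; exact hf i j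
    | ha x y hx hy => rw [map_add]; exact hx.add_right hy
    | hm x y hx hy => rw [map_mul]; exact hx.mul_right hy
  change pbwRep s (x * y) _ = f (pbwRep s x _)
  rw [← Module.End.mul_apply, (hc x).eq, Module.End.mul_apply, h0, map_mul]
  rfl

theorem pbwEv_left (i j : Fin 2) (x : OSLq s) :
    pbwEv s (u s i j * x) = pbwGen s i j (pbwEv s x) := by
  change pbwRep s (u s i j * x) _ = pbwGen s i j (pbwRep s x _)
  rw [map_mul, pbwRep_u]
  rfl

theorem pbwEv_u (i j : Fin 2) : pbwEv s (u s i j) = pbwGen s i j (pbw 0 0 0) := by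
  change pbwRep s (u s i j) _ = _
  rw [pbwRep_u]

theorem pbwEv_one : pbwEv s 1 = pbw 0 0 0 := by
  change pbwRep s 1 _ = _
  rw [map_one]
  rfl

theorem pbwEv_gens : pbwEv s (u s 0 0) = pbw 1 0 0 ∧ pbwEv s (u s 0 1) = pbw 0 1 0 ∧
    pbwEv s (u s 1 0) = pbw 0 0 1 ∧ pbwEv s (u s 1 1) = pbw (-1) 0 0 := by
  simp [pbwEv_u, pbwGen, pbwA, pbwB, pbwC, pbwD]

theorem pbwEv_mul_b (x : OSLq s) : pbwEv s (x * u s 0 1) = pbwRightB (pbwEv s x) := by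
  refine pbwEv_mul s (fun i j => ?_) ?_ x
  · fin_cases i <;> fin_cases j <;> refine pbw_ext fun i j k => ?_ <;>
      simp [pbwGen, pbwA, pbwB, pbwC, pbwD, pbwRightB, -ite_smul]
  · simp [pbwEv_gens, pbwRightB]

theorem pbwEv_mul_c (x : OSLq s) : pbwEv s (x * u s 1 0) = pbwRightC (pbwEv s x) := by
  refine pbwEv_mul s (fun i j => ?_) ?_ x
  · fin_cases i <;> fin_cases j <;> refine pbw_ext fun i j k => ?_ <;>
      simp [pbwGen, pbwA, pbwB, pbwC, pbwD, pbwRightC, -ite_smul]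
  · simp [pbwEv_gens, pbwRightC]

theorem pbwEv_mul_a (x : OSLq s) : pbwEv s (x * u s 0 0) = pbwRightA s (pbwEv s x) := by
  have hs : (s : ℂ) ^ 2 ≠ 0 := pow_ne_zero 2 s.ne_zero
  refine pbwEv_mul s (fun i j => ?_) ?_ x
  · generalize hq : (s : ℂ) ^ 2 = q at hs
    fin_cases i <;> fin_cases j <;> refine pbw_ext fun i j k => ?_
    · change (pbwRightA s * pbwA s) _ = (pbwA s * pbwRightA s) _
      simp only [pbwA, pbwRightA, hq, Module.End.mul_apply, pbwMap_pbw, map_add, map_smul]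
      obtain hi | rfl | hi : i < -1 ∨ i = -1 ∨ 0 ≤ i := by omega
      · simp only [if_pos (show i < 0 by omega), if_pos (show i + 1 < 0 by omega)]
        match_scalars <;>
          simp [zpow_sub₀ hs, zpow_neg, zpow_add₀ hs, mul_add, two_mul] <;> field_simp
        ring
      · norm_num
        match_scalars <;> simp [zpow_sub₀ hs, zpow_neg, zpow_add₀ hs] <;> field_simp
      · simp only [if_neg (show ¬ i < 0 by omega), if_neg (show ¬ i + 1 < 0 by omega)]
        match_scalars <;> simp
    · change (pbwRightA s * pbwB s) _ = (pbwB s * pbwRightA s) _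
      simp only [pbwB, pbwRightA, hq, Module.End.mul_apply, pbwMap_pbw, map_add, map_smul]
      match_scalars <;> simp [zpow_sub₀ hs, zpow_neg, zpow_add₀ hs] <;> field_simp
    · change (pbwRightA s * pbwC s) _ = (pbwC s * pbwRightA s) _
      simp only [pbwC, pbwRightA, hq, Module.End.mul_apply, pbwMap_pbw, map_add, map_smul]
      match_scalars <;> simp [zpow_sub₀ hs, zpow_neg, zpow_add₀ hs] <;> field_simp
    · change (pbwRightA s * pbwD s) _ = (pbwD s * pbwRightA s) _
      simp only [pbwD, pbwRightA, hq, Module.End.mul_apply, pbwMap_pbw, map_add, map_smul]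
      obtain hi | rfl | hi : i < 0 ∨ i = 0 ∨ 0 < i := by omega
      · simp only [if_pos hi, if_neg (show ¬ 0 < i by omega), if_neg (show ¬ 0 < i + 1 by omega),
          if_pos (show i - 1 < 0 by omega), sub_add_cancel, add_sub_cancel_right]
        match_scalars <;> simp
      · norm_num
      · simp only [if_pos hi, if_neg (show ¬ i < 0 by omega), if_pos (show 0 < i + 1 by omega),
          if_neg (show ¬ i - 1 < 0 by omega), sub_add_cancel, add_sub_cancel_right]
        match_scalars <;>
          simp [zpow_sub₀ hs, zpow_neg, zpow_add₀ hs, mul_add, two_mul] <;> field_simp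
  · simp [pbwEv_gens, pbwRightA]

theorem pbwB_apply (v : PBW) (i : ℤ) (j k : ℕ) :
    pbwB s v (i, j + 1, k) = ((s : ℂ) ^ 2) ^ (-i) * v (i, j, k) := by
  suffices h : Finsupp.lapply (i, j + 1, k) ∘ₗ pbwB s =
      (((s : ℂ) ^ 2) ^ (-i)) • Finsupp.lapply (i, j, k) from LinearMap.congr_fun h v
  refine pbw_ext fun i' j' k' => ?_
  simp only [pbwB, pbw, LinearMap.comp_apply, LinearMap.smul_apply, Finsupp.lapply_apply]
  rw [← pbw, pbwMap_pbw]
  by_cases h : i' = i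
  · subst h; simp [pbw, Finsupp.single_apply]
  · simp [pbw, h]

theorem pbwC_apply (v : PBW) (i : ℤ) (j k : ℕ) :
    pbwC s v (i, j, k + 1) = ((s : ℂ) ^ 2) ^ (-i) * v (i, j, k) := by
  suffices h : Finsupp.lapply (i, j, k + 1) ∘ₗ pbwC s =
      (((s : ℂ) ^ 2) ^ (-i)) • Finsupp.lapply (i, j, k) from LinearMap.congr_fun h v
  refine pbw_ext fun i' j' k' => ?_
  simp only [pbwC, pbw, LinearMap.comp_apply, LinearMap.smul_apply, Finsupp.lapply_apply]
  rw [← pbw, pbwMap_pbw]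
  by_cases h : i' = i
  · subst h; simp [pbw, Finsupp.single_apply]
  · simp [pbw, h]

theorem pbwRightB_apply (v : PBW) (i : ℤ) (j k : ℕ) :
    pbwRightB v (i, j + 1, k) = v (i, j, k) := by
  suffices h : Finsupp.lapply (i, j + 1, k) ∘ₗ pbwRightB =
      (Finsupp.lapply (i, j, k) : PBW →ₗ[ℂ] ℂ) from LinearMap.congr_fun h v
  refine pbw_ext fun i' j' k' => ?_
  rw [LinearMap.comp_apply, pbwRightB, pbwMap_pbw]
  simp [pbw, Finsupp.single_apply]

theorem pbwRightC_apply (v : PBW) (i : ℤ) (j k : ℕ) :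
    pbwRightC v (i, j, k + 1) = v (i, j, k) := by
  suffices h : Finsupp.lapply (i, j, k + 1) ∘ₗ pbwRightC =
      (Finsupp.lapply (i, j, k) : PBW →ₗ[ℂ] ℂ) from LinearMap.congr_fun h v
  refine pbw_ext fun i' j' k' => ?_
  rw [LinearMap.comp_apply, pbwRightC, pbwMap_pbw]
  simp [pbw, Finsupp.single_apply]

theorem pbwA_apply (v : PBW) (j k : ℕ) : pbwA s v (1, j, k) = v (0, j, k) := by
  suffices h : Finsupp.lapply (1, j, k) ∘ₗ pbwA s =
      (Finsupp.lapply (0, j, k) : PBW →ₗ[ℂ] ℂ) from LinearMap.congr_fun h v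
  refine pbw_ext fun i' j' k' => ?_
  rw [LinearMap.comp_apply, pbwA, pbwMap_pbw]
  by_cases h : i' = 0
  · simp [pbw, Finsupp.single_apply, h]
  · simp only [pbw]
    split_ifs <;> simp [h]

theorem pbwRightA_apply (v : PBW) (j k : ℕ) :
    pbwRightA s v (1, j, k) = ((s : ℂ) ^ 2) ^ (-(j : ℤ) - k) * v (0, j, k) := by
  suffices h : Finsupp.lapply (1, j, k) ∘ₗ pbwRightA s =
      (((s : ℂ) ^ 2) ^ (-(j : ℤ) - k)) • (Finsupp.lapply (0, j, k) : PBW →ₗ[ℂ] ℂ) from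
    LinearMap.congr_fun h v
  refine pbw_ext fun i' j' k' => ?_
  rw [LinearMap.comp_apply, pbwRightA, pbwMap_pbw]
  by_cases h : i' = 0
  · by_cases h1 : j' = j
    · subst h1; by_cases h2 : k' = k
      · subst h2; simp [pbw, h]
      · simp [pbw, h, h2]
    · simp [pbw, h, h1]
  · simp only [pbw]
    split_ifs <;> simp [h]

variable {s}

theorem zpow_eq_one_of_not_root (hq : ∀ n : ℕ, 0 < n → ((s : ℂ) ^ 2) ^ n ≠ 1) {n : ℤ}
    (h : ((s : ℂ) ^ 2) ^ n = 1) : n = 0 := by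
  obtain ⟨m, rfl | rfl⟩ := n.eq_nat_or_neg
  · by_contra hm
    exact hq m (by omega) (by simpa using h)
  · by_contra hm
    refine hq m (by omega) ?_
    rw [zpow_neg, zpow_natCast, inv_eq_one] at h
    exact h

/-- An element which commutes with the generators up to scalars and lower order terms is a
scalar. -/
theorem eq_algebraMap_of_twisted_commute (hq : ∀ n : ℕ, 0 < n → ((s : ℂ) ^ 2) ^ n ≠ 1)
    {x : OSLq s} {r α α' β β' γ γ' : ℂ} (hr : r ≠ 0)
    (hb : r • (u s 0 1 * x) - x * u s 0 1 = α • u s 0 0 + α' • u s 0 1)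
    (hc : r⁻¹ • (u s 1 0 * x) - x * u s 1 0 = β • u s 1 0 + β' • u s 1 1)
    (ha : r⁻¹ • (u s 0 0 * x) - x * u s 0 0 = γ • u s 0 0 + γ' • u s 0 1) :
    ∃ c, x = algebraMap ℂ (OSLq s) c := by
  have hs : (s : ℂ) ^ 2 ≠ 0 := pow_ne_zero 2 s.ne_zero
  have key : ∀ i j k, (i, j, k) ≠ ((0 : ℤ), (0 : ℕ), (0 : ℕ)) → pbwEv s x (i, j, k) = 0 := by
    intro i j k hne
    by_contra hx
    have hb' := DFunLike.congr_fun (congrArg (pbwEv s) hb) (i, j + 1, k)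
    have hc' := DFunLike.congr_fun (congrArg (pbwEv s) hc) (i, j, k + 1)
    have ha' := DFunLike.congr_fun (congrArg (pbwEv s) ha) (1, j, k)
    simp only [map_sub, map_add, map_smul, pbwEv_left, pbwEv_mul_a, pbwEv_mul_b, pbwEv_mul_c,
      pbwEv_gens, pbwGen, Finsupp.sub_apply, Finsupp.add_apply, Finsupp.smul_apply, smul_eq_mul,
      Matrix.of_apply, Matrix.cons_val_zero, Matrix.cons_val_one, pbwA_apply, pbwB_apply,
      pbwC_apply, pbwRightA_apply, pbwRightB_apply, pbwRightC_apply] at ha' hb' hc'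
    have hb0 : pbw 1 0 0 (i, j + 1, k) = 0 ∧ pbw 0 1 0 (i, j + 1, k) = 0 := by
      simp only [pbw, Finsupp.single_apply, Prod.mk.injEq]
      exact ⟨if_neg (by omega), if_neg fun h => hne (by simp; omega)⟩
    have hc0 : pbw 0 0 1 (i, j, k + 1) = 0 ∧ pbw (-1) 0 0 (i, j, k + 1) = 0 := by
      simp only [pbw, Finsupp.single_apply, Prod.mk.injEq]
      exact ⟨if_neg fun h => hne (by simp; omega), if_neg (by omega)⟩
    rw [hb0.1, hb0.2] at hb'
    rw [hc0.1, hc0.2] at hc'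
    have h1 : r * ((s : ℂ) ^ 2) ^ (-i) = 1 := by
      refine mul_right_cancel₀ hx ?_
      linear_combination hb'
    have h2 : r⁻¹ * ((s : ℂ) ^ 2) ^ (-i) = 1 := by
      refine mul_right_cancel₀ hx ?_
      linear_combination hc'
    have h3 : i = 0 := by
      have h : ((s : ℂ) ^ 2) ^ (-i + -i) = 1 := by
        rw [zpow_add₀ hs]
        linear_combination h1 * r⁻¹ * ((s : ℂ) ^ 2) ^ (-i) + h2 -
          mul_inv_cancel₀ hr * ((s : ℂ) ^ 2) ^ (-i) * ((s : ℂ) ^ 2) ^ (-i)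
      have := zpow_eq_one_of_not_root hq h
      omega
    subst h3
    have h4 : r = 1 := by simpa using h1
    have ha0 : pbw 1 0 0 (1, j, k) = 0 ∧ pbw 0 1 0 (1, j, k) = 0 := by
      simp only [pbw, Finsupp.single_apply, Prod.mk.injEq]
      exact ⟨if_neg fun h => hne (by simp; omega), if_neg (by omega)⟩
    rw [ha0.1, ha0.2, h4] at ha'
    have h5 : ((s : ℂ) ^ 2) ^ (-(j : ℤ) - k) = 1 := by
      refine mul_right_cancel₀ hx ?_
      linear_combination -ha'
    have := zpow_eq_one_of_not_root hq h5
    exact hne (by simp; omega)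
  refine ⟨pbwEv s x (0, 0, 0), pbwEv_injective s ?_⟩
  rw [Algebra.algebraMap_eq_smul_one, map_smul, pbwEv_one]
  ext ⟨i, j, k⟩
  by_cases h : (i, j, k) = ((0 : ℤ), (0 : ℕ), (0 : ℕ))
  · rw [h]; simp [pbw]
  · rw [key i j k h]
    simp [pbw, Ne.symm h]

theorem algebraMap_slq_injective : Function.Injective (algebraMap ℂ (OSLq s)) := by
  intro c d h
  have h1 := DFunLike.congr_fun (congrArg (pbwEv s) h) (0, 0, 0)
  simpa [Algebra.algebraMap_eq_smul_one, pbwEv_one, pbw] using h1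

theorem lin_indep_ab {x y : ℂ} (h : x • u s 0 0 + y • u s 0 1 = 0) : x = 0 ∧ y = 0 := by
  have h1 := congrArg (pbwEv s) h
  simp only [map_add, map_smul, pbwEv_gens, map_zero] at h1
  constructor
  · simpa [pbw] using DFunLike.congr_fun h1 (1, 0, 0)
  · simpa [pbw] using DFunLike.congr_fun h1 (0, 1, 0)

end CoordinateAlgebra

section Intertwiners

variable {s : ℂˣ}

/-- Matrices `G^k_l` (the images of the generators under a representation) which are triangular
with respect to a height function, with diagonal entries `D` for `d` and `D⁻¹` for `a`. -/
structure IsTriangularRep {ι : Type*} (G : Fin 2 → Fin 2 → Matrix ι ι ℂ) (h : ι → ℕ)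
    (D : ι → ℂ) : Prop where
  raise : ∀ k l p r, G k l p r ≠ 0 → p = r ∨ h p < h r
  diag_a : ∀ p, G 0 0 p p = (D p)⁻¹
  diag_b : ∀ p, G 0 1 p p = 0
  diag_c : ∀ p, G 1 0 p p = 0
  diag_d : ∀ p, G 1 1 p p = D p
  ne_zero : ∀ p, D p ≠ 0

/-- An intertwiner with entries in `O(SL_q(2))` between triangular representations has scalar
entries. -/
theorem intertwiner_scalar {ι κ : Type*} [Fintype ι] [Fintype κ] [DecidableEq ι] [DecidableEq κ]
    (hq : ∀ n : ℕ, 0 < n → ((s : ℂ) ^ 2) ^ n ≠ 1)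
    {G : Fin 2 → Fin 2 → Matrix ι ι ℂ} {h : ι → ℕ} {D : ι → ℂ} (hG : IsTriangularRep G h D)
    {G' : Fin 2 → Fin 2 → Matrix κ κ ℂ} {h' : κ → ℕ} {D' : κ → ℂ} (hG' : IsTriangularRep G' h' D')
    (t : ι → κ → OSLq s)
    (ht : ∀ k l p r, ∑ m, ∑ p', G m l p p' • (u s k m * t p' r) =
      ∑ m, ∑ r', G' m l r' r • (t p r' * u s k m)) (p : ι) (r : κ) :
    ∃ c, t p r = algebraMap ℂ (OSLq s) c := by
  obtain ⟨H, hH⟩ : ∃ H, ∀ p, h p ≤ H := ⟨Finset.univ.sup h, fun p => Finset.le_sup (Finset.mem_univ p)⟩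
  induction hn : (H - h p) + h' r using Nat.strong_induction_on generalizing p r with
  | _ n ih =>
  have h1 : ∀ p', h p < h p' → ∃ c, t p' r = algebraMap ℂ (OSLq s) c := fun p' hp =>
    ih _ (by have := hH p'; omega) p' r rfl
  have h2 : ∀ r', h' r' < h' r → ∃ c, t p r' = algebraMap ℂ (OSLq s) c := fun r' hr =>
    ih _ (by omega) p r' rfl
  have e1 : ∀ m l, ∃ c : ℂ, ∀ k, ∑ p', G m l p p' • (u s k m * t p' r) =
      G m l p p • (u s k m * t p r) + c • u s k m := by
    intro m l
    choose! c hc using h1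
    refine ⟨∑ p' ∈ Finset.univ.erase p, G m l p p' * c p', fun k => ?_⟩
    rw [← Finset.add_sum_erase _ _ (Finset.mem_univ p), Finset.sum_smul]
    congr 1
    refine Finset.sum_congr rfl fun p' hp' => ?_
    by_cases h0 : G m l p p' = 0
    · rw [h0, zero_mul, zero_smul, zero_smul]
    · rcases hG.raise _ _ _ _ h0 with rfl | hlt
      · simp at hp'
      · rw [hc p' hlt, ← Algebra.commutes, ← Algebra.smul_def, smul_smul]
  have e2 : ∀ m l, ∃ c : ℂ, ∀ k, ∑ r', G' m l r' r • (t p r' * u s k m) =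
      G' m l r r • (t p r * u s k m) + c • u s k m := by
    intro m l
    choose! c hc using h2
    refine ⟨∑ r' ∈ Finset.univ.erase r, G' m l r' r * c r', fun k => ?_⟩
    rw [← Finset.add_sum_erase _ _ (Finset.mem_univ r), Finset.sum_smul]
    congr 1
    refine Finset.sum_congr rfl fun r' hr' => ?_
    by_cases h0 : G' m l r' r = 0
    · rw [h0, zero_mul, zero_smul, zero_smul]
    · rcases hG'.raise _ _ _ _ h0 with rfl | hlt
      · simp at hr'
      · rw [hc r' hlt, ← Algebra.smul_def, smul_smul]
  choose c hc using e1
  choose c' hc' using e2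
  have e3 : ∀ k l, ∑ m, (G m l p p • (u s k m * t p r) + c m l • u s k m) =
      ∑ m, (G' m l r r • (t p r * u s k m) + c' m l • u s k m) := by
    intro k l
    simpa only [hc, hc'] using ht k l p r
  have eb := e3 0 1
  have ec := e3 1 0
  have ea := e3 0 0
  simp only [Fin.sum_univ_two, hG.diag_a, hG.diag_b, hG.diag_c, hG.diag_d, hG'.diag_a, hG'.diag_b,
    hG'.diag_c, hG'.diag_d, zero_smul, zero_add] at ea eb ec
  have d0 := hG.ne_zero p
  have d0' := hG'.ne_zero r
  refine eq_algebraMap_of_twisted_commute hq (r := D p / D' r) (div_ne_zero d0 d0')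
    (α := (D' r)⁻¹ * (c' 0 1 - c 0 1)) (α' := (D' r)⁻¹ * (c' 1 1 - c 1 1))
    (β := D' r * (c' 0 0 - c 0 0)) (β' := D' r * (c' 1 0 - c 1 0))
    (γ := D' r * (c' 0 0 - c 0 0)) (γ' := D' r * (c' 1 0 - c 1 0)) ?_ ?_ ?_
  · linear_combination (norm := skip) (D' r)⁻¹ • eb
    match_scalars <;> field_simp <;> ring
  · linear_combination (norm := skip) (D' r) • ec
    match_scalars <;> field_simp <;> ring
  · linear_combination (norm := skip) (D' r) • ea
    match_scalars <;> field_simp <;> ring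

/-- An intertwiner with scalar entries commutes with the representation matrices. -/
theorem intertwiner_matrix {ι κ : Type*} [Fintype ι] [Fintype κ]
    {G : Fin 2 → Fin 2 → Matrix ι ι ℂ} {G' : Fin 2 → Fin 2 → Matrix κ κ ℂ}
    (T : Matrix ι κ ℂ)
    (ht : ∀ k l p r, ∑ m, ∑ p', G m l p p' • (u s k m * algebraMap ℂ (OSLq s) (T p' r)) =
      ∑ m, ∑ r', G' m l r' r • (algebraMap ℂ (OSLq s) (T p r') * u s k m)) (k l : Fin 2) :
    G k l * T = T * G' k l := by
  ext p r
  have h : ((G 0 l * T) p r - (T * G' 0 l) p r) • u s 0 0 +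
      ((G 1 l * T) p r - (T * G' 1 l) p r) • u s 0 1 = 0 := by
    have h0 := ht 0 l p r
    simp only [← Algebra.commutes, ← Algebra.smul_def, smul_smul, ← Finset.sum_smul,
      Fin.sum_univ_two] at h0
    simp only [Matrix.mul_apply, mul_comm (T p _)]
    linear_combination (norm := skip) h0
    module
  have h2 := lin_indep_ab h
  rw [sub_eq_zero, sub_eq_zero] at h2
  fin_cases k
  · exact h2.1
  · exact h2.2

end Intertwiners

section GamTwo

variable (s : ℂˣ) (ε : ℤˣ)

/-- The basis elements `θ_I ⊗ θ_J` of `Γ ⊗_A Γ`. -/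
def thetaTwo (p : Idx × Idx) : GamTwo s ε := btmul (OSLq s) (theta s ε p.1) (theta s ε p.2)

theorem gam_eq_sum (x : Gam s ε) : x = ∑ I, x I • theta s ε I := by
  funext J
  rw [gam_sum, Fintype.sum_eq_single J fun I hI => by
    rw [smul_gam, theta, if_neg (Ne.symm hI), mul_zero], smul_gam, theta, if_pos rfl, mul_one]

theorem btmul_theta (x : Gam s ε) (J : Idx) :
    btmul (OSLq s) x (theta s ε J) = ∑ I, x I • thetaTwo s ε (I, J) := by
  have h : ∀ (f : Idx → Gam s ε) (t : Finset Idx), btmul (OSLq s) (∑ I ∈ t, f I) (theta s ε J) =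
      ∑ I ∈ t, btmul (OSLq s) (f I) (theta s ε J) := fun f t =>
    map_sum (AddMonoidHom.mk' (fun x => btmul (OSLq s) x (theta s ε J))
      fun x y => btmul_add_left _ _ _ : Gam s ε →+ GamTwo s ε) f t
  conv_lhs => rw [gam_eq_sum s ε x]
  rw [h]
  rfl

theorem gamTwo_eq_sum (x : GamTwo s ε) : x = ∑ p, coords s ε x p • thetaTwo s ε p := by
  induction x using bal_induction with
  | h0 => simp
  | ht x y =>
    have h : ∀ (f : Idx → Gam s ε) (t : Finset Idx), btmul (OSLq s) x (∑ I ∈ t, f I) =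
        ∑ I ∈ t, btmul (OSLq s) x (f I) := fun f t =>
      map_sum (AddMonoidHom.mk' (fun y => btmul (OSLq s) x y)
        fun y z => btmul_add_right _ _ _ : Gam s ε →+ GamTwo s ε) f t
    conv_lhs => rw [gam_eq_sum s ε y]
    rw [h]
    refine Eq.trans ?_ (Fintype.sum_prod_type_right _).symm
    refine Finset.sum_congr rfl fun J _ => ?_
    rw [← btmul_balance, btmul_theta]
    rfl
  | ha x y hx hy =>
    conv_lhs => rw [hx, hy]
    simp only [map_add, Pi.add_apply, add_smul, Finset.sum_add_distrib]

theorem coords_injective : Function.Injective (coords s ε) := fun x y h => by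
  rw [gamTwo_eq_sum s ε x, gamTwo_eq_sum s ε y, h]

theorem coords_thetaTwo (p r : Idx × Idx) :
    coords s ε (thetaTwo s ε p) r = if r = p then 1 else 0 := by
  obtain ⟨p1, p2⟩ := p
  obtain ⟨r1, r2⟩ := r
  rw [thetaTwo, coords_btmul]
  by_cases h2 : r2 = p2
  · simp [theta, h2]
  · simp [theta, h2, gam_zero]

theorem coords_sum_smul (a : Idx × Idx → OSLq s) :
    coords s ε (∑ p, a p • thetaTwo s ε p) = a := by
  funext r
  rw [map_sum, Finset.sum_apply, Fintype.sum_eq_single r fun p hp => by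
    rw [coords_smul, coords_thetaTwo, if_neg (Ne.symm hp), mul_zero], coords_smul, coords_thetaTwo,
    if_pos rfl, mul_one]

theorem op_finset_sum_smul {N : Type*} [AddCommGroup N] [Module (OSLq s)ᵐᵒᵖ N] {ι : Type*}
    (t : Finset ι) (a : ι → OSLq s) (x : N) :
    (op (∑ i ∈ t, a i)) • x = ∑ i ∈ t, op (a i) • x := by
  rw [← Finset.sum_smul]
  congr 1
  exact map_sum (opAddEquiv (α := OSLq s)) a t

theorem coords_op_smul (a : OSLq s) (x : GamTwo s ε) (r : Idx × Idx) :
    coords s ε (op a • x) r = ∑ p, coords s ε x p * phi s ε (phi s ε a p.2 r.2) p.1 r.1 := by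
  induction x using bal_induction with
  | h0 => simp
  | ht x y =>
    rw [op_smul_btmul, coords_btmul, op_smul_gam s ε a y, op_finset_sum_smul, gam_sum]
    refine Eq.trans ?_ (Fintype.sum_prod_type_right _).symm
    refine Finset.sum_congr rfl fun J _ => ?_
    rw [op_mul, mul_smul, op_smul_gam]
    rfl
  | ha x y hx hy => rw [smul_add, map_add, map_add]; simp [hx, hy, add_mul, Finset.sum_add_distrib]

/-- The matrices of the right action of the generators on the basis `θ_I ⊗ θ_J`. -/
def fTwo (k l : Fin 2) : Matrix (Idx × Idx) (Idx × Idx) ℂ := Matrix.of fun p r =>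
  ∑ m, fGen s ε k m p.1 r.1 * fGen s ε m l p.2 r.2

theorem coords_op_u_smul (k l : Fin 2) (x : GamTwo s ε) (r : Idx × Idx) :
    coords s ε (op (u s k l) • x) r =
      ∑ p, coords s ε x p * ∑ m, fTwo s ε m l p r • u s k m := by
  rw [coords_op_smul]
  refine Finset.sum_congr rfl fun p _ => ?_
  congr 1
  rw [phi_u, map_sum, Matrix.sum_apply]
  simp only [map_smul, Matrix.smul_apply, phi_u, fTwo, Matrix.of_apply, Finset.smul_sum,
    Finset.sum_smul, smul_smul]
  rw [Finset.sum_comm]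
  simp only [mul_comm]

end GamTwo

section Triangular

theorem IsTriangularRep.prod {ι κ : Type*} {G : Fin 2 → Fin 2 → Matrix ι ι ℂ} {h : ι → ℕ} {D : ι → ℂ}
    (hG : IsTriangularRep G h D) {G' : Fin 2 → Fin 2 → Matrix κ κ ℂ} {h' : κ → ℕ} {D' : κ → ℂ}
    (hG' : IsTriangularRep G' h' D') :
    IsTriangularRep (fun k l => Matrix.of fun (p r : ι × κ) => ∑ m, G k m p.1 r.1 * G' m l p.2 r.2)
      (fun p => h p.1 + h' p.2) (fun p => D p.1 * D' p.2) where
  raise k l p r hne := by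
    simp only [Matrix.of_apply] at hne
    obtain ⟨m, -, hm⟩ := Finset.exists_ne_zero_of_sum_ne_zero hne
    rcases hG.raise _ _ _ _ (left_ne_zero_of_mul hm) with h1 | h1 <;>
      rcases hG'.raise _ _ _ _ (right_ne_zero_of_mul hm) with h2 | h2
    · exact Or.inl (Prod.ext h1 h2)
    · rw [h1]; right; omega
    · rw [h2]; right; omega
    · right; omega
  diag_a p := by simp [Fin.sum_univ_two, hG.diag_a, hG.diag_b, hG'.diag_a, mul_comm]
  diag_b p := by simp [Fin.sum_univ_two, hG.diag_b, hG'.diag_b]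
  diag_c p := by simp [Fin.sum_univ_two, hG.diag_c, hG'.diag_c]
  diag_d p := by simp [Fin.sum_univ_two, hG.diag_c, hG.diag_d, hG'.diag_d]
  ne_zero p := mul_ne_zero (hG.ne_zero _) (hG'.ne_zero _)

variable (s : ℂˣ) (ε : ℤˣ)

theorem fGen_apply (k l : Fin 2) (I J : Idx) : fGen s ε k l I J =
    ((ε : ℤ) : ℂ) * ∑ t, Lplus s k t I.1 J.1 * Lminus s t l I.2 J.2 := rfl

variable {s} in
theorem Lplus_entries : (Lplus s 0 0 0 0 = s ∧ Lplus s 0 0 0 1 = 0 ∧ Lplus s 0 0 1 0 = 0 ∧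
    Lplus s 0 0 1 1 = (s : ℂ)⁻¹) ∧ (Lplus s 0 1 0 0 = 0 ∧
    Lplus s 0 1 0 1 = (s : ℂ)⁻¹ * ((s : ℂ) ^ 2 - ((s : ℂ) ^ 2)⁻¹) ∧ Lplus s 0 1 1 0 = 0 ∧
    Lplus s 0 1 1 1 = 0) ∧ (∀ i r, Lplus s 1 0 i r = 0) ∧ Lplus s 1 1 0 0 = (s : ℂ)⁻¹ ∧
    Lplus s 1 1 0 1 = 0 ∧ Lplus s 1 1 1 0 = 0 ∧ Lplus s 1 1 1 1 = s := by
  simp [Lplus_eq]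

variable {s} in
theorem Lminus_entries : (Lminus s 0 0 0 0 = (s : ℂ)⁻¹ ∧ Lminus s 0 0 0 1 = 0 ∧ Lminus s 0 0 1 0 = 0 ∧
    Lminus s 0 0 1 1 = s) ∧ (∀ i r, Lminus s 0 1 i r = 0) ∧ (Lminus s 1 0 0 0 = 0 ∧
    Lminus s 1 0 0 1 = 0 ∧ Lminus s 1 0 1 0 = (s : ℂ)⁻¹ - (s : ℂ) ^ 3 ∧
    Lminus s 1 0 1 1 = 0) ∧ Lminus s 1 1 0 0 = s ∧
    Lminus s 1 1 0 1 = 0 ∧ Lminus s 1 1 1 0 = 0 ∧ Lminus s 1 1 1 1 = (s : ℂ)⁻¹ := by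
  simp [Lminus_eq]

variable {s} in
theorem Ccheck_entries : Ccheck s 0 0 = 0 ∧ Ccheck s 0 1 = (s : ℂ)⁻¹ ∧ Ccheck s 1 0 = -(s : ℂ) ∧
    Ccheck s 1 1 = 0 := by
  simp [Ccheck]

theorem sign_mul_self : ((ε : ℤ) : ℂ) * ((ε : ℤ) : ℂ) = 1 := by
  rcases Int.units_eq_one_or ε with rfl | rfl <;> simp

theorem sign_inv : ((ε : ℤ) : ℂ)⁻¹ = ((ε : ℤ) : ℂ) :=
  inv_eq_of_mul_eq_one_left (sign_mul_self ε)

theorem sign_ne_zero : ((ε : ℤ) : ℂ) ≠ 0 := left_ne_zero_of_mul_eq_one (sign_mul_self ε)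

/-- The height of a basis element `θ_{ij}`. -/
def idxHeight (I : Idx) : ℕ := I.1 + (1 - I.2)

/-- The eigenvalues of the diagonal part of `f(u^2_2)`. -/
def idxWeight (I : Idx) : ℂ := ((ε : ℤ) : ℂ) * ((s : ℂ) ^ 2) ^ ((I.1 : ℤ) - (I.2 : ℤ))

theorem isTriangularRep_fGen : IsTriangularRep (fGen s ε) idxHeight (idxWeight s ε) := by
  have hs : (s : ℂ) ≠ 0 := s.ne_zero
  have hε := sign_inv ε
  constructor
  · rintro k l ⟨i, j⟩ ⟨r, x⟩ h
    contrapose! h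
    revert h
    fin_cases k <;> fin_cases l <;> fin_cases i <;> fin_cases j <;> fin_cases r <;> fin_cases x <;>
      simp only [Fin.zero_eta, Fin.mk_one, fGen_apply, Fin.sum_univ_two, Lplus_entries, Lminus_entries,
        mul_zero, zero_mul, add_zero, implies_true] <;>
      simp [idxHeight]
  · rintro ⟨i, j⟩
    fin_cases i <;> fin_cases j <;>
      simp [fGen_apply, Fin.sum_univ_two, Lplus_eq, Lminus_eq, idxWeight, hε, pow_two, mul_comm]
  · rintro ⟨i, j⟩
    fin_cases i <;> fin_cases j <;>
      simp [fGen_apply, Fin.sum_univ_two, Lplus_eq, Lminus_eq]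
  · rintro ⟨i, j⟩
    fin_cases i <;> fin_cases j <;>
      simp [fGen_apply, Fin.sum_univ_two, Lplus_eq, Lminus_eq]
  · rintro ⟨i, j⟩
    fin_cases i <;> fin_cases j <;>
      simp [fGen_apply, Fin.sum_univ_two, Lplus_eq, Lminus_eq, idxWeight, hs, pow_two]
  · intro p
    exact mul_ne_zero (sign_ne_zero ε) (zpow_ne_zero _ (pow_ne_zero 2 hs))

theorem isTriangularRep_fTwo : IsTriangularRep (fTwo s ε) (fun p => idxHeight p.1 + idxHeight p.2)
    (fun p => idxWeight s ε p.1 * idxWeight s ε p.2) :=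
  (isTriangularRep_fGen s ε).prod (isTriangularRep_fGen s ε)

end Triangular

section Legs

variable {R : Type*} [CommRing R]

theorem leg23_mul_apply (M : Matrix Idx Idx ℂ) {κ : Type*} (N : Matrix (Idx × Idx) κ ℂ)
    (p : Idx × Idx) (r : κ) : (leg23 M * N) p r =
      ∑ c : Idx, M (p.1.2, p.2.1) c * N ((p.1.1, c.1), (c.2, p.2.2)) r := by
  obtain ⟨⟨i, j⟩, k, l⟩ := p
  simp only [Matrix.mul_apply, leg23, Matrix.of_apply, Fintype.sum_prod_type, Fin.sum_univ_two]
  fin_cases i <;> fin_cases l <;> simp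

theorem mul_leg23_apply (M : Matrix Idx Idx ℂ) {κ : Type*} (N : Matrix κ (Idx × Idx) ℂ)
    (p : κ) (r : Idx × Idx) : (N * leg23 M) p r =
      ∑ c : Idx, N p ((r.1.1, c.1), (c.2, r.2.2)) * M c (r.1.2, r.2.1) := by
  obtain ⟨⟨i, j⟩, k, l⟩ := r
  simp only [Matrix.mul_apply, leg23, Matrix.of_apply, Fintype.sum_prod_type, Fin.sum_univ_two]
  fin_cases i <;> fin_cases l <;> simp

theorem leg23_mul (M N : Matrix Idx Idx ℂ) : leg23 (M * N) = leg23 M * leg23 N := by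
  ext ⟨⟨i, j⟩, k, l⟩ ⟨⟨i', j'⟩, k', l'⟩
  rw [leg23_mul_apply]
  simp only [leg23, Matrix.of_apply, Matrix.mul_apply]
  split_ifs <;> simp

theorem leg23_one : leg23 (1 : Matrix Idx Idx ℂ) = 1 := by
  ext ⟨⟨i, j⟩, k, l⟩ ⟨⟨i', j'⟩, k', l'⟩
  simp only [leg23, Matrix.of_apply, Matrix.one_apply, Prod.mk.injEq]
  split_ifs <;> first | rfl | (exfalso; tauto)

end Legs

section Sorted

variable (s : ℂˣ) (ε : ℤˣ)

/-- The rank one matrix `Č^{ij} Č^{kl}`, which generates the Temperley-Lieb algebra. -/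
def cupCap : Matrix Idx Idx ℂ := Matrix.of fun a b => Ccheck s a.1 a.2 * Ccheck s b.1 b.2

theorem Rhat_eq : Rhat s = (s : ℂ) • 1 - (s : ℂ)⁻¹ • cupCap s := by
  have hs : (s : ℂ) ≠ 0 := s.ne_zero
  ext ⟨i, j⟩ ⟨k, l⟩
  fin_cases i <;> fin_cases j <;> fin_cases k <;> fin_cases l <;>
    simp [Rhat_entries, cupCap, Ccheck, hs] <;> try field_simp

theorem RhatInv_eq : RhatInv s = (s : ℂ)⁻¹ • 1 - (s : ℂ) • cupCap s := by
  ext a b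
  simp only [RhatInv, cupCap, Matrix.of_apply, Matrix.sub_apply, Matrix.smul_apply,
    Matrix.one_apply, smul_eq_mul]
  ring

theorem RhatInv_mul_Rhat : RhatInv s * Rhat s = 1 := mul_eq_one_comm.1 (Rhat_mul_RhatInv s)

/-- The matrices of `u^k_l` on the first and third legs. -/
def LplusTwo (k l : Fin 2) : Matrix Idx Idx ℂ := Matrix.of fun a b =>
  ∑ m, Lplus s k m a.1 b.1 * Lplus s m l a.2 b.2

/-- The matrices of `u^k_l` on the second and fourth legs. -/
def LminusTwo (k l : Fin 2) : Matrix Idx Idx ℂ := Matrix.of fun a b =>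
  ∑ m, Lminus s k m a.1 b.1 * Lminus s m l a.2 b.2

/-- The matrices of `u^k_l` after the legs of `θ_{ij} ⊗ θ_{kl}` have been sorted. -/
def fSorted (k l : Fin 2) : Matrix (Idx × Idx) (Idx × Idx) ℂ := Matrix.of fun p r =>
  ∑ m, LplusTwo s k m p.1 r.1 * LminusTwo s m l p.2 r.2

theorem Rhat_mixed (t t' : Fin 2) :
    (Rhat s * Matrix.of fun a b : Idx => ∑ m, Lminus s t m a.1 b.1 * Lplus s m t' a.2 b.2) =
      (Matrix.of fun a b : Idx => ∑ m, Lplus s t m a.1 b.1 * Lminus s m t' a.2 b.2) * Rhat s := by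
  have hs : (s : ℂ) ≠ 0 := s.ne_zero
  ext ⟨i, j⟩ ⟨k, l⟩
  simp only [Matrix.mul_apply, Matrix.of_apply, Fintype.sum_prod_type, Fin.sum_univ_two]
  fin_cases t <;> fin_cases t' <;> fin_cases i <;> fin_cases j <;> fin_cases k <;> fin_cases l <;>
    simp only [Fin.zero_eta, Fin.mk_one, Rhat_entries, Lplus_eq, Lminus_eq] <;>
    simp <;> field_simp <;> ring

theorem leg23_mul_fTwo (k l : Fin 2) :
    leg23 (Rhat s) * fTwo s ε k l = fSorted s k l * leg23 (Rhat s) := by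
  ext ⟨⟨i, j⟩, a, b⟩ ⟨⟨r, x⟩, c, d⟩
  rw [leg23_mul_apply, mul_leg23_apply]
  have h : ∀ t t', _ := fun t t' => congrFun (congrFun (Rhat_mixed s t t') (j, a)) (x, c)
  simp only [Matrix.mul_apply, Matrix.of_apply] at h
  calc _ = ∑ t, ∑ t', Lplus s k t i r * Lminus s t' l b d *
        (∑ e, Rhat s (j, a) e * ∑ m, Lminus s t m e.1 x * Lplus s m t' e.2 c) := by
        have hε : ∀ x y : ℂ, ((ε : ℤ) : ℂ) * x * (((ε : ℤ) : ℂ) * y) = x * y := fun x y => by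
          rw [mul_mul_mul_comm, sign_mul_self, one_mul]
        simp only [fTwo, Matrix.of_apply, fGen_apply, hε, Fintype.sum_prod_type, Fin.sum_univ_two]
        ring
    _ = _ := by
        simp only [h]
        simp only [fSorted, LplusTwo, LminusTwo, Matrix.of_apply, Fintype.sum_prod_type, Fin.sum_univ_two]
        ring

theorem cupCap_mul_LplusTwo (k l : Fin 2) : cupCap s * LplusTwo s k l = LplusTwo s k l * cupCap s := by
  have hs : (s : ℂ) ≠ 0 := s.ne_zero
  ext ⟨i, j⟩ ⟨r, x⟩
  simp only [Matrix.mul_apply, LplusTwo, cupCap, Matrix.of_apply, Fintype.sum_prod_type, Fin.sum_univ_two]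
  fin_cases k <;> fin_cases l <;> fin_cases i <;> fin_cases j <;> fin_cases r <;> fin_cases x <;>
    simp [Lplus_eq, Ccheck] <;> field_simp <;> ring

theorem cupCap_mul_LminusTwo (k l : Fin 2) :
    cupCap s * LminusTwo s k l = LminusTwo s k l * cupCap s := by
  have hs : (s : ℂ) ≠ 0 := s.ne_zero
  ext ⟨i, j⟩ ⟨r, x⟩
  simp only [Matrix.mul_apply, LminusTwo, cupCap, Matrix.of_apply, Fintype.sum_prod_type, Fin.sum_univ_two]
  fin_cases k <;> fin_cases l <;> fin_cases i <;> fin_cases j <;> fin_cases r <;> fin_cases x <;>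
    simp [Lminus_eq, Ccheck] <;> field_simp <;> ring

end Sorted

section Classification

variable (s : ℂˣ) (ε : ℤˣ)

/-- The nilpotent matrix by which `u^1_2` acts on two sorted legs, up to a factor. -/
def raiseMat : Matrix Idx Idx ℂ := Matrix.of fun a b =>
  if a = (0, 0) ∧ b = (0, 1) then (s : ℂ) else if a = (0, 0) ∧ b = (1, 0) then (s : ℂ)⁻¹
  else if a = (0, 1) ∧ b = (1, 1) then (s : ℂ) else if a = (1, 0) ∧ b = (1, 1) then (s : ℂ)⁻¹ else 0

/-- The number of legs with index `2`. -/
def legCount (a : Idx) : ℤ := (a.1 : ℤ) + (a.2 : ℤ)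

theorem LplusTwo_01 :
    LplusTwo s 0 1 = ((s : ℂ)⁻¹ * ((s : ℂ) ^ 2 - ((s : ℂ) ^ 2)⁻¹)) • raiseMat s := by
  ext ⟨i, j⟩ ⟨k, l⟩
  fin_cases i <;> fin_cases j <;> fin_cases k <;> fin_cases l <;>
    simp [LplusTwo, Lplus_eq, raiseMat] <;> field_simp

theorem LplusTwo_10 : LplusTwo s 1 0 = 0 := by
  ext a b
  simp [LplusTwo, Fin.sum_univ_two, Lplus_eq]

theorem LplusTwo_11 :
    LplusTwo s 1 1 = Matrix.diagonal fun a => ((s : ℂ) ^ 2) ^ (legCount a - 1) := by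
  have hs : (s : ℂ) ≠ 0 := s.ne_zero
  ext ⟨i, j⟩ ⟨k, l⟩
  fin_cases i <;> fin_cases j <;> fin_cases k <;> fin_cases l <;>
    simp [LplusTwo, Fin.sum_univ_two, Lplus_eq, Matrix.diagonal, legCount, hs, pow_two]

theorem LminusTwo_01 : LminusTwo s 0 1 = 0 := by
  ext a b
  simp [LminusTwo, Fin.sum_univ_two, Lminus_eq]

theorem LminusTwo_10 : LminusTwo s 1 0 = ((s : ℂ)⁻¹ - (s : ℂ) ^ 3) • (raiseMat s).transpose := by
  ext ⟨i, j⟩ ⟨k, l⟩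
  fin_cases i <;> fin_cases j <;> fin_cases k <;> fin_cases l <;>
    simp [LminusTwo, Lminus_eq, raiseMat] <;> field_simp

theorem LminusTwo_11 :
    LminusTwo s 1 1 = Matrix.diagonal fun a => ((s : ℂ) ^ 2) ^ (1 - legCount a) := by
  have hs : (s : ℂ) ≠ 0 := s.ne_zero
  ext ⟨i, j⟩ ⟨k, l⟩
  fin_cases i <;> fin_cases j <;> fin_cases k <;> fin_cases l <;>
    simp [LminusTwo, Fin.sum_univ_two, Lminus_eq, Matrix.diagonal, legCount, hs, pow_two]

variable {s}

theorem q_sub_inv_ne_zero (hq : ∀ n : ℕ, 0 < n → ((s : ℂ) ^ 2) ^ n ≠ 1) :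
    (s : ℂ) ^ 2 - ((s : ℂ) ^ 2)⁻¹ ≠ 0 := by
  have hs : (s : ℂ) ^ 2 ≠ 0 := pow_ne_zero 2 s.ne_zero
  intro h
  refine hq 2 (by norm_num) ?_
  field_simp at h
  linear_combination h

theorem raise_const_ne_zero (hq : ∀ n : ℕ, 0 < n → ((s : ℂ) ^ 2) ^ n ≠ 1) :
    (s : ℂ)⁻¹ * ((s : ℂ) ^ 2 - ((s : ℂ) ^ 2)⁻¹) ≠ 0 :=
  mul_ne_zero (inv_ne_zero s.ne_zero) (q_sub_inv_ne_zero hq)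

theorem lower_const_ne_zero (hq : ∀ n : ℕ, 0 < n → ((s : ℂ) ^ 2) ^ n ≠ 1) :
    (s : ℂ)⁻¹ - (s : ℂ) ^ 3 ≠ 0 := by
  have hs : (s : ℂ) ≠ 0 := s.ne_zero
  intro h
  refine hq 2 (by norm_num) ?_
  field_simp at h
  linear_combination -h

theorem q_add_inv_ne_zero (hq : ∀ n : ℕ, 0 < n → ((s : ℂ) ^ 2) ^ n ≠ 1) :
    (s : ℂ) ^ 2 + ((s : ℂ) ^ 2)⁻¹ ≠ 0 := by
  have hs : (s : ℂ) ^ 2 ≠ 0 := pow_ne_zero 2 s.ne_zero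
  intro h
  refine hq 4 (by norm_num) ?_
  field_simp at h
  linear_combination (((s : ℂ) ^ 2) ^ 2 - 1) * h

/-- A matrix which lowers the number of legs of index `2` and commutes with `raiseMat` up to
factors vanishes. -/
theorem eq_zero_of_lowering (hq : ∀ n : ℕ, 0 < n → ((s : ℂ) ^ 2) ^ n ≠ 1)
    {M : Matrix Idx Idx ℂ} {r r' : ℂ} (hr : r ≠ 0) (hr' : r' ≠ 0)
    (h : r • (raiseMat s * M) = r' • (M * raiseMat s))
    (hM : ∀ a b, M a b ≠ 0 → legCount b < legCount a) : M = 0 := by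
  have hs : (s : ℂ) ≠ 0 := s.ne_zero
  have hM' : ∀ a b, legCount a ≤ legCount b → M a b = 0 := fun a b hab => by
    by_contra h0; exact absurd (hM a b h0) (by omega)
  have e := fun a b => congrFun (congrFun h a) b
  simp only [Matrix.smul_apply, Matrix.mul_apply, Fintype.sum_prod_type, Fin.sum_univ_two] at e
  have e1 := e (0, 0) (0, 0)
  have e2 := e (0, 1) (0, 1)
  have e3 := e (0, 1) (1, 0)
  have e4 := e (1, 0) (0, 1)
  have e5 := e (1, 0) (1, 0)
  have e6 := e (1, 1) (1, 1)
  have e7 := e (0, 1) (0, 0)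
  have z00 := fun b => hM' (0, 0) b (by rcases b with ⟨i, j⟩; fin_cases i <;> fin_cases j <;> simp [legCount])
  have z11 := fun b => hM' b (1, 1) (by rcases b with ⟨i, j⟩; fin_cases i <;> fin_cases j <;> simp [legCount])
  have m1 := hM' (0, 1) (0, 1) le_rfl
  have m2 := hM' (1, 0) (1, 0) le_rfl
  have m3 := hM' (0, 1) (1, 0) (by simp [legCount])
  have m4 := hM' (1, 0) (0, 1) (by simp [legCount])
  simp [raiseMat, z00, z11, m1, m2, m3, m4, hr, hr', hs] at e1 e2 e3 e4 e5 e6 e7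
  have hqq := q_add_inv_ne_zero hq
  have k1 : M (0, 1) (0, 0) = 0 := by
    have : ((s : ℂ) ^ 2 + ((s : ℂ) ^ 2)⁻¹) * (r' * M (0, 1) (0, 0)) = 0 := by
      linear_combination (norm := skip) (s : ℂ) * r' * e1 + (s : ℂ)⁻¹ * e4 - ((s : ℂ)⁻¹) ^ 3 * e2
      field_simp
      ring
    simpa [hqq, hr'] using this
  have k2 : M (1, 0) (0, 0) = 0 := by simpa [k1, hs] using e1
  have k3 : M (1, 1) (0, 1) = 0 := by simpa [k1, hs, hr] using e2
  have k4 : M (1, 1) (1, 0) = 0 := by simpa [k1, hs, hr] using e3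
  ext ⟨i, j⟩ ⟨k, l⟩
  fin_cases i <;> fin_cases j <;> fin_cases k <;> fin_cases l <;>
    simp [z00, z11, m1, m2, m3, m4, k1, k2, k3, k4, e7]

/-- The centralizer of `raiseMat` in degree zero is the Temperley-Lieb algebra on two legs. -/
theorem eq_of_commute_raise (hq : ∀ n : ℕ, 0 < n → ((s : ℂ) ^ 2) ^ n ≠ 1)
    {M : Matrix Idx Idx ℂ} (h : raiseMat s * M = M * raiseMat s)
    (hM : ∀ a b, M a b ≠ 0 → legCount b = legCount a) :
    ∃ α β : ℂ, M = α • 1 + β • cupCap s := by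
  have hs : (s : ℂ) ≠ 0 := s.ne_zero
  have hM' : ∀ a b, legCount b ≠ legCount a → M a b = 0 := fun a b hab => by
    by_contra h0; exact hab (hM a b h0)
  have e := fun a b => congrFun (congrFun h a) b
  simp only [Matrix.mul_apply, Fintype.sum_prod_type, Fin.sum_univ_two] at e
  have e1 := e (0, 0) (0, 1)
  have e2 := e (0, 0) (1, 0)
  have e3 := e (0, 1) (1, 1)
  have e4 := e (1, 0) (1, 1)
  have z1 := hM' (0, 0) (0, 1) (by simp [legCount])
  have z2 := hM' (0, 0) (1, 0) (by simp [legCount])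
  have z3 := hM' (0, 0) (1, 1) (by simp [legCount])
  have z4 := hM' (0, 1) (0, 0) (by simp [legCount])
  have z5 := hM' (1, 0) (0, 0) (by simp [legCount])
  have z6 := hM' (1, 1) (0, 0) (by simp [legCount])
  have z7 := hM' (0, 1) (1, 1) (by simp [legCount])
  have z8 := hM' (1, 0) (1, 1) (by simp [legCount])
  have z9 := hM' (1, 1) (0, 1) (by simp [legCount])
  have z10 := hM' (1, 1) (1, 0) (by simp [legCount])
  simp [raiseMat, z1, z2, z3, z4, z5, z7, z8, z9, z10] at e1 e2 e3 e4
  have hqq := q_add_inv_ne_zero hq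
  generalize h00 : M (0, 0) (0, 0) = m0 at *
  generalize h11 : M (1, 1) (1, 1) = m2 at *
  generalize hpp : M (0, 1) (0, 1) = x at *
  generalize hpm : M (0, 1) (1, 0) = y at *
  generalize hmp : M (1, 0) (0, 1) = z at *
  generalize hmm : M (1, 0) (1, 0) = w at *
  have f1 : z = (s : ℂ) ^ 2 * (m0 - x) := by
    linear_combination (norm := skip) (s : ℂ) * e1
    field_simp
    ring
  have f2 : y = ((s : ℂ) ^ 2)⁻¹ * (m0 - w) := by
    linear_combination (norm := skip) (s : ℂ)⁻¹ * e2
    field_simp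
    ring
  have f3 : m2 = m0 := by
    have : ((s : ℂ) ^ 2 + ((s : ℂ) ^ 2)⁻¹) * (m2 - m0) = 0 := by
      linear_combination (norm := skip) (s : ℂ) * e1 + (s : ℂ)⁻¹ * e2 + (s : ℂ) * e3 + (s : ℂ)⁻¹ * e4
      field_simp
      ring
    simpa [hqq, sub_eq_zero] using this
  have f4 : w = m0 + (s : ℂ) ^ 4 * (x - m0) := by
    rw [f3] at e3
    rw [f2] at e3
    linear_combination (norm := skip) ((s : ℂ) ^ 3) * e3
    field_simp
    ring
  refine ⟨m0, (s : ℂ) ^ 2 * (x - m0), ?_⟩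
  ext ⟨i, j⟩ ⟨k, l⟩
  fin_cases i <;> fin_cases j <;> fin_cases k <;> fin_cases l <;>
    simp [z1, z2, z3, z4, z5, z6, z7, z8, z9, z10, h00, h11, hpp, hpm, hmp, hmm, cupCap, Ccheck, f3] <;>
    (try rw [f1]) <;> (try rw [f2]) <;> (try rw [f4]) <;> field_simp <;> ring

theorem cupCap_transpose : (cupCap s).transpose = cupCap s := by
  ext a b
  simp [cupCap, mul_comm]

theorem fSorted_b (p r : Idx × Idx) : fSorted s 0 1 p r =
    (s : ℂ)⁻¹ * ((s : ℂ) ^ 2 - ((s : ℂ) ^ 2)⁻¹) * (raiseMat s p.1 r.1 *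
      if p.2 = r.2 then ((s : ℂ) ^ 2) ^ (1 - legCount p.2) else 0) := by
  simp only [fSorted, Matrix.of_apply, Fin.sum_univ_two, LminusTwo_01, LplusTwo_01, LminusTwo_11,
    Matrix.zero_apply, mul_zero, zero_add, Matrix.smul_apply, smul_eq_mul, Matrix.diagonal_apply,
    mul_assoc]

theorem fSorted_c (p r : Idx × Idx) : fSorted s 1 0 p r =
    ((s : ℂ)⁻¹ - (s : ℂ) ^ 3) * ((if p.1 = r.1 then ((s : ℂ) ^ 2) ^ (legCount p.1 - 1) else 0) *
      raiseMat s r.2 p.2) := by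
  simp only [fSorted, Matrix.of_apply, Fin.sum_univ_two, LminusTwo_10, LplusTwo_10, LplusTwo_11,
    Matrix.zero_apply, zero_mul, zero_add, Matrix.smul_apply, smul_eq_mul, Matrix.diagonal_apply,
    Matrix.transpose_apply]
  ring

theorem fSorted_d (p r : Idx × Idx) : fSorted s 1 1 p r =
    if p = r then ((s : ℂ) ^ 2) ^ (legCount p.1 - legCount p.2) else 0 := by
  have hs : (s : ℂ) ^ 2 ≠ 0 := pow_ne_zero 2 s.ne_zero
  simp only [fSorted, Matrix.of_apply, Fin.sum_univ_two, LplusTwo_10, LplusTwo_11, LminusTwo_11,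
    Matrix.zero_apply, zero_mul, zero_add, Matrix.diagonal_apply]
  by_cases h1 : p.1 = r.1 <;> by_cases h2 : p.2 = r.2 <;> simp [h1, h2, Prod.ext_iff]
  rw [← zpow_add₀ hs]
  ring_nf

/-- A matrix which commutes with the matrices of the generators on the sorted legs belongs to the
tensor product of two Temperley-Lieb algebras. -/
theorem commutant_sorted (hq : ∀ n : ℕ, 0 < n → ((s : ℂ) ^ 2) ^ n ≠ 1)
    {T : Matrix (Idx × Idx) (Idx × Idx) ℂ} (hT : ∀ k l, fSorted s k l * T = T * fSorted s k l) :
    ∃ A B C D : ℂ, ∀ p r, T p r =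
      A * ((1 : Matrix Idx Idx ℂ) p.1 r.1 * (1 : Matrix Idx Idx ℂ) p.2 r.2) +
      B * (cupCap s p.1 r.1 * (1 : Matrix Idx Idx ℂ) p.2 r.2) +
      C * ((1 : Matrix Idx Idx ℂ) p.1 r.1 * cupCap s p.2 r.2) +
      D * (cupCap s p.1 r.1 * cupCap s p.2 r.2) := by
  have hs : (s : ℂ) ^ 2 ≠ 0 := pow_ne_zero 2 s.ne_zero
  have hz : ∀ n : ℤ, ((s : ℂ) ^ 2) ^ n ≠ 0 := fun n => zpow_ne_zero n hs
  have hd : ∀ p r, T p r ≠ 0 → legCount p.1 - legCount p.2 = legCount r.1 - legCount r.2 := by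
    intro p r h
    have e := congrFun (congrFun (hT 1 1) p) r
    simp only [Matrix.mul_apply, fSorted_d, ite_mul, mul_ite, zero_mul, mul_zero,
      Finset.sum_ite_eq, Finset.sum_ite_eq', Finset.mem_univ, if_true] at e
    have e' : ((s : ℂ) ^ 2) ^ ((legCount p.1 - legCount p.2) - (legCount r.1 - legCount r.2)) = 1 := by
      rw [zpow_sub₀ hs, div_eq_one_iff_eq (hz _)]
      exact mul_right_cancel₀ h (by rw [e, mul_comm])
    have := zpow_eq_one_of_not_root hq e'
    omega
  have hb : ∀ y y', (((s : ℂ) ^ 2) ^ (1 - legCount y)) • (raiseMat s * Matrix.of fun a b => T (a, y) (b, y')) =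
      (((s : ℂ) ^ 2) ^ (1 - legCount y')) • ((Matrix.of fun a b => T (a, y) (b, y')) * raiseMat s) := by
    intro y y'
    ext a b
    have e := congrFun (congrFun (hT 0 1) (a, y)) (b, y')
    simp only [Matrix.mul_apply, fSorted_b, Fintype.sum_prod_type (α₁ := Idx) (α₂ := Idx),
      ite_mul, mul_ite, zero_mul, mul_zero, Finset.sum_ite_eq, Finset.sum_ite_eq', Finset.mem_univ,
      if_true] at e
    refine mul_left_cancel₀ (raise_const_ne_zero hq) ?_
    simp only [Matrix.smul_apply, Matrix.mul_apply, Matrix.of_apply, smul_eq_mul, Finset.mul_sum]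
    convert e using 2 <;> ring
  have hc : ∀ x x', (((s : ℂ) ^ 2) ^ (legCount x' - 1)) •
        (raiseMat s * (Matrix.of fun a b => T (x, b) (x', a))) =
      (((s : ℂ) ^ 2) ^ (legCount x - 1)) • ((Matrix.of fun a b => T (x, b) (x', a)) * raiseMat s) := by
    intro x x'
    ext a b
    have e := congrFun (congrFun (hT 1 0) (x, b)) (x', a)
    simp only [Matrix.mul_apply, fSorted_c, Fintype.sum_prod_type_right (α₁ := Idx) (α₂ := Idx),
      ite_mul, mul_ite, zero_mul, mul_zero, Finset.sum_ite_eq, Finset.sum_ite_eq', Finset.mem_univ,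
      if_true] at e
    refine mul_left_cancel₀ (lower_const_ne_zero hq) ?_
    simp only [Matrix.smul_apply, Matrix.mul_apply, Matrix.of_apply, smul_eq_mul, Finset.mul_sum]
    convert e.symm using 2 <;> ring
  have h0 : ∀ p r, T p r ≠ 0 → legCount p.1 = legCount r.1 ∧ legCount p.2 = legCount r.2 := by
    rintro ⟨x, y⟩ ⟨x', y'⟩ h
    have h1 := hd _ _ h
    dsimp only at h1 ⊢
    rcases lt_trichotomy (legCount x') (legCount x) with h2 | h2 | h2
    · have := eq_zero_of_lowering hq (hz _) (hz _) (hb y y') (fun a b hab => by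
        have := hd _ _ hab; dsimp only at this; omega)
      exact absurd (congrFun (congrFun this x) x') h
    · omega
    · have := eq_zero_of_lowering hq (hz _) (hz _) (hc x x') (fun a b hab => by
        have := hd _ _ hab; dsimp only at this; omega)
      exact absurd (congrFun (congrFun this y') y) h
  have hb' : ∀ y y', ∃ α β : ℂ, (Matrix.of fun a b => T (a, y) (b, y')) = α • 1 + β • cupCap s := by
    intro y y'
    by_cases hy : legCount y = legCount y'
    · refine eq_of_commute_raise hq ?_ fun a b hab => (h0 _ _ hab).1.symm
      have := hb y y'
      rw [hy] at this
      exact smul_right_injective _ (hz _) this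
    · refine ⟨0, 0, ?_⟩
      ext a b
      by_contra h
      exact hy (h0 (a, y) (b, y') (by simpa using h)).2
  have hc' : ∀ x, ∃ α β : ℂ, (Matrix.of fun a b => T (x, b) (x, a)) = α • 1 + β • cupCap s := by
    intro x
    refine eq_of_commute_raise hq ?_ fun a b hab => (h0 _ _ hab).2
    exact smul_right_injective _ (hz _) (hc x x)
  choose α β hαβ using hb'
  obtain ⟨A, C, hAC⟩ := hc' (0, 0)
  obtain ⟨A', C', hAC'⟩ := hc' (0, 1)
  have hα : ∀ y y', α y y' = A * (1 : Matrix Idx Idx ℂ) y y' + C * cupCap s y y' := by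
    intro y y'
    have e1 := congrFun (congrFun (hαβ y y') (0, 0)) (0, 0)
    have e2 := congrFun (congrFun hAC y') y
    rw [← cupCap_transpose, ← Matrix.transpose_one]
    simp [cupCap, Ccheck] at e1 e2 ⊢
    rw [← e1, e2]
  have hs1 : (s : ℂ) ≠ 0 := s.ne_zero
  have hβ : ∀ y y', β y y' = (s : ℂ) ^ 2 * (A' - A) * (1 : Matrix Idx Idx ℂ) y y' +
      (s : ℂ) ^ 2 * (C' - C) * cupCap s y y' := by
    intro y y'
    have e1 := congrFun (congrFun (hαβ y y') (0, 1)) (0, 1)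
    have e2 := congrFun (congrFun hAC' y') y
    rw [← cupCap_transpose, ← Matrix.transpose_one] at e2
    simp only [Matrix.of_apply, Matrix.add_apply, Matrix.smul_apply, Matrix.transpose_apply,
      smul_eq_mul] at e1 e2
    have hcc : cupCap s (0, 1) (0, 1) = (s : ℂ)⁻¹ * (s : ℂ)⁻¹ := by simp [cupCap, Ccheck]
    rw [e1, hα, hcc, Matrix.one_apply_eq] at e2
    linear_combination (norm := skip) (s : ℂ) ^ 2 * e2
    field_simp
    ring
  refine ⟨A, (s : ℂ) ^ 2 * (A' - A), C, (s : ℂ) ^ 2 * (C' - C), ?_⟩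
  rintro ⟨x, y⟩ ⟨x', y'⟩
  have e := congrFun (congrFun (hαβ y y') x) x'
  simp only [Matrix.of_apply, Matrix.add_apply, Matrix.smul_apply, smul_eq_mul] at e
  rw [e, hα, hβ]
  ring

theorem fGen_b (p r : Idx) : fGen s ε 0 1 p r =
    (s : ℂ)⁻¹ * ((s : ℂ) ^ 2 - ((s : ℂ) ^ 2)⁻¹) * (((ε : ℤ) : ℂ) *
      if p.1 = 0 ∧ r.1 = 1 ∧ p.2 = r.2 then (s : ℂ) ^ (1 - 2 * (p.2 : ℤ)) else 0) := by
  obtain ⟨i, j⟩ := p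
  obtain ⟨k, l⟩ := r
  fin_cases i <;> fin_cases j <;> fin_cases k <;> fin_cases l <;>
    simp [fGen_apply, Fin.sum_univ_two, Lplus_eq, Lminus_eq] <;> ring

theorem fGen_c (p r : Idx) : fGen s ε 1 0 p r =
    ((s : ℂ)⁻¹ - (s : ℂ) ^ 3) * (((ε : ℤ) : ℂ) *
      if p.2 = 1 ∧ r.2 = 0 ∧ p.1 = r.1 then (s : ℂ) ^ (2 * (p.1 : ℤ) - 1) else 0) := by
  obtain ⟨i, j⟩ := p
  obtain ⟨k, l⟩ := r
  fin_cases i <;> fin_cases j <;> fin_cases k <;> fin_cases l <;>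
    simp [fGen_apply, Fin.sum_univ_two, Lplus_eq, Lminus_eq] <;> ring

theorem fGen_d (p r : Idx) : fGen s ε 1 1 p r =
    if p = r then ((ε : ℤ) : ℂ) * ((s : ℂ) ^ 2) ^ ((p.1 : ℤ) - (p.2 : ℤ)) else 0 := by
  have hs : (s : ℂ) ≠ 0 := s.ne_zero
  obtain ⟨i, j⟩ := p
  obtain ⟨k, l⟩ := r
  fin_cases i <;> fin_cases j <;> fin_cases k <;> fin_cases l <;>
    simp [fGen_apply, Fin.sum_univ_two, Lplus_eq, Lminus_eq, pow_two, hs]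

theorem one_le_legCount {a : Idx} (h : a ≠ (0, 0)) : 1 ≤ legCount a := by
  revert h a
  unfold legCount
  decide

theorem legCount_le_one {a : Idx} (h : a ≠ (1, 1)) : legCount a ≤ 1 := by
  revert h a
  unfold legCount
  decide

theorem legCount_zero : legCount (0, 0) = 0 := rfl

theorem legCount_two : legCount (1, 1) = 2 := rfl

theorem eq_of_legCount_eq_zero {a : Idx} (h : legCount a = 0) : a = (0, 0) := by
  revert h a
  unfold legCount
  decide

theorem eq_of_legCount_eq_two {a : Idx} (h : legCount a = 2) : a = (1, 1) := by
  revert h a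
  unfold legCount
  decide

/-- There are no intertwiners from `Γ` to the sorted legs of `Γ ⊗ Γ`. -/
theorem intertwiner_gam_sorted_eq_zero (hq : ∀ n : ℕ, 0 < n → ((s : ℂ) ^ 2) ^ n ≠ 1)
    {W : Matrix Idx (Idx × Idx) ℂ} (hW : ∀ k l, fGen s ε k l * W = W * fSorted s k l) : W = 0 := by
  have hs1 : (s : ℂ) ≠ 0 := s.ne_zero
  have hs : (s : ℂ) ^ 2 ≠ 0 := pow_ne_zero 2 s.ne_zero
  have hz : ∀ n : ℤ, ((s : ℂ) ^ 2) ^ n ≠ 0 := fun n => zpow_ne_zero n hs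
  have hε := sign_ne_zero ε
  have hd : ∀ p r, W p r ≠ 0 → (p.1 : ℤ) - (p.2 : ℤ) = legCount r.1 - legCount r.2 := by
    intro p r h
    have e := congrFun (congrFun (hW 1 1) p) r
    simp only [Matrix.mul_apply, fSorted_d, fGen_d, ite_mul, mul_ite, zero_mul, mul_zero,
      Finset.sum_ite_eq, Finset.sum_ite_eq', Finset.mem_univ, if_true] at e
    have e1 : ((ε : ℤ) : ℂ) * ((s : ℂ) ^ 2) ^ ((p.1 : ℤ) - (p.2 : ℤ)) =
        ((s : ℂ) ^ 2) ^ (legCount r.1 - legCount r.2) :=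
      mul_right_cancel₀ h (by rw [e, mul_comm])
    have e' : ((s : ℂ) ^ 2) ^ (2 * ((p.1 : ℤ) - (p.2 : ℤ) - (legCount r.1 - legCount r.2))) = 1 := by
      rw [two_mul, zpow_add₀ hs, zpow_sub₀ hs, ← e1, div_mul_div_comm, mul_mul_mul_comm,
        sign_mul_self, one_mul, div_self (mul_ne_zero (hz _) (hz _))]
    have := zpow_eq_one_of_not_root hq e'
    omega
  have hb : ∀ i j b y, (if i = 0 then (s : ℂ) ^ (1 - 2 * ((j : Fin 2) : ℤ)) * W (1, j) (b, y) else 0) =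
      ((ε : ℤ) : ℂ) * ((s : ℂ) ^ 2) ^ (1 - legCount y) * ∑ a, W (i, j) (a, y) * raiseMat s a b := by
    intro i j b y
    have e := congrFun (congrFun (hW 0 1) (i, j)) (b, y)
    rw [Matrix.mul_apply, Matrix.mul_apply, Fintype.sum_eq_single (1, j) fun p hp => by
      rw [fGen_b, if_neg fun h => hp (Prod.ext h.2.1 h.2.2.symm), mul_zero, mul_zero, zero_mul],
      fGen_b] at e
    simp only [fSorted_b, Fintype.sum_prod_type (α₁ := Idx) (α₂ := Idx), mul_ite, mul_zero,
      Finset.sum_ite_eq', Finset.mem_univ, if_true, and_true] at e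
    refine mul_left_cancel₀ hε (mul_left_cancel₀ (raise_const_ne_zero hq) ?_)
    have e2 : ∀ S : ℂ, ((ε : ℤ) : ℂ) * (((ε : ℤ) : ℂ) * ((s : ℂ) ^ 2) ^ (1 - legCount y) * S) = ((s : ℂ) ^ 2) ^ (1 - legCount y) * S :=
      fun S => by linear_combination ((s : ℂ) ^ 2) ^ (1 - legCount y) * S * sign_mul_self ε
    rw [e2, Finset.mul_sum, Finset.mul_sum]
    refine Eq.trans ?_ (e.trans (Finset.sum_congr rfl fun a _ => by ring))
    split_ifs
    · ring
    · ring
  have hc : ∀ i j x b, (if j = 1 then (s : ℂ) ^ (2 * ((i : Fin 2) : ℤ) - 1) * W (i, 0) (x, b) else 0) =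
      ((ε : ℤ) : ℂ) * ((s : ℂ) ^ 2) ^ (legCount x - 1) * ∑ a, W (i, j) (x, a) * raiseMat s b a := by
    intro i j x b
    have e := congrFun (congrFun (hW 1 0) (i, j)) (x, b)
    rw [Matrix.mul_apply, Matrix.mul_apply, Fintype.sum_eq_single (i, 0) fun p hp => by
      rw [fGen_c, if_neg fun h => hp (Prod.ext h.2.2.symm h.2.1), mul_zero, mul_zero, zero_mul],
      fGen_c] at e
    simp only [fSorted_c, Fintype.sum_prod_type_right (α₁ := Idx) (α₂ := Idx), mul_ite, mul_zero,
      ite_mul, zero_mul,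
      Finset.sum_ite_eq', Finset.mem_univ, if_true, and_true] at e
    refine mul_left_cancel₀ hε (mul_left_cancel₀ (lower_const_ne_zero hq) ?_)
    have e2 : ∀ S : ℂ, ((ε : ℤ) : ℂ) * (((ε : ℤ) : ℂ) * ((s : ℂ) ^ 2) ^ (legCount x - 1) * S) = ((s : ℂ) ^ 2) ^ (legCount x - 1) * S :=
      fun S => by linear_combination ((s : ℂ) ^ 2) ^ (legCount x - 1) * S * sign_mul_self ε
    rw [e2, Finset.mul_sum, Finset.mul_sum]
    refine Eq.trans ?_ (e.trans (Finset.sum_congr rfl fun a _ => by ring))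
    split_ifs
    · ring
    · ring
  have hqq := q_add_inv_ne_zero hq
  have hzs : ∀ n : ℤ, (s : ℂ) ^ n ≠ 0 := fun n => zpow_ne_zero n hs1
  have b0 : ∀ j y, W (0, j) ((0, 0), y) = 0 := by
    intro j y
    have e1 := hb 0 j (0, 1) y
    have e2 := hb 0 j (1, 0) y
    have e3 := hb 1 j (1, 1) y
    simp [raiseMat, Fintype.sum_prod_type, hε, hz] at e1 e2 e3
    have hk := mul_ne_zero hε (hz (1 - legCount y))
    generalize ((ε : ℤ) : ℂ) * ((s : ℂ) ^ 2) ^ (1 - legCount y) = k at hk e1 e2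
    have : ((s : ℂ) ^ 2 + ((s : ℂ) ^ 2)⁻¹) * (k * W (0, j) ((0, 0), y)) = 0 := by
      linear_combination (norm := skip) -(s : ℂ) * e1 - (s : ℂ)⁻¹ * e2 +
        (s : ℂ) ^ (1 - 2 * (j : ℤ)) * e3
      field_simp
      ring
    simpa [hqq, hk] using this
  have b1 : ∀ j y b, b ≠ (1, 1) → W (1, j) (b, y) = 0 := by
    rintro j y ⟨k, l⟩ hne
    have e1 := hb 0 j (0, 1) y
    have e2 := hb 0 j (1, 0) y
    have e3 := hb 0 j (0, 0) y
    simp [raiseMat, b0, hzs] at e1 e2 e3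
    fin_cases k <;> fin_cases l
    · exact e3
    · exact e1
    · exact e2
    · exact absurd rfl hne
  have c0 : ∀ i x, W (i, 1) (x, (1, 1)) = 0 := by
    intro i x
    have e1 := hc i 1 x (0, 1)
    have e2 := hc i 1 x (1, 0)
    have e3 := hc i 0 x (0, 0)
    simp [raiseMat, Fintype.sum_prod_type, hε, hz] at e1 e2 e3
    have hk := mul_ne_zero hε (hz (legCount x - 1))
    generalize ((ε : ℤ) : ℂ) * ((s : ℂ) ^ 2) ^ (legCount x - 1) = k at hk e1 e2
    have : ((s : ℂ) ^ 2 + ((s : ℂ) ^ 2)⁻¹) * (k * W (i, 1) (x, (1, 1))) = 0 := by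
      linear_combination (norm := skip) -(s : ℂ) * e1 - (s : ℂ)⁻¹ * e2 +
        (s : ℂ) ^ (2 * (i : ℤ) - 1) * e3
      field_simp
      ring
    simpa [hqq, hk] using this
  have c1 : ∀ i x b, b ≠ (0, 0) → W (i, 0) (x, b) = 0 := by
    rintro i x ⟨k, l⟩ hne
    have e1 := hc i 1 x (0, 1)
    have e2 := hc i 1 x (1, 0)
    have e3 := hc i 1 x (1, 1)
    simp [raiseMat, c0, hzs] at e1 e2 e3
    fin_cases k <;> fin_cases l
    · exact absurd rfl hne
    · exact e1
    · exact e2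
    · exact e3
  ext ⟨i, j⟩ ⟨x, y⟩
  by_contra h
  have h1 := hd _ _ h
  have hx : i = 1 → x = (1, 1) := fun hi => by
    by_contra hx; exact h (by rw [hi]; exact b1 j y x hx)
  have hx' : i = 0 → x ≠ (0, 0) := fun hi hx => h (by rw [hi, hx]; exact b0 j y)
  have hy : j = 0 → y = (0, 0) := fun hj => by
    by_contra hy; exact h (by rw [hj]; exact c1 i x y hy)
  have hy' : j = 1 → y ≠ (1, 1) := fun hj hy => h (by rw [hj, hy]; exact c0 i x)
  obtain rfl | rfl : i = 0 ∨ i = 1 := by omega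
  · have := one_le_legCount (hx' rfl)
    obtain rfl | rfl : j = 0 ∨ j = 1 := by omega
    · rw [hy rfl, legCount_zero] at h1
      simp at h1
      omega
    · have := legCount_le_one (hy' rfl)
      simp at h1
      omega
  · rw [hx rfl, legCount_two] at h1
    obtain rfl | rfl : j = 0 ∨ j = 1 := by omega
    · rw [hy rfl, legCount_zero] at h1
      simp at h1
    · have := legCount_le_one (hy' rfl)
      simp at h1
      omega

/-- An intertwiner from the sorted legs of `Γ ⊗ Γ` to the trivial representation is a multiple of
the tensor product of the two invariant forms. -/
theorem invariant_form_sorted (hq : ∀ n : ℕ, 0 < n → ((s : ℂ) ^ 2) ^ n ≠ 1)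
    {v : Idx × Idx → ℂ} (hv : ∀ k l p, ∑ r, fSorted s k l p r * v r = if k = l then v p else 0) :
    ∃ κ : ℂ, ∀ p, v p = κ * (Ccheck s p.1.1 p.1.2 * Ccheck s p.2.1 p.2.2) := by
  have hs1 : (s : ℂ) ≠ 0 := s.ne_zero
  have hs : (s : ℂ) ^ 2 ≠ 0 := pow_ne_zero 2 s.ne_zero
  have hz : ∀ n : ℤ, ((s : ℂ) ^ 2) ^ n ≠ 0 := fun n => zpow_ne_zero n hs
  have hb : ∀ a y, ∑ b, raiseMat s a b * v (b, y) = 0 := by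
    intro a y
    have e := hv 0 1 (a, y)
    simp only [fSorted_b, Fintype.sum_prod_type (α₁ := Idx) (α₂ := Idx), ite_mul, mul_ite, zero_mul,
      mul_zero, Finset.sum_ite_eq, Finset.mem_univ, if_true] at e
    rw [if_neg (by decide)] at e
    refine mul_left_cancel₀ (raise_const_ne_zero hq) (mul_left_cancel₀ (hz (1 - legCount y)) ?_)
    rw [mul_zero, mul_zero, ← e, Finset.mul_sum, Finset.mul_sum]
    exact Finset.sum_congr rfl fun _ _ => by ring
  have hc : ∀ x b, ∑ a, raiseMat s a b * v (x, a) = 0 := by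
    intro x b
    have e := hv 1 0 (x, b)
    simp only [fSorted_c, Fintype.sum_prod_type_right (α₁ := Idx) (α₂ := Idx), ite_mul, mul_ite,
      zero_mul, mul_zero, Finset.sum_ite_eq, Finset.mem_univ, if_true] at e
    rw [if_neg (by decide)] at e
    refine mul_left_cancel₀ (lower_const_ne_zero hq) (mul_left_cancel₀ (hz (legCount x - 1)) ?_)
    rw [mul_zero, mul_zero, ← e, Finset.mul_sum, Finset.mul_sum]
    exact Finset.sum_congr rfl fun _ _ => by ring
  have hd : ∀ x y, v (x, y) ≠ 0 → legCount x = legCount y := by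
    intro x y h
    have e := hv 1 1 (x, y)
    simp only [fSorted_d, ite_mul, zero_mul, Finset.sum_ite_eq, Finset.mem_univ, if_true] at e
    have := zpow_eq_one_of_not_root hq (mul_right_cancel₀ h (e.trans (one_mul _).symm))
    omega
  have b1 : ∀ y, v ((1, 1), y) = 0 := fun y => by
    simpa [raiseMat, Fintype.sum_prod_type, hs1] using hb (0, 1) y
  have b2 : ∀ y, v ((1, 0), y) = - (s : ℂ) ^ 2 * v ((0, 1), y) := fun y => by
    have := hb (0, 0) y
    simp [raiseMat, Fintype.sum_prod_type] at this
    linear_combination (norm := skip) (s : ℂ) * this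
    field_simp
    ring
  have c1 : ∀ x, v (x, (0, 0)) = 0 := fun x => by
    simpa [raiseMat, Fintype.sum_prod_type, hs1] using hc x (0, 1)
  have c2 : ∀ x, v (x, (1, 0)) = - (s : ℂ) ^ 2 * v (x, (0, 1)) := fun x => by
    have := hc x (1, 1)
    simp [raiseMat, Fintype.sum_prod_type] at this
    linear_combination (norm := skip) (s : ℂ) * this
    field_simp
    ring
  have d1 : ∀ y, v ((0, 0), y) = 0 := fun y => by
    by_contra h
    rw [eq_of_legCount_eq_zero (hd _ _ h).symm] at h
    exact h (c1 _)
  have d2 : ∀ x, v (x, (1, 1)) = 0 := fun x => by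
    by_contra h
    rw [eq_of_legCount_eq_two (hd _ _ h)] at h
    exact h (b1 _)
  refine ⟨(s : ℂ) ^ 2 * v ((0, 1), (0, 1)), ?_⟩
  rintro ⟨⟨i, j⟩, k, l⟩
  fin_cases i <;> fin_cases j <;> fin_cases k <;> fin_cases l <;>
    simp [b1, b2, c1, c2, d1, d2, Ccheck] <;> field_simp

end Classification

section LeftLinear

variable {s : ℂˣ} {ε : ℤˣ}

theorem coords_leftLinear (T : Matrix (Idx × Idx) (Idx × Idx) ℂ) (x : GamTwo s ε) (p : Idx × Idx) :
    coords s ε (leftLinear s ε T x) p = ∑ p', coords s ε x p' * algebraMap ℂ (OSLq s) (T p p') :=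
  congrFun (coords_sum_smul s ε fun p => ∑ p', coords s ε x p' * algebraMap ℂ (OSLq s) (T p p')) p

theorem leftLinear_mul (T U : Matrix (Idx × Idx) (Idx × Idx) ℂ) (x : GamTwo s ε) :
    leftLinear s ε (T * U) x = leftLinear s ε T (leftLinear s ε U x) := by
  refine coords_injective s ε (funext fun p => ?_)
  simp only [coords_leftLinear, Matrix.mul_apply, map_sum, map_mul, Finset.mul_sum, Finset.sum_mul,
    mul_assoc]
  rw [Finset.sum_comm]
  refine Finset.sum_congr rfl fun q _ => Finset.sum_congr rfl fun r _ => ?_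
  rw [← map_mul, ← map_mul, mul_comm]

theorem leftLinear_one (x : GamTwo s ε) : leftLinear s ε 1 x = x := by
  refine coords_injective s ε (funext fun p => ?_)
  rw [coords_leftLinear, Fintype.sum_eq_single p fun q hq => by
    rw [Matrix.one_apply_ne hq.symm, map_zero, mul_zero], Matrix.one_apply_eq, map_one, mul_one]

theorem op_algebraMap_smul_gamTwo (c : ℂ) (x : GamTwo s ε) :
    (op (algebraMap ℂ (OSLq s) c) • x : GamTwo s ε) = algebraMap ℂ (OSLq s) c • x := by
  induction x using bal_induction with
  | h0 => simp
  | ht x y =>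
    rw [op_smul_btmul, smul_btmul, op_algebraMap_smul, ← algebraMap_smul (OSLq s) c y,
      ← btmul_balance, op_algebraMap_smul, algebraMap_smul]
  | ha x y hx hy => rw [smul_add, smul_add, hx, hy]

/-- A left-linear map that commutes with the right multiplication by the generators is a
homomorphism of bimodules. -/
theorem map_op_smul_of_generators {M N : Type*} [AddCommGroup M] [Module (OSLq s) M]
    [Module (OSLq s)ᵐᵒᵖ M] [AddCommGroup N] [Module (OSLq s) N] [Module (OSLq s)ᵐᵒᵖ N]
    (hM : ∀ (c : ℂ) (x : M), op (algebraMap ℂ (OSLq s) c) • x = algebraMap ℂ (OSLq s) c • x)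
    (hN : ∀ (c : ℂ) (x : N), op (algebraMap ℂ (OSLq s) c) • x = algebraMap ℂ (OSLq s) c • x)
    (F : M →+ N) (hl : ∀ (a : OSLq s) x, F (a • x) = a • F x)
    (hu : ∀ k l x, F (op (u s k l) • x) = op (u s k l) • F x) (a : OSLq s) :
    ∀ x, F (op a • x) = op a • F x := by
  induction a using slq_induction with
  | hc c => intro x; rw [hM, hN, hl]
  | hu i j => exact hu i j
  | ha a b iha ihb => intro x; rw [op_add, add_smul, add_smul, map_add, iha, ihb]
  | hm a b iha ihb => intro x; rw [op_mul, mul_smul, mul_smul, ihb, iha]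

theorem leftLinear_op_smul {T : Matrix (Idx × Idx) (Idx × Idx) ℂ}
    (hT : ∀ k l, fTwo s ε k l * T.transpose = T.transpose * fTwo s ε k l) (a : OSLq s)
    (x : GamTwo s ε) : leftLinear s ε T (op a • x) = op a • leftLinear s ε T x := by
  refine map_op_smul_of_generators op_algebraMap_smul_gamTwo op_algebraMap_smul_gamTwo _
    (leftLinear_smul s ε T) (fun k l x => ?_) a x
  refine coords_injective s ε (funext fun r => ?_)
  rw [coords_leftLinear, coords_op_u_smul]
  simp only [coords_leftLinear, coords_op_u_smul, Finset.sum_mul, mul_assoc]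
  rw [Finset.sum_comm, Finset.sum_comm (f := fun q p => coords s ε x p * _)]
  refine Finset.sum_congr rfl fun p _ => ?_
  rw [← Finset.mul_sum, ← Finset.mul_sum]
  congr 1
  simp only [← Algebra.commutes (T _ _), ← Algebra.smul_def, Finset.smul_sum, smul_smul]
  rw [Finset.sum_comm, Finset.sum_comm (s := Finset.univ (α := Idx × Idx))]
  refine Finset.sum_congr rfl fun m _ => ?_
  have h := congrFun (congrFun (hT m l) p) r
  simp only [Matrix.mul_apply, Matrix.transpose_apply] at h
  rw [← Finset.sum_smul, ← Finset.sum_smul, ← h]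
  simp only [mul_comm]

/-- The bimodule homomorphism given by a matrix that commutes with the right action. -/
def leftLinearHom (T : Matrix (Idx × Idx) (Idx × Idx) ℂ)
    (hT : ∀ k l, fTwo s ε k l * T.transpose = T.transpose * fTwo s ε k l) :
    BimodHom (OSLq s) (GamTwo s ε) (GamTwo s ε) where
  toFun := leftLinear s ε T
  map_left := leftLinear_smul s ε T
  map_right := leftLinear_op_smul hT

variable (s) in
/-- The general endomorphism of the sorted legs. -/
def sortedMatrix (A B C D : ℂ) : Matrix (Idx × Idx) (Idx × Idx) ℂ := Matrix.of fun p r =>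
  A * ((1 : Matrix Idx Idx ℂ) p.1 r.1 * (1 : Matrix Idx Idx ℂ) p.2 r.2) +
  B * (cupCap s p.1 r.1 * (1 : Matrix Idx Idx ℂ) p.2 r.2) +
  C * ((1 : Matrix Idx Idx ℂ) p.1 r.1 * cupCap s p.2 r.2) +
  D * (cupCap s p.1 r.1 * cupCap s p.2 r.2)

variable (s) in
/-- The matrix of the general bimodule endomorphism of `Γ ⊗ Γ`. -/
def endoMatrix (A B C D : ℂ) : Matrix (Idx × Idx) (Idx × Idx) ℂ :=
  leg23 (Rhat s) * sortedMatrix s A B C D * leg23 (RhatInv s)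

theorem Rhat_transpose : (Rhat s).transpose = Rhat s := by
  rw [Rhat_eq, Matrix.transpose_sub, Matrix.transpose_smul, Matrix.transpose_smul,
    Matrix.transpose_one, cupCap_transpose]

theorem RhatInv_transpose : (RhatInv s).transpose = RhatInv s := by
  rw [RhatInv_eq, Matrix.transpose_sub, Matrix.transpose_smul, Matrix.transpose_smul,
    Matrix.transpose_one, cupCap_transpose]

theorem leg23_transpose (M : Matrix Idx Idx ℂ) : (leg23 M).transpose = leg23 M.transpose := by
  ext p r
  simp [leg23, eq_comm]

theorem leg23_Rhat_mul_RhatInv : leg23 (Rhat s) * leg23 (RhatInv s) = 1 := by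
  rw [← leg23_mul, Rhat_mul_RhatInv, leg23_one]

theorem leg23_RhatInv_mul_Rhat : leg23 (RhatInv s) * leg23 (Rhat s) = 1 := by
  rw [← leg23_mul, RhatInv_mul_Rhat, leg23_one]

theorem sortedMatrix_transpose (A B C D : ℂ) :
    (sortedMatrix s A B C D).transpose = sortedMatrix s A B C D := by
  have h1 : ∀ a b : Idx, (1 : Matrix Idx Idx ℂ) a b = (1 : Matrix Idx Idx ℂ) b a := fun a b => by
    simp only [Matrix.one_apply, eq_comm]
  have h2 : ∀ a b : Idx, cupCap s a b = cupCap s b a := fun a b =>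
    congrFun (congrFun cupCap_transpose b) a
  ext p r
  simp only [sortedMatrix, Matrix.transpose_apply, Matrix.of_apply, h1 r.1, h1 r.2, h2 r.1, h2 r.2]

theorem endoMatrix_transpose (A B C D : ℂ) : (endoMatrix s A B C D).transpose =
    leg23 (RhatInv s) * sortedMatrix s A B C D * leg23 (Rhat s) := by
  rw [endoMatrix, Matrix.transpose_mul, Matrix.transpose_mul, leg23_transpose, leg23_transpose,
    Rhat_transpose, RhatInv_transpose, sortedMatrix_transpose, Matrix.mul_assoc]

theorem sortedMatrix_mul_fSorted (A B C D : ℂ) (k l : Fin 2) :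
    sortedMatrix s A B C D * fSorted s k l = fSorted s k l * sortedMatrix s A B C D := by
  ext p r
  have e1 := fun m => congrFun (congrFun (cupCap_mul_LplusTwo s k m) p.1) r.1
  have e2 := fun m => congrFun (congrFun (cupCap_mul_LminusTwo s m l) p.2) r.2
  simp only [Matrix.mul_apply] at e1 e2
  have key : ∀ X Y : Matrix Idx Idx ℂ,
      (∀ m, ∑ c, X p.1 c * LplusTwo s k m c r.1 = ∑ c, LplusTwo s k m p.1 c * X c r.1) →
      (∀ m, ∑ c, Y p.2 c * LminusTwo s m l c r.2 = ∑ c, LminusTwo s m l p.2 c * Y c r.2) →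
      ∑ q : Idx × Idx, X p.1 q.1 * Y p.2 q.2 * fSorted s k l q r =
        ∑ q : Idx × Idx, fSorted s k l p q * (X q.1 r.1 * Y q.2 r.2) := by
    intro X Y hX hY
    calc _ = ∑ m, (∑ c, X p.1 c * LplusTwo s k m c r.1) * ∑ c, Y p.2 c * LminusTwo s m l c r.2 := by
          simp only [fSorted, Matrix.of_apply, Finset.mul_sum, Finset.sum_mul,
            Fintype.sum_prod_type (α₁ := Idx) (α₂ := Idx)]
          rw [Finset.sum_congr rfl fun c _ => Finset.sum_comm, Finset.sum_comm]
          refine Finset.sum_congr rfl fun m _ => ?_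
          rw [Finset.sum_comm]
          exact Finset.sum_congr rfl fun a _ => Finset.sum_congr rfl fun b _ => by ring
      _ = ∑ m, (∑ c, LplusTwo s k m p.1 c * X c r.1) * ∑ c, LminusTwo s m l p.2 c * Y c r.2 := by
          simp only [hX, hY]
      _ = _ := by
          simp only [fSorted, Matrix.of_apply, Finset.mul_sum, Finset.sum_mul,
            Fintype.sum_prod_type (α₁ := Idx) (α₂ := Idx)]
          refine Eq.symm ?_
          rw [Finset.sum_congr rfl fun c _ => Finset.sum_comm, Finset.sum_comm]
          refine Finset.sum_congr rfl fun m _ => ?_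
          rw [Finset.sum_comm]
          exact Finset.sum_congr rfl fun a _ => Finset.sum_congr rfl fun b _ => by ring
  have h1 : ∀ m, ∑ c, (1 : Matrix Idx Idx ℂ) p.1 c * LplusTwo s k m c r.1 =
      ∑ c, LplusTwo s k m p.1 c * (1 : Matrix Idx Idx ℂ) c r.1 := fun m => by
    rw [← Matrix.mul_apply, ← Matrix.mul_apply, Matrix.one_mul, Matrix.mul_one]
  have h2 : ∀ m, ∑ c, (1 : Matrix Idx Idx ℂ) p.2 c * LminusTwo s m l c r.2 =
      ∑ c, LminusTwo s m l p.2 c * (1 : Matrix Idx Idx ℂ) c r.2 := fun m => by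
    rw [← Matrix.mul_apply, ← Matrix.mul_apply, Matrix.one_mul, Matrix.mul_one]
  simp only [Matrix.mul_apply, sortedMatrix, Matrix.of_apply, add_mul, mul_add,
    Finset.sum_add_distrib, mul_assoc, mul_left_comm (fSorted _ _ _ _ _), ← Finset.mul_sum]
  have k1 := key _ _ h1 h2
  have k2 := key _ _ e1 h2
  have k3 := key _ _ h1 e2
  have k4 := key _ _ e1 e2
  simp only [mul_assoc, mul_left_comm (fSorted _ _ _ _ _)] at k1 k2 k3 k4
  rw [k1, k2, k3, k4]

theorem fTwo_mul_leg23_RhatInv (k l : Fin 2) :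
    fTwo s ε k l * leg23 (RhatInv s) = leg23 (RhatInv s) * fSorted s k l := by
  calc _ = leg23 (RhatInv s) * (leg23 (Rhat s) * fTwo s ε k l) * leg23 (RhatInv s) := by
        rw [← Matrix.mul_assoc (leg23 (RhatInv s)), leg23_RhatInv_mul_Rhat, Matrix.one_mul]
    _ = _ := by
        rw [leg23_mul_fTwo, Matrix.mul_assoc, Matrix.mul_assoc, leg23_Rhat_mul_RhatInv,
          Matrix.mul_one]

theorem endoMatrix_comm (A B C D : ℂ) (k l : Fin 2) :
    fTwo s ε k l * (endoMatrix s A B C D).transpose =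
      (endoMatrix s A B C D).transpose * fTwo s ε k l := by
  rw [endoMatrix_transpose, ← Matrix.mul_assoc, ← Matrix.mul_assoc, fTwo_mul_leg23_RhatInv, Matrix.mul_assoc _ (leg23 (Rhat s)),
    leg23_mul_fTwo, ← Matrix.mul_assoc, Matrix.mul_assoc _ (fSorted s k l), Matrix.mul_assoc _ (sortedMatrix s A B C D),
    sortedMatrix_mul_fSorted]

variable (s ε) in
/-- The general bimodule endomorphism of `Γ ⊗ Γ`. -/
def endoHom (A B C D : ℂ) : BimodHom (OSLq s) (GamTwo s ε) (GamTwo s ε) :=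
  leftLinearHom (endoMatrix s A B C D) (endoMatrix_comm A B C D)

theorem endoHom_apply (A B C D : ℂ) (x : GamTwo s ε) :
    endoHom s ε A B C D x = leftLinear s ε (endoMatrix s A B C D) x := rfl

theorem RhatPow_eq (η : ℤˣ) :
    RhatPow s η = (s : ℂ) ^ (η : ℤ) • 1 - (s : ℂ) ^ (-(η : ℤ)) • cupCap s := by
  rcases Int.units_eq_one_or η with rfl | rfl
  · simp [RhatPow, Rhat_eq]
  · rw [RhatPow, if_neg (by decide), RhatInv_eq]
    simp

theorem leg12_RhatPow_mul_leg34 (η η' : ℤˣ) :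
    leg12 (RhatPow s η) * leg34 (RhatPow s η') =
      sortedMatrix s ((s : ℂ) ^ (η : ℤ) * (s : ℂ) ^ (η' : ℤ)) (-((s : ℂ) ^ (-(η : ℤ)) * (s : ℂ) ^ (η' : ℤ)))
        (-((s : ℂ) ^ (η : ℤ) * (s : ℂ) ^ (-(η' : ℤ)))) ((s : ℂ) ^ (-(η : ℤ)) * (s : ℂ) ^ (-(η' : ℤ))) := by
  ext p r
  rw [Matrix.mul_apply, Fintype.sum_eq_single (r.1, p.2)]
  · simp only [leg12, leg34, Matrix.of_apply, if_true, RhatPow_eq, sortedMatrix, Matrix.sub_apply,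
      Matrix.smul_apply, smul_eq_mul]
    ring
  · intro q hq
    simp only [leg12, leg34, Matrix.of_apply]
    by_cases h : p.2 = q.2
    · rw [if_neg (c := q.1 = r.1) fun h' => hq (Prod.ext h' h.symm), mul_zero]
    · rw [if_neg h, zero_mul]

theorem flipMatrix_eq (η η' : ℤˣ) : flipMatrix s η η' =
    endoMatrix s ((s : ℂ) ^ (η : ℤ) * (s : ℂ) ^ (η' : ℤ)) (-((s : ℂ) ^ (-(η : ℤ)) * (s : ℂ) ^ (η' : ℤ)))
      (-((s : ℂ) ^ (η : ℤ) * (s : ℂ) ^ (-(η' : ℤ)))) ((s : ℂ) ^ (-(η : ℤ)) * (s : ℂ) ^ (-(η' : ℤ))) := by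
  rw [flipMatrix, endoMatrix, ← leg12_RhatPow_mul_leg34]
  simp only [Matrix.mul_assoc]

theorem braidingMatrix_eq_flipMatrix : braidingMatrix s = flipMatrix s 1 (-1) := by
  simp [braidingMatrix, flipMatrix, RhatPow]

variable (s ε) in
/-- The coordinates with respect to the basis of `Γ ⊗ Γ` with sorted legs. -/
def sortedCoords : GamTwo s ε →+ (Idx × Idx → OSLq s) :=
  (coords s ε).comp (leftLinear s ε (leg23 (RhatInv s)))

theorem sortedCoords_eq (x : GamTwo s ε) :
    sortedCoords s ε x = coords s ε (leftLinear s ε (leg23 (RhatInv s)) x) := by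
  rw [sortedCoords, AddMonoidHom.comp_apply]

theorem sortedCoords_apply (x : GamTwo s ε) (r : Idx × Idx) : sortedCoords s ε x r =
    ∑ p, coords s ε x p * algebraMap ℂ (OSLq s) (leg23 (RhatInv s) r p) := by
  rw [sortedCoords_eq, coords_leftLinear]

theorem sortedCoords_endo (A B C D : ℂ) (x : GamTwo s ε) (r : Idx × Idx) :
    sortedCoords s ε (leftLinear s ε (endoMatrix s A B C D) x) r =
      ∑ p, sortedCoords s ε x p * algebraMap ℂ (OSLq s) (sortedMatrix s A B C D r p) := by
  rw [sortedCoords_eq, sortedCoords_eq, ← leftLinear_mul, endoMatrix, ← Matrix.mul_assoc,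
    ← Matrix.mul_assoc, leg23_RhatInv_mul_Rhat, Matrix.one_mul, leftLinear_mul, coords_leftLinear]

theorem thetaTwo_op_smul (k l : Fin 2) (p : Idx × Idx) :
    (op (u s k l) • thetaTwo s ε p : GamTwo s ε) =
      ∑ r, (∑ m, fTwo s ε m l p r • u s k m) • thetaTwo s ε r := by
  refine coords_injective s ε (funext fun r => ?_)
  rw [coords_sum_smul, coords_op_u_smul, Fintype.sum_eq_single p fun q hq => by
    rw [coords_thetaTwo, if_neg hq, zero_mul], coords_thetaTwo, if_pos rfl, one_mul]

/-- Bimodule endomorphisms of `Γ ⊗ Γ`. -/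
theorem exists_endo (hq : ∀ n : ℕ, 0 < n → ((s : ℂ) ^ 2) ^ n ≠ 1)
    (τ : BimodHom (OSLq s) (GamTwo s ε) (GamTwo s ε)) :
    ∃ A B C D : ℂ, ∀ x, τ x = leftLinear s ε (endoMatrix s A B C D) x := by
  have ht : ∀ k l p r, ∑ m, ∑ p', fTwo s ε m l p p' • (u s k m * coords s ε (τ (thetaTwo s ε p')) r) =
      ∑ m, ∑ r', fTwo s ε m l r' r • (coords s ε (τ (thetaTwo s ε p)) r' * u s k m) := by
    intro k l p r
    have h := congrArg (fun x => coords s ε x r) (τ.map_right (u s k l) (thetaTwo s ε p))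
    simp only [thetaTwo_op_smul, map_sum, τ.map_left, Finset.sum_apply, coords_smul,
      coords_op_u_smul, Finset.sum_mul, Finset.mul_sum, smul_mul_assoc, mul_smul_comm] at h
    rw [Finset.sum_comm, h, Finset.sum_comm]
  have hT := fun p r => intertwiner_scalar hq (isTriangularRep_fTwo s ε) (isTriangularRep_fTwo s ε)
    (fun p r => coords s ε (τ (thetaTwo s ε p)) r) ht p r
  choose T hT using hT
  simp only [hT] at ht
  have hc := intertwiner_matrix (Matrix.of T) ht
  obtain ⟨A, B, C, D, hN⟩ := commutant_sorted hq
    (T := leg23 (Rhat s) * Matrix.of T * leg23 (RhatInv s)) (fun k l => by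
      rw [← Matrix.mul_assoc, ← Matrix.mul_assoc, ← leg23_mul_fTwo, Matrix.mul_assoc _ (fTwo s ε k l),
        hc, Matrix.mul_assoc _ _ (fSorted s k l), ← fTwo_mul_leg23_RhatInv (ε := ε)]
      simp only [Matrix.mul_assoc])
  refine ⟨A, B, C, D, fun x => ?_⟩
  have hT' : (endoMatrix s A B C D).transpose = Matrix.of T := by
    have : sortedMatrix s A B C D = leg23 (Rhat s) * Matrix.of T * leg23 (RhatInv s) := by
      ext p r
      rw [hN]
      rfl
    rw [endoMatrix_transpose, this, ← Matrix.mul_assoc, ← Matrix.mul_assoc, leg23_RhatInv_mul_Rhat,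
      Matrix.one_mul, Matrix.mul_assoc, leg23_RhatInv_mul_Rhat, Matrix.mul_one]
  refine coords_injective s ε (funext fun r => ?_)
  conv_lhs => rw [gamTwo_eq_sum s ε x]
  simp only [map_sum, τ.map_left, Finset.sum_apply, coords_smul, hT, coords_leftLinear]
  refine Finset.sum_congr rfl fun p _ => ?_
  rw [← Matrix.transpose_apply (endoMatrix s A B C D), hT', Matrix.of_apply]

end LeftLinear

section InnerConnections

variable {A : Type*} [Ring A]
variable {Γ : Type*} [AddCommGroup Γ] [Module A Γ] [Module Aᵐᵒᵖ Γ] [SMulCommClass A Aᵐᵒᵖ Γ]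
variable {C : Type*} [AddCommGroup C] [Module A C] [Module Aᵐᵒᵖ C] [SMulCommClass A Aᵐᵒᵖ C]

theorem btmul_sub_left (m m' : Γ) (n : C) : btmul A (m - m') n = btmul A m n - btmul A m' n := by
  rw [eq_sub_iff_add_eq, ← btmul_add_left, sub_add_cancel]

theorem btmul_sub_right (m : Γ) (n n' : C) : btmul A m (n - n') = btmul A m n - btmul A m n' := by
  rw [eq_sub_iff_add_eq, ← btmul_add_right, sub_add_cancel]

theorem btmul_zero_right (m : Γ) : btmul A m (0 : C) = 0 := by
  rw [← sub_self (0 : C), btmul_sub_right, sub_self]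

variable {θ : Γ} {d : A →+ Γ}

/-- A bimodule homomorphism `τ : C ⊗ Γ → Γ ⊗ C` defines a linear left connection
`ρ ↦ θ ⊗ ρ - τ(ρ ⊗ θ)` with respect to the inner derivation `d`. -/
theorem isLeftConnection_of_inner (hd : ∀ a, d a = op a • θ - a • θ)
    (τ : BimodHom A (BalTensor A C Γ) (BalTensor A Γ C))
    {nabla : C →+ BalTensor A Γ C} (h : ∀ ρ, nabla ρ = btmul A θ ρ - τ (btmul A ρ θ)) :
    IsLeftConnection d nabla := by
  intro a ρ
  rw [h, h, hd, ← smul_btmul, τ.map_left, ← btmul_balance, btmul_sub_left, smul_sub, smul_btmul]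
  abel

theorem isConnectionFlip_of_inner (hd : ∀ a, d a = op a • θ - a • θ)
    (τ : BimodHom A (BalTensor A C Γ) (BalTensor A Γ C))
    {nabla : C →+ BalTensor A Γ C} (h : ∀ ρ, nabla ρ = btmul A θ ρ - τ (btmul A ρ θ)) :
    IsConnectionFlip d nabla τ := by
  intro a ρ
  rw [h, h, hd, btmul_sub_right, map_sub, ← op_smul_btmul, τ.map_right, btmul_balance, smul_sub,
    ← op_smul_btmul]
  abel

/-- The difference between a linear left connection and the connection defined by its flip is a
homomorphism of bimodules. -/
def innerDefect (hd : ∀ a, d a = op a • θ - a • θ)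
    (τ : BimodHom A (BalTensor A C Γ) (BalTensor A Γ C))
    (nabla : C →+ BalTensor A Γ C) (hn : IsLeftConnection d nabla)
    (hτ : IsConnectionFlip d nabla τ) : BimodHom A C (BalTensor A Γ C) where
  toFun := AddMonoidHom.mk' (fun ρ => btmul A θ ρ - τ (btmul A ρ θ) - nabla ρ) (fun ρ ρ' => by
    rw [btmul_add_right, btmul_add_left, map_add, map_add]
    abel)
  map_left a ρ := by
    simp only [AddMonoidHom.mk'_apply]
    rw [hn, hd, ← smul_btmul, τ.map_left, ← btmul_balance, btmul_sub_left, smul_sub, smul_sub,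
      smul_btmul]
    abel
  map_right a ρ := by
    simp only [AddMonoidHom.mk'_apply]
    have h := hτ a ρ
    rw [hd, btmul_sub_right, map_sub, ← op_smul_btmul, τ.map_right] at h
    rw [btmul_balance, smul_sub, smul_sub, ← op_smul_btmul]
    rw [sub_eq_iff_eq_add] at h
    rw [h]
    abel

theorem innerDefect_apply (hd : ∀ a, d a = op a • θ - a • θ)
    (τ : BimodHom A (BalTensor A C Γ) (BalTensor A Γ C))
    (nabla : C →+ BalTensor A Γ C) (hn : IsLeftConnection d nabla)
    (hτ : IsConnectionFlip d nabla τ) (ρ : C) :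
    innerDefect hd τ nabla hn hτ ρ = btmul A θ ρ - τ (btmul A ρ θ) - nabla ρ := rfl

end InnerConnections

section CliffordUniversal

variable {A : Type*} [Ring A]
variable {Γ : Type*} [AddCommGroup Γ] [Module A Γ] [Module Aᵐᵒᵖ Γ] [SMulCommClass A Aᵐᵒᵖ Γ]
variable {B : Type*} [Ring B]

/-- A pair of compatible maps `A → B`, `Γ → B` into a ring `B`. -/
structure IsBimodPair (α : A →+* B) (β : Γ →+ B) : Prop where
  left : ∀ (a : A) (γ : Γ), α a * β γ = β (a • γ)
  right : ∀ (a : A) (γ : Γ), β γ * α a = β (op a • γ)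

variable {α : A →+* B} {β : Γ →+ B}

/-- The map `γ ⊗ γ' ↦ β(γ) β(γ')`. -/
def pairTwo (h : IsBimodPair α β) : BalTensor A Γ Γ →+ B :=
  balLift (biadd (fun γ γ' => β γ * β γ') (fun p p' q => by rw [map_add, add_mul])
    (fun p q q' => by rw [map_add, mul_add])) (fun m a n => by
      simp only [biadd_apply]
      rw [← h.right, ← h.left, mul_assoc])

@[simp] theorem pairTwo_btmul (h : IsBimodPair α β) (γ γ' : Γ) :
    pairTwo h (btmul A γ γ') = β γ * β γ' := rfl

/-- The universal property of the tensor algebra of a bimodule. -/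
def tensLift (h : IsBimodPair α β) : BimodTensorAlgebra A Γ →+* B :=
  RingQuot.lift ⟨(TensorAlgebra.lift ℤ ((α.toAddMonoidHom.coprod β).toIntLinearMap)).toRingHom, by
    intro x y hxy
    cases hxy <;> simp [h.left, h.right]⟩

theorem tensLift_tensAlg (h : IsBimodPair α β) (a : A) : tensLift h (tensAlg a) = α a := by
  change tensLift h (RingQuot.mkRingHom (TensRel A Γ) (TensorAlgebra.ι ℤ (a, (0 : Γ)))) = α a
  rw [tensLift]
  erw [RingQuot.lift_mkRingHom_apply]
  simp

theorem tensLift_tensGam (h : IsBimodPair α β) (γ : Γ) : tensLift h (tensGam γ) = β γ := by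
  change tensLift h (RingQuot.mkRingHom (TensRel A Γ) (TensorAlgebra.ι ℤ ((0 : A), γ))) = β γ
  rw [tensLift]
  erw [RingQuot.lift_mkRingHom_apply]
  simp

theorem tensLift_tensTwo (h : IsBimodPair α β) (x : BalTensor A Γ Γ) :
    tensLift h (tensTwo x) = pairTwo h x := by
  induction x using bal_induction with
  | h0 => simp
  | ht m n =>
    change tensLift h (tensGam m * tensGam n) = _
    rw [map_mul, tensLift_tensGam, tensLift_tensGam, pairTwo_btmul]
  | ha x y hx hy => rw [map_add, map_add, map_add, hx, hy]

variable (σ : BalTensor A Γ Γ →+ BalTensor A Γ Γ) (g : BimodHom A (BalTensor A Γ Γ) A)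

theorem cl_isBimodPair : IsBimodPair (clAlg σ g) (clGam σ g) where
  left a γ := by
    change clMk σ g (tensAlg a) * clMk σ g (tensGam γ) = clMk σ g (tensGam (a • γ))
    rw [← map_mul, tensAlg_mul_tensGam]
  right a γ := by
    change clMk σ g (tensGam γ) * clMk σ g (tensAlg a) = clMk σ g (tensGam (op a • γ))
    rw [← map_mul, tensGam_mul_tensAlg]

theorem cl_pairTwo {x : BalTensor A Γ Γ} (hx : σ x = x) :
    pairTwo (cl_isBimodPair σ g) x = clAlg σ g (g x) := by
  have h : pairTwo (cl_isBimodPair σ g) x = clMk σ g (tensTwo x) := by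
    clear hx
    induction x using bal_induction with
    | h0 => simp
    | ht m n => exact (map_mul (clMk σ g) (tensGam m) (tensGam n)).symm
    | ha x y hx hy => rw [map_add, map_add, map_add, hx, hy]
  rw [h]
  exact RingQuot.mkRingHom_rel (CliffordRel.of x hx)

variable {σ g} in
/-- The universal property of the quantum Clifford algebra. -/
def clLift (h : IsBimodPair α β) (hg : ∀ x, σ x = x → pairTwo h x = α (g x)) : QCl σ g →+* B :=
  RingQuot.lift ⟨tensLift h, by
    intro x y hxy
    cases hxy with
    | of x hx => rw [tensLift_tensTwo, tensLift_tensAlg, hg x hx]⟩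

variable {σ g} in
theorem clLift_clMk (h : IsBimodPair α β) (hg : ∀ x, σ x = x → pairTwo h x = α (g x))
    (x : BimodTensorAlgebra A Γ) : clLift h hg (clMk σ g x) = tensLift h x :=
  RingQuot.lift_mkRingHom_apply _ _ _

variable {σ g} in
theorem clLift_clAlg (h : IsBimodPair α β) (hg : ∀ x, σ x = x → pairTwo h x = α (g x)) (a : A) :
    clLift h hg (clAlg σ g a) = α a :=
  (clLift_clMk h hg _).trans (tensLift_tensAlg h a)

variable {σ g} in
theorem clLift_clGam (h : IsBimodPair α β) (hg : ∀ x, σ x = x → pairTwo h x = α (g x)) (γ : Γ) :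
    clLift h hg (clGam σ g γ) = β γ :=
  (clLift_clMk h hg _).trans (tensLift_tensGam h γ)

variable {σ g} in
theorem cl_induction {p : QCl σ g → Prop} (hA : ∀ a, p (clAlg σ g a)) (hΓ : ∀ γ, p (clGam σ g γ))
    (ha : ∀ x y, p x → p y → p (x + y)) (hm : ∀ x y, p x → p y → p (x * y)) (x : QCl σ g) : p x := by
  obtain ⟨y, rfl⟩ : ∃ y, clMk σ g y = x := RingQuot.mkRingHom_surjective _ x
  obtain ⟨z, rfl⟩ : ∃ z, RingQuot.mkRingHom (TensRel A Γ) z = y := RingQuot.mkRingHom_surjective _ y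
  have hz : ∀ z, p (clMk σ g (RingQuot.mkRingHom (TensRel A Γ) z : BimodTensorAlgebra A Γ)) := by
    intro z
    induction z using TensorAlgebra.induction with
    | algebraMap r =>
      have : (clMk σ g (RingQuot.mkRingHom (TensRel A Γ) (algebraMap ℤ _ r) : BimodTensorAlgebra A Γ)) =
          clAlg σ g (r : A) := by
        rw [map_intCast]
        change ((clMk σ g).comp (RingQuot.mkRingHom (TensRel A Γ))) _ = _
        simp
      rw [this]
      exact hA _
    | ι y =>
      have : (clMk σ g (RingQuot.mkRingHom (TensRel A Γ) (TensorAlgebra.ι ℤ y) :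
          BimodTensorAlgebra A Γ)) = clAlg σ g y.1 + clGam σ g y.2 := by
        have h : y = (y.1, 0) + (0, y.2) := by simp
        conv_lhs => rw [h, map_add]
        change ((clMk σ g).comp (RingQuot.mkRingHom (TensRel A Γ))) _ = _
        rw [map_add]
        rfl
      rw [this]
      exact ha _ _ (hA _) (hΓ _)
    | mul a b iha ihb =>
      have : (clMk σ g (RingQuot.mkRingHom (TensRel A Γ) (a * b) : BimodTensorAlgebra A Γ)) =
          clMk σ g (RingQuot.mkRingHom (TensRel A Γ) a : BimodTensorAlgebra A Γ) *
          clMk σ g (RingQuot.mkRingHom (TensRel A Γ) b : BimodTensorAlgebra A Γ) :=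
        map_mul ((clMk σ g).comp (RingQuot.mkRingHom (TensRel A Γ))) a b
      rw [this]
      exact hm _ _ iha ihb
    | add a b iha ihb =>
      have : (clMk σ g (RingQuot.mkRingHom (TensRel A Γ) (a + b) : BimodTensorAlgebra A Γ)) =
          clMk σ g (RingQuot.mkRingHom (TensRel A Γ) a : BimodTensorAlgebra A Γ) +
          clMk σ g (RingQuot.mkRingHom (TensRel A Γ) b : BimodTensorAlgebra A Γ) :=
        map_add ((clMk σ g).comp (RingQuot.mkRingHom (TensRel A Γ))) a b
      rw [this]
      exact ha _ _ iha ihb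
  exact hz z

end CliffordUniversal

section CliffordConnections

variable {A : Type*} [Ring A]
variable {Γ : Type*} [AddCommGroup Γ] [Module A Γ] [Module Aᵐᵒᵖ Γ] [SMulCommClass A Aᵐᵒᵖ Γ]
variable {σ : BalTensor A Γ Γ →+ BalTensor A Γ Γ} {g : BimodHom A (BalTensor A Γ Γ) A}

@[simp] theorem idTensorCl_btmul (γ γ' : Γ) :
    idTensorCl (σ := σ) (g := g) (btmul A γ γ') = btmul A γ (clGam σ g γ') := rfl

theorem idTensorCl_smul (a : A) (z : BalTensor A Γ Γ) :
    idTensorCl (σ := σ) (g := g) (a • z) = a • idTensorCl z := by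
  induction z using bal_induction with
  | h0 => simp
  | ht m n => rw [smul_btmul, idTensorCl_btmul, idTensorCl_btmul, smul_btmul]
  | ha y z hy hz => rw [smul_add, map_add, map_add, smul_add, hy, hz]

theorem idTensorCl_op_smul (a : A) (z : BalTensor A Γ Γ) :
    idTensorCl (σ := σ) (g := g) (op a • z) = op a • idTensorCl z := by
  induction z using bal_induction with
  | h0 => simp
  | ht m n =>
    rw [op_smul_btmul, idTensorCl_btmul, idTensorCl_btmul, op_smul_btmul, op_smul_cl,
      (cl_isBimodPair σ g).right]
  | ha y z hy hz => rw [smul_add, map_add, map_add, smul_add, hy, hz]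

theorem mulCl_smul_left (a : A) (x : QCl σ g) (z : BalTensor A Γ (QCl σ g)) :
    mulCl x (a • z) = a • mulCl x z := by
  induction z using bal_induction with
  | h0 => simp
  | ht m n => simp only [smul_btmul, mulCl_btmul]
  | ha y z hy hz => rw [smul_add, map_add, map_add, smul_add, hy, hz]

theorem mulCl_mulCl (x y : QCl σ g) (z : BalTensor A Γ (QCl σ g)) :
    mulCl y (mulCl x z) = mulCl (x * y) z := by
  induction z using bal_induction with
  | h0 => simp
  | ht m n => simp only [mulCl_btmul, mul_assoc]
  | ha w z hw hz => rw [map_add, map_add, map_add, hw, hz]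

theorem mulCl_one (z : BalTensor A Γ (QCl σ g)) : mulCl 1 z = z := by
  induction z using bal_induction with
  | h0 => simp
  | ht m n => simp only [mulCl_btmul, mul_one]
  | ha w z hw hz => rw [map_add, hw, hz]

theorem mulCl_clAlg (a : A) (z : BalTensor A Γ (QCl σ g)) : mulCl (clAlg σ g a) z = op a • z := by
  induction z using bal_induction with
  | h0 => simp
  | ht m n => rw [mulCl_btmul, op_smul_btmul, op_smul_cl]
  | ha w z hw hz => rw [map_add, smul_add, hw, hz]

@[simp] theorem flipMulCl_btmul (τ : BimodHom A (BalTensor A (QCl σ g) Γ) (BalTensor A Γ (QCl σ g)))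
    (x : QCl σ g) (γ : Γ) (y : QCl σ g) :
    flipMulCl τ x (btmul A γ y) = mulCl y (τ (btmul A x γ)) := rfl

variable (τ : BimodHom A (BalTensor A Γ Γ) (BalTensor A Γ Γ))

/-- The action `γ' ⊗ y ↦ τ(γ ⊗ γ') y` of `Γ` on `Γ ⊗ Cl`. -/
def gamAct : Γ →+ AddMonoid.End (BalTensor A Γ (QCl σ g)) :=
  AddMonoidHom.mk' (fun γ => balLift
    (biadd (fun γ' y => mulCl y (idTensorCl (τ (btmul A γ γ'))))
      (fun p p' q => by rw [btmul_add_right, map_add, map_add, map_add])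
      (fun p q q' => mulCl_add _ _ _))
    (fun m a n => by
      simp only [biadd_apply]
      rw [← op_smul_btmul, τ.map_right, idTensorCl_op_smul, mulCl_smul]))
    (fun γ γ' => bal_hom_ext fun m n => by
      change mulCl n (idTensorCl (τ (btmul A (γ + γ') m))) =
        mulCl n (idTensorCl (τ (btmul A γ m))) + mulCl n (idTensorCl (τ (btmul A γ' m)))
      rw [btmul_add_left, map_add, map_add, map_add])

theorem gamAct_btmul (γ γ' : Γ) (y : QCl σ g) :
    gamAct τ γ (btmul A γ' y) = mulCl y (idTensorCl (τ (btmul A γ γ'))) := rfl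

/-- The left action of `A` on `Γ ⊗ Cl`. -/
def algAct : A →+* AddMonoid.End (BalTensor A Γ (QCl σ g)) :=
  Module.toAddMonoidEnd A (BalTensor A Γ (QCl σ g))

theorem algAct_apply (a : A) (z : BalTensor A Γ (QCl σ g)) : algAct a z = a • z := rfl

theorem act_isBimodPair : IsBimodPair (algAct (σ := σ) (g := g)) (gamAct τ) where
  left a γ := by
    refine bal_hom_ext fun m n => ?_
    change a • mulCl n (idTensorCl (τ (btmul A γ m))) = mulCl n (idTensorCl (τ (btmul A (a • γ) m)))
    rw [← smul_btmul, τ.map_left, idTensorCl_smul, mulCl_smul_left]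
  right a γ := by
    refine bal_hom_ext fun m n => ?_
    change gamAct τ γ (a • btmul A m n) = gamAct τ (op a • γ) (btmul A m n)
    rw [smul_btmul, gamAct_btmul, gamAct_btmul, btmul_balance]

theorem end_add_apply {M : Type*} [AddCommGroup M] (f f' : AddMonoid.End M) (z : M) :
    (f + f') z = f z + f' z := rfl

theorem end_mul_apply {M : Type*} [AddCommGroup M] (f f' : AddMonoid.End M) (z : M) :
    (f * f') z = f (f' z) := rfl

/-- The flip `x ⊗ γ ↦ Φ(x)(γ ⊗ 1)` defined by an action `Φ` of the Clifford algebra. -/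
def flipMap (Φ : QCl σ g →+* AddMonoid.End (BalTensor A Γ (QCl σ g)))
    (hA : ∀ a z, Φ (clAlg σ g a) z = a • z) :
    BalTensor A (QCl σ g) Γ →+ BalTensor A Γ (QCl σ g) :=
  balLift (biadd (fun x γ => Φ x (btmul A γ 1))
    (fun p p' q => by rw [map_add, end_add_apply])
    (fun p q q' => by rw [btmul_add_left, map_add]))
    (fun x a γ => by
      simp only [biadd_apply]
      rw [op_smul_cl, map_mul, end_mul_apply, hA, smul_btmul])

theorem flipMap_btmul (Φ : QCl σ g →+* AddMonoid.End (BalTensor A Γ (QCl σ g)))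
    (hA : ∀ a z, Φ (clAlg σ g a) z = a • z) (x : QCl σ g) (γ : Γ) :
    flipMap Φ hA (btmul A x γ) = Φ x (btmul A γ 1) := rfl

/-- The flip `x ⊗ γ ↦ Φ(x)(γ ⊗ 1)` as a bimodule homomorphism. -/
def flipOfAct (Φ : QCl σ g →+* AddMonoid.End (BalTensor A Γ (QCl σ g)))
    (hA : ∀ a z, Φ (clAlg σ g a) z = a • z) (hm : ∀ x y z, Φ x (mulCl y z) = mulCl y (Φ x z)) :
    BimodHom A (BalTensor A (QCl σ g) Γ) (BalTensor A Γ (QCl σ g)) where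
  toFun := flipMap Φ hA
  map_left a z := by
    induction z using bal_induction with
    | h0 => rw [smul_zero, map_zero, smul_zero]
    | ht x γ => rw [smul_btmul, flipMap_btmul, flipMap_btmul, smul_cl, map_mul, end_mul_apply, hA]
    | ha w z hw hz => rw [smul_add, map_add, map_add, smul_add, hw, hz]
  map_right a z := by
    induction z using bal_induction with
    | h0 => rw [smul_zero, map_zero, smul_zero]
    | ht x γ =>
      have h : btmul A (op a • γ) (1 : QCl σ g) = mulCl (clAlg σ g a) (btmul A γ 1) := by
        rw [mulCl_btmul, btmul_balance, smul_cl, mul_one, one_mul]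
      rw [op_smul_btmul, flipMap_btmul, flipMap_btmul, h, hm, mulCl_clAlg]
    | ha w z hw hz => rw [smul_add, map_add, map_add, smul_add, hw, hz]

/-- If `τ` is compatible with the Clifford relations, then the connection defined by `τ` extends to
the quantum Clifford algebra. -/
theorem isCliffordCompatible_of_act {θ : Γ} {d : A →+ Γ} (hd : ∀ a, d a = op a • θ - a • θ)
    (hτ : ∀ x, σ x = x → ∀ z : BalTensor A Γ (QCl σ g), pairTwo (act_isBimodPair τ) x z = g x • z)
    {nabla : Γ →+ BalTensor A Γ Γ} (hn : ∀ ρ, nabla ρ = btmul A θ ρ - τ (btmul A ρ θ)) :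
    IsCliffordCompatible σ g d nabla := by
  let Φ : QCl σ g →+* AddMonoid.End (BalTensor A Γ (QCl σ g)) :=
    clLift (act_isBimodPair τ) (fun x hx => AddMonoidHom.ext fun z => hτ x hx z)
  have hΦA : ∀ a z, Φ (clAlg σ g a) z = a • z := fun a z =>
    DFunLike.congr_fun (clLift_clAlg (act_isBimodPair τ) _ a) z
  have hΦΓ : ∀ γ z, Φ (clGam σ g γ) z = gamAct τ γ z := fun γ z =>
    DFunLike.congr_fun (clLift_clGam (act_isBimodPair τ) _ γ) z
  have hΦm : ∀ x y z, Φ x (mulCl y z) = mulCl y (Φ x z) := by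
    intro x
    induction x using cl_induction with
    | hA a => intro y z; rw [hΦA, hΦA, mulCl_smul_left]
    | hΓ γ =>
      intro y z
      rw [hΦΓ, hΦΓ]
      induction z using bal_induction with
      | h0 => simp
      | ht m n => rw [mulCl_btmul, gamAct_btmul, gamAct_btmul, mulCl_mulCl]
      | ha w z hw hz => rw [map_add, map_add, map_add, map_add, hw, hz]
    | ha x x' hx hx' =>
      intro y z
      rw [map_add, end_add_apply, end_add_apply, map_add, hx, hx']
    | hm x x' hx hx' =>
      intro y z
      rw [map_mul, end_mul_apply, end_mul_apply, hx', hx]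
  let τ' := flipOfAct Φ hΦA hΦm
  have hτ' : ∀ x γ, τ' (btmul A x γ) = Φ x (btmul A γ 1) := fun x γ => rfl
  have hf : ∀ x z, flipMulCl τ' x z = Φ x z := fun x z => by
    induction z using bal_induction with
    | h0 => simp
    | ht γ y => rw [flipMulCl_btmul, hτ', ← hΦm, mulCl_btmul, one_mul]
    | ha w z hw hz => rw [map_add, map_add, hw, hz]
  let nablaCl : QCl σ g →+ BalTensor A Γ (QCl σ g) :=
    AddMonoidHom.mk' (fun x => btmul A θ x - Φ x (btmul A θ 1)) (fun x y => by
      rw [btmul_add_right, map_add, end_add_apply]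
      abel)
  have hnCl : ∀ x, nablaCl x = btmul A θ x - Φ x (btmul A θ 1) := fun x => rfl
  refine ⟨nablaCl, ⟨isLeftConnection_of_inner hd τ' hnCl, τ',
    isConnectionFlip_of_inner hd τ' hnCl, fun x y => ?_⟩, fun a => ?_, fun ρ => ?_⟩
  · rw [hf, hnCl, hnCl, hnCl, map_mul, map_sub, map_sub, mulCl_btmul, ← hΦm x y, mulCl_btmul,
      one_mul, end_mul_apply]
    abel
  · rw [hnCl, hΦA, hd, btmul_sub_left, smul_btmul, btmul_balance, smul_cl, mul_one]
  · rw [hnCl, hΦΓ, gamAct_btmul, mulCl_one, hn, map_sub, idTensorCl_btmul]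

/-- Necessary condition for the compatibility with the Clifford relations. -/
theorem act_of_isCliffordCompatible {θ : Γ} {d : A →+ Γ} (hd : ∀ a, d a = op a • θ - a • θ)
    (hΓ : AddSubgroup.closure {γ | ∃ a b : A, γ = a • d b} = ⊤)
    {nabla : Γ →+ BalTensor A Γ Γ} (hn : ∀ ρ, nabla ρ = btmul A θ ρ - τ (btmul A ρ θ))
    (hc : IsCliffordCompatible σ g d nabla) (x : BalTensor A Γ Γ) (hx : σ x = x) :
    pairTwo (act_isBimodPair (σ := σ) (g := g) τ) x (btmul A θ 1) = g x • btmul A θ 1 := by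
  obtain ⟨nablaCl, ⟨-, τ', hflip, hprod⟩, hA, hΓn⟩ := hc
  have h1 : ∀ ρ γ, τ' (btmul A (clGam σ g ρ) γ) = idTensorCl (τ (btmul A ρ γ)) := by
    intro ρ γ
    have hγ : γ ∈ AddSubgroup.closure {γ | ∃ a b : A, γ = a • d b} := by rw [hΓ]; trivial
    induction hγ using AddSubgroup.closure_induction generalizing ρ with
    | mem γ h =>
      obtain ⟨a, b, rfl⟩ := h
      rw [← btmul_balance, ← btmul_balance, op_smul_cl, (cl_isBimodPair σ g).right, hflip, op_smul_cl,
        (cl_isBimodPair σ g).right, hΓn, hΓn, ← idTensorCl_op_smul, ← map_sub,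
        ← isConnectionFlip_of_inner hd τ hn]
    | zero => rw [btmul_zero_right, btmul_zero_right, map_zero, map_zero, map_zero]
    | add γ γ' _ _ h h' =>
      rw [btmul_add_right, btmul_add_right, map_add, map_add, map_add, h, h']
    | neg γ _ h =>
      rw [← zero_sub, btmul_sub_right, btmul_sub_right, map_sub, map_sub, map_sub, h,
        btmul_zero_right, btmul_zero_right, map_zero, map_zero, map_zero]
  have h2 : ∀ ρ z, flipMulCl τ' (clGam σ g ρ) z = gamAct τ ρ z := fun ρ z => by
    induction z using bal_induction with
    | h0 => simp
    | ht γ y => rw [flipMulCl_btmul, gamAct_btmul, h1]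
    | ha w z hw hz => rw [map_add, map_add, hw, hz]
  have h3 : ∀ x, nablaCl (pairTwo (cl_isBimodPair σ g) x) = btmul A θ (pairTwo (cl_isBimodPair σ g) x) -
      pairTwo (act_isBimodPair (σ := σ) (g := g) τ) x (btmul A θ 1) := by
    intro x
    induction x using bal_induction with
    | h0 =>
      rw [map_zero, map_zero, map_zero, btmul_zero_right]
      exact (sub_zero _).symm
    | ht ρ ρ' =>
      rw [pairTwo_btmul, pairTwo_btmul, hprod, h2, hΓn, hΓn, hn, hn, map_sub, map_sub, map_sub,
        map_sub]
      change _ = _ - gamAct τ ρ (gamAct τ ρ' (btmul A θ 1))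
      rw [gamAct_btmul τ ρ', mulCl_one, idTensorCl_btmul, idTensorCl_btmul, mulCl_btmul, gamAct_btmul]
      abel
    | ha x y hx hy =>
      rw [map_add, map_add, hx, hy, btmul_add_right, map_add, end_add_apply]
      abel
  have h4 := h3 x
  rw [cl_pairTwo σ g hx, hA, hd, btmul_sub_left, btmul_balance, smul_cl, mul_one] at h4
  rw [smul_btmul]
  exact (sub_right_injective h4).symm

end CliffordConnections

section Homs

variable {s : ℂˣ} {ε : ℤˣ}

theorem theta_op_smul (k l : Fin 2) (I : Idx) :
    (op (u s k l) • theta s ε I : Gam s ε) =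
      ∑ J, (∑ m, fGen s ε m l I J • u s k m) • theta s ε J := by
  rw [gam_eq_sum s ε (op (u s k l) • theta s ε I : Gam s ε)]
  refine Finset.sum_congr rfl fun J _ => ?_
  rw [op_smul_gam, Fintype.sum_eq_single I fun K hK => by rw [theta, if_neg hK, zero_mul], theta,
    if_pos rfl, one_mul, phi_u]

/-- There are no non-zero bimodule homomorphisms from `Γ` to `Γ ⊗ Γ`. -/
theorem hom_gam_gamTwo_eq_zero (hq : ∀ n : ℕ, 0 < n → ((s : ℂ) ^ 2) ^ n ≠ 1)
    (W : BimodHom (OSLq s) (Gam s ε) (GamTwo s ε)) (x : Gam s ε) : W x = 0 := by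
  have ht : ∀ k l I r, ∑ m, ∑ I', fGen s ε m l I I' • (u s k m * coords s ε (W (theta s ε I')) r) =
      ∑ m, ∑ r', fTwo s ε m l r' r • (coords s ε (W (theta s ε I)) r' * u s k m) := by
    intro k l I r
    have h := congrArg (fun x => coords s ε x r) (W.map_right (u s k l) (theta s ε I))
    simp only [theta_op_smul, map_sum, W.map_left, Finset.sum_apply, coords_smul,
      coords_op_u_smul, Finset.sum_mul, Finset.mul_sum, smul_mul_assoc, mul_smul_comm] at h
    rw [Finset.sum_comm, h, Finset.sum_comm]
  have hT := fun p r => intertwiner_scalar hq (isTriangularRep_fGen s ε) (isTriangularRep_fTwo s ε)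
    (fun I r => coords s ε (W (theta s ε I)) r) ht p r
  choose T hT using hT
  simp only [hT] at ht
  have hc := intertwiner_matrix (Matrix.of T) ht
  have h0 : Matrix.of T * leg23 (RhatInv s) = 0 := intertwiner_gam_sorted_eq_zero (ε := ε) hq
    (fun k l => by
      rw [← Matrix.mul_assoc, hc, Matrix.mul_assoc, fTwo_mul_leg23_RhatInv, Matrix.mul_assoc])
  have h1 : Matrix.of T = 0 := by
    rw [← Matrix.mul_one (Matrix.of T), ← leg23_RhatInv_mul_Rhat (s := s), ← Matrix.mul_assoc, h0,
      Matrix.zero_mul]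
  rw [gam_eq_sum s ε x, map_sum]
  refine Finset.sum_eq_zero fun I _ => ?_
  rw [W.map_left]
  have : W (theta s ε I) = 0 := coords_injective s ε (funext fun r => by
    have h2 : T I r = 0 := congrFun (congrFun h1 I) r
    rw [hT, h2, map_zero, map_zero]
    rfl)
  rw [this, smul_zero]

/-- Every bimodule homomorphism `Γ ⊗ Γ → A` is a multiple of the standard one. -/
theorem exists_metric_form (hq : ∀ n : ℕ, 0 < n → ((s : ℂ) ^ 2) ^ n ≠ 1)
    (g : BimodHom (OSLq s) (GamTwo s ε) (OSLq s)) :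
    ∃ κ : ℂ, ∀ x, g x = ∑ r, sortedCoords s ε x r *
      algebraMap ℂ (OSLq s) (κ * (Ccheck s r.1.1 r.1.2 * Ccheck s r.2.1 r.2.2)) := by
  let G : Fin 2 → Fin 2 → Matrix Unit Unit ℂ := fun k l => Matrix.of fun _ _ => if k = l then 1 else 0
  have hG : IsTriangularRep G (fun _ => 0) (fun _ => 1) :=
    { raise := fun _ _ _ _ _ => Or.inl rfl
      diag_a := fun _ => by simp [G]
      diag_b := fun _ => by simp [G]
      diag_c := fun _ => by simp [G]
      diag_d := fun _ => by simp [G]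
      ne_zero := fun _ => one_ne_zero }
  have ht : ∀ k l p (r : Unit), ∑ m, ∑ p', fTwo s ε m l p p' • (u s k m * g (thetaTwo s ε p')) =
      ∑ m, ∑ r', G m l r' r • (g (thetaTwo s ε p) * u s k m) := by
    intro k l p r
    have h := g.map_right (u s k l) (thetaTwo s ε p)
    simp only [thetaTwo_op_smul, map_sum, g.map_left, smul_eq_mul, op_smul_eq_mul,
      Finset.sum_mul, smul_mul_assoc] at h
    rw [Finset.sum_comm, h]
    simp [G, ite_smul]
  have hT := fun p r => intertwiner_scalar hq (isTriangularRep_fTwo s ε) hG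
    (fun p _ => g (thetaTwo s ε p)) ht p r
  choose T hT using hT
  simp only [hT _ ()] at ht
  have hc := intertwiner_matrix (Matrix.of T) ht
  obtain ⟨κ, hκ⟩ := invariant_form_sorted hq (v := fun p => (leg23 (Rhat s) * Matrix.of T) p ())
    (fun k l p => by
      have : fSorted s k l * (leg23 (Rhat s) * Matrix.of T) =
          leg23 (Rhat s) * Matrix.of T * G k l := by
        rw [← Matrix.mul_assoc, ← leg23_mul_fTwo s ε, Matrix.mul_assoc, hc, Matrix.mul_assoc]
      have := congrFun (congrFun this p) ()
      rw [Matrix.mul_apply] at this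
      rw [this, Matrix.mul_apply]
      simp [G])
  refine ⟨κ, fun x => ?_⟩
  have h1 : ∀ p, T p () = ∑ r, leg23 (RhatInv s) r p *
      (κ * (Ccheck s r.1.1 r.1.2 * Ccheck s r.2.1 r.2.2)) := by
    intro p
    have h2 : Matrix.of T = leg23 (RhatInv s) * (leg23 (Rhat s) * Matrix.of T) := by
      rw [← Matrix.mul_assoc, leg23_RhatInv_mul_Rhat, Matrix.one_mul]
    have h3 := congrFun (congrFun h2 p) ()
    rw [Matrix.mul_apply, Matrix.of_apply] at h3
    rw [h3]
    refine Finset.sum_congr rfl fun r _ => ?_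
    have hsym : leg23 (RhatInv s) p r = leg23 (RhatInv s) r p := by
      rw [← Matrix.transpose_apply (leg23 (RhatInv s)), leg23_transpose, RhatInv_transpose]
    rw [← hκ r, hsym]
  conv_lhs => rw [gamTwo_eq_sum s ε x]
  simp only [map_sum, g.map_left, smul_eq_mul, hT _ (), h1, sortedCoords_apply, Finset.sum_mul,
    Finset.mul_sum, map_mul, mul_assoc]
  exact Finset.sum_comm

theorem diff_apply (a : OSLq s) :
    diff s ε a = op a • thetaInv s ε - a • thetaInv s ε := rfl

/-- The linear left connections on `Γ`. -/
theorem exists_endo_of_connection (hq : ∀ n : ℕ, 0 < n → ((s : ℂ) ^ 2) ^ n ≠ 1)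
    {nabla : Gam s ε →+ GamTwo s ε} (hn : IsLinearLeftConnection (diff s ε) nabla) :
    ∃ A B C D : ℂ, ∀ ρ, nabla ρ = btmul (OSLq s) (thetaInv s ε) ρ -
      endoHom s ε A B C D (btmul (OSLq s) ρ (thetaInv s ε)) := by
  obtain ⟨hn, τ, hτ⟩ := hn
  obtain ⟨A, B, C, D, h⟩ := exists_endo hq τ
  refine ⟨A, B, C, D, fun ρ => ?_⟩
  have h0 := hom_gam_gamTwo_eq_zero hq (innerDefect diff_apply τ nabla hn hτ) ρ
  rw [innerDefect_apply, sub_eq_zero] at h0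
  rw [← h0, h]
  rfl

theorem thetaInv_eq : thetaInv s ε = algebraMap ℂ (OSLq s) ((s : ℂ) ^ 2 - ((s : ℂ) ^ 2)⁻¹)⁻¹ •
    (theta s ε (0, 1) - algebraMap ℂ (OSLq s) ((s : ℂ) ^ 2) • theta s ε (1, 0)) := by
  have hs : (s : ℂ) ≠ 0 := s.ne_zero
  rw [smul_sub, smul_smul, ← map_mul, sub_eq_add_neg, ← neg_smul, ← map_neg]
  simp only [thetaInv, Fin.sum_univ_two, Ccheck]
  simp [hs, pow_two, div_eq_mul_inv, mul_comm]

theorem generation_det_ne_zero (hq : ∀ n : ℕ, 0 < n → ((s : ℂ) ^ 2) ^ n ≠ 1) (ε : ℤˣ) :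
    (((ε : ℤ) : ℂ) * ((s : ℂ) ^ 2)⁻¹ - 1) * (-(s : ℂ) ^ 2 * (((ε : ℤ) : ℂ) * ((s : ℂ) ^ 2)⁻¹ - 1) -
      ((ε : ℤ) : ℂ) * ((s : ℂ) ^ 2 - ((s : ℂ) ^ 2)⁻¹) ^ 2) +
      (s : ℂ) ^ 2 * (((ε : ℤ) : ℂ) * (s : ℂ) ^ 2 - 1) ^ 2 ≠ 0 := by
  have hs : (s : ℂ) ^ 2 ≠ 0 := pow_ne_zero 2 s.ne_zero
  generalize (s : ℂ) ^ 2 = q at *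
  have h1 : q ^ 2 - 1 ≠ 0 := sub_ne_zero.2 (hq 2 (by norm_num))
  have h2 : q ^ 6 - 1 ≠ 0 := sub_ne_zero.2 (hq 6 (by norm_num))
  have h3 : q ^ 2 - 1 = (q - 1) * (q + 1) := by ring
  have h4 : q ^ 6 - 1 = (q ^ 3 - 1) * (q ^ 3 + 1) := by ring
  have h5 := h1
  rw [h3, mul_ne_zero_iff] at h5
  rw [h4, mul_ne_zero_iff] at h2
  intro h
  rcases Int.units_eq_one_or ε with rfl | rfl
  · refine mul_ne_zero (mul_ne_zero h5.1 h2.1) h1 ?_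
    field_simp at h
    push_cast at h
    linear_combination h
  · refine mul_ne_zero (mul_ne_zero h5.2 h2.2) h1 ?_
    field_simp at h
    push_cast at h
    linear_combination h

/-- `Γ` is generated by the differentials. -/
theorem closure_diff_eq_top (hq : ∀ n : ℕ, 0 < n → ((s : ℂ) ^ 2) ^ n ≠ 1) :
    AddSubgroup.closure {γ | ∃ a b : OSLq s, γ = a • diff s ε b} = ⊤ := by
  have hs : (s : ℂ) ≠ 0 := s.ne_zero
  have hsm : ∀ (a : OSLq s) {γ : Gam s ε},
      γ ∈ AddSubgroup.closure {γ | ∃ a b : OSLq s, γ = a • diff s ε b} →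
      a • γ ∈ AddSubgroup.closure {γ | ∃ a b : OSLq s, γ = a • diff s ε b} := by
    intro a γ h
    induction h using AddSubgroup.closure_induction with
    | mem γ h =>
      obtain ⟨b, c, rfl⟩ := h
      exact AddSubgroup.subset_closure ⟨a * b, c, by rw [mul_smul]⟩
    | zero => rw [smul_zero]; exact zero_mem _
    | add x y _ _ hx hy => rw [smul_add]; exact add_mem hx hy
    | neg x _ hx => rw [smul_neg]; exact neg_mem hx
  have hd : ∀ b, diff s ε b ∈ AddSubgroup.closure {γ | ∃ a b : OSLq s, γ = a • diff s ε b} :=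
    fun b => AddSubgroup.subset_closure ⟨1, b, (one_smul _ _).symm⟩
  generalize AddSubgroup.closure {γ | ∃ a b : OSLq s, γ = a • diff s ε b} = V at *
  have hcancel : ∀ {c : ℂ} {x : Gam s ε}, c ≠ 0 → algebraMap ℂ (OSLq s) c • x ∈ V → x ∈ V := by
    intro c x hc h
    have := hsm (algebraMap ℂ (OSLq s) c⁻¹) h
    rwa [smul_smul, ← map_mul, inv_mul_cancel₀ hc, map_one, one_smul] at this
  let ω : Gam s ε := theta s ε (0, 1) - algebraMap ℂ (OSLq s) ((s : ℂ) ^ 2) • theta s ε (1, 0)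
  have hω : ∀ a : OSLq s, (op a • ω - a • ω : Gam s ε) ∈ V := by
    intro a
    refine hcancel (inv_ne_zero (q_sub_inv_ne_zero hq)) ?_
    have h := hd a
    rw [diff_apply, thetaInv_eq] at h
    have e : ∀ (x : Gam s ε), a • algebraMap ℂ (OSLq s) ((s : ℂ) ^ 2 - ((s : ℂ) ^ 2)⁻¹)⁻¹ • x =
        algebraMap ℂ (OSLq s) ((s : ℂ) ^ 2 - ((s : ℂ) ^ 2)⁻¹)⁻¹ • a • x := fun x => by
      rw [smul_smul, smul_smul, Algebra.commutes]
    rw [smul_sub, smul_comm _ (op a), ← e]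
    exact h
  let z : Fin 2 → Fin 2 → Gam s ε := fun m l =>
    ∑ J, algebraMap ℂ (OSLq s) (fGen s ε m l (0, 1) J - (s : ℂ) ^ 2 * fGen s ε m l (1, 0) J) •
      theta s ε J - if m = l then ω else 0
  have hz : ∀ k l, u s k 0 • z 0 l + u s k 1 • z 1 l ∈ V := by
    intro k l
    have h := hω (u s k l)
    have e : (op (u s k l) • ω - u s k l • ω : Gam s ε) = u s k 0 • z 0 l + u s k 1 • z 1 l := by
      have e1 : (op (u s k l) • ω : Gam s ε) = ∑ m, u s k m •
          ∑ J, algebraMap ℂ (OSLq s) (fGen s ε m l (0, 1) J - (s : ℂ) ^ 2 * fGen s ε m l (1, 0) J) •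
            theta s ε J := by
        simp only [ω, smul_sub, theta_op_smul, Finset.smul_sum, Finset.sum_smul]
        rw [← smul_comm, theta_op_smul, Finset.smul_sum]
        simp only [Finset.sum_smul, Finset.smul_sum, smul_smul]
        rw [← Finset.sum_sub_distrib, Finset.sum_comm (γ := Fin 2)]
        refine Finset.sum_congr rfl fun J _ => ?_
        rw [← Finset.sum_sub_distrib]
        refine Finset.sum_congr rfl fun m _ => ?_
        rw [← sub_smul, ← Algebra.commutes (_ - _), map_sub, sub_mul, Algebra.smul_def,
          Algebra.smul_def, ← mul_assoc, ← map_mul]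
      rw [e1, Fin.sum_univ_two]
      simp only [z, smul_sub]
      fin_cases l <;> simp <;> abel
    rwa [e] at h
  have tup := slqTuple_u (s := s)
  have hs2 : (s : ℂ) ^ 2 ≠ 0 := pow_ne_zero 2 hs
  have hz0 : ∀ l, z 0 l ∈ V := by
    intro l
    have h := sub_mem (hsm (u s 1 1) (hz 0 l)) (hsm (((s : ℂ) ^ 2)⁻¹ • u s 0 1) (hz 1 l))
    have e : u s 1 1 • (u s 0 0 • z 0 l + u s 0 1 • z 1 l) -
        (((s : ℂ) ^ 2)⁻¹ • u s 0 1) • (u s 1 0 • z 0 l + u s 1 1 • z 1 l) = z 0 l := by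
      have e1 : u s 1 1 * u s 0 0 - (((s : ℂ) ^ 2)⁻¹ • u s 0 1) * u s 1 0 = 1 := by
        rw [tup.da, smul_mul_assoc, add_sub_cancel_right]
      have e2 : u s 1 1 * u s 0 1 - (((s : ℂ) ^ 2)⁻¹ • u s 0 1) * u s 1 1 = 0 := by
        rw [smul_mul_assoc, tup.bd, smul_smul, inv_mul_cancel₀ hs2, one_smul, sub_self]
      simp only [smul_add, smul_smul]
      rw [add_sub_add_comm, ← sub_smul, ← sub_smul, e1, e2, one_smul, zero_smul, add_zero]
    rwa [e] at h
  have hz1 : ∀ l, z 1 l ∈ V := by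
    intro l
    have h := sub_mem (hsm (u s 0 0) (hz 1 l)) (hsm ((s : ℂ) ^ 2 • u s 1 0) (hz 0 l))
    have e : u s 0 0 • (u s 1 0 • z 0 l + u s 1 1 • z 1 l) -
        ((s : ℂ) ^ 2 • u s 1 0) • (u s 0 0 • z 0 l + u s 0 1 • z 1 l) = z 1 l := by
      have e1 : u s 0 0 * u s 1 0 - ((s : ℂ) ^ 2 • u s 1 0) * u s 0 0 = 0 := by
        rw [smul_mul_assoc, tup.ac, smul_smul, mul_inv_cancel₀ hs2, one_smul, sub_self]
      have e2 : u s 0 0 * u s 1 1 - ((s : ℂ) ^ 2 • u s 1 0) * u s 0 1 = 1 := by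
        rw [tup.ad, smul_mul_assoc, tup.bc, add_sub_cancel_right]
      simp only [smul_add, smul_smul]
      rw [add_sub_add_comm, ← sub_smul, ← sub_smul, e1, e2, one_smul, zero_smul, zero_add]
    rwa [e] at h
  have hε := sign_ne_zero ε
  have h11 : theta s ε (1, 1) ∈ V := by
    refine hcancel (mul_ne_zero (raise_const_ne_zero hq) (mul_ne_zero hε (inv_ne_zero hs))) ?_
    convert hz0 1 using 1
    simp [z, Fintype.sum_prod_type, fGen_b]
  have h00 : theta s ε (0, 0) ∈ V := by
    refine hcancel (mul_ne_zero (lower_const_ne_zero hq) (mul_ne_zero hε (inv_ne_zero hs))) ?_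
    convert hz1 0 using 1
    simp [z, Fintype.sum_prod_type, fGen_c]
  have ha := hz0 0
  have hdd := hz1 1
  have ea : z 0 0 = algebraMap ℂ (OSLq s) (((ε : ℤ) : ℂ) * (s : ℂ) ^ 2 - 1) • theta s ε (0, 1) +
      algebraMap ℂ (OSLq s) (-(s : ℂ) ^ 2 * (((ε : ℤ) : ℂ) * ((s : ℂ) ^ 2)⁻¹ - 1) -
      ((ε : ℤ) : ℂ) * ((s : ℂ) ^ 2 - ((s : ℂ) ^ 2)⁻¹) ^ 2) • theta s ε (1, 0) := by
    have e1 : fGen s ε 0 0 (0, 1) (1, 0) = -((ε : ℤ) : ℂ) * ((s : ℂ) ^ 2 - ((s : ℂ) ^ 2)⁻¹) ^ 2 := by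
      simp [fGen_apply, Fin.sum_univ_two, Lplus_eq, Lminus_eq]
      field_simp
      ring
    have e2 : fGen s ε 0 0 (0, 1) (0, 1) = ((ε : ℤ) : ℂ) * (s : ℂ) ^ 2 := by
      simp [fGen_apply, Fin.sum_univ_two, Lplus_eq, Lminus_eq, pow_two]
    have e3 : fGen s ε 0 0 (1, 0) (1, 0) = ((ε : ℤ) : ℂ) * ((s : ℂ) ^ 2)⁻¹ := by
      simp [fGen_apply, Fin.sum_univ_two, Lplus_eq, Lminus_eq, pow_two]
    have e4 : fGen s ε 0 0 (1, 0) (0, 1) = 0 ∧ fGen s ε 0 0 (0, 1) (0, 0) = 0 ∧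
        fGen s ε 0 0 (0, 1) (1, 1) = 0 ∧ fGen s ε 0 0 (1, 0) (0, 0) = 0 ∧
        fGen s ε 0 0 (1, 0) (1, 1) = 0 := by
      simp [fGen_apply, Fin.sum_univ_two, Lplus_eq, Lminus_eq]
    simp only [z, ω, Fintype.sum_prod_type, Fin.sum_univ_two, e1, e2, e3, e4, if_true, mul_zero,
      sub_zero, algebraMap_smul, zero_smul, add_zero, zero_add]
    module
  have ed : z 1 1 = algebraMap ℂ (OSLq s) (((ε : ℤ) : ℂ) * ((s : ℂ) ^ 2)⁻¹ - 1) • theta s ε (0, 1) +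
      algebraMap ℂ (OSLq s) (-(s : ℂ) ^ 2 * (((ε : ℤ) : ℂ) * (s : ℂ) ^ 2 - 1)) • theta s ε (1, 0) := by
    simp only [z, ω, Fintype.sum_prod_type, Fin.sum_univ_two, fGen_d, if_true]
    simp only [algebraMap_smul]
    simp
    module
  rw [ea] at ha
  rw [ed] at hdd
  have hΔ := generation_det_ne_zero hq ε
  generalize (-(s : ℂ) ^ 2 * (((ε : ℤ) : ℂ) * ((s : ℂ) ^ 2)⁻¹ - 1) -
      ((ε : ℤ) : ℂ) * ((s : ℂ) ^ 2 - ((s : ℂ) ^ 2)⁻¹) ^ 2) = M at *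
  generalize (((ε : ℤ) : ℂ) * ((s : ℂ) ^ 2)⁻¹ - 1) = P at *
  generalize (((ε : ℤ) : ℂ) * (s : ℂ) ^ 2 - 1) = Q at *
  have h10 : theta s ε (1, 0) ∈ V := by
    refine hcancel hΔ ?_
    convert sub_mem (hsm (algebraMap ℂ (OSLq s) P) ha) (hsm (algebraMap ℂ (OSLq s) Q) hdd) using 1
    simp only [smul_add, smul_smul, ← map_mul]
    rw [mul_comm P Q, add_sub_add_left_eq_sub, ← sub_smul, ← map_sub]
    congr 2
    ring
  have h01 : theta s ε (0, 1) ∈ V := by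
    refine hcancel hΔ ?_
    convert add_mem (hsm (algebraMap ℂ (OSLq s) M) hdd)
      (hsm (algebraMap ℂ (OSLq s) ((s : ℂ) ^ 2 * Q)) ha) using 1
    simp only [smul_add, smul_smul, ← map_mul]
    rw [add_add_add_comm, ← add_smul, ← add_smul, ← map_add, ← map_add]
    have e1 : M * (-(s : ℂ) ^ 2 * Q) + (s : ℂ) ^ 2 * Q * M = 0 := by ring
    have e2 : M * P + (s : ℂ) ^ 2 * Q * Q = P * M + (s : ℂ) ^ 2 * Q ^ 2 := by ring
    rw [e1, e2, map_zero, zero_smul, add_zero]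
  refine eq_top_iff.2 fun x _ => ?_
  rw [gam_eq_sum s ε x]
  refine sum_mem fun I _ => hsm _ ?_
  obtain ⟨i, j⟩ := I
  fin_cases i <;> fin_cases j
  · exact h00
  · exact h01
  · exact h10
  · exact h11

end Homs

section BraidGroup

variable {G : Type*} [Group G]

/-- In a group, `a b a = b a b` implies that conjugation by `a b` maps `a` to `b`. -/
theorem semiconjBy_of_braid {a b : G} (h : a * b * a = b * a * b) : SemiconjBy (a * b) a b := by
  rw [SemiconjBy, h, mul_assoc]

theorem semiconjBy_sign_of_braid {a b : G} (h : a * b * a = b * a * b) (η : ℤˣ) :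
    SemiconjBy (a ^ (η : ℤ) * b ^ (η : ℤ)) a b := by
  rcases Int.units_eq_one_or η with rfl | rfl
  · simpa using semiconjBy_of_braid h
  · have h' : a⁻¹ * b⁻¹ * a⁻¹ = b⁻¹ * a⁻¹ * b⁻¹ := by
      simpa [mul_assoc] using congrArg (fun x => x⁻¹) h
    simp only [Units.val_neg, Units.val_one, zpow_neg, zpow_one, SemiconjBy]
    calc a⁻¹ * b⁻¹ * a = b * (b⁻¹ * a⁻¹ * b⁻¹) * a := by group
      _ = _ := by rw [← h']; group

/-- The Yang-Baxter equation for the braidings of the double strands. -/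
theorem yang_baxter_double {r1 r2 r3 r4 r5 : G} (h12 : r1 * r2 * r1 = r2 * r1 * r2)
    (h23 : r2 * r3 * r2 = r3 * r2 * r3) (h34 : r3 * r4 * r3 = r4 * r3 * r4)
    (h45 : r4 * r5 * r4 = r5 * r4 * r5) (c13 : Commute r1 r3) (c14 : Commute r1 r4)
    (c15 : Commute r1 r5) (c24 : Commute r2 r4) (c25 : Commute r2 r5) (c35 : Commute r3 r5)
    (η η' : ℤˣ) :
    (r2 * r1 ^ (η : ℤ) * r3 ^ (η' : ℤ) * r2⁻¹) * (r4 * r3 ^ (η : ℤ) * r5 ^ (η' : ℤ) * r4⁻¹) *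
        (r2 * r4 * r3) =
      (r2 * r4 * r3) * ((r1 ^ (η : ℤ) * r2 ^ (η : ℤ)) * (r4 ^ (η' : ℤ) * r5 ^ (η' : ℤ))) ∧
    (r4 * r3 * r5⁻¹ * r4⁻¹) * ((r2 * r1 ^ (η : ℤ) * r3 ^ (η' : ℤ) * r2⁻¹) *
        (r4 * r3 ^ (η : ℤ) * r5 ^ (η' : ℤ) * r4⁻¹)) =
      ((r2 * r1 ^ (η : ℤ) * r3 ^ (η' : ℤ) * r2⁻¹) *
        (r4 * r3 ^ (η : ℤ) * r5 ^ (η' : ℤ) * r4⁻¹)) * (r2 * r1 * r3⁻¹ * r2⁻¹) := by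
  have t12 : ∀ a b : ℤ, SemiconjBy (r2 * r4 * r3) (r1 ^ a * r4 ^ b)
      (r2 * r1 ^ a * r3 ^ b * r2⁻¹) := by
    intro a b
    have e1 : r4 * r3 * r4 ^ b = r3 ^ b * (r4 * r3) :=
      ((semiconjBy_of_braid h34.symm).zpow_right b).eq
    have e2 : Commute (r4 * r3) (r1 ^ a) := ((c14.mul_right c13).zpow_left a).symm
    calc r2 * r4 * r3 * (r1 ^ a * r4 ^ b) = r2 * ((r4 * r3) * r1 ^ a) * r4 ^ b := by group
      _ = r2 * r1 ^ a * (r4 * r3 * r4 ^ b) := by rw [e2.eq]; group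
      _ = _ := by rw [e1]; group
  have t23 : ∀ a b : ℤ, SemiconjBy (r2 * r4 * r3) (r2 ^ a * r5 ^ b)
      (r4 * r3 ^ a * r5 ^ b * r4⁻¹) := by
    intro a b
    have e1 : r2 * r3 * r2 ^ a = r3 ^ a * (r2 * r3) :=
      ((semiconjBy_of_braid h23).zpow_right a).eq
    have e2 : Commute (r2 * r3) (r5 ^ b) := (c25.mul_left c35).zpow_right b
    calc r2 * r4 * r3 * (r2 ^ a * r5 ^ b) = r4 * (r2 * r3 * r2 ^ a) * r5 ^ b := by
          rw [c24.eq]; group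
      _ = r4 * r3 ^ a * ((r2 * r3) * r5 ^ b) := by rw [e1]; group
      _ = r4 * r3 ^ a * r5 ^ b * r4⁻¹ * ((r4 * r2) * r3) := by rw [e2.eq]; group
      _ = _ := by rw [← c24.eq]
  have c : ∀ a b c d : ℤ, Commute (r1 ^ a * r2 ^ b) (r4 ^ c * r5 ^ d) := fun a b c d =>
    ((c14.zpow_zpow a c).mul_right (c15.zpow_zpow a d)).mul_left
      ((c24.zpow_zpow b c).mul_right (c25.zpow_zpow b d))
  have hQ : SemiconjBy (r2 * r4 * r3)
      ((r1 ^ (η : ℤ) * r2 ^ (η : ℤ)) * (r4 ^ (η' : ℤ) * r5 ^ (η' : ℤ)))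
      ((r2 * r1 ^ (η : ℤ) * r3 ^ (η' : ℤ) * r2⁻¹) * (r4 * r3 ^ (η : ℤ) * r5 ^ (η' : ℤ) * r4⁻¹)) := by
    have := (t12 η η').mul_right (t23 η η')
    have e : r1 ^ (η : ℤ) * r4 ^ (η' : ℤ) * (r2 ^ (η : ℤ) * r5 ^ (η' : ℤ)) =
        (r1 ^ (η : ℤ) * r2 ^ (η : ℤ)) * (r4 ^ (η' : ℤ) * r5 ^ (η' : ℤ)) := by
      rw [mul_assoc, ← mul_assoc (r4 ^ _), ← (c24.zpow_zpow η η').eq]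
      group
    rwa [e] at this
  refine ⟨hQ.eq.symm, ?_⟩
  have s12 : SemiconjBy (r2 * r4 * r3) (r1 * r4⁻¹) (r2 * r1 * r3⁻¹ * r2⁻¹) := by
    simpa using t12 1 (-1)
  have s23 : SemiconjBy (r2 * r4 * r3) (r2 * r5⁻¹) (r4 * r3 * r5⁻¹ * r4⁻¹) := by
    simpa using t23 1 (-1)
  have key : (r2 * r5⁻¹) * ((r1 ^ (η : ℤ) * r2 ^ (η : ℤ)) * (r4 ^ (η' : ℤ) * r5 ^ (η' : ℤ))) =
      ((r1 ^ (η : ℤ) * r2 ^ (η : ℤ)) * (r4 ^ (η' : ℤ) * r5 ^ (η' : ℤ))) * (r1 * r4⁻¹) := by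
    have e1 := (semiconjBy_sign_of_braid h12 η).eq
    have e2 := ((semiconjBy_sign_of_braid h45 η').inv_right).eq
    have e3 : Commute r5⁻¹ (r1 ^ (η : ℤ) * r2 ^ (η : ℤ)) := by
      simpa using (c η η 0 (-1)).symm
    have e4 : Commute r1 (r4 ^ (η' : ℤ) * r5 ^ (η' : ℤ)) := by
      simpa using c 1 0 η' η'
    calc _ = r2 * (r5⁻¹ * (r1 ^ (η : ℤ) * r2 ^ (η : ℤ))) * (r4 ^ (η' : ℤ) * r5 ^ (η' : ℤ)) := by
          simp only [mul_assoc]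
      _ = (r2 * (r1 ^ (η : ℤ) * r2 ^ (η : ℤ))) * (r5⁻¹ * (r4 ^ (η' : ℤ) * r5 ^ (η' : ℤ))) := by
          rw [e3.eq]; simp only [mul_assoc]
      _ = (r1 ^ (η : ℤ) * r2 ^ (η : ℤ)) * (r1 * (r4 ^ (η' : ℤ) * r5 ^ (η' : ℤ))) * r4⁻¹ := by
          rw [← e1, ← e2]; simp only [mul_assoc]
      _ = _ := by rw [e4.eq]; simp only [mul_assoc]
  have l1 := (s23.mul_right hQ).eq
  rw [key] at l1
  have l2 := (hQ.mul_right s12).eq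
  exact mul_right_cancel (l1.symm.trans l2)

end BraidGroup

section TemperleyLieb

variable (s : ℂˣ) {X Y Z : Type*} [AddCommGroup X] [Module ℂ X] [AddCommGroup Y] [Module ℂ Y]
  [AddCommGroup Z] [Module ℂ Z]

/-- Contraction of the first two legs with `Č`. -/
def capMap : (Fin 2 → Fin 2 → X) →ₗ[ℂ] X where
  toFun f := ∑ i, ∑ j, Ccheck s i j • f i j
  map_add' f g := by simp only [Pi.add_apply, smul_add, Finset.sum_add_distrib]
  map_smul' c f := by
    simp only [Pi.smul_apply, Finset.smul_sum, RingHom.id_apply, smul_comm c]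

/-- Insertion of `Č` on the first two legs. -/
def cupMap : X →ₗ[ℂ] (Fin 2 → Fin 2 → X) where
  toFun x := fun i j => Ccheck s i j • x
  map_add' f g := by funext i j; simp only [Pi.add_apply, smul_add]
  map_smul' c f := by funext i j; simp only [Pi.smul_apply, RingHom.id_apply, smul_comm c]

/-- Application of a linear map behind the first leg. -/
def shiftMap (T : X →ₗ[ℂ] Y) : (Fin 2 → X) →ₗ[ℂ] (Fin 2 → Y) := T.compLeft (Fin 2)

@[simp] theorem shiftMap_apply (T : X →ₗ[ℂ] Y) (f : Fin 2 → X) (i : Fin 2) :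
    shiftMap T f i = T (f i) := rfl

/-- `shiftMap` as a homomorphism of monoids. -/
def shiftHom : Module.End ℂ X →* Module.End ℂ (Fin 2 → X) where
  toFun := shiftMap
  map_one' := rfl
  map_mul' _ _ := rfl

/-- `shiftMap` on invertible maps. -/
def shiftUnit : (Module.End ℂ X)ˣ →* (Module.End ℂ (Fin 2 → X))ˣ := Units.map shiftHom

theorem shiftUnit_apply (T : (Module.End ℂ X)ˣ) (f : Fin 2 → X) :
    (shiftUnit T : Module.End ℂ (Fin 2 → X)) f = shiftMap (T : Module.End ℂ X) f := rfl

theorem capMap_cupMap (x : X) :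
    capMap s (cupMap s x) = ((s : ℂ) ^ 2 + ((s : ℂ) ^ 2)⁻¹) • x := by
  simp [capMap, cupMap, Fin.sum_univ_two, Ccheck, smul_smul, pow_two, add_smul, add_comm]

theorem capMap_shift_cupMap (f : Fin 2 → X) : capMap s (shiftMap (cupMap s) f) = -f := by
  have hs : (s : ℂ) ≠ 0 := s.ne_zero
  funext i
  fin_cases i <;> simp [capMap, cupMap, Fin.sum_univ_two, Ccheck, smul_smul, hs]

theorem shift_capMap_cupMap (f : Fin 2 → X) : shiftMap (capMap s) (cupMap s f) = -f := by
  have hs : (s : ℂ) ≠ 0 := s.ne_zero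
  funext i
  fin_cases i <;> simp [capMap, cupMap, Fin.sum_univ_two, Ccheck, smul_smul, hs]

theorem capMap_shift (T : X →ₗ[ℂ] Y) (f : Fin 2 → Fin 2 → X) :
    capMap s (shiftMap (shiftMap T) f) = T (capMap s f) := by
  simp [capMap]

theorem cupMap_shift (T : X →ₗ[ℂ] Y) (x : X) :
    cupMap s (T x) = shiftMap (shiftMap T) (cupMap s x) := by
  funext i j
  simp [cupMap]

/-- The Temperley-Lieb generator on the first two legs. -/
def tlGen : Module.End ℂ (Fin 2 → Fin 2 → X) := cupMap s ∘ₗ capMap s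

/-- `R̂^η` on the first two legs. -/
def braidGen (η : ℤˣ) : Module.End ℂ (Fin 2 → Fin 2 → X) :=
  (s : ℂ) ^ (η : ℤ) • 1 - (s : ℂ) ^ (-(η : ℤ)) • tlGen s

theorem braidGen_apply (η : ℤˣ) (f : Fin 2 → Fin 2 → X) : braidGen s η f =
    (s : ℂ) ^ (η : ℤ) • f - (s : ℂ) ^ (-(η : ℤ)) • cupMap s (capMap s f) := rfl

theorem sign_zpow_add (η : ℤˣ) : (s : ℂ) ^ (η : ℤ) * (s : ℂ) ^ (η : ℤ) +
    (s : ℂ) ^ (-(η : ℤ)) * (s : ℂ) ^ (-(η : ℤ)) = (s : ℂ) ^ 2 + ((s : ℂ) ^ 2)⁻¹ := by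
  rcases Int.units_eq_one_or η with rfl | rfl
  · simp [pow_two]
  · simp [pow_two, add_comm]

theorem sign_zpow_mul (η : ℤˣ) : (s : ℂ) ^ (η : ℤ) * (s : ℂ) ^ (-(η : ℤ)) = 1 := by
  rw [← zpow_add₀ s.ne_zero, add_neg_cancel, zpow_zero]

theorem braidGen_mul_neg (η : ℤˣ) : braidGen s η * braidGen s (-η) =
    (1 : Module.End ℂ (Fin 2 → Fin 2 → X)) := by
  refine LinearMap.ext fun f => ?_
  rw [Module.End.mul_apply, braidGen_apply, braidGen_apply]
  simp only [map_sub, map_smul, capMap_cupMap, Units.val_neg, neg_neg, Module.End.one_apply]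
  have h1 := sign_zpow_mul s η
  have h2 := sign_zpow_add s η
  generalize (s : ℂ) ^ (η : ℤ) = a at *
  generalize (s : ℂ) ^ (-(η : ℤ)) = b at *
  rw [← h2]
  match_scalars
  · linear_combination h1
  · linear_combination (b * b + a * a) * h1

/-- `R̂` on the first two legs as a unit. -/
def braidUnit : (Module.End ℂ (Fin 2 → Fin 2 → X))ˣ where
  val := braidGen s 1
  inv := braidGen s (-1)
  val_inv := braidGen_mul_neg s 1
  inv_val := by simpa using braidGen_mul_neg (X := X) s (-1)

theorem braidUnit_zpow (η : ℤˣ) :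
    ((braidUnit s ^ (η : ℤ) : (Module.End ℂ (Fin 2 → Fin 2 → X))ˣ) :
      Module.End ℂ (Fin 2 → Fin 2 → X)) = braidGen s η := by
  rcases Int.units_eq_one_or η with rfl | rfl
  · simp [braidUnit]
  · simp [braidUnit, Units.inv_mk]

theorem braidUnit_braid :
    braidUnit s * shiftUnit (X := Fin 2 → Fin 2 → X) (braidUnit s) * braidUnit s =
      shiftUnit (X := Fin 2 → Fin 2 → X) (braidUnit s) * braidUnit s *
        shiftUnit (X := Fin 2 → Fin 2 → X) (braidUnit s) := by
  have hs : (s : ℂ) ≠ 0 := s.ne_zero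
  have h1 : ∀ f : Fin 2 → Fin 2 → X, ((braidUnit s : (Module.End ℂ (Fin 2 → Fin 2 → X))ˣ) :
      Module.End ℂ (Fin 2 → Fin 2 → X)) f = (s : ℂ) • f - (s : ℂ)⁻¹ • cupMap s (capMap s f) := fun f => by
    change braidGen s 1 f = _
    simp [braidGen_apply]
  have h1' : ∀ f : Fin 2 → Fin 2 → Fin 2 → X, ((braidUnit s : (Module.End ℂ (Fin 2 → Fin 2 → Fin 2 → X))ˣ) :
      Module.End ℂ (Fin 2 → Fin 2 → Fin 2 → X)) f = (s : ℂ) • f - (s : ℂ)⁻¹ • cupMap s (capMap s f) := fun f => by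
    change braidGen s 1 f = _
    simp [braidGen_apply]
  have h2 : ∀ f : Fin 2 → Fin 2 → Fin 2 → X, (shiftUnit (X := Fin 2 → Fin 2 → X) (braidUnit s) :
      Module.End ℂ (Fin 2 → Fin 2 → Fin 2 → X)) f =
      (s : ℂ) • f - (s : ℂ)⁻¹ • shiftMap (cupMap s) (shiftMap (capMap s) f) := fun f => by
    funext i
    exact h1 (f i)
  refine Units.ext (LinearMap.ext fun f => ?_)
  simp only [Units.val_mul, Module.End.mul_apply, h1', h2, map_sub, map_smul, capMap_shift_cupMap,
    shift_capMap_cupMap, capMap_cupMap, map_neg]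
  have e : ∀ g : Fin 2 → X, shiftMap (capMap s) (shiftMap (cupMap s) g) =
      ((s : ℂ) ^ 2 + ((s : ℂ) ^ 2)⁻¹) • g := fun g => by
    funext i
    exact capMap_cupMap s (g i)
  simp only [e, map_smul]
  match_scalars <;> field_simp <;> ring

theorem braidUnit_commute_shift (T : (Module.End ℂ X)ˣ) :
    Commute (braidUnit s) (shiftUnit (X := Fin 2 → X) (shiftUnit T)) := by
  refine Units.ext (LinearMap.ext fun f => ?_)
  change braidGen s 1 (shiftMap (shiftMap (T : Module.End ℂ X)) f) =
    shiftMap (shiftMap (T : Module.End ℂ X)) (braidGen s 1 f)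
  rw [braidGen_apply, braidGen_apply, map_sub, map_smul, map_smul, capMap_shift, cupMap_shift]

theorem shift_capMap_braid (η : ℤˣ) (f : Fin 2 → Fin 2 → Fin 2 → X) :
    shiftMap (capMap s) (braidGen s η (shiftMap (braidGen s η) f)) = capMap s f := by
  have e : ∀ g : Fin 2 → X, shiftMap (capMap s) (shiftMap (cupMap s) g) =
      ((s : ℂ) ^ 2 + ((s : ℂ) ^ 2)⁻¹) • g := fun g => by
    funext i
    exact capMap_cupMap s (g i)
  have h2 : shiftMap (braidGen s η) f =
      (s : ℂ) ^ (η : ℤ) • f - (s : ℂ) ^ (-(η : ℤ)) • shiftMap (cupMap s) (shiftMap (capMap s) f) := rfl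
  rw [h2, braidGen_apply]
  simp only [map_sub, map_smul, capMap_shift_cupMap, shift_capMap_cupMap, e, map_neg]
  have h1 := sign_zpow_mul s η
  have h2 := sign_zpow_add s η
  generalize (s : ℂ) ^ (η : ℤ) = a at *
  generalize (s : ℂ) ^ (-(η : ℤ)) = b at *
  rw [← h2]
  match_scalars
  · linear_combination (-(a * a) - b * b) * h1
  · linear_combination h1

theorem capMap_braid (η : ℤˣ) (f : Fin 2 → Fin 2 → Fin 2 → X) :
    capMap s (shiftMap (braidGen s η) (braidGen s η f)) = shiftMap (capMap s) f := by
  have h2 : ∀ f : Fin 2 → Fin 2 → Fin 2 → X, shiftMap (braidGen s η) f =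
      (s : ℂ) ^ (η : ℤ) • f - (s : ℂ) ^ (-(η : ℤ)) • shiftMap (cupMap s) (shiftMap (capMap s) f) :=
    fun f => rfl
  rw [h2, braidGen_apply]
  simp only [map_sub, map_smul, capMap_shift_cupMap, shift_capMap_cupMap, capMap_cupMap, map_neg]
  have h1 := sign_zpow_mul s η
  have h2 := sign_zpow_add s η
  generalize (s : ℂ) ^ (η : ℤ) = a at *
  generalize (s : ℂ) ^ (-(η : ℤ)) = b at *
  rw [← h2]
  match_scalars
  · linear_combination (-(a * a) - b * b) * h1
  · linear_combination h1

end TemperleyLieb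

/-- Tensors with two additional legs. -/
abbrev TwoLegs (X : Type*) : Type _ := Fin 2 → Fin 2 → X

section SixLegs

variable (s : ℂˣ) {X : Type*} [AddCommGroup X] [Module ℂ X]

theorem shiftUnit_braidUnit_zpow (η : ℤˣ) (f : Fin 2 → TwoLegs X) :
    ((shiftUnit (X := TwoLegs X) (braidUnit s) ^ (η : ℤ) :
      (Module.End ℂ (Fin 2 → TwoLegs X))ˣ) : Module.End ℂ (Fin 2 → TwoLegs X)) f =
      shiftMap (braidGen s η) f := by
  rw [← map_zpow, shiftUnit_apply, braidUnit_zpow]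

/-- The contraction of four legs which corresponds to a bicovariant metric. -/
def metricMap : TwoLegs (TwoLegs X) →ₗ[ℂ] X :=
  capMap s ∘ₗ capMap s ∘ₗ shiftMap (braidGen s (-1))

theorem metricMap_apply (f : TwoLegs (TwoLegs X)) :
    metricMap s f = capMap s (capMap s (shiftMap (braidGen s (-1)) f)) := rfl

theorem metricMap_shift (f : TwoLegs (TwoLegs X)) :
    metricMap s (shiftMap (braidGen s 1) f) = capMap s (capMap s f) := by
  rw [metricMap_apply]
  have : shiftMap (braidGen s (-1)) (shiftMap (braidGen s 1) f) = f := by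
    funext i
    have := braidGen_mul_neg (X := Fin 2 → X) s (-1)
    rw [neg_neg] at this
    exact LinearMap.congr_fun this (f i)
  rw [this]

/-- `R̂_{23} R̂^η_{12} R̂^{η'}_{34} R̂⁻¹_{23}` on four legs. -/
def flipUnit (η η' : ℤˣ) : (Module.End ℂ (TwoLegs (TwoLegs X)))ˣ :=
  shiftUnit (X := Fin 2 → TwoLegs X) (braidUnit s) * braidUnit s ^ (η : ℤ) *
    shiftUnit (X := Fin 2 → TwoLegs X) (shiftUnit (X := TwoLegs X) (braidUnit s)) ^ (η' : ℤ) *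
    (shiftUnit (X := Fin 2 → TwoLegs X) (braidUnit s))⁻¹

theorem flip_yang_baxter (η η' : ℤˣ) (w : TwoLegs (TwoLegs (TwoLegs X))) :
    shiftMap (shiftMap (metricMap s)) ((flipUnit (X := TwoLegs X) s η η').val
      (shiftMap (shiftMap (flipUnit (X := X) s η η').val) w)) = metricMap s w ∧
    shiftMap (shiftMap (flipUnit (X := X) s 1 (-1)).val) ((flipUnit (X := TwoLegs X) s η η').val
        (shiftMap (shiftMap (flipUnit (X := X) s η η').val) w)) =
      (flipUnit (X := TwoLegs X) s η η').val (shiftMap (shiftMap (flipUnit (X := X) s η η').val)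
          ((flipUnit (X := TwoLegs X) s 1 (-1)).val w)) := by
  let r1 : (Module.End ℂ (TwoLegs (TwoLegs (TwoLegs X))))ˣ := braidUnit s
  let r2 : (Module.End ℂ (TwoLegs (TwoLegs (TwoLegs X))))ˣ :=
    shiftUnit (X := Fin 2 → TwoLegs (TwoLegs X)) (braidUnit s)
  let sh : (Module.End ℂ (TwoLegs (TwoLegs X)))ˣ →* (Module.End ℂ (TwoLegs (TwoLegs (TwoLegs X))))ˣ :=
    (shiftUnit (X := Fin 2 → TwoLegs (TwoLegs X))).comp (shiftUnit (X := TwoLegs (TwoLegs X)))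
  let r3 := sh (braidUnit s)
  let r4 := sh (shiftUnit (X := Fin 2 → TwoLegs X) (braidUnit s))
  let r5 := sh (shiftUnit (X := Fin 2 → TwoLegs X) (shiftUnit (X := TwoLegs X) (braidUnit s)))
  have h12 : r1 * r2 * r1 = r2 * r1 * r2 := braidUnit_braid s
  have h23 : r2 * r3 * r2 = r3 * r2 * r3 := by
    have := congrArg (shiftUnit (X := Fin 2 → TwoLegs (TwoLegs X))) (braidUnit_braid (X := TwoLegs X) s)
    rw [map_mul, map_mul, map_mul, map_mul] at this
    exact this
  have h34 : r3 * r4 * r3 = r4 * r3 * r4 := by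
    have := congrArg sh (braidUnit_braid (X := Fin 2 → X) s)
    simpa only [map_mul] using this
  have h45 : r4 * r5 * r4 = r5 * r4 * r5 := by
    have := congrArg (fun x => sh (shiftUnit (X := Fin 2 → TwoLegs X) x)) (braidUnit_braid (X := X) s)
    simpa only [map_mul] using this
  have c1 : ∀ T, Commute r1 (sh T) := fun T => braidUnit_commute_shift s T
  have c2 : ∀ T, Commute r2 (sh (shiftUnit (X := Fin 2 → TwoLegs X) T)) := fun T =>
    (braidUnit_commute_shift (X := Fin 2 → TwoLegs X) s T).map (shiftUnit (X := Fin 2 → TwoLegs (TwoLegs X)))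
  have c35 : Commute r3 r5 := (braidUnit_commute_shift (X := TwoLegs X) s (braidUnit s)).map sh
  have hyb := yang_baxter_double h12 h23 h34 h45 (c1 _) (c1 _) (c1 _) (c2 _) (c2 _) c35 η η'
  have e12 : ∀ η η', (flipUnit s η η' : (Module.End ℂ (TwoLegs (TwoLegs (TwoLegs X))))ˣ) =
      r2 * r1 ^ (η : ℤ) * r3 ^ (η' : ℤ) * r2⁻¹ := fun _ _ => rfl
  have e23 : ∀ η η', sh (flipUnit s η η') = r4 * r3 ^ (η : ℤ) * r5 ^ (η' : ℤ) * r4⁻¹ := by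
    intro η η'
    rw [flipUnit, map_mul, map_mul, map_mul, map_zpow, map_zpow, map_inv]
  have e0 : ∀ (T : (Module.End ℂ (TwoLegs (TwoLegs X)))ˣ) x,
      (sh T).val x = shiftMap (shiftMap T.val) x := fun _ _ => rfl
  constructor
  · obtain ⟨v, rfl⟩ : ∃ v, (r2 * r4 * r3).val v = w :=
      ⟨(r2 * r4 * r3)⁻¹.val w, by
        rw [← Module.End.mul_apply, ← Units.val_mul, mul_inv_cancel]; rfl⟩
    have h := LinearMap.congr_fun (congrArg Units.val hyb.1) v
    rw [← e12, ← e23] at h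
    have a2 : ∀ x, r2.val x = shiftMap (braidGen (X := Fin 2 → TwoLegs X) s 1) x := fun x => rfl
    have a3 : ∀ x, r3.val x = shiftMap (shiftMap (braidGen (X := TwoLegs X) s 1)) x := fun x => rfl
    have a4 : ∀ x, r4.val x = shiftMap (shiftMap (shiftMap (braidGen (X := Fin 2 → X) s 1))) x :=
      fun x => rfl
    have z1 : ∀ (η : ℤˣ) x, (r1 ^ (η : ℤ)).val x = braidGen (X := TwoLegs (TwoLegs X)) s η x :=
      fun η x => by rw [braidUnit_zpow]
    have z2 : ∀ (η : ℤˣ) x, (r2 ^ (η : ℤ)).val x =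
        shiftMap (braidGen (X := Fin 2 → TwoLegs X) s η) x := fun η x =>
      shiftUnit_braidUnit_zpow (X := Fin 2 → TwoLegs X) s η x
    have z4 : ∀ (η : ℤˣ) x, (r4 ^ (η : ℤ)).val x =
        shiftMap (shiftMap (shiftMap (braidGen (X := Fin 2 → X) s η))) x := fun η x => by
      rw [← braidUnit_zpow, ← map_zpow, ← map_zpow]
      rfl
    have z5 : ∀ (η : ℤˣ) x, (r5 ^ (η : ℤ)).val x =
        shiftMap (shiftMap (shiftMap (shiftMap (braidGen (X := X) s η)))) x := fun η x => by
      rw [← braidUnit_zpow, ← map_zpow, ← map_zpow, ← map_zpow]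
      rfl
    have hQ : ∀ x, (r2 * r4 * r3).val x = r2.val (r4.val (r3.val x)) := fun x => rfl
    have hQ' : ∀ x, (r2 * r4 * r3).val x = r4.val (r2.val (r3.val x)) := fun x => by
      rw [(c2 _ : Commute r2 r4).eq]
      rfl
    have m1 : metricMap s ((r2 * r4 * r3).val v) =
        shiftMap (capMap (X := Fin 2 → X) s) (capMap (X := TwoLegs (TwoLegs X)) s v) := by
      rw [hQ, a2, a3, a4, metricMap_shift, capMap_shift, capMap_shift, capMap_braid]
    have m2 : ∀ y, shiftMap (shiftMap (metricMap (X := X) s)) ((r2 * r4 * r3).val y) =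
        shiftMap (shiftMap (capMap (X := X) s)) (shiftMap (capMap (X := Fin 2 → TwoLegs X) s) y) := by
      intro y
      rw [hQ', a2, a3, a4]
      have h1 : ∀ z : TwoLegs (TwoLegs (TwoLegs X)), shiftMap (shiftMap (metricMap s))
          (shiftMap (shiftMap (shiftMap (braidGen (X := Fin 2 → X) s 1))) z) =
          shiftMap (shiftMap (capMap (X := X) s ∘ₗ capMap (X := TwoLegs X) s)) z := fun z => by
        funext i j
        exact metricMap_shift s (z i j)
      rw [h1]
      have h2 : shiftMap (shiftMap (capMap (X := TwoLegs X) s))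
          (shiftMap (braidGen (X := Fin 2 → TwoLegs X) s 1)
            (shiftMap (shiftMap (braidGen (X := TwoLegs X) s 1)) y)) =
          shiftMap (capMap (X := Fin 2 → TwoLegs X) s) y := by
        funext i
        exact shift_capMap_braid s 1 (y i)
      rw [← h2]
      rfl
    rw [m1]
    have h' : (flipUnit (X := TwoLegs X) s η η').val (shiftMap (shiftMap (flipUnit (X := X) s η η').val)
        ((r2 * r4 * r3).val v)) = (r2 * r4 * r3).val ((r1 ^ (η : ℤ)).val ((r2 ^ (η : ℤ)).val
          ((r4 ^ (η' : ℤ)).val ((r5 ^ (η' : ℤ)).val v)))) := h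
    rw [h', m2, z1, z2, shift_capMap_braid, z4, z5, capMap_shift, capMap_shift]
    funext i
    exact shift_capMap_braid s η' (capMap s v i)
  · have h := hyb.2
    have e1 : r2 * r1 * r3⁻¹ * r2⁻¹ = flipUnit s 1 (-1) := by rw [e12]; simp
    have e2 : r4 * r3 * r5⁻¹ * r4⁻¹ = sh (flipUnit s 1 (-1)) := by rw [e23]; simp
    rw [← e12, ← e23, e1, e2] at h
    have h3 := LinearMap.congr_fun (congrArg Units.val h) w
    simp only [Units.val_mul, Module.End.mul_apply, e0] at h3
    exact h3

end SixLegs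

section MatrixAction

variable {s : ℂˣ} {X : Type*} [AddCommGroup X] [Module ℂ X]

/-- The action of a matrix on the first four legs. -/
def matOp (M : Matrix (Idx × Idx) (Idx × Idx) ℂ) : Module.End ℂ (TwoLegs (TwoLegs X)) where
  toFun f := fun i j k l => ∑ p, M ((i, j), (k, l)) p • f p.1.1 p.1.2 p.2.1 p.2.2
  map_add' f g := by
    funext i j k l
    simp only [Pi.add_apply, smul_add, Finset.sum_add_distrib]
  map_smul' c f := by
    funext i j k l
    simp only [Pi.smul_apply, Finset.smul_sum, RingHom.id_apply, smul_comm c]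

theorem matOp_apply (M : Matrix (Idx × Idx) (Idx × Idx) ℂ) (f : TwoLegs (TwoLegs X)) (i j k l : Fin 2) :
    matOp M f i j k l = ∑ p, M ((i, j), (k, l)) p • f p.1.1 p.1.2 p.2.1 p.2.2 := rfl

theorem matOp_mul (M N : Matrix (Idx × Idx) (Idx × Idx) ℂ) (f : TwoLegs (TwoLegs X)) :
    matOp (M * N) f = matOp M (matOp N f) := by
  funext i j k l
  simp only [matOp_apply, Matrix.mul_apply, Finset.smul_sum, Finset.sum_smul, smul_smul]
  exact Finset.sum_comm

theorem matOp_leg12 (η : ℤˣ) (f : TwoLegs (TwoLegs X)) :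
    matOp (leg12 (RhatPow s η)) f = braidGen s η f := by
  funext i j k l
  have h : matOp (leg12 (RhatPow s η)) f i j k l = ∑ a : Idx, RhatPow s η (i, j) a • f a.1 a.2 k l := by
    rw [matOp_apply, Fintype.sum_prod_type]
    refine Finset.sum_congr rfl fun a _ => ?_
    rw [Fintype.sum_eq_single (k, l) fun b hb => by
      simp only [leg12, Matrix.of_apply, if_neg (Ne.symm hb), zero_smul]]
    simp only [leg12, Matrix.of_apply, if_true]
  rw [h, braidGen_apply]
  simp only [RhatPow_eq, Matrix.sub_apply, Matrix.smul_apply, sub_smul, Finset.sum_sub_distrib,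
    smul_assoc, ← Finset.smul_sum, Pi.sub_apply, Pi.smul_apply, Matrix.one_apply, ite_smul, one_smul,
    zero_smul, Finset.sum_ite_eq, Finset.mem_univ, if_true]
  congr 2
  simp only [cupCap, Matrix.of_apply, mul_smul, ← Finset.smul_sum, Fintype.sum_prod_type]
  rw [cupMap, capMap]
  simp

theorem matOp_leg34 (η : ℤˣ) (f : TwoLegs (TwoLegs X)) :
    matOp (leg34 (RhatPow s η)) f = shiftMap (shiftMap (braidGen s η)) f := by
  funext i j k l
  have h : matOp (leg34 (RhatPow s η)) f i j k l = ∑ a : Idx, RhatPow s η (k, l) a • f i j a.1 a.2 := by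
    rw [matOp_apply, Fintype.sum_prod_type, Fintype.sum_eq_single (i, j) fun b hb =>
      Finset.sum_eq_zero fun c _ => by
        simp only [leg34, Matrix.of_apply, if_neg (Ne.symm hb), zero_smul]]
    simp only [leg34, Matrix.of_apply, if_true]
  rw [h, shiftMap_apply, shiftMap_apply, braidGen_apply]
  simp only [RhatPow_eq, Matrix.sub_apply, Matrix.smul_apply, sub_smul, Finset.sum_sub_distrib,
    smul_assoc, ← Finset.smul_sum, Pi.sub_apply, Pi.smul_apply, Matrix.one_apply, ite_smul, one_smul,
    zero_smul, Finset.sum_ite_eq, Finset.mem_univ, if_true]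
  congr 2
  simp only [cupCap, Matrix.of_apply, mul_smul, ← Finset.smul_sum, Fintype.sum_prod_type]
  rw [cupMap, capMap]
  simp

theorem matOp_leg23 (η : ℤˣ) (f : TwoLegs (TwoLegs X)) :
    matOp (leg23 (RhatPow s η)) f = shiftMap (braidGen (X := Fin 2 → X) s η) f := by
  funext i j k l
  have h : matOp (leg23 (RhatPow s η)) f i j k l = ∑ a : Idx, RhatPow s η (j, k) a • f i a.1 a.2 l := by
    rw [matOp_apply]
    simp only [leg23, Matrix.of_apply, Fintype.sum_prod_type, Fin.sum_univ_two]
    fin_cases i <;> fin_cases l <;> simp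
  rw [h, shiftMap_apply, braidGen_apply]
  simp only [RhatPow_eq, Matrix.sub_apply, Matrix.smul_apply, sub_smul, Finset.sum_sub_distrib,
    smul_assoc, ← Finset.smul_sum, Pi.sub_apply, Pi.smul_apply, Matrix.one_apply, ite_smul, one_smul,
    zero_smul, Finset.sum_ite_eq, Finset.mem_univ, if_true]
  congr 2
  simp only [cupCap, Matrix.of_apply, mul_smul, ← Finset.smul_sum, Fintype.sum_prod_type]
  rw [cupMap, capMap]
  simp

theorem RhatPow_one : RhatPow s 1 = Rhat s := if_pos rfl

theorem RhatPow_neg_one : RhatPow s (-1) = RhatInv s := if_neg (by decide)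

theorem matOp_flipMatrix (η η' : ℤˣ) (f : TwoLegs (TwoLegs X)) :
    matOp (flipMatrix s η η') f = (flipUnit s η η').val f := by
  rw [flipMatrix, matOp_mul, matOp_mul, matOp_mul, ← RhatPow_one, ← RhatPow_neg_one, matOp_leg23,
    matOp_leg12, matOp_leg34, matOp_leg23, flipUnit]
  simp only [Units.val_mul, Module.End.mul_apply, braidUnit_zpow]
  rw [← map_zpow, ← map_zpow]
  have e : ∀ x, (shiftUnit (X := Fin 2 → TwoLegs X)
      (shiftUnit (X := TwoLegs X) (braidUnit s ^ (η' : ℤ)))).val x =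
      shiftMap (shiftMap (braidUnit s ^ (η' : ℤ)).val) x := fun x => rfl
  rw [e, braidUnit_zpow]
  rfl

end MatrixAction

section Evaluation

variable {s : ℂˣ} {ε : ℤˣ}

variable (s ε) in
/-- The element of `Γ ⊗ Γ` with the given scalar coordinates. -/
def vecTwo : TwoLegs (TwoLegs ℂ) →+ GamTwo s ε :=
  AddMonoidHom.mk' (fun f => ∑ p : Idx × Idx,
    algebraMap ℂ (OSLq s) (f p.1.1 p.1.2 p.2.1 p.2.2) • thetaTwo s ε p) (fun f g => by
      simp only [Pi.add_apply, map_add, add_smul, Finset.sum_add_distrib])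

theorem vecTwo_apply (f : TwoLegs (TwoLegs ℂ)) : vecTwo s ε f = ∑ p : Idx × Idx,
    algebraMap ℂ (OSLq s) (f p.1.1 p.1.2 p.2.1 p.2.2) • thetaTwo s ε p := rfl

theorem vecTwo_smul (c : ℂ) (f : TwoLegs (TwoLegs ℂ)) :
    vecTwo s ε (c • f) = algebraMap ℂ (OSLq s) c • vecTwo s ε f := by
  simp only [vecTwo_apply, Finset.smul_sum, Pi.smul_apply, smul_smul, ← map_mul, smul_eq_mul]

theorem coords_vecTwo (f : TwoLegs (TwoLegs ℂ)) (p : Idx × Idx) :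
    coords s ε (vecTwo s ε f) p = algebraMap ℂ (OSLq s) (f p.1.1 p.1.2 p.2.1 p.2.2) := by
  rw [vecTwo_apply, coords_sum_smul]

theorem leftLinear_vecTwo (M : Matrix (Idx × Idx) (Idx × Idx) ℂ) (f : TwoLegs (TwoLegs ℂ)) :
    leftLinear s ε M (vecTwo s ε f) = vecTwo s ε (matOp M f) := by
  refine coords_injective s ε (funext fun p => ?_)
  rw [coords_leftLinear, coords_vecTwo, matOp_apply, map_sum]
  refine Finset.sum_congr rfl fun r _ => ?_
  rw [coords_vecTwo, ← map_mul, smul_eq_mul, mul_comm]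

theorem metric_vecTwo {g : BimodHom (OSLq s) (GamTwo s ε) (OSLq s)} {κ : ℂ}
    (hκ : ∀ x, g x = ∑ r, sortedCoords s ε x r *
      algebraMap ℂ (OSLq s) (κ * (Ccheck s r.1.1 r.1.2 * Ccheck s r.2.1 r.2.2)))
    (f : TwoLegs (TwoLegs ℂ)) :
    g (vecTwo s ε f) = algebraMap ℂ (OSLq s) (κ * metricMap s f) := by
  rw [hκ]
  simp only [sortedCoords_eq, leftLinear_vecTwo, coords_vecTwo, ← map_mul, ← map_sum]
  rw [metricMap_apply, ← matOp_leg23, RhatPow_neg_one]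
  congr 1
  generalize matOp (leg23 (RhatInv s)) f = h
  simp only [capMap, LinearMap.coe_mk, AddHom.coe_mk, Fintype.sum_prod_type,
    Fin.sum_univ_two, Pi.add_apply, Pi.smul_apply, smul_eq_mul]
  ring

/-- The indicator tensor of a basis element. -/
def deltaTensor (I : Idx) : TwoLegs ℂ := fun i j => if (i, j) = I then 1 else 0

theorem pairTwo_smul {A : Type*} [Ring A] {Γ : Type*} [AddCommGroup Γ] [Module A Γ] [Module Aᵐᵒᵖ Γ]
    [SMulCommClass A Aᵐᵒᵖ Γ] {B : Type*} [Ring B] {α : A →+* B} {β : Γ →+ B} (h : IsBimodPair α β)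
    (a : A) (x : BalTensor A Γ Γ) : pairTwo h (a • x) = α a * pairTwo h x := by
  induction x using bal_induction with
  | h0 => simp
  | ht m n => rw [smul_btmul, pairTwo_btmul, pairTwo_btmul, ← mul_assoc, h.left]
  | ha x y hx hy => rw [smul_add, map_add, map_add, mul_add, hx, hy]

theorem pairTwo_op_smul {A : Type*} [Ring A] {Γ : Type*} [AddCommGroup Γ] [Module A Γ]
    [Module Aᵐᵒᵖ Γ] [SMulCommClass A Aᵐᵒᵖ Γ] {B : Type*} [Ring B] {α : A →+* B} {β : Γ →+ B}
    (h : IsBimodPair α β) (a : A) (x : BalTensor A Γ Γ) :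
    pairTwo h (op a • x) = pairTwo h x * α a := by
  induction x using bal_induction with
  | h0 => simp
  | ht m n => rw [op_smul_btmul, pairTwo_btmul, pairTwo_btmul, mul_assoc, h.right]
  | ha x y hx hy => rw [smul_add, map_add, map_add, add_mul, hx, hy]

variable {σ : GamTwo s ε →+ GamTwo s ε} {g : BimodHom (OSLq s) (GamTwo s ε) (OSLq s)}

variable (σ g) in
/-- The element `∑ w^{IJK} θ_I ⊗ θ_J θ_K` of `Γ ⊗ Cl`. -/
def evalThree : TwoLegs (TwoLegs (TwoLegs ℂ)) →+ BalTensor (OSLq s) (Gam s ε) (QCl σ g) :=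
  AddMonoidHom.mk' (fun w => ∑ I : Idx, btmul (OSLq s) (theta s ε I)
    (pairTwo (cl_isBimodPair σ g) (vecTwo s ε (w I.1 I.2)))) (fun w w' => by
      simp only [Pi.add_apply, map_add, btmul_add_right, Finset.sum_add_distrib])

theorem evalThree_apply (w : TwoLegs (TwoLegs (TwoLegs ℂ))) :
    evalThree σ g w = ∑ I : Idx, btmul (OSLq s) (theta s ε I)
      (pairTwo (cl_isBimodPair σ g) (vecTwo s ε (w I.1 I.2))) := rfl

theorem btmul_algebraMap_smul (c : ℂ) (γ : Gam s ε) (y : QCl σ g) :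
    btmul (OSLq s) γ (algebraMap ℂ (OSLq s) c • y) = algebraMap ℂ (OSLq s) c • btmul (OSLq s) γ y := by
  rw [← btmul_balance, op_algebraMap_smul, smul_btmul, algebraMap_smul]

theorem evalThree_smul (c : ℂ) (w : TwoLegs (TwoLegs (TwoLegs ℂ))) :
    evalThree σ g (c • w) = algebraMap ℂ (OSLq s) c • evalThree σ g w := by
  simp only [evalThree_apply, Pi.smul_apply, vecTwo_smul, pairTwo_smul, ← smul_cl,
    btmul_algebraMap_smul, Finset.smul_sum]

theorem btmul_finset_sum_right {ι : Type*} (t : Finset ι) (γ : Gam s ε) (y : ι → QCl σ g) :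
    btmul (OSLq s) γ (∑ i ∈ t, y i) = ∑ i ∈ t, btmul (OSLq s) γ (y i) :=
  map_sum (AddMonoidHom.mk' (fun y => btmul (OSLq s) γ y) fun _ _ => btmul_add_right _ _ _ :
    QCl σ g →+ BalTensor (OSLq s) (Gam s ε) (QCl σ g)) y t

theorem gamAct_smul (τ : BimodHom (OSLq s) (GamTwo s ε) (GamTwo s ε)) (I : Idx) (c : ℂ)
    (z : BalTensor (OSLq s) (Gam s ε) (QCl σ g)) :
    gamAct τ (theta s ε I) (algebraMap ℂ (OSLq s) c • z) =
      algebraMap ℂ (OSLq s) c • gamAct τ (theta s ε I) z := by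
  have h1 := DFunLike.congr_fun ((act_isBimodPair (σ := σ) (g := g) τ).right
    (algebraMap ℂ (OSLq s) c) (theta s ε I)) z
  have h2 := DFunLike.congr_fun ((act_isBimodPair (σ := σ) (g := g) τ).left
    (algebraMap ℂ (OSLq s) c) (theta s ε I)) z
  rw [op_algebraMap_smul, ← algebraMap_smul (OSLq s)] at h1
  exact h1.trans h2.symm

theorem gamAct_vecTwo {τ : BimodHom (OSLq s) (GamTwo s ε) (GamTwo s ε)}
    {T : Matrix (Idx × Idx) (Idx × Idx) ℂ} (hτ : ∀ x, τ x = leftLinear s ε T x) (I : Idx)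
    (f : TwoLegs (TwoLegs ℂ)) :
    gamAct τ (theta s ε I) (idTensorCl (σ := σ) (g := g) (vecTwo s ε f)) =
      evalThree σ g (matOp T fun i j => deltaTensor I i j • f) := by
  have h1 : ∀ M N, gamAct τ (theta s ε I) (idTensorCl (σ := σ) (g := g) (thetaTwo s ε (M, N))) =
      ∑ p : Idx × Idx, algebraMap ℂ (OSLq s) (T p (I, M)) •
        btmul (OSLq s) (theta s ε p.1) (clGam σ g (theta s ε p.2) * clGam σ g (theta s ε N)) := by
    intro M N
    rw [thetaTwo, idTensorCl_btmul, gamAct_btmul, hτ, leftLinear_theta s ε T (I, M), map_sum, map_sum]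
    refine Finset.sum_congr rfl fun p _ => ?_
    rw [idTensorCl_smul, mulCl_smul_left, idTensorCl_btmul, mulCl_btmul]
  have h2 : ∀ (i j k l m n : Fin 2), matOp T (fun i j => deltaTensor I i j • f) i j k l m n =
      ∑ M : Idx, T ((i, j), (k, l)) (I, M) * f M.1 M.2 m n := by
    intro i j k l m n
    rw [matOp_apply, Finset.sum_apply, Finset.sum_apply, Fintype.sum_prod_type,
      Fintype.sum_eq_single I fun J hJ => Finset.sum_eq_zero fun M _ => by
        simp [deltaTensor, hJ]]
    refine Finset.sum_congr rfl fun M _ => ?_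
    simp [deltaTensor]
  rw [vecTwo_apply, map_sum, map_sum, Fintype.sum_prod_type, evalThree_apply]
  simp only [idTensorCl_smul, gamAct_smul, h1, vecTwo_apply, map_sum, pairTwo_smul, ← smul_cl,
    btmul_finset_sum_right, btmul_algebraMap_smul, h2, Finset.sum_smul, Finset.smul_sum, smul_smul,
    ← map_mul, Fintype.sum_prod_type (α₁ := Idx) (α₂ := Idx)]
  rw [Finset.sum_congr rfl fun M _ => Finset.sum_comm, Finset.sum_comm]
  refine Finset.sum_congr rfl fun P _ => ?_
  rw [Finset.sum_comm, Finset.sum_congr rfl fun N _ => Finset.sum_comm, Finset.sum_comm]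
  refine Finset.sum_congr rfl fun Q _ => Finset.sum_congr rfl fun N _ =>
    Finset.sum_congr rfl fun M _ => ?_
  rw [mul_comm (f _ _ _ _), thetaTwo, pairTwo_btmul]

theorem end_sum_apply {M ι : Type*} [AddCommGroup M] (t : Finset ι) (f : ι → AddMonoid.End M) (z : M) :
    (∑ i ∈ t, f i) z = ∑ i ∈ t, f i z :=
  map_sum (AddMonoidHom.mk' (fun f : AddMonoid.End M => f z) fun _ _ => rfl) f t

theorem vecTwo_delta (J K : Idx) :
    vecTwo s ε (fun i j => deltaTensor J i j • deltaTensor K) = thetaTwo s ε (J, K) := by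
  rw [vecTwo_apply, Fintype.sum_eq_single (J, K) fun p hp => ?_]
  · simp [deltaTensor]
  · have : ¬ (p.1 = J ∧ p.2 = K) := fun h => hp (Prod.ext h.1 h.2)
    simp only [deltaTensor, Pi.smul_apply, smul_eq_mul]
    by_cases e1 : p.1 = J
    · rw [if_neg (c := (p.2.1, p.2.2) = K) fun e2 => this ⟨e1, e2⟩, mul_zero, map_zero, zero_smul]
    · rw [if_neg (c := (p.1.1, p.1.2) = J) e1, zero_mul, map_zero, zero_smul]

theorem braidGen_shift {X Y : Type*} [AddCommGroup X] [Module ℂ X] [AddCommGroup Y] [Module ℂ Y]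
    (η : ℤˣ) (L : X →ₗ[ℂ] Y) (f : TwoLegs X) :
    braidGen s η (shiftMap (shiftMap L) f) = shiftMap (shiftMap L) (braidGen s η f) := by
  rw [braidGen_apply, braidGen_apply, map_sub, map_smul, map_smul, capMap_shift, cupMap_shift]

theorem metricMap_shift_map {X Y : Type*} [AddCommGroup X] [Module ℂ X] [AddCommGroup Y] [Module ℂ Y]
    (L : X →ₗ[ℂ] Y) (f : TwoLegs (TwoLegs X)) :
    metricMap s (shiftMap (shiftMap (shiftMap (shiftMap L))) f) = L (metricMap s f) := by
  have h : shiftMap (braidGen (X := Fin 2 → Y) s (-1)) (shiftMap (shiftMap (shiftMap (shiftMap L))) f) =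
      shiftMap (shiftMap (shiftMap (shiftMap L))) (shiftMap (braidGen (X := Fin 2 → X) s (-1)) f) := by
    funext i
    exact braidGen_shift (-1) (shiftMap L) (f i)
  rw [metricMap_apply, metricMap_apply, h, capMap_shift, capMap_shift]

theorem metricMap_smul_const (h : TwoLegs (TwoLegs ℂ)) (v : TwoLegs ℂ) :
    metricMap s (fun i j k l => h i j k l • v) = metricMap s h • v :=
  metricMap_shift_map (LinearMap.toSpanSingleton ℂ (TwoLegs ℂ) v) h

theorem matOp_smul_const (M : Matrix (Idx × Idx) (Idx × Idx) ℂ) (h : TwoLegs (TwoLegs ℂ))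
    (v : TwoLegs ℂ) : matOp M (fun i j k l => h i j k l • v) = fun i j k l => matOp M h i j k l • v := by
  funext i j k l
  simp only [matOp_apply, smul_smul, Finset.sum_smul, smul_eq_mul]

theorem matOp_smul {X : Type*} [AddCommGroup X] [Module ℂ X] (c : ℂ)
    (M : Matrix (Idx × Idx) (Idx × Idx) ℂ) (f : TwoLegs (TwoLegs X)) :
    matOp (c • M) f = c • matOp M f := by
  funext i j k l
  simp only [matOp_apply, Matrix.smul_apply, smul_assoc, Pi.smul_apply, Finset.smul_sum]

end Evaluation

section Twofold

variable {s : ℂˣ} {ε : ℤˣ}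
variable {σ : GamTwo s ε →+ GamTwo s ε} {g : BimodHom (OSLq s) (GamTwo s ε) (OSLq s)}

theorem sum_deltaTensor_smul {X : Type*} [AddCommGroup X] [Module ℂ X]
    (f : Idx → TwoLegs X) (F : TwoLegs (TwoLegs X)) (hF : ∀ I, F I.1 I.2 = f I) :
    (∑ I : Idx, fun i j => deltaTensor I i j • f I) = F := by
  funext i j
  rw [Finset.sum_apply, Finset.sum_apply, Fintype.sum_eq_single (i, j) fun J hJ => by
    rw [deltaTensor, if_neg (Ne.symm hJ), zero_smul], deltaTensor, if_pos rfl, one_smul]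
  exact (hF (i, j)).symm

theorem sum_deltaTensor_matOp (T : Matrix (Idx × Idx) (Idx × Idx) ℂ)
    (h : TwoLegs (TwoLegs ℂ)) (v : TwoLegs ℂ) :
    (∑ p : Idx × Idx, h p.1.1 p.1.2 p.2.1 p.2.2 • (fun i j => deltaTensor p.1 i j •
        matOp T fun i j => deltaTensor p.2 i j • v : TwoLegs (TwoLegs (TwoLegs ℂ)))) =
      shiftMap (shiftMap (matOp T)) (fun i j k l => h i j k l • v) := by
  have e : ∀ I J : Idx, (h I.1 I.2 J.1 J.2 • (fun i j => deltaTensor I i j •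
        matOp T fun i j => deltaTensor J i j • v : TwoLegs (TwoLegs (TwoLegs ℂ)))) =
      fun i j => deltaTensor I i j • matOp T (h I.1 I.2 J.1 J.2 • fun i j => deltaTensor J i j • v) := by
    intro I J
    funext i j
    rw [map_smul, Pi.smul_apply, Pi.smul_apply, smul_comm]
  have e' : ∀ I : Idx, ∑ J : Idx, (fun i j => deltaTensor I i j •
      matOp T (h I.1 I.2 J.1 J.2 • fun i j => deltaTensor J i j • v) : TwoLegs (TwoLegs (TwoLegs ℂ))) =
      fun i j => deltaTensor I i j • matOp T (fun k l => h I.1 I.2 k l • v) := by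
    intro I
    funext i j
    rw [Finset.sum_apply, Finset.sum_apply, ← Finset.smul_sum, ← map_sum]
    refine congrArg (fun w => deltaTensor I i j • matOp T w) ?_
    rw [← sum_deltaTensor_smul (fun J : Idx => h I.1 I.2 J.1 J.2 • v)
      (fun k l => h I.1 I.2 k l • v) fun J => rfl]
    refine Finset.sum_congr rfl fun J _ => ?_
    funext k l
    rw [Pi.smul_apply, Pi.smul_apply, smul_comm]
  rw [Fintype.sum_prod_type]
  simp only [e, e']
  exact sum_deltaTensor_smul (fun I : Idx => matOp T (fun k l => h I.1 I.2 k l • v)) _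
    fun I => rfl

theorem linear_sum_smul {V W ι : Type*} [AddCommGroup V] [Module ℂ V] [AddCommGroup W] [Module ℂ W]
    [Fintype ι] (L : V →ₗ[ℂ] W) (c : ι → ℂ) (v : ι → V) :
    L (∑ i, c i • v i) = ∑ i, c i • L (v i) := by
  simp only [map_sum, map_smul]

theorem matOp_flip_twice {X : Type*} [AddCommGroup X] [Module ℂ X] (c : ℂ) (η η' : ℤˣ)
    (w : TwoLegs (TwoLegs (TwoLegs X))) :
    matOp (c • flipMatrix s η η') (shiftMap (shiftMap (matOp (c • flipMatrix s η η'))) w) =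
      c ^ 2 • (flipUnit (X := TwoLegs X) s η η').val
        (shiftMap (shiftMap (flipUnit (X := X) s η η').val) w) := by
  have e2 : shiftMap (shiftMap (matOp (X := X) (c • flipMatrix s η η'))) w =
      c • shiftMap (shiftMap (flipUnit (X := X) s η η').val) w := by
    funext i j
    exact (matOp_smul c _ (w i j)).trans (congrArg (fun z => c • z) (matOp_flipMatrix η η' (w i j)))
  rw [e2, map_smul, matOp_smul, matOp_flipMatrix, smul_smul, pow_two]

theorem flip_twice_fixed {X : Type*} [AddCommGroup X] [Module ℂ X] (η η' : ℤˣ)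
    (w : TwoLegs (TwoLegs (TwoLegs X))) (hw : matOp (braidingMatrix s) w = w) (i j : Fin 2) :
    matOp (braidingMatrix s) ((flipUnit (X := TwoLegs X) s η η').val
        (shiftMap (shiftMap (flipUnit (X := X) s η η').val) w) i j) =
      (flipUnit (X := TwoLegs X) s η η').val
        (shiftMap (shiftMap (flipUnit (X := X) s η η').val) w) i j := by
  have h := (flip_yang_baxter s η η' w).2
  have e : (flipUnit (X := TwoLegs X) s 1 (-1)).val w = w := by
    rw [← matOp_flipMatrix, ← braidingMatrix_eq_flipMatrix, hw]
  rw [e] at h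
  rw [braidingMatrix_eq_flipMatrix, matOp_flipMatrix]
  exact congrFun (congrFun h i) j

theorem metricMap_flip_twice {X : Type*} [AddCommGroup X] [Module ℂ X] (η η' : ℤˣ)
    (w : TwoLegs (TwoLegs (TwoLegs X))) (i j : Fin 2) :
    metricMap s ((flipUnit (X := TwoLegs X) s η η').val
        (shiftMap (shiftMap (flipUnit (X := X) s η η').val) w) i j) = metricMap s w i j :=
  congrFun (congrFun (flip_yang_baxter s η η' w).1 i) j

theorem gamAct_theta_one {τ : BimodHom (OSLq s) (GamTwo s ε) (GamTwo s ε)}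
    {T : Matrix (Idx × Idx) (Idx × Idx) ℂ} (hτ : ∀ x, τ x = leftLinear s ε T x) (J K : Idx) :
    gamAct τ (theta s ε J) (btmul (OSLq s) (theta s ε K) 1) =
      idTensorCl (σ := σ) (g := g) (vecTwo s ε (matOp T fun i j => deltaTensor J i j • deltaTensor K)) := by
  rw [gamAct_btmul, mulCl_one, hτ, ← leftLinear_vecTwo, vecTwo_delta, thetaTwo]

theorem pairTwo_act_thetaTwo {τ : BimodHom (OSLq s) (GamTwo s ε) (GamTwo s ε)}
    {T : Matrix (Idx × Idx) (Idx × Idx) ℂ} (hτ : ∀ x, τ x = leftLinear s ε T x) (p : Idx × Idx) (K : Idx) :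
    pairTwo (act_isBimodPair (σ := σ) (g := g) τ) (thetaTwo s ε p)
      (btmul (OSLq s) (theta s ε K) 1) = evalThree σ g (matOp T fun i j => deltaTensor p.1 i j •
        matOp T fun i j => deltaTensor p.2 i j • deltaTensor K) := by
  rw [thetaTwo, pairTwo_btmul, end_mul_apply, gamAct_theta_one hτ, gamAct_vecTwo hτ]

theorem pairTwo_act_smul {τ : BimodHom (OSLq s) (GamTwo s ε) (GamTwo s ε)}
    (a : OSLq s) (x : GamTwo s ε) (z) : pairTwo (act_isBimodPair (σ := σ) (g := g) τ)
      (a • x) z = a • pairTwo (act_isBimodPair (σ := σ) (g := g) τ) x z := by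
  rw [pairTwo_smul]
  rfl

/-- The twofold action on `θ_K ⊗ 1`. -/
theorem pairTwo_act_vecTwo {τ : BimodHom (OSLq s) (GamTwo s ε) (GamTwo s ε)}
    {T : Matrix (Idx × Idx) (Idx × Idx) ℂ} (hτ : ∀ x, τ x = leftLinear s ε T x)
    (h : TwoLegs (TwoLegs ℂ)) (K : Idx) :
    pairTwo (act_isBimodPair (σ := σ) (g := g) τ) (vecTwo s ε h) (btmul (OSLq s) (theta s ε K) 1) =
      evalThree σ g (matOp T (shiftMap (shiftMap (matOp T))
        (fun i j k l => h i j k l • deltaTensor K))) := by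
  have e : matOp T (shiftMap (shiftMap (matOp T)) (fun i j k l => h i j k l • deltaTensor K)) =
      ∑ p : Idx × Idx, h p.1.1 p.1.2 p.2.1 p.2.2 • matOp T (fun i j => deltaTensor p.1 i j •
        matOp T fun i j => deltaTensor p.2 i j • deltaTensor K) := by
    rw [← sum_deltaTensor_matOp]
    exact linear_sum_smul (V := TwoLegs (TwoLegs (TwoLegs ℂ))) (W := TwoLegs (TwoLegs (TwoLegs ℂ)))
      (matOp T) _ _
  rw [e, map_sum, vecTwo_apply, map_sum, end_sum_apply]
  refine Finset.sum_congr rfl fun p _ => ?_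
  rw [evalThree_smul, pairTwo_act_smul, pairTwo_act_thetaTwo hτ]

theorem pairTwo_vecTwo_of_fixed {κ : ℂ} (hκ : ∀ x, g x = ∑ r, sortedCoords s ε x r *
      algebraMap ℂ (OSLq s) (κ * (Ccheck s r.1.1 r.1.2 * Ccheck s r.2.1 r.2.2)))
    {f : TwoLegs (TwoLegs ℂ)} (hf : matOp (braidingMatrix s) f = f) :
    pairTwo (cl_isBimodPair (braiding s ε) g) (vecTwo s ε f) =
      clAlg (braiding s ε) g (algebraMap ℂ (OSLq s) (κ * metricMap s f)) := by
  rw [cl_pairTwo (braiding s ε) g (show braiding s ε (vecTwo s ε f) = vecTwo s ε f by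
    rw [braiding, leftLinear_vecTwo, hf]), metric_vecTwo hκ]

theorem evalThree_of_fixed {κ : ℂ} (hκ : ∀ x, g x = ∑ r, sortedCoords s ε x r *
      algebraMap ℂ (OSLq s) (κ * (Ccheck s r.1.1 r.1.2 * Ccheck s r.2.1 r.2.2)))
    {y : TwoLegs (TwoLegs (TwoLegs ℂ))} (hy : ∀ i j, matOp (braidingMatrix s) (y i j) = y i j)
    {c : ℂ} {K : Idx} (hm : ∀ i j, metricMap s (y i j) = c * deltaTensor K i j) :
    evalThree (braiding s ε) g y = algebraMap ℂ (OSLq s) (κ * c) • btmul (OSLq s) (theta s ε K) 1 := by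
  rw [evalThree_apply, Fintype.sum_eq_single K fun I hI => ?_]
  · rw [pairTwo_vecTwo_of_fixed hκ (hy _ _), hm, deltaTensor, if_pos rfl, mul_one,
      ← btmul_algebraMap_smul, smul_cl, mul_one]
  · rw [pairTwo_vecTwo_of_fixed hκ (hy _ _), hm, deltaTensor, if_neg hI, mul_zero, mul_zero, map_zero,
      map_zero]
    exact map_zero (AddMonoidHom.mk' (fun y => btmul (OSLq s) (theta s ε I) y)
      fun _ _ => btmul_add_right _ _ _)

theorem pairTwo_act_flip_vecTwo {κ : ℂ} (hκ : ∀ x, g x = ∑ r, sortedCoords s ε x r *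
      algebraMap ℂ (OSLq s) (κ * (Ccheck s r.1.1 r.1.2 * Ccheck s r.2.1 r.2.2)))
    {τ : BimodHom (OSLq s) (GamTwo s ε) (GamTwo s ε)} {c : ℂ} {η η' : ℤˣ}
    (hτ : ∀ x, τ x = leftLinear s ε (c • flipMatrix s η η') x) {h : TwoLegs (TwoLegs ℂ)}
    (hh : matOp (braidingMatrix s) h = h) (K : Idx) :
    pairTwo (act_isBimodPair (σ := braiding s ε) (g := g) τ) (vecTwo s ε h)
      (btmul (OSLq s) (theta s ε K) 1) =
    algebraMap ℂ (OSLq s) (c ^ 2) • g (vecTwo s ε h) • btmul (OSLq s) (theta s ε K) 1 := by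
  rw [pairTwo_act_vecTwo hτ]
  set w : TwoLegs (TwoLegs (TwoLegs ℂ)) := fun i j k l => h i j k l • deltaTensor K with hw
  have e3 : matOp (braidingMatrix s) w = w := by rw [hw, matOp_smul_const, hh]
  rw [matOp_flip_twice, evalThree_smul]
  refine congrArg (fun z => algebraMap ℂ (OSLq s) (c ^ 2) • z) ?_
  rw [evalThree_of_fixed hκ (c := metricMap s h) (K := K) (flip_twice_fixed η η' w e3),
    metric_vecTwo hκ]
  intro i j
  rw [metricMap_flip_twice, hw, metricMap_smul_const]
  rfl

end Twofold

section EndoAlgebra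

variable {s : ℂˣ} {ε : ℤˣ}

theorem cupCap_mul_cupCap : cupCap s * cupCap s = ((s : ℂ) ^ 2 + ((s : ℂ) ^ 2)⁻¹) • cupCap s := by
  have hs := s.ne_zero
  ext a b
  have h : ∀ x y : ℂ, ∑ i : Idx, x * Ccheck s i.1 i.2 * (Ccheck s i.1 i.2 * y) =
      ((s : ℂ) ^ 2 + ((s : ℂ) ^ 2)⁻¹) * (x * y) := by
    intro x y
    simp [Fintype.sum_prod_type, Ccheck]
    field_simp
    ring
  exact h _ _

theorem sortedMatrix_eq_kronecker (A B C D : ℂ) : sortedMatrix s A B C D =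
    A • 1 + B • Matrix.kronecker (cupCap s) 1 + C • Matrix.kronecker 1 (cupCap s) +
      D • Matrix.kronecker (cupCap s) (cupCap s) := by
  ext p r
  rw [← Matrix.one_kronecker_one]
  simp only [sortedMatrix, Matrix.kroneckerMap_apply, Matrix.of_apply, Matrix.add_apply,
    Matrix.smul_apply, smul_eq_mul, Matrix.kronecker]

theorem sortedMatrix_mul (A B C D A' B' C' D' d : ℂ) (hd : (s : ℂ) ^ 2 + ((s : ℂ) ^ 2)⁻¹ = d) :
    sortedMatrix s A B C D * sortedMatrix s A' B' C' D' =
      sortedMatrix s (A * A') (A * B' + B * A' + d * B * B') (A * C' + C * A' + d * C * C')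
        (A * D' + D * A' + B * C' + C * B' + d * (B * D' + D * B' + C * D' + D * C') +
          d ^ 2 * D * D') := by
  have hE : cupCap s * cupCap s = d • cupCap s := hd ▸ cupCap_mul_cupCap
  simp only [sortedMatrix_eq_kronecker, add_mul, mul_add, Matrix.smul_mul, Matrix.mul_smul, mul_one,
    one_mul, Matrix.kronecker, ← Matrix.mul_kronecker_mul, hE,
    Matrix.smul_kronecker, Matrix.kronecker_smul]
  module

theorem endoMatrix_mul (A B C D A' B' C' D' d : ℂ) (hd : (s : ℂ) ^ 2 + ((s : ℂ) ^ 2)⁻¹ = d) :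
    endoMatrix s A B C D * endoMatrix s A' B' C' D' =
      endoMatrix s (A * A') (A * B' + B * A' + d * B * B') (A * C' + C * A' + d * C * C')
        (A * D' + D * A' + B * C' + C * B' + d * (B * D' + D * B' + C * D' + D * C') +
          d ^ 2 * D * D') := by
  simp only [endoMatrix]
  rw [← sortedMatrix_mul _ _ _ _ _ _ _ _ d hd]
  simp only [Matrix.mul_assoc]
  rw [← Matrix.mul_assoc (leg23 (RhatInv s)), leg23_RhatInv_mul_Rhat, Matrix.one_mul]

theorem endoMatrix_one : endoMatrix s 1 0 0 0 = 1 := by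
  rw [endoMatrix, sortedMatrix_eq_kronecker]
  simp [leg23_Rhat_mul_RhatInv]

theorem sortedMatrix_add (A B C D A' B' C' D' : ℂ) :
    sortedMatrix s A B C D + sortedMatrix s A' B' C' D' =
      sortedMatrix s (A + A') (B + B') (C + C') (D + D') := by
  simp only [sortedMatrix_eq_kronecker]
  module

theorem smul_sortedMatrix (c A B C D : ℂ) :
    c • sortedMatrix s A B C D = sortedMatrix s (c * A) (c * B) (c * C) (c * D) := by
  simp only [sortedMatrix_eq_kronecker]
  module

theorem endoMatrix_add (A B C D A' B' C' D' : ℂ) :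
    endoMatrix s A B C D + endoMatrix s A' B' C' D' =
      endoMatrix s (A + A') (B + B') (C + C') (D + D') := by
  simp only [endoMatrix, ← Matrix.add_mul, ← Matrix.mul_add, sortedMatrix_add]

theorem smul_endoMatrix (c A B C D : ℂ) :
    c • endoMatrix s A B C D = endoMatrix s (c * A) (c * B) (c * C) (c * D) := by
  rw [endoMatrix, ← Matrix.smul_mul, ← Matrix.mul_smul, smul_sortedMatrix, endoMatrix]

theorem braidingMatrix_eq_endoMatrix : braidingMatrix s =
    endoMatrix s 1 (-((s : ℂ) ^ 2)⁻¹) (-(s : ℂ) ^ 2) 1 := by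
  have hs := s.ne_zero
  rw [braidingMatrix_eq_flipMatrix, flipMatrix_eq]
  congr 1 <;> simp [hs] <;> ring

theorem leftLinear_add (M N : Matrix (Idx × Idx) (Idx × Idx) ℂ) (x : GamTwo s ε) :
    leftLinear s ε (M + N) x = leftLinear s ε M x + leftLinear s ε N x := by
  refine coords_injective s ε (funext fun p => ?_)
  rw [map_add, Pi.add_apply, coords_leftLinear, coords_leftLinear, coords_leftLinear,
    ← Finset.sum_add_distrib]
  simp only [Matrix.add_apply, map_add, mul_add]

theorem leftLinear_matrix_smul (c : ℂ) (M : Matrix (Idx × Idx) (Idx × Idx) ℂ) (x : GamTwo s ε) :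
    leftLinear s ε (c • M) x = algebraMap ℂ (OSLq s) c • leftLinear s ε M x := by
  refine coords_injective s ε (funext fun p => ?_)
  rw [coords_smul, coords_leftLinear, coords_leftLinear, Finset.mul_sum]
  refine Finset.sum_congr rfl fun r _ => ?_
  rw [Matrix.smul_apply, smul_eq_mul, map_mul, ← mul_assoc, ← mul_assoc, Algebra.commutes]

/-- The symmetrizer has the fixed elements of the braiding as its image. -/
theorem braidingMatrix_mul_symmetrizer (d : ℂ) (hd : (s : ℂ) ^ 2 + ((s : ℂ) ^ 2)⁻¹ = d) :
    braidingMatrix s * endoMatrix s (d ^ 2) (-d) (-d) 2 = endoMatrix s (d ^ 2) (-d) (-d) 2 := by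
  have hs : (s : ℂ) ^ 2 * ((s : ℂ) ^ 2)⁻¹ = 1 := mul_inv_cancel₀ (pow_ne_zero 2 s.ne_zero)
  rw [braidingMatrix_eq_endoMatrix, endoMatrix_mul _ _ _ _ _ _ _ _ d hd, ← hd]
  generalize ((s : ℂ) ^ 2)⁻¹ = p at *
  generalize (s : ℂ) ^ 2 = q at *
  congr 1
  · ring
  · ring
  · ring
  · ring

theorem symmetrizer_of_fixed (d : ℂ) (hd : (s : ℂ) ^ 2 + ((s : ℂ) ^ 2)⁻¹ = d)
    {x : GamTwo s ε} (hx : braiding s ε x = x) :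
    leftLinear s ε (endoMatrix s (d ^ 2) (-d) (-d) 2) x = algebraMap ℂ (OSLq s) (d ^ 2) • x := by
  have hs : (s : ℂ) ^ 2 * ((s : ℂ) ^ 2)⁻¹ = 1 := mul_inv_cancel₀ (pow_ne_zero 2 s.ne_zero)
  have h1 : endoMatrix s 0 (s ^ 2) ((s : ℂ) ^ 2)⁻¹ 0 * braidingMatrix s =
      endoMatrix s 0 (-((s : ℂ) ^ 2)⁻¹) (-(s : ℂ) ^ 2) 2 := by
    rw [braidingMatrix_eq_endoMatrix, endoMatrix_mul _ _ _ _ _ _ _ _ d hd, ← hd]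
    generalize ((s : ℂ) ^ 2)⁻¹ = p at *
    generalize (s : ℂ) ^ 2 = q at *
    congr 1
    · ring
    · linear_combination (-q - p) * hs
    · linear_combination (-q - p) * hs
    · linear_combination (2 : ℂ) * hs
  have h2 : leftLinear s ε (endoMatrix s 0 (-((s : ℂ) ^ 2)⁻¹) (-(s : ℂ) ^ 2) 2) x =
      leftLinear s ε (endoMatrix s 0 (s ^ 2) ((s : ℂ) ^ 2)⁻¹ 0) x := by
    rw [← h1, leftLinear_mul]
    exact congrArg _ hx
  have h3 : leftLinear s ε (endoMatrix s 0 (-d) (-d) 2) x = 0 := by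
    have e : endoMatrix s 0 (-((s : ℂ) ^ 2)⁻¹) (-(s : ℂ) ^ 2) 2 =
        endoMatrix s 0 (s ^ 2) ((s : ℂ) ^ 2)⁻¹ 0 + endoMatrix s 0 (-d) (-d) 2 := by
      rw [endoMatrix_add, ← hd]
      congr 1 <;> ring
    rw [e, leftLinear_add] at h2
    exact add_eq_left.mp h2
  have e : endoMatrix s (d ^ 2) (-d) (-d) 2 = d ^ 2 • 1 + endoMatrix s 0 (-d) (-d) 2 := by
    rw [← endoMatrix_one, smul_endoMatrix, endoMatrix_add]
    congr 1 <;> ring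
  rw [e, leftLinear_add, h3, add_zero, leftLinear_matrix_smul, leftLinear_one]

end EndoAlgebra

section Sufficiency

variable {s : ℂˣ} {ε : ℤˣ} {g : BimodHom (OSLq s) (GamTwo s ε) (OSLq s)}

theorem braiding_op_smul (a : OSLq s) (x : GamTwo s ε) :
    braiding s ε (op a • x) = op a • braiding s ε x := by
  refine leftLinear_op_smul (fun k l => ?_) a x
  rw [braidingMatrix_eq_endoMatrix]
  exact endoMatrix_comm _ _ _ _ k l

theorem algebraMap_commute_smul {M : Type*} [AddCommGroup M] [Module (OSLq s) M] (c : ℂ) (a : OSLq s)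
    (z : M) : algebraMap ℂ (OSLq s) c • a • z = a • algebraMap ℂ (OSLq s) c • z := by
  rw [smul_smul, smul_smul, Algebra.commutes]

theorem algebraMap_smul_cancel {M : Type*} [AddCommGroup M] [Module (OSLq s) M] {c : ℂ} (hc : c ≠ 0)
    {z w : M} (h : algebraMap ℂ (OSLq s) c • z = algebraMap ℂ (OSLq s) c • w) : z = w := by
  have := congrArg (fun z => algebraMap ℂ (OSLq s) c⁻¹ • z) h
  simpa only [smul_smul, ← map_mul, inv_mul_cancel₀ hc, map_one, one_smul] using this

variable {κ : ℂ} {τ : BimodHom (OSLq s) (GamTwo s ε) (GamTwo s ε)} {c : ℂ} {η η' : ℤˣ}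

theorem pairTwo_act_flip_theta (hq : ∀ n : ℕ, 0 < n → ((s : ℂ) ^ 2) ^ n ≠ 1)
    (hκ : ∀ x, g x = ∑ r, sortedCoords s ε x r *
      algebraMap ℂ (OSLq s) (κ * (Ccheck s r.1.1 r.1.2 * Ccheck s r.2.1 r.2.2)))
    (hτ : ∀ x, τ x = leftLinear s ε (c • flipMatrix s η η') x) {x : GamTwo s ε}
    (hx : braiding s ε x = x) (K : Idx) :
    pairTwo (act_isBimodPair (σ := braiding s ε) (g := g) τ) x (btmul (OSLq s) (theta s ε K) 1) =
      algebraMap ℂ (OSLq s) (c ^ 2) • g x • btmul (OSLq s) (theta s ε K) 1 := by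
  set d := (s : ℂ) ^ 2 + ((s : ℂ) ^ 2)⁻¹ with hd
  have hd0 : d ^ 2 ≠ 0 := pow_ne_zero 2 (q_add_inv_ne_zero hq)
  refine algebraMap_smul_cancel (s := s) hd0 ?_
  have h1 : ∀ p, leftLinear s ε (endoMatrix s (d ^ 2) (-d) (-d) 2) (thetaTwo s ε p) =
      vecTwo s ε (matOp (endoMatrix s (d ^ 2) (-d) (-d) 2)
        (fun i j => deltaTensor p.1 i j • deltaTensor p.2)) := by
    intro p
    rw [← leftLinear_vecTwo, vecTwo_delta]
  have h2 : algebraMap ℂ (OSLq s) (d ^ 2) • x = ∑ p, coords s ε x p •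
      vecTwo s ε (matOp (endoMatrix s (d ^ 2) (-d) (-d) 2)
        (fun i j => deltaTensor p.1 i j • deltaTensor p.2)) := by
    rw [← symmetrizer_of_fixed d hd.symm hx]
    conv_lhs => rw [gamTwo_eq_sum s ε x]
    rw [map_sum]
    refine Finset.sum_congr rfl fun p _ => ?_
    rw [leftLinear_smul, h1]
  rw [← pairTwo_act_smul, algebraMap_commute_smul (s := s), ← smul_assoc (algebraMap ℂ (OSLq s) (d ^ 2)) (g x),
    smul_eq_mul, ← smul_eq_mul, ← g.map_left, h2, map_sum, end_sum_apply]
  have h3 : g.toFun (∑ p, coords s ε x p •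
      vecTwo s ε (matOp (endoMatrix s (d ^ 2) (-d) (-d) 2)
        (fun i j => deltaTensor p.1 i j • deltaTensor p.2))) = ∑ p, coords s ε x p *
      g.toFun (vecTwo s ε (matOp (endoMatrix s (d ^ 2) (-d) (-d) 2)
        (fun i j => deltaTensor p.1 i j • deltaTensor p.2))) := by
    rw [map_sum]
    exact Finset.sum_congr rfl fun p _ => g.map_left _ _
  rw [h3, Finset.sum_smul, Finset.smul_sum]
  refine Finset.sum_congr rfl fun p _ => ?_
  rw [pairTwo_act_smul, pairTwo_act_flip_vecTwo hκ hτ (by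
    rw [← matOp_mul, braidingMatrix_mul_symmetrizer d hd.symm]), mul_smul,
    algebraMap_commute_smul (s := s) (c ^ 2) (coords s ε x p)]

theorem gamAct_mulCl (γ : Gam s ε) (y : QCl (braiding s ε) g)
    (z : BalTensor (OSLq s) (Gam s ε) (QCl (braiding s ε) g)) :
    gamAct τ γ (mulCl y z) = mulCl y (gamAct τ γ z) := by
  induction z using bal_induction with
  | h0 => simp only [map_zero]
  | ht m n => rw [mulCl_btmul, gamAct_btmul, gamAct_btmul, mulCl_mulCl]
  | ha z z' hz hz' => rw [map_add, map_add, hz, hz', map_add, map_add]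

theorem pairTwo_act_flip (hq : ∀ n : ℕ, 0 < n → ((s : ℂ) ^ 2) ^ n ≠ 1)
    (hκ : ∀ x, g x = ∑ r, sortedCoords s ε x r *
      algebraMap ℂ (OSLq s) (κ * (Ccheck s r.1.1 r.1.2 * Ccheck s r.2.1 r.2.2)))
    (hτ : ∀ x, τ x = leftLinear s ε (c • flipMatrix s η η') x) {x : GamTwo s ε}
    (hx : braiding s ε x = x) (z : BalTensor (OSLq s) (Gam s ε) (QCl (braiding s ε) g)) :
    pairTwo (act_isBimodPair (σ := braiding s ε) (g := g) τ) x z =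
      algebraMap ℂ (OSLq s) (c ^ 2) • g x • z := by
  have h1 : ∀ (x : GamTwo s ε) y z, pairTwo (act_isBimodPair (σ := braiding s ε) (g := g) τ) x
      (mulCl y z) = mulCl y (pairTwo (act_isBimodPair τ) x z) := by
    intro x y z
    induction x using bal_induction with
    | h0 => rw [map_zero]; exact (map_zero (mulCl y)).symm
    | ht m n => rw [pairTwo_btmul, end_mul_apply, end_mul_apply, gamAct_mulCl, gamAct_mulCl]
    | ha x x' hx hx' => rw [map_add, end_add_apply, end_add_apply, hx, hx', map_add]
  have h2 : ∀ (b : OSLq s) K, pairTwo (act_isBimodPair (σ := braiding s ε) (g := g) τ) x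
      (b • btmul (OSLq s) (theta s ε K) 1) =
      algebraMap ℂ (OSLq s) (c ^ 2) • g x • b • btmul (OSLq s) (theta s ε K) 1 := by
    intro b K
    have h3 := DFunLike.congr_fun (pairTwo_op_smul
      (act_isBimodPair (σ := braiding s ε) (g := g) τ) b x) (btmul (OSLq s) (theta s ε K) 1)
    rw [end_mul_apply, algAct_apply] at h3
    rw [← h3, pairTwo_act_flip_theta hq hκ hτ (by rw [braiding_op_smul, hx]), g.map_right,
      op_smul_eq_mul, mul_smul]
  induction z using bal_induction with
  | h0 => simp
  | ht γ y =>
    have h3 : btmul (OSLq s) γ y = mulCl y (∑ K, γ K • btmul (OSLq s) (theta s ε K) 1) := by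
      conv_lhs => rw [gam_eq_sum s ε γ]
      rw [map_sum]
      simp only [smul_btmul, mulCl_btmul, one_mul]
      exact map_sum (AddMonoidHom.mk' (fun m => btmul (OSLq s) m y)
        fun _ _ => btmul_add_left _ _ _) _ _
    rw [h3, h1, map_sum, ← mulCl_smul_left, ← mulCl_smul_left, Finset.smul_sum, Finset.smul_sum]
    exact congrArg (mulCl y) (Finset.sum_congr rfl fun K _ => h2 _ K)
  | ha z z' hz hz' => rw [map_add, hz, hz', smul_add, smul_add]

end Sufficiency

section Spin

variable {s : ℂˣ}

variable (s) in
/-- The upper right blocks of the spin representation. -/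
def spinUp (I : Idx) : Matrix (Fin 2) (Fin 2) ℂ :=
  Matrix.of fun k l => Ccheck s k I.1 * if I.2 = l then 1 else 0

variable (s) in
/-- The lower left blocks of the spin representation. -/
def spinDown (I : Idx) : Matrix (Fin 2) (Fin 2) ℂ :=
  Matrix.of fun k l => ∑ b, RhatInv s (l, b) (k, I.1) * Ccheck s b I.2

theorem spinUp_eq : spinUp s (0, 0) = !![0, 0; -(s : ℂ), 0] ∧ spinUp s (0, 1) = !![0, 0; 0, -(s : ℂ)] ∧
    spinUp s (1, 0) = !![(s : ℂ)⁻¹, 0; 0, 0] ∧ spinUp s (1, 1) = !![0, (s : ℂ)⁻¹; 0, 0] := by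
  refine ⟨?_, ?_, ?_, ?_⟩ <;> ext a b <;> fin_cases a <;> fin_cases b <;> simp [spinUp, Ccheck]

theorem spinDown_eq : spinDown s (0, 0) = !![0, 0; -(s : ℂ) ^ 2, 0] ∧
    spinDown s (0, 1) = !![((s : ℂ) ^ 2)⁻¹, 0; 0, ((s : ℂ) ^ 2)⁻¹ - (s : ℂ) ^ 2] ∧
    spinDown s (1, 0) = !![0, 0; 0, -1] ∧ spinDown s (1, 1) = !![0, 1; 0, 0] := by
  have hs : (s : ℂ) ≠ 0 := s.ne_zero
  refine ⟨?_, ?_, ?_, ?_⟩ <;> ext a b <;> fin_cases a <;> fin_cases b <;>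
    simp [spinDown, RhatInv, Ccheck] <;> field_simp

theorem spinUp_entries : (∀ j l, spinUp s (0, j) 0 l = 0) ∧ (∀ j l, spinUp s (1, j) 1 l = 0) ∧
    (∀ i k, spinUp s (i, 0) k 1 = 0) ∧ (∀ i k, spinUp s (i, 1) k 0 = 0) ∧ spinUp s (0, 0) 1 0 = -(s : ℂ) ∧
    spinUp s (0, 1) 1 1 = -(s : ℂ) ∧ spinUp s (1, 0) 0 0 = (s : ℂ)⁻¹ ∧
    spinUp s (1, 1) 0 1 = (s : ℂ)⁻¹ := by
  simp [spinUp, Ccheck]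

theorem spinDown_entries : (spinDown s (0, 0) 0 0 = 0 ∧ spinDown s (0, 0) 0 1 = 0 ∧
    spinDown s (0, 0) 1 0 = -(s : ℂ) ^ 2 ∧ spinDown s (0, 0) 1 1 = 0) ∧
    (spinDown s (0, 1) 0 0 = ((s : ℂ) ^ 2)⁻¹ ∧ spinDown s (0, 1) 0 1 = 0 ∧
    spinDown s (0, 1) 1 0 = 0 ∧ spinDown s (0, 1) 1 1 = ((s : ℂ) ^ 2)⁻¹ - (s : ℂ) ^ 2) ∧
    (spinDown s (1, 0) 0 0 = 0 ∧ spinDown s (1, 0) 0 1 = 0 ∧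
    spinDown s (1, 0) 1 0 = 0 ∧ spinDown s (1, 0) 1 1 = -1) ∧
    spinDown s (1, 1) 0 0 = 0 ∧ spinDown s (1, 1) 0 1 = 1 ∧
    spinDown s (1, 1) 1 0 = 0 ∧ spinDown s (1, 1) 1 1 = 0 := by
  simp [spinDown_eq]

theorem spinUp_comm (n l i j : Fin 2) :
    spinUp s (i, j) * Lminus s n l = ∑ m, ∑ r, ∑ x, (∑ t, Lplus s m t i r * Lminus s t l j x) •
      (Lplus s n m * spinUp s (r, x)) := by
  have hs : (s : ℂ) ≠ 0 := s.ne_zero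
  ext K L
  simp only [Fin.sum_univ_two, Matrix.add_apply, Matrix.smul_apply, Matrix.mul_apply, smul_eq_mul]
  fin_cases i <;> fin_cases j <;> fin_cases n <;> fin_cases l <;> fin_cases K <;> fin_cases L <;>
    simp only [Fin.zero_eta, Fin.mk_one, Lplus_entries, Lminus_entries, spinUp_entries, mul_zero,
      zero_mul, add_zero, zero_add] <;>
    field_simp <;> ring

theorem spinDown_comm (n l i j : Fin 2) :
    spinDown s (i, j) * Lplus s n l = ∑ m, ∑ r, ∑ x, (∑ t, Lplus s m t i r * Lminus s t l j x) •
      (Lminus s n m * spinDown s (r, x)) := by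
  have hs : (s : ℂ) ≠ 0 := s.ne_zero
  ext K L
  simp only [Fin.sum_univ_two, Matrix.add_apply, Matrix.smul_apply, Matrix.mul_apply, smul_eq_mul]
  fin_cases i <;> fin_cases j <;> fin_cases n <;> fin_cases l <;> fin_cases K <;> fin_cases L <;>
    simp only [Fin.zero_eta, Fin.mk_one, Lplus_entries, Lminus_entries, spinDown_entries, mul_zero,
      zero_mul, add_zero, zero_add] <;>
    field_simp <;> ring

theorem spinUp_mul_spinDown_sorted (i j k l : Fin 2) :
    ∑ j', ∑ k', Rhat s (j', k') (j, k) • (spinUp s (i, j') * spinDown s (k', l)) =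
      Ccheck s k l • Matrix.of fun K L => Ccheck s K i * (if L = j then 1 else 0 : ℂ) := by
  have hs : (s : ℂ) ≠ 0 := s.ne_zero
  ext K L
  simp only [Fin.sum_univ_two, Matrix.add_apply, Matrix.smul_apply, Matrix.mul_apply, smul_eq_mul,
    Matrix.of_apply]
  fin_cases i <;> fin_cases j <;> fin_cases k <;> fin_cases l <;> fin_cases K <;> fin_cases L <;>
    simp only [Fin.zero_eta, Fin.mk_one, Rhat_entries, spinUp_entries, spinDown_entries,
      Ccheck_entries, if_true, zero_ne_one, one_ne_zero, if_false, mul_zero, zero_mul, add_zero,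
      zero_add] <;>
    field_simp <;> ring

theorem spinDown_mul_spinUp_sorted (i j k l : Fin 2) :
    ∑ j', ∑ k', Rhat s (j', k') (j, k) • (spinDown s (i, j') * spinUp s (k', l)) =
      Ccheck s i j • Matrix.of fun K L => Ccheck s K k * (if L = l then 1 else 0 : ℂ) := by
  have hs : (s : ℂ) ≠ 0 := s.ne_zero
  ext K L
  simp only [Fin.sum_univ_two, Matrix.add_apply, Matrix.smul_apply, Matrix.mul_apply, smul_eq_mul,
    Matrix.of_apply]
  fin_cases i <;> fin_cases j <;> fin_cases k <;> fin_cases l <;> fin_cases K <;> fin_cases L <;>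
    simp only [Fin.zero_eta, Fin.mk_one, Rhat_entries, spinUp_entries, spinDown_entries,
      Ccheck_entries, if_true, zero_ne_one, one_ne_zero, if_false, mul_zero, zero_mul, add_zero,
      zero_add] <;>
    field_simp <;> ring

end Spin

section SpinRep

variable {s : ℂˣ} {ε : ℤˣ}

/-- The algebra carrying the spin representation. -/
abbrev SpinAlg : Type := Matrix (Fin 2 ⊕ Fin 2) (Fin 2 ⊕ Fin 2) ℂ

variable (s ε) in
/-- The generators of `O(SL_q(2))` in the spin representation. -/
def spinGen (k l : Fin 2) : SpinAlg :=
  Matrix.fromBlocks (Lplus s k l) 0 0 (((ε : ℤ) : ℂ) • Lminus s k l)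

theorem smul_sign_mul (x y : Matrix (Fin 2) (Fin 2) ℂ) :
    (((ε : ℤ) : ℂ) • x) * (((ε : ℤ) : ℂ) • y) = x * y := by
  rw [Matrix.smul_mul, Matrix.mul_smul, smul_smul, sign_mul_self, one_smul]

theorem spinGen_mul (k l m n : Fin 2) : spinGen s ε k l * spinGen s ε m n =
    Matrix.fromBlocks (Lplus s k l * Lplus s m n) 0 0 (Lminus s k l * Lminus s m n) := by
  rw [spinGen, spinGen, Matrix.fromBlocks_multiply, smul_sign_mul]
  simp

theorem spinGen_rtt (i j m n : Fin 2) :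
    ∑ k, ∑ l, Rhat s (i, j) (k, l) • (spinGen s ε k m * spinGen s ε l n) =
      ∑ k, ∑ l, Rhat s (k, l) (m, n) • (spinGen s ε i k * spinGen s ε j l) := by
  have h1 := Lplus_rtt s i j m n
  have h2 := Lminus_rtt s i j m n
  simp only [Fin.sum_univ_two] at h1 h2
  simp only [spinGen_mul, Fin.sum_univ_two, Matrix.fromBlocks_smul, Matrix.fromBlocks_add, h1, h2]
  simp

theorem spinGen_det : spinGen s ε 0 0 * spinGen s ε 1 1 -
    (s : ℂ) ^ 2 • (spinGen s ε 0 1 * spinGen s ε 1 0) = 1 := by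
  rw [spinGen_mul, spinGen_mul, ← Matrix.fromBlocks_one, ← Lplus_det s]
  conv_rhs => rw [Lplus_det s]
  rw [sub_eq_iff_eq_add, Matrix.fromBlocks_smul, Matrix.fromBlocks_add, ← sub_eq_iff_eq_add.1 (Lplus_det s),
    ← sub_eq_iff_eq_add.1 (Lminus_det s)]
  simp

variable (s ε) in
/-- The spin representation of `O(SL_q(2))`. -/
def spinAlg : OSLq s →ₐ[ℂ] SpinAlg := slqLift (spinGen s ε) spinGen_rtt spinGen_det

variable (s) in
/-- The matrices of the `θ_I` in the spin representation. -/
def spinTheta (μ : ℂ) (I : Idx) : SpinAlg := Matrix.fromBlocks 0 (spinUp s I) (μ • spinDown s I) 0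

theorem spinTheta_comm (μ : ℂ) (n l : Fin 2) (I : Idx) :
    spinTheta s μ I * spinAlg s ε (u s n l) =
      ∑ J, spinAlg s ε (phi s ε (u s n l) I J) * spinTheta s μ J := by
  have e : ∀ m J, spinGen s ε n m * spinTheta s μ J = Matrix.fromBlocks 0 (Lplus s n m * spinUp s J)
      ((((ε : ℤ) : ℂ) * μ) • (Lminus s n m * spinDown s J)) 0 := by
    intro m J
    rw [spinGen, spinTheta, Matrix.fromBlocks_multiply]
    simp [smul_smul, mul_comm μ]
  have e1 : spinTheta s μ I * spinGen s ε n l =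
      Matrix.fromBlocks 0 (((ε : ℤ) : ℂ) • (spinUp s I * Lminus s n l))
      (μ • (spinDown s I * Lplus s n l)) 0 := by
    rw [spinGen, spinTheta, Matrix.fromBlocks_multiply]
    simp
  have h1 : ((ε : ℤ) : ℂ) • (spinUp s I * Lminus s n l) = ∑ J : Idx, ∑ m,
      fGen s ε m l I J • (Lplus s n m * spinUp s J) := by
    obtain ⟨i, j⟩ := I
    simp only [spinUp_comm, fGen_apply, Fintype.sum_prod_type, Fin.sum_univ_two, smul_add,
      mul_smul]
    abel
  have h2 : μ • (spinDown s I * Lplus s n l) = ∑ J : Idx, ∑ m, fGen s ε m l I J •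
      ((((ε : ℤ) : ℂ) * μ) • (Lminus s n m * spinDown s J)) := by
    have h : ∀ (c : ℂ) (M : Matrix (Fin 2) (Fin 2) ℂ), (((ε : ℤ) : ℂ) * c) •
        (((ε : ℤ) : ℂ) * μ) • M = μ • c • M := fun c M => by
      rw [smul_smul, mul_mul_mul_comm, sign_mul_self, one_mul, mul_comm, mul_smul]
    obtain ⟨i, j⟩ := I
    simp only [spinDown_comm, fGen_apply, Fintype.sum_prod_type, Fin.sum_univ_two, smul_add, h]
    abel
  have e2 : ∀ c : Idx → Fin 2 → ℂ, ∑ J : Idx, ∑ m, c J m • (spinGen s ε n m * spinTheta s μ J) =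
      Matrix.fromBlocks 0 (∑ J : Idx, ∑ m, c J m • (Lplus s n m * spinUp s J))
        (∑ J : Idx, ∑ m, c J m • ((((ε : ℤ) : ℂ) * μ) • (Lminus s n m * spinDown s J))) 0 := by
    intro c
    simp only [e, Matrix.fromBlocks_smul, Fin.sum_univ_two, Fintype.sum_prod_type,
      Matrix.fromBlocks_add, smul_zero, add_zero]
  rw [spinAlg, slqLift_u, e1, h1, h2, ← e2]
  refine Finset.sum_congr rfl fun J _ => ?_
  rw [phi_u, map_sum, Finset.sum_mul]
  refine Finset.sum_congr rfl fun m _ => ?_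
  rw [map_smul, slqLift_u, smul_mul_assoc]

variable (s ε) in
/-- The spin representation of `Γ`. -/
def spinGam (μ : ℂ) : Gam s ε →+ SpinAlg :=
  AddMonoidHom.mk' (fun γ => ∑ I, spinAlg s ε (γ I) * spinTheta s μ I) (fun γ γ' => by
    simp only [gam_add, map_add, add_mul, Finset.sum_add_distrib])

theorem spinGam_apply (μ : ℂ) (γ : Gam s ε) :
    spinGam s ε μ γ = ∑ I, spinAlg s ε (γ I) * spinTheta s μ I := rfl

theorem spinGam_theta (μ : ℂ) (I : Idx) : spinGam s ε μ (theta s ε I) = spinTheta s μ I := by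
  rw [spinGam_apply, Fintype.sum_eq_single I fun J hJ => by
    rw [theta, if_neg hJ, map_zero, zero_mul], theta, if_pos rfl, map_one, one_mul]

theorem spinTheta_mul_spinAlg (μ : ℂ) (a : OSLq s) : ∀ I,
    spinTheta s μ I * spinAlg s ε a = ∑ J, spinAlg s ε (phi s ε a I J) * spinTheta s μ J := by
  induction a using slq_induction with
  | hc c =>
    intro I
    rw [AlgHom.commutes, AlgHom.commutes, Fintype.sum_eq_single I fun J hJ => by
      rw [Matrix.algebraMap_matrix_apply, if_neg hJ.symm, map_zero, zero_mul],
      Matrix.algebraMap_matrix_apply, if_pos rfl, AlgHom.commutes, Algebra.commutes]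
  | hu k l => exact spinTheta_comm μ k l
  | ha a b iha ihb =>
    intro I
    simp only [map_add, mul_add, Matrix.add_apply, add_mul, Finset.sum_add_distrib, iha, ihb]
  | hm a b iha ihb =>
    intro I
    simp only [map_mul, Matrix.mul_apply, map_sum, Finset.sum_mul]
    rw [← mul_assoc, iha, Finset.sum_mul, Finset.sum_comm]
    simp only [mul_assoc, ihb, Finset.mul_sum]

theorem spin_isBimodPair (μ : ℂ) :
    IsBimodPair (spinAlg s ε : OSLq s →+* SpinAlg) (spinGam s ε μ) where
  left a γ := by
    simp only [spinGam_apply, smul_gam, map_mul, mul_assoc, Finset.mul_sum, RingHom.coe_coe]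
  right a γ := by
    simp only [spinGam_apply, op_smul_gam, map_sum, map_mul, mul_assoc, Finset.sum_mul, RingHom.coe_coe,
      spinTheta_mul_spinAlg, Finset.mul_sum]
    exact Finset.sum_comm

theorem sum_leg23_smul {V : Type*} [AddCommGroup V] [Module ℂ V] (M : Matrix Idx Idx ℂ)
    (F : Idx × Idx → V) (i j k l : Fin 2) : ∑ p, leg23 M p ((i, j), (k, l)) • F p =
      ∑ j', ∑ k', M (j', k') (j, k) • F ((i, j'), (k', l)) := by
  simp only [leg23, Matrix.of_apply, Fintype.sum_prod_type, Fin.sum_univ_two]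
  fin_cases i <;> fin_cases l <;> simp

/-- The elementary operators appearing in the sorted products. -/
def spinUnit (s : ℂˣ) (a : Idx) : Matrix (Fin 2) (Fin 2) ℂ :=
  Matrix.of fun k l => Ccheck s k a.1 * if l = a.2 then 1 else 0

theorem sum_spinUnit : ∑ a : Idx, Ccheck s a.1 a.2 • spinUnit s a = -1 := by
  have hs := s.ne_zero
  ext k l
  fin_cases k <;> fin_cases l <;>
    simp [spinUnit, Ccheck, Fintype.sum_prod_type, Matrix.sum_apply, hs]

theorem spinTheta_mul_sorted (μ : ℂ) (t : Idx × Idx) :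
    ∑ p, leg23 (Rhat s) p t • (spinTheta s μ p.1 * spinTheta s μ p.2) =
      Matrix.fromBlocks (μ • Ccheck s t.2.1 t.2.2 • spinUnit s t.1) 0 0
        (μ • Ccheck s t.1.1 t.1.2 • spinUnit s t.2) := by
  obtain ⟨⟨i, j⟩, ⟨k, l⟩⟩ := t
  have h1 := spinUp_mul_spinDown_sorted (s := s) i j k l
  have h2 := spinDown_mul_spinUp_sorted (s := s) i j k l
  rw [sum_leg23_smul, spinUnit, spinUnit, ← h1, ← h2]
  simp only [Fin.sum_univ_two, spinTheta, Matrix.fromBlocks_multiply, Matrix.fromBlocks_smul,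
    Matrix.fromBlocks_add, Matrix.zero_mul, Matrix.mul_zero, zero_add, add_zero, Matrix.smul_mul,
    Matrix.mul_smul, smul_zero, smul_add, smul_comm μ]

theorem sum_Ccheck_mul_self :
    ∑ b : Idx, Ccheck s b.1 b.2 * Ccheck s b.1 b.2 = (s : ℂ) ^ 2 + ((s : ℂ) ^ 2)⁻¹ := by
  have hs := s.ne_zero
  simp [Fintype.sum_prod_type, Ccheck]
  ring

theorem sum_symmetrizer_right {d : ℂ} (hd : (s : ℂ) ^ 2 + ((s : ℂ) ^ 2)⁻¹ = d) (a : Idx)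
    (t : Idx × Idx) : ∑ b : Idx, sortedMatrix s (d ^ 2) (-d) (-d) 2 (a, b) t * Ccheck s b.1 b.2 =
      d * Ccheck s t.1.1 t.1.2 * Ccheck s t.2.1 t.2.2 * Ccheck s a.1 a.2 := by
  have h1 : ∑ b : Idx, (1 : Matrix Idx Idx ℂ) b t.2 * Ccheck s b.1 b.2 = Ccheck s t.2.1 t.2.2 := by
    simp [Matrix.one_apply]
  have h2 : ∑ b : Idx, cupCap s b t.2 * Ccheck s b.1 b.2 = d * Ccheck s t.2.1 t.2.2 := by
    rw [← hd, ← sum_Ccheck_mul_self, Finset.sum_mul]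
    exact Finset.sum_congr rfl fun b _ => by rw [cupCap, Matrix.of_apply]; ring
  have h3 : ∀ b : Idx, sortedMatrix s (d ^ 2) (-d) (-d) 2 (a, b) t * Ccheck s b.1 b.2 =
      (d ^ 2 * (1 : Matrix Idx Idx ℂ) a t.1 - d * cupCap s a t.1) *
        ((1 : Matrix Idx Idx ℂ) b t.2 * Ccheck s b.1 b.2) +
      (2 * cupCap s a t.1 - d * (1 : Matrix Idx Idx ℂ) a t.1) *
        (cupCap s b t.2 * Ccheck s b.1 b.2) := fun b => by
    rw [sortedMatrix, Matrix.of_apply]; ring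
  simp only [h3]
  rw [Finset.sum_add_distrib, ← Finset.mul_sum, ← Finset.mul_sum, h1, h2, cupCap, Matrix.of_apply]
  ring

theorem sum_symmetrizer_left {d : ℂ} (hd : (s : ℂ) ^ 2 + ((s : ℂ) ^ 2)⁻¹ = d) (b : Idx)
    (t : Idx × Idx) : ∑ a : Idx, sortedMatrix s (d ^ 2) (-d) (-d) 2 (a, b) t * Ccheck s a.1 a.2 =
      d * Ccheck s t.1.1 t.1.2 * Ccheck s t.2.1 t.2.2 * Ccheck s b.1 b.2 := by
  have h : ∀ a, sortedMatrix s (d ^ 2) (-d) (-d) 2 (a, b) t =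
      sortedMatrix s (d ^ 2) (-d) (-d) 2 (b, a) (t.2, t.1) := fun a => by
    simp only [sortedMatrix, Matrix.of_apply]; ring
  simp only [h]
  rw [sum_symmetrizer_right hd]
  ring

theorem spinTheta_mul_symmetrizer_sorted (κ : ℂ) {d : ℂ} (hd : (s : ℂ) ^ 2 + ((s : ℂ) ^ 2)⁻¹ = d)
    (r : Idx × Idx) :
    ∑ t, sortedMatrix s (d ^ 2) (-d) (-d) 2 t r •
      ∑ p, leg23 (Rhat s) p t • (spinTheta s (-(κ * d)) p.1 * spinTheta s (-(κ * d)) p.2) =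
      (κ * d ^ 2 * (Ccheck s r.1.1 r.1.2 * Ccheck s r.2.1 r.2.2)) • 1 := by
  set c := Ccheck s r.1.1 r.1.2 * Ccheck s r.2.1 r.2.2 with hc
  have h1 : ∑ a : Idx, ∑ b : Idx, sortedMatrix s (d ^ 2) (-d) (-d) 2 (a, b) r •
      (-(κ * d)) • Ccheck s b.1 b.2 • spinUnit s a = (κ * d ^ 2 * c) • 1 := by
    have : ∀ a : Idx, ∑ b : Idx, sortedMatrix s (d ^ 2) (-d) (-d) 2 (a, b) r •
      (-(κ * d)) • Ccheck s b.1 b.2 • spinUnit s a =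
        (-(κ * d ^ 2 * c)) • Ccheck s a.1 a.2 • spinUnit s a := fun a => by
      simp only [smul_smul, ← Finset.sum_smul]
      refine congrArg (fun z => z • spinUnit s a) ?_
      rw [Finset.sum_congr rfl fun b _ => mul_left_comm (sortedMatrix s (d ^ 2) (-d) (-d) 2 (a, b) r)
        (-(κ * d)) (Ccheck s b.1 b.2), ← Finset.mul_sum, sum_symmetrizer_right hd, hc]
      ring
    simp only [this]
    rw [← Finset.smul_sum, sum_spinUnit, smul_neg, neg_smul, neg_neg]
  have h2 : ∑ a : Idx, ∑ b : Idx, sortedMatrix s (d ^ 2) (-d) (-d) 2 (a, b) r •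
      (-(κ * d)) • Ccheck s a.1 a.2 • spinUnit s b = (κ * d ^ 2 * c) • 1 := by
    rw [Finset.sum_comm]
    have : ∀ b : Idx, ∑ a : Idx, sortedMatrix s (d ^ 2) (-d) (-d) 2 (a, b) r •
      (-(κ * d)) • Ccheck s a.1 a.2 • spinUnit s b =
        (-(κ * d ^ 2 * c)) • Ccheck s b.1 b.2 • spinUnit s b := fun b => by
      simp only [smul_smul, ← Finset.sum_smul]
      refine congrArg (fun z => z • spinUnit s b) ?_
      rw [Finset.sum_congr rfl fun a _ => mul_left_comm (sortedMatrix s (d ^ 2) (-d) (-d) 2 (a, b) r)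
        (-(κ * d)) (Ccheck s a.1 a.2), ← Finset.mul_sum, sum_symmetrizer_left hd, hc]
      ring
    simp only [this]
    rw [← Finset.smul_sum, sum_spinUnit, smul_neg, neg_smul, neg_neg]
  have h3 : ∀ (c : Idx × Idx → ℂ) (X Y : Idx × Idx → Matrix (Fin 2) (Fin 2) ℂ),
      ∑ t, c t • Matrix.fromBlocks (X t) 0 0 (Y t) =
        Matrix.fromBlocks (∑ a, ∑ b, c (a, b) • X (a, b)) 0 0 (∑ a, ∑ b, c (a, b) • Y (a, b)) := by
    intro c X Y
    rw [← Fintype.sum_prod_type (f := fun t => c t • X t), ← Fintype.sum_prod_type (f := fun t => c t • Y t)]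
    ext (i | i) (j | j) <;> simp [Matrix.sum_apply]
  simp only [spinTheta_mul_sorted]
  rw [h3, h1, h2, ← Matrix.fromBlocks_one, Matrix.fromBlocks_smul, smul_zero]

theorem sum_triple_mul_smul {V ι : Type*} [AddCommGroup V] [Module ℂ V] [Fintype ι]
    (L S N : Matrix ι ι ℂ) (X : ι → V) (r : ι) :
    ∑ p, (L * S * N) p r • X p = ∑ b, N b r • ∑ a, S a b • ∑ p, L p a • X p := by
  simp only [Matrix.mul_apply, Finset.sum_smul, Finset.smul_sum, smul_smul, Finset.sum_mul]
  rw [Finset.sum_comm]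
  refine Finset.sum_congr rfl fun b _ => ?_
  rw [Finset.sum_comm]
  refine Finset.sum_congr rfl fun a _ => Finset.sum_congr rfl fun p _ => ?_
  rw [mul_comm (N b r), mul_comm (S a b)]

theorem spinTheta_mul_symmetrizer (κ : ℂ) {d : ℂ} (hd : (s : ℂ) ^ 2 + ((s : ℂ) ^ 2)⁻¹ = d)
    (r : Idx × Idx) :
    ∑ p, endoMatrix s (d ^ 2) (-d) (-d) 2 p r • (spinTheta s (-(κ * d)) p.1 * spinTheta s (-(κ * d)) p.2) =
      (∑ t, leg23 (RhatInv s) t r *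
        (κ * d ^ 2 * (Ccheck s t.1.1 t.1.2 * Ccheck s t.2.1 t.2.2))) • 1 := by
  rw [endoMatrix, sum_triple_mul_smul, Finset.sum_smul]
  refine Finset.sum_congr rfl fun t _ => ?_
  rw [spinTheta_mul_symmetrizer_sorted κ hd, smul_smul]

/-- The spin representation satisfies the relations of the quantum Clifford algebra. -/
theorem pairTwo_spin_of_fixed (hq : ∀ n : ℕ, 0 < n → ((s : ℂ) ^ 2) ^ n ≠ 1)
    {g : BimodHom (OSLq s) (GamTwo s ε) (OSLq s)} {κ d : ℂ}
    (hκ : ∀ x, g x = ∑ r, sortedCoords s ε x r *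
      algebraMap ℂ (OSLq s) (κ * (Ccheck s r.1.1 r.1.2 * Ccheck s r.2.1 r.2.2)))
    (hd : (s : ℂ) ^ 2 + ((s : ℂ) ^ 2)⁻¹ = d) (x : GamTwo s ε) (hx : braiding s ε x = x) :
    pairTwo (spin_isBimodPair (s := s) (ε := ε) (-(κ * d))) x = spinAlg s ε (g x) := by
  have hd0 : d ^ 2 ≠ 0 := pow_ne_zero 2 (hd ▸ q_add_inv_ne_zero hq)
  have h1 : ∀ T, pairTwo (spin_isBimodPair (s := s) (ε := ε) (-(κ * d))) (leftLinear s ε T x) =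
      ∑ r, spinAlg s ε (coords s ε x r) *
        ∑ p, T p r • (spinTheta s (-(κ * d)) p.1 * spinTheta s (-(κ * d)) p.2) := by
    intro T
    conv_lhs => rw [gamTwo_eq_sum s ε x]
    rw [map_sum, map_sum]
    refine Finset.sum_congr rfl fun r _ => ?_
    rw [leftLinear_smul, pairTwo_smul, thetaTwo, leftLinear_theta, map_sum]
    refine congrArg (fun z => spinAlg s ε (coords s ε x r) * z) (Finset.sum_congr rfl fun p _ => ?_)
    rw [pairTwo_smul, pairTwo_btmul, spinGam_theta, spinGam_theta, RingHom.coe_coe, AlgHom.commutes,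
      ← Algebra.smul_def]
  have h2 := h1 (endoMatrix s (d ^ 2) (-d) (-d) 2)
  rw [symmetrizer_of_fixed d hd hx, pairTwo_smul, RingHom.coe_coe, AlgHom.commutes,
    ← Algebra.smul_def] at h2
  have h3 : d ^ 2 • spinAlg s ε (g x) = ∑ r, spinAlg s ε (coords s ε x r) *
      ∑ p, endoMatrix s (d ^ 2) (-d) (-d) 2 p r •
        (spinTheta s (-(κ * d)) p.1 * spinTheta s (-(κ * d)) p.2) := by
    simp only [spinTheta_mul_symmetrizer κ hd, hκ, sortedCoords_eq, coords_leftLinear]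
    rw [map_sum, Finset.smul_sum]
    simp only [map_sum, map_smul, Finset.sum_smul, Finset.mul_sum,
      Finset.smul_sum, Algebra.algebraMap_eq_smul_one, mul_smul_comm, mul_one, smul_smul]
    rw [Finset.sum_comm]
    refine Finset.sum_congr rfl fun a _ => Finset.sum_congr rfl fun b _ => ?_
    congr 1
    ring
  have h4 := h2.trans h3.symm
  exact (smul_right_injective _ hd0) h4

end SpinRep

section EndoEntries

variable {s : ℂˣ} {X : Type*} [AddCommGroup X] [Module ℂ X]

theorem matOp_delta (T : Matrix (Idx × Idx) (Idx × Idx) ℂ) (I : Idx) (F : TwoLegs X) (i j k l : Fin 2) :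
    matOp T (fun i j => deltaTensor I i j • F) i j k l =
      ∑ M : Idx, T ((i, j), (k, l)) (I, M) • F M.1 M.2 := by
  rw [matOp_apply, Fintype.sum_prod_type, Fintype.sum_eq_single I fun J hJ =>
    Finset.sum_eq_zero fun M _ => by simp [deltaTensor, hJ]]
  exact Finset.sum_congr rfl fun M _ => by simp [deltaTensor]

theorem endoMatrix_apply (A B C D : ℂ) (p r : Idx × Idx) : endoMatrix s A B C D p r =
    ∑ d : Idx, (∑ c : Idx, Rhat s (p.1.2, p.2.1) c *
      sortedMatrix s A B C D ((p.1.1, c.1), (c.2, p.2.2)) ((r.1.1, d.1), (d.2, r.2.2))) *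
        RhatInv s d (r.1.2, r.2.1) := by
  rw [endoMatrix, mul_leg23_apply]
  simp only [leg23_mul_apply]

theorem endoMatrix_column_zero (A B C D : ℂ) (p : Idx × Idx) (n : Fin 2) :
    endoMatrix s A B C D p ((1, 0), (0, n)) = (s : ℂ)⁻¹ * ∑ c : Idx, Rhat s (p.1.2, p.2.1) c *
      sortedMatrix s A B C D ((p.1.1, c.1), (c.2, p.2.2)) ((1, 0), (0, n)) := by
  rw [endoMatrix_apply, Fintype.sum_eq_single (0, 0) fun d hd => by
    simp [RhatInv, Ccheck, hd], mul_comm]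
  simp [RhatInv, Ccheck]

theorem endoMatrix_column_one (A B C D : ℂ) (p : Idx × Idx) (n : Fin 2) :
    endoMatrix s A B C D p ((1, 0), (1, n)) = (s : ℂ) * ∑ c : Idx, Rhat s (p.1.2, p.2.1) c *
      sortedMatrix s A B C D ((p.1.1, c.1), (c.2, p.2.2)) ((1, 1), (0, n)) := by
  have hs := s.ne_zero
  rw [endoMatrix_apply, Fintype.sum_eq_single (1, 0) fun d hd => ?_, mul_comm]
  · simp [RhatInv, Ccheck, hs]
  · obtain ⟨d, d'⟩ := d
    fin_cases d <;> fin_cases d' <;> simp_all [RhatInv, Ccheck]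

theorem sum_Rhat_row (f : Idx → ℂ) :
    ∑ c, Rhat s (0, 0) c * f c = s * f (0, 0) ∧ ∑ c, Rhat s (1, 1) c * f c = s * f (1, 1) ∧
    ∑ c, Rhat s (0, 1) c * f c = (s : ℂ)⁻¹ * ((s : ℂ) ^ 2 - ((s : ℂ) ^ 2)⁻¹) * f (0, 1) +
      (s : ℂ)⁻¹ * f (1, 0) ∧
    ∑ c, Rhat s (1, 0) c * f c = (s : ℂ)⁻¹ * f (0, 1) := by
  simp [Fintype.sum_prod_type, Rhat_entries]

theorem deltaTensor_values :
    deltaTensor (0, 0) 0 0 = 1 ∧ deltaTensor (0, 0) 0 1 = 0 ∧ deltaTensor (0, 0) 1 0 = 0 ∧ deltaTensor (0, 0) 1 1 = 0 ∧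
    deltaTensor (0, 1) 0 0 = 0 ∧ deltaTensor (0, 1) 0 1 = 1 ∧ deltaTensor (0, 1) 1 0 = 0 ∧ deltaTensor (0, 1) 1 1 = 0 ∧
    deltaTensor (1, 0) 0 0 = 0 ∧ deltaTensor (1, 0) 0 1 = 0 ∧ deltaTensor (1, 0) 1 0 = 1 ∧ deltaTensor (1, 0) 1 1 = 0 ∧
    deltaTensor (1, 1) 0 0 = 0 ∧ deltaTensor (1, 1) 0 1 = 0 ∧ deltaTensor (1, 1) 1 0 = 0 ∧ deltaTensor (1, 1) 1 1 = 1 := by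
  simp [deltaTensor]

theorem sortedMatrix_apply (A B C D : ℂ) (i j k l i' j' k' l' : Fin 2) :
    sortedMatrix s A B C D ((i, j), (k, l)) ((i', j'), (k', l')) =
      A * ((if i = i' then if j = j' then 1 else 0 else 0) * if k = k' then if l = l' then 1 else 0 else 0) +
      B * (Ccheck s i j * Ccheck s i' j' * if k = k' then if l = l' then 1 else 0 else 0) +
      C * ((if i = i' then if j = j' then 1 else 0 else 0) * (Ccheck s k l * Ccheck s k' l')) +
      D * (Ccheck s i j * Ccheck s i' j' * (Ccheck s k l * Ccheck s k' l')) := by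
  simp only [sortedMatrix, cupCap, Matrix.of_apply, Matrix.one_apply, Prod.mk.injEq, ite_and]

theorem endoMatrix_column_00 (A B C D : ℂ) (i j k l : Fin 2) :
    endoMatrix s A B C D ((i, j), (k, l)) ((1, 0), (0, 0)) =
      deltaTensor (1, 0) i j * deltaTensor (0, 0) k l * (A + (s : ℂ) ^ 2 * B) -
      deltaTensor (0, 0) i j * deltaTensor (1, 0) k l * (((s : ℂ) ^ 2)⁻¹ * B) := by
  have hs := s.ne_zero
  rw [endoMatrix_column_zero]
  fin_cases i <;> fin_cases j <;> fin_cases k <;> fin_cases l <;>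
    simp only [Fin.zero_eta, Fin.mk_one, sum_Rhat_row] <;>
    simp only [sortedMatrix_apply, Ccheck_entries, deltaTensor_values,
      if_true, if_false, zero_ne_one, one_ne_zero, mul_zero, zero_mul, add_zero, zero_add, mul_one,
      one_mul, sub_zero, zero_sub] <;>
    field_simp

theorem endoMatrix_column_10 (A B C D : ℂ) (i j k l : Fin 2) :
    endoMatrix s A B C D ((i, j), (k, l)) ((1, 0), (1, 0)) =
      deltaTensor (1, 0) i j * deltaTensor (1, 0) k l * A := by
  have hs := s.ne_zero
  rw [endoMatrix_column_one]
  fin_cases i <;> fin_cases j <;> fin_cases k <;> fin_cases l <;>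
    simp only [Fin.zero_eta, Fin.mk_one, sum_Rhat_row] <;>
    simp only [sortedMatrix_apply, Ccheck_entries, deltaTensor_values,
      if_true, if_false, zero_ne_one, one_ne_zero, mul_zero, zero_mul, add_zero, zero_add, mul_one,
      one_mul, sub_zero, zero_sub] <;>
    exact mul_inv_cancel_left₀ hs A

theorem endoMatrix_column_11 (A B C D : ℂ) (i j k l : Fin 2) :
    endoMatrix s A B C D ((i, j), (k, l)) ((1, 0), (1, 1)) =
      deltaTensor (1, 0) i j * deltaTensor (1, 1) k l * (A + ((s : ℂ) ^ 2)⁻¹ * C) -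
      deltaTensor (1, 1) i j * deltaTensor (1, 0) k l * ((s : ℂ) ^ 2 * C) := by
  have hs := s.ne_zero
  rw [endoMatrix_column_one]
  fin_cases i <;> fin_cases j <;> fin_cases k <;> fin_cases l <;>
    simp only [Fin.zero_eta, Fin.mk_one, sum_Rhat_row] <;>
    simp only [sortedMatrix_apply, Ccheck_entries, deltaTensor_values,
      if_true, if_false, zero_ne_one, one_ne_zero, mul_zero, zero_mul, add_zero, zero_add, mul_one,
      one_mul, sub_zero, zero_sub] <;>
    field_simp

theorem endoMatrix_column_01 (A B C D : ℂ) (i j k l : Fin 2) :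
    endoMatrix s A B C D ((i, j), (k, l)) ((1, 0), (0, 1)) =
      deltaTensor (1, 0) i j * deltaTensor (0, 1) k l * (A + (s : ℂ) ^ 2 * B + ((s : ℂ) ^ 2)⁻¹ * C + D) -
      deltaTensor (0, 0) i j * deltaTensor (1, 1) k l * (((s : ℂ) ^ 2)⁻¹ * (B + ((s : ℂ) ^ 2)⁻¹ * D)) -
      deltaTensor (1, 1) i j * deltaTensor (0, 0) k l * (((s : ℂ) ^ 2)⁻¹ * (C + (s : ℂ) ^ 2 * D)) -
      deltaTensor (1, 0) i j * deltaTensor (1, 0) k l * (((s : ℂ) ^ 2)⁻¹ *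
        (C + (s : ℂ) ^ 2 * D) * ((s : ℂ) ^ 2 - ((s : ℂ) ^ 2)⁻¹)) +
      deltaTensor (0, 1) i j * deltaTensor (1, 0) k l * D := by
  have hs := s.ne_zero
  rw [endoMatrix_column_zero]
  fin_cases i <;> fin_cases j <;> fin_cases k <;> fin_cases l <;>
    simp only [Fin.zero_eta, Fin.mk_one, sum_Rhat_row] <;>
    simp only [sortedMatrix_apply, Ccheck_entries, deltaTensor_values,
      if_true, if_false, zero_ne_one, one_ne_zero, mul_zero, zero_mul, add_zero, zero_add, mul_one,
      one_mul, sub_zero, zero_sub] <;>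
    field_simp <;> try ring

end EndoEntries

section Recoupling

variable {s : ℂˣ} {X : Type*} [AddCommGroup X] [Module ℂ X]

/-- The action of an endomorphism of `Γ ⊗ Γ` on tensors starting with `θ_{21}`. -/
theorem matOp_endoMatrix_delta (A B C D : ℂ) (F : TwoLegs X) (i j k l : Fin 2) :
    matOp (endoMatrix s A B C D) (fun i j => deltaTensor (1, 0) i j • F) i j k l =
      deltaTensor (1, 0) i j • (deltaTensor (0, 1) k l •
          (A + (s : ℂ) ^ 2 * B + ((s : ℂ) ^ 2)⁻¹ * C + D) • F 0 1 +
        deltaTensor (1, 0) k l • (A • F 1 0 - (((s : ℂ) ^ 2)⁻¹ *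
          (C + (s : ℂ) ^ 2 * D) * ((s : ℂ) ^ 2 - ((s : ℂ) ^ 2)⁻¹)) • F 0 1) +
        deltaTensor (0, 0) k l • (A + (s : ℂ) ^ 2 * B) • F 0 0 +
        deltaTensor (1, 1) k l • (A + ((s : ℂ) ^ 2)⁻¹ * C) • F 1 1) -
      deltaTensor (0, 0) i j • (deltaTensor (1, 1) k l •
          (((s : ℂ) ^ 2)⁻¹ * (B + ((s : ℂ) ^ 2)⁻¹ * D)) • F 0 1 +
        deltaTensor (1, 0) k l • (((s : ℂ) ^ 2)⁻¹ * B) • F 0 0) -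
      deltaTensor (1, 1) i j • (deltaTensor (0, 0) k l •
          (((s : ℂ) ^ 2)⁻¹ * (C + (s : ℂ) ^ 2 * D)) • F 0 1 +
        deltaTensor (1, 0) k l • ((s : ℂ) ^ 2 * C) • F 1 1) +
      deltaTensor (0, 1) i j • deltaTensor (1, 0) k l • D • F 0 1 := by
  rw [matOp_delta, Fintype.sum_prod_type]
  simp only [Fin.sum_univ_two, endoMatrix_column_00, endoMatrix_column_10, endoMatrix_column_11,
    endoMatrix_column_01]
  module

/-- The tensor `θ_I ⊗ θ_J`. -/
def deltaTwo (I J : Idx) : TwoLegs (TwoLegs ℂ) := fun i j => deltaTensor I i j • deltaTensor J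

variable (s) in
/-- The twofold action of an endomorphism on `θ_{21} ⊗ θ_{21} ⊗ θ`. -/
def recoupled (A B C D : ℂ) : TwoLegs (TwoLegs (TwoLegs ℂ)) :=
  matOp (endoMatrix s A B C D) (fun i j => deltaTensor (1, 0) i j •
    matOp (endoMatrix s A B C D) fun i j => deltaTensor (1, 0) i j •
      (deltaTensor (0, 1) - (s : ℂ) ^ 2 • deltaTensor (1, 0)))

theorem recoupled_00 (A B C D : ℂ) : recoupled s A B C D 0 0 =
    -(((s : ℂ) ^ 2)⁻¹ * (B + ((s : ℂ) ^ 2)⁻¹ * D) * D) • deltaTwo (1, 1) (1, 0) +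
    (((s : ℂ) ^ 2)⁻¹ * B * (((s : ℂ) ^ 2)⁻¹ * (B + ((s : ℂ) ^ 2)⁻¹ * D))) • deltaTwo (1, 0) (1, 1) := by
  funext k l m n
  rw [recoupled, matOp_endoMatrix_delta]
  simp only [Pi.add_apply, Pi.sub_apply, Pi.smul_apply, matOp_endoMatrix_delta, deltaTwo, smul_eq_mul]
  simp only [deltaTensor_values, one_mul, zero_mul, mul_zero, add_zero, zero_add, sub_zero, zero_sub]
  ring

theorem recoupled_11 (A B C D : ℂ) : recoupled s A B C D 1 1 =
    -(((s : ℂ) ^ 2)⁻¹ * (C + (s : ℂ) ^ 2 * D) * D) • deltaTwo (0, 0) (1, 0) +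
    (C * (C + (s : ℂ) ^ 2 * D)) • deltaTwo (1, 0) (0, 0) := by
  have hs : (s : ℂ) ≠ 0 := s.ne_zero
  funext k l m n
  rw [recoupled, matOp_endoMatrix_delta]
  simp only [Pi.add_apply, Pi.sub_apply, Pi.smul_apply, matOp_endoMatrix_delta, deltaTwo, smul_eq_mul]
  simp only [deltaTensor_values, one_mul, zero_mul, mul_zero, add_zero, zero_add, sub_zero, zero_sub]
  field_simp
  ring

theorem recoupled_10 (A B C D a₁ : ℂ) (ha : A + (s : ℂ) ^ 2 * B + ((s : ℂ) ^ 2)⁻¹ * C + D = a₁) :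
    ∃ z : ℂ, recoupled s A B C D 1 0 = (a₁ * D) • deltaTwo (0, 1) (1, 0) +
      (A * a₁) • deltaTwo (1, 0) (0, 1) + z • deltaTwo (1, 0) (1, 0) -
      ((A + (s : ℂ) ^ 2 * B) * (((s : ℂ) ^ 2)⁻¹ * (B + ((s : ℂ) ^ 2)⁻¹ * D))) • deltaTwo (0, 0) (1, 1) -
      ((A + ((s : ℂ) ^ 2)⁻¹ * C) * (((s : ℂ) ^ 2)⁻¹ * (C + (s : ℂ) ^ 2 * D))) •
        deltaTwo (1, 1) (0, 0) := by
  refine ⟨-(((s : ℂ) ^ 2)⁻¹ * (C + (s : ℂ) ^ 2 * D) * ((s : ℂ) ^ 2 - ((s : ℂ) ^ 2)⁻¹)) * D +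
    A * (-(((s : ℂ) ^ 2)⁻¹ * (C + (s : ℂ) ^ 2 * D) * ((s : ℂ) ^ 2 - ((s : ℂ) ^ 2)⁻¹)) -
      (s : ℂ) ^ 2 * A), ?_⟩
  funext k l m n
  rw [recoupled, matOp_endoMatrix_delta, ha]
  simp only [Pi.add_apply, Pi.sub_apply, Pi.smul_apply, matOp_endoMatrix_delta, deltaTwo, smul_eq_mul, ha]
  simp only [deltaTensor_values, one_mul, zero_mul, mul_zero, add_zero, zero_add, sub_zero, zero_sub]
  ring

end Recoupling

section Detection

variable {s : ℂˣ} {ε : ℤˣ} {g : BimodHom (OSLq s) (GamTwo s ε) (OSLq s)}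

theorem metricMap_deltaTwo (I J : Idx) : metricMap s (deltaTwo I J) =
    ∑ x, ∑ y, Ccheck s I.1 x * Ccheck s y J.2 * RhatInv s (x, y) (I.2, J.1) := by
  have h : ∀ i j k l, matOp (leg23 (RhatInv s)) (deltaTwo I J) i j k l =
      leg23 (RhatInv s) ((i, j), (k, l)) (I, J) := by
    intro i j k l
    refine (matOp_delta (leg23 (RhatInv s)) I (deltaTensor J) i j k l).trans ?_
    rw [Fintype.sum_eq_single J fun M hM => by
      rw [deltaTensor, if_neg hM, smul_zero], deltaTensor, if_pos rfl, smul_eq_mul, mul_one]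
  obtain ⟨a, b⟩ := I
  obtain ⟨c, d⟩ := J
  rw [metricMap_apply, ← matOp_leg23, RhatPow_neg_one]
  simp only [capMap, LinearMap.coe_mk, AddHom.coe_mk, Fin.sum_univ_two, Pi.add_apply, Pi.smul_apply,
    smul_eq_mul, h]
  simp only [leg23, Matrix.of_apply]
  fin_cases a <;> fin_cases d <;> simp <;> ring

theorem metricMap_deltaTwo_00 (J : Idx) :
    metricMap s (deltaTwo (0, 0) J) = if J = (1, 1) then (s : ℂ)⁻¹ else 0 := by
  have hs := s.ne_zero
  obtain ⟨j, k⟩ := J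
  rw [metricMap_deltaTwo]
  simp only [Fin.sum_univ_two]
  fin_cases j <;> fin_cases k <;> simp [RhatInv, Ccheck, hs]

theorem metricMap_deltaTwo_11 (J : Idx) :
    metricMap s (deltaTwo (1, 1) J) = if J = (0, 0) then (s : ℂ) ^ 3 else 0 := by
  have hs := s.ne_zero
  obtain ⟨j, k⟩ := J
  rw [metricMap_deltaTwo]
  simp only [Fin.sum_univ_two]
  fin_cases j <;> fin_cases k <;> simp [RhatInv, Ccheck, hs]
  ring

theorem metricMap_deltaTwo_10 (J : Idx) :
    metricMap s (deltaTwo (1, 0) J) = if J = (0, 1) then -(s : ℂ)⁻¹ else 0 := by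
  have hs := s.ne_zero
  obtain ⟨j, k⟩ := J
  rw [metricMap_deltaTwo]
  simp only [Fin.sum_univ_two]
  fin_cases j <;> fin_cases k <;> simp [RhatInv, Ccheck, hs]

theorem metricMap_deltaTwo_01 (J : Idx) :
    metricMap s (deltaTwo (0, 1) J) = if J = (1, 0) then -(s : ℂ)⁻¹ else
      if J = (0, 1) then ((s : ℂ) ^ 3)⁻¹ - s else 0 := by
  have hs := s.ne_zero
  obtain ⟨j, k⟩ := J
  rw [metricMap_deltaTwo]
  simp only [Fin.sum_univ_two]
  fin_cases j <;> fin_cases k <;> simp [RhatInv, Ccheck, hs]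
  field_simp

variable {κ : ℂ}

variable (g κ) in
/-- The spin representation of the quantum Clifford algebra exists for the metric `g`. -/
def IsSpinMetric : Prop := ∀ x : GamTwo s ε, braiding s ε x = x →
  pairTwo (spin_isBimodPair (s := s) (ε := ε) κ) x = spinAlg s ε (g x)

/-- The spin representation of the quantum Clifford algebra. -/
def spinCl (h : IsSpinMetric g κ) : QCl (braiding s ε) g →+* SpinAlg :=
  clLift (spin_isBimodPair κ) h

/-- The map `γ ⊗ y ↦ g(γ₀ ⊗ γ) y` in the spin representation. -/
def spinDetect (h : IsSpinMetric g κ) (γ₀ : Gam s ε) :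
    BalTensor (OSLq s) (Gam s ε) (QCl (braiding s ε) g) →+ SpinAlg :=
  balLift (biadd (fun γ y => spinAlg s ε (g (btmul (OSLq s) γ₀ γ)) * spinCl h y)
    (fun p p' q => by rw [btmul_add_right, map_add, map_add, add_mul])
    (fun p q q' => by rw [map_add, mul_add]))
    (fun m a n => by
      simp only [biadd_apply]
      rw [← op_smul_btmul, g.map_right, op_smul_eq_mul, map_mul, smul_cl, map_mul, mul_assoc]
      congr 2
      exact (clLift_clAlg (spin_isBimodPair κ) h a).symm)

theorem spinDetect_btmul (h : IsSpinMetric g κ) (γ₀ γ : Gam s ε) (y) :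
    spinDetect h γ₀ (btmul (OSLq s) γ y) =
      spinAlg s ε (g (btmul (OSLq s) γ₀ γ)) * spinCl h y := rfl

variable (s κ) in
/-- The quadratic element with the given coordinates in the spin representation. -/
def spinQuad : TwoLegs (TwoLegs ℂ) →ₗ[ℂ] SpinAlg where
  toFun f := ∑ p : Idx × Idx, f p.1.1 p.1.2 p.2.1 p.2.2 • (spinTheta s κ p.1 * spinTheta s κ p.2)
  map_add' f f' := by simp only [Pi.add_apply, add_smul, Finset.sum_add_distrib]
  map_smul' c f := by simp only [Pi.smul_apply, smul_assoc, Finset.smul_sum, RingHom.id_apply]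

theorem spinQuad_apply (f : TwoLegs (TwoLegs ℂ)) : spinQuad s κ f =
    ∑ p : Idx × Idx, f p.1.1 p.1.2 p.2.1 p.2.2 • (spinTheta s κ p.1 * spinTheta s κ p.2) := rfl

theorem spinQuad_deltaTwo (I J : Idx) :
    spinQuad s κ (deltaTwo I J) = Matrix.fromBlocks (κ • (spinUp s I * spinDown s J)) 0 0
      (κ • (spinDown s I * spinUp s J)) := by
  rw [spinQuad_apply, Fintype.sum_eq_single (I, J) fun p hp => ?_]
  · simp [deltaTwo, deltaTensor, spinTheta, Matrix.fromBlocks_multiply]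
  · have : ¬ (p.1 = I ∧ p.2 = J) := fun h => hp (Prod.ext h.1 h.2)
    simp only [deltaTwo, deltaTensor, Pi.smul_apply, smul_eq_mul]
    by_cases e1 : p.1 = I
    · rw [if_neg (c := (p.2.1, p.2.2) = J) fun e2 => this ⟨e1, e2⟩, mul_zero, zero_smul]
    · rw [if_neg (c := (p.1.1, p.1.2) = I) e1, zero_mul, zero_smul]

theorem spinCl_pairTwo_vecTwo (h : IsSpinMetric g κ) (f : TwoLegs (TwoLegs ℂ)) :
    spinCl h (pairTwo (cl_isBimodPair (braiding s ε) g) (vecTwo s ε f)) = spinQuad s κ f := by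
  rw [vecTwo_apply, map_sum, map_sum, spinQuad_apply]
  refine Finset.sum_congr rfl fun p _ => ?_
  have h1 : ∀ a, spinCl h (clAlg (braiding s ε) g a) = spinAlg s ε a :=
    fun a => clLift_clAlg (spin_isBimodPair κ) h a
  have h2 : ∀ I, spinCl h (clGam (braiding s ε) g (theta s ε I)) = spinTheta s κ I :=
    fun I => (clLift_clGam (spin_isBimodPair κ) h _).trans (spinGam_theta κ I)
  rw [pairTwo_smul, thetaTwo, pairTwo_btmul, map_mul, map_mul, h1, h2, h2, AlgHom.commutes,
    ← Algebra.smul_def]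

theorem spinDetect_evalThree {κ₀ : ℂ} (h : IsSpinMetric g κ)
    (hκ : ∀ x, g x = ∑ r, sortedCoords s ε x r *
      algebraMap ℂ (OSLq s) (κ₀ * (Ccheck s r.1.1 r.1.2 * Ccheck s r.2.1 r.2.2))) (I : Idx)
    (w : TwoLegs (TwoLegs (TwoLegs ℂ))) :
    spinDetect h (theta s ε I) (evalThree (braiding s ε) g w) =
      ∑ J : Idx, (κ₀ * metricMap s (deltaTwo I J)) • spinQuad s κ (w J.1 J.2) := by
  rw [evalThree_apply, map_sum]
  refine Finset.sum_congr rfl fun J _ => ?_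
  rw [spinDetect_btmul, spinCl_pairTwo_vecTwo]
  have e : btmul (OSLq s) (theta s ε I) (theta s ε J) = vecTwo s ε (deltaTwo I J) :=
    (vecTwo_delta I J).symm
  rw [e, metric_vecTwo hκ, AlgHom.commutes, ← Algebra.smul_def]

end Detection

section Conditions

variable {s : ℂˣ} {ε : ℤˣ} {g : BimodHom (OSLq s) (GamTwo s ε) (OSLq s)} {κ : ℂ}

theorem metric_symmetrizer {d : ℂ} (hd : (s : ℂ) ^ 2 + ((s : ℂ) ^ 2)⁻¹ = d)
    (hκ : ∀ x, g x = ∑ r, sortedCoords s ε x r *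
      algebraMap ℂ (OSLq s) (κ * (Ccheck s r.1.1 r.1.2 * Ccheck s r.2.1 r.2.2))) (x : GamTwo s ε) :
    g (leftLinear s ε (endoMatrix s (d ^ 2) (-d) (-d) 2) x) = algebraMap ℂ (OSLq s) (d ^ 2) * g x := by
  have h : ∀ t : Idx × Idx, ∑ r : Idx × Idx, sortedMatrix s (d ^ 2) (-d) (-d) 2 r t *
      (Ccheck s r.1.1 r.1.2 * Ccheck s r.2.1 r.2.2) =
      d ^ 2 * (Ccheck s t.1.1 t.1.2 * Ccheck s t.2.1 t.2.2) := by
    intro t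
    rw [Fintype.sum_prod_type]
    have : ∀ a : Idx, ∑ b : Idx, sortedMatrix s (d ^ 2) (-d) (-d) 2 (a, b) t *
        (Ccheck s a.1 a.2 * Ccheck s b.1 b.2) =
        d * Ccheck s t.1.1 t.1.2 * Ccheck s t.2.1 t.2.2 * (Ccheck s a.1 a.2 * Ccheck s a.1 a.2) := by
      intro a
      rw [← mul_assoc, ← sum_symmetrizer_right hd, Finset.sum_mul]
      exact Finset.sum_congr rfl fun b _ => by ring
    simp only [this]
    rw [← Finset.mul_sum, sum_Ccheck_mul_self, hd]
    ring
  rw [hκ, hκ, Finset.mul_sum]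
  simp only [sortedCoords_endo, Finset.sum_mul]
  rw [Finset.sum_comm]
  refine Finset.sum_congr rfl fun t _ => ?_
  simp only [mul_assoc, ← map_mul, ← Finset.mul_sum, ← map_sum]
  rw [← mul_assoc (algebraMap ℂ (OSLq s) (d ^ 2)), Algebra.commutes, mul_assoc, ← map_mul]
  refine congrArg (fun c => sortedCoords s ε x t * algebraMap ℂ (OSLq s) c) ?_
  rw [mul_left_comm, ← h t, Finset.mul_sum]
  exact Finset.sum_congr rfl fun r _ => by ring

theorem pairTwo_act_algebraMap_smul {σ : GamTwo s ε →+ GamTwo s ε}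
    (τ : BimodHom (OSLq s) (GamTwo s ε) (GamTwo s ε)) (c : ℂ) (x : GamTwo s ε)
    (z : BalTensor (OSLq s) (Gam s ε) (QCl σ g)) :
    pairTwo (act_isBimodPair (σ := σ) (g := g) τ) x (algebraMap ℂ (OSLq s) c • z) =
      algebraMap ℂ (OSLq s) c • pairTwo (act_isBimodPair τ) x z := by
  have h1 := DFunLike.congr_fun (pairTwo_op_smul (act_isBimodPair (σ := σ) (g := g) τ)
    (algebraMap ℂ (OSLq s) c) x) z
  rw [op_algebraMap_smul_gamTwo, pairTwo_act_smul, end_mul_apply, algAct_apply] at h1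
  exact h1.symm

theorem thetaInv_tmul_one {σ : GamTwo s ε →+ GamTwo s ε} :
    (btmul (OSLq s) (thetaInv s ε) 1 : BalTensor (OSLq s) (Gam s ε) (QCl σ g)) =
      algebraMap ℂ (OSLq s) ((s : ℂ) ^ 2 - ((s : ℂ) ^ 2)⁻¹)⁻¹ •
        (btmul (OSLq s) (theta s ε (0, 1)) 1 -
          algebraMap ℂ (OSLq s) ((s : ℂ) ^ 2) • btmul (OSLq s) (theta s ε (1, 0)) 1) := by
  rw [thetaInv_eq, ← smul_btmul, btmul_sub_left, smul_btmul _ (theta s ε (1, 0))]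

theorem matOp_delta_sub_smul {X : Type*} [AddCommGroup X] [Module ℂ X]
    (T : Matrix (Idx × Idx) (Idx × Idx) ℂ) (I : Idx) (F G : TwoLegs X) (c : ℂ) :
    matOp T (fun i j => deltaTensor I i j • (F - c • G)) =
      matOp T (fun i j => deltaTensor I i j • F) - c • matOp T (fun i j => deltaTensor I i j • G) := by
  funext i j k l
  simp only [matOp_delta, Pi.sub_apply, Pi.smul_apply]
  simp only [smul_sub, Finset.sum_sub_distrib, Finset.smul_sum, smul_comm c]

theorem evalThree_recoupled (hq : ∀ n : ℕ, 0 < n → ((s : ℂ) ^ 2) ^ n ≠ 1)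
    (hκ : ∀ x, g x = ∑ r, sortedCoords s ε x r *
      algebraMap ℂ (OSLq s) (κ * (Ccheck s r.1.1 r.1.2 * Ccheck s r.2.1 r.2.2)))
    {A B C D : ℂ}
    (h : ∀ x, braiding s ε x = x → pairTwo (act_isBimodPair (σ := braiding s ε) (g := g)
      (endoHom s ε A B C D)) x (btmul (OSLq s) (thetaInv s ε) 1) =
        g x • btmul (OSLq s) (thetaInv s ε) 1) :
    evalThree (braiding s ε) g (recoupled s A B C D) = 0 := by
  have e0 : thetaTwo s ε ((1, 0), (1, 0)) = vecTwo s ε (deltaTwo (1, 0) (1, 0)) :=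
    (vecTwo_delta _ _).symm
  have e1 : braiding s ε (thetaTwo s ε ((1, 0), (1, 0))) = thetaTwo s ε ((1, 0), (1, 0)) := by
    rw [e0, braiding, leftLinear_vecTwo, braidingMatrix_eq_endoMatrix]
    refine congrArg (vecTwo s ε) ?_
    funext i j k l
    refine (matOp_endoMatrix_delta _ _ _ _ _ i j k l).trans ?_
    simp [deltaTensor_values, deltaTwo]
  have e2 : g (thetaTwo s ε ((1, 0), (1, 0))) = 0 := by
    rw [e0, metric_vecTwo hκ, metricMap_deltaTwo_10, if_neg (by decide), mul_zero, map_zero]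
  have e3 := h _ e1
  rw [e2, zero_smul, thetaInv_tmul_one, pairTwo_act_algebraMap_smul, map_sub,
    pairTwo_act_algebraMap_smul, pairTwo_act_thetaTwo (endoHom_apply A B C D),
    pairTwo_act_thetaTwo (endoHom_apply A B C D), ← evalThree_smul, ← map_sub] at e3
  have e4 := algebraMap_smul_cancel (s := s) (inv_ne_zero (q_sub_inv_ne_zero hq)) (e3.trans (smul_zero _).symm)
  rw [← e4, recoupled]
  exact congrArg (evalThree (braiding s ε) g) (by rw [matOp_delta_sub_smul, matOp_delta_sub_smul])

theorem spinQuad_recoupled (hκ0 : κ ≠ 0)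
    (hκ : ∀ x, g x = ∑ r, sortedCoords s ε x r *
      algebraMap ℂ (OSLq s) (κ * (Ccheck s r.1.1 r.1.2 * Ccheck s r.2.1 r.2.2)))
    {μ : ℂ} (hs : IsSpinMetric g μ) {w : TwoLegs (TwoLegs (TwoLegs ℂ))}
    (hw : evalThree (braiding s ε) g w = 0) :
    spinQuad s μ (w 0 0) = 0 ∧ spinQuad s μ (w 1 1) = 0 ∧ spinQuad s μ (w 0 1) = 0 ∧
      spinQuad s μ (w 1 0) = 0 := by
  have h : ∀ I : Idx, ∑ J : Idx, (κ * metricMap s (deltaTwo I J)) • spinQuad s μ (w J.1 J.2) = 0 :=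
    fun I => by rw [← spinDetect_evalThree hs hκ, hw, map_zero]
  have hs0 := s.ne_zero
  have h00 := h (0, 0)
  have h11 := h (1, 1)
  have h10 := h (1, 0)
  have h01 := h (0, 1)
  simp only [metricMap_deltaTwo_00, metricMap_deltaTwo_11, metricMap_deltaTwo_10,
    metricMap_deltaTwo_01, mul_ite, mul_zero, ite_smul, zero_smul, Finset.sum_ite_eq',
    Finset.mem_univ, if_true] at h00 h11 h10 h01
  have z00 := (smul_eq_zero.1 h00).resolve_left (mul_ne_zero hκ0 (inv_ne_zero hs0))
  have z11 := (smul_eq_zero.1 h11).resolve_left (mul_ne_zero hκ0 (pow_ne_zero 3 hs0))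
  have z10 := (smul_eq_zero.1 h10).resolve_left (mul_ne_zero hκ0 (neg_ne_zero.2 (inv_ne_zero hs0)))
  refine ⟨z11, z00, z10, ?_⟩
  have h01' : (κ * -(s : ℂ)⁻¹) • spinQuad s μ (w 1 0) = 0 := by
    rw [← h01, Fintype.sum_eq_single (1, 0) fun J hJ => ?_]
    · simp
    · rw [if_neg hJ]
      split_ifs with hJ'
      · rw [hJ', z10, smul_zero]
      · rfl
  exact (smul_eq_zero.1 h01').resolve_left (mul_ne_zero hκ0 (neg_ne_zero.2 (inv_ne_zero hs0)))

theorem recoupling_equations {μ : ℂ} (hμ : μ ≠ 0)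
    {A B C D : ℂ} (h00 : spinQuad s μ (recoupled s A B C D 0 0) = 0)
    (h11 : spinQuad s μ (recoupled s A B C D 1 1) = 0)
    (h10 : spinQuad s μ (recoupled s A B C D 1 0) = 0) {q a : ℂ} (hqs : (s : ℂ) ^ 2 = q)
    (ha : A + q * B + q⁻¹ * C + D = a) :
    (B + q⁻¹ * D) * (B + q * D) = 0 ∧ (C + q * D) * (q * C + D) = 0 ∧
    a * D = -(A + q * B) * (q⁻¹ * (B + q⁻¹ * D)) ∧ A * a = -(A + q * B) * (q⁻¹ * (B + q⁻¹ * D)) ∧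
    A * a = - q * (A + q⁻¹ * C) * (C + q * D) := by
  have hs := s.ne_zero
  subst hqs
  obtain ⟨z, hz⟩ := recoupled_10 (s := s) A B C D a ha
  rw [recoupled_00] at h00
  rw [recoupled_11] at h11
  rw [hz] at h10
  simp only [map_add, map_sub, map_smul, spinQuad_deltaTwo, spinUp_eq, spinDown_eq] at h00 h11 h10
  have f00 := congrFun (congrFun h00 (Sum.inl 0)) (Sum.inl 1)
  have f11 := congrFun (congrFun h11 (Sum.inr 1)) (Sum.inr 0)
  have f1 := congrFun (congrFun h10 (Sum.inl 0)) (Sum.inl 0)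
  have f2 := congrFun (congrFun h10 (Sum.inl 1)) (Sum.inl 1)
  have f3 := congrFun (congrFun h10 (Sum.inr 1)) (Sum.inr 1)
  simp at f00 f11 f1 f2 f3
  refine ⟨?_, ?_, ?_, ?_, ?_⟩
  · field_simp at f00 ⊢
    refine mul_left_cancel₀ hμ ?_
    linear_combination f00
  · field_simp at f11 ⊢
    refine mul_left_cancel₀ hμ ?_
    linear_combination f11
  · field_simp at f2 ⊢
    refine mul_left_cancel₀ hμ ?_
    linear_combination f2
  · field_simp at f3 ⊢
    refine mul_left_cancel₀ hμ ?_
    linear_combination f3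
  · field_simp at f1 ⊢
    refine mul_left_cancel₀ hμ ?_
    linear_combination f1

end Conditions

section Solve

variable {s : ℂˣ} {ε : ℤˣ} {g : BimodHom (OSLq s) (GamTwo s ε) (OSLq s)} {κ : ℂ}

/-- The solutions of the recoupling equations. -/
theorem recoupling_solutions {q A B C D : ℂ} (hq : q ≠ 0) (hq4 : q ^ 4 ≠ 1)
    (h1 : (B + q⁻¹ * D) * (B + q * D) = 0) (h2 : (C + q * D) * (q * C + D) = 0)
    (h3 : (A + q * B + q⁻¹ * C + D) * D = -(A + q * B) * (q⁻¹ * (B + q⁻¹ * D)))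
    (h4 : A * (A + q * B + q⁻¹ * C + D) = -(A + q * B) * (q⁻¹ * (B + q⁻¹ * D)))
    (h5 : A * (A + q * B + q⁻¹ * C + D) = -q * (A + q⁻¹ * C) * (C + q * D)) :
    (B = -(q⁻¹ * D) ∧ C = -(q * D) ∧ A = D) ∨ (B = -(q * D) ∧ C = -(q⁻¹ * D) ∧ A = D) ∨
    (B = -(q⁻¹ * D) ∧ C = -(q⁻¹ * D) ∧ A = (q ^ 2)⁻¹ * D) ∨
    (B = -(q * D) ∧ C = -(q * D) ∧ A = q ^ 2 * D) := by
  have hsq : ∀ z : ℂ, z * z = 0 → z = 0 := fun z h => (mul_self_eq_zero.1 h)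
  have hq2 : q ^ 2 - 1 ≠ 0 := fun h => hq4 (by linear_combination (q ^ 2 + 1) * h)
  rcases mul_eq_zero.1 h1 with hB | hB <;> rcases mul_eq_zero.1 h2 with hC | hC
  · refine Or.inl ⟨eq_neg_of_add_eq_zero_left hB, eq_neg_of_add_eq_zero_left hC, ?_⟩
    obtain rfl : B = -(q⁻¹ * D) := eq_neg_of_add_eq_zero_left hB
    obtain rfl : C = -(q * D) := eq_neg_of_add_eq_zero_left hC
    refine sub_eq_zero.1 (hsq _ ?_)
    field_simp at h3 h4
    refine mul_left_cancel₀ (pow_ne_zero 2 hq) ?_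
    linear_combination h4 - h3
  · have hC' : C = -(q⁻¹ * D) := by field_simp; linear_combination hC
    refine Or.inr (Or.inr (Or.inl ⟨eq_neg_of_add_eq_zero_left hB, hC', ?_⟩))
    obtain rfl : B = -(q⁻¹ * D) := eq_neg_of_add_eq_zero_left hB
    subst hC'
    refine sub_eq_zero.1 (hsq _ ?_)
    have e3 : (A - (q ^ 2)⁻¹ * D) * D = 0 := by
      field_simp at h3 ⊢
      linear_combination h3
    have e4 : A * (A - (q ^ 2)⁻¹ * D) = 0 := by
      field_simp at h4 ⊢
      linear_combination h4
    linear_combination e4 - (q ^ 2)⁻¹ * e3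
  · refine Or.inr (Or.inr (Or.inr ⟨eq_neg_of_add_eq_zero_left hB, eq_neg_of_add_eq_zero_left hC, ?_⟩))
    obtain rfl : B = -(q * D) := eq_neg_of_add_eq_zero_left hB
    obtain rfl : C = -(q * D) := eq_neg_of_add_eq_zero_left hC
    refine sub_eq_zero.1 (hsq _ ?_)
    have e5 : A * (A - q ^ 2 * D) = 0 := by
      field_simp at h5 ⊢
      linear_combination h5
    have e3 : (A - q ^ 2 * D) * D = 0 := by
      have := h3.trans h4.symm
      field_simp at this
      linear_combination this + e5
    linear_combination e5 - q ^ 2 * e3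
  · have hC' : C = -(q⁻¹ * D) := by field_simp; linear_combination hC
    refine Or.inr (Or.inl ⟨eq_neg_of_add_eq_zero_left hB, hC', ?_⟩)
    obtain rfl : B = -(q * D) := eq_neg_of_add_eq_zero_left hB
    subst hC'
    have e : (A + q * -(q * D) + q⁻¹ * -(q⁻¹ * D) + D) * (A - D) = 0 := by
      linear_combination h4 - h3
    rcases mul_eq_zero.1 e with e | e
    · have hD : (q ^ 4 - 1) * (D * D) = 0 := by
        rw [e] at h4 h5
        field_simp at h4 h5
        refine mul_left_cancel₀ hq2 ?_
        linear_combination q ^ 2 * h4 + h5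
      have hD0 := hsq D ((mul_eq_zero.1 hD).resolve_left (sub_ne_zero.2 hq4))
      rw [hD0] at e ⊢
      linear_combination e
    · exact sub_eq_zero.1 e

theorem exists_smul_flipMatrix (hq : ∀ n : ℕ, 0 < n → ((s : ℂ) ^ 2) ^ n ≠ 1) {A B C D : ℂ}
    (h1 : (B + ((s : ℂ) ^ 2)⁻¹ * D) * (B + (s : ℂ) ^ 2 * D) = 0)
    (h2 : (C + (s : ℂ) ^ 2 * D) * ((s : ℂ) ^ 2 * C + D) = 0)
    (h3 : (A + (s : ℂ) ^ 2 * B + ((s : ℂ) ^ 2)⁻¹ * C + D) * D =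
      -(A + (s : ℂ) ^ 2 * B) * (((s : ℂ) ^ 2)⁻¹ * (B + ((s : ℂ) ^ 2)⁻¹ * D)))
    (h4 : A * (A + (s : ℂ) ^ 2 * B + ((s : ℂ) ^ 2)⁻¹ * C + D) =
      -(A + (s : ℂ) ^ 2 * B) * (((s : ℂ) ^ 2)⁻¹ * (B + ((s : ℂ) ^ 2)⁻¹ * D)))
    (h5 : A * (A + (s : ℂ) ^ 2 * B + ((s : ℂ) ^ 2)⁻¹ * C + D) =
      -(s : ℂ) ^ 2 * (A + ((s : ℂ) ^ 2)⁻¹ * C) * (C + (s : ℂ) ^ 2 * D)) :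
    ∃ (c : ℂ) (η η' : ℤˣ), endoMatrix s A B C D = c • flipMatrix s η η' := by
  have hs := s.ne_zero
  rcases recoupling_solutions (pow_ne_zero 2 hs) (hq 4 (by norm_num)) h1 h2 h3 h4 h5 with
    ⟨rfl, rfl, rfl⟩ | ⟨rfl, rfl, rfl⟩ | ⟨rfl, rfl, rfl⟩ | ⟨rfl, rfl, rfl⟩
  · refine ⟨A, 1, -1, ?_⟩
    rw [flipMatrix_eq, smul_endoMatrix]
    congr 1 <;> simp [hs] <;> ring
  · refine ⟨A, -1, 1, ?_⟩
    rw [flipMatrix_eq, smul_endoMatrix]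
    congr 1 <;> simp [hs] <;> ring
  · refine ⟨((s : ℂ) ^ 2)⁻¹ * D, -1, -1, ?_⟩
    rw [flipMatrix_eq, smul_endoMatrix]
    congr 1 <;> simp [hs] <;> field_simp
  · refine ⟨(s : ℂ) ^ 2 * D, 1, 1, ?_⟩
    rw [flipMatrix_eq, smul_endoMatrix]
    congr 1 <;> simp [hs] <;> field_simp

theorem metric_scalar_ne_zero (hg : IsBicovariantSigmaMetric g)
    (hκ : ∀ x, g x = ∑ r, sortedCoords s ε x r *
      algebraMap ℂ (OSLq s) (κ * (Ccheck s r.1.1 r.1.2 * Ccheck s r.2.1 r.2.2))) : κ ≠ 0 := by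
  rintro rfl
  have h := hg.nondegenerate_left (theta s ε (0, 0)) fun ρ => by
    rw [hκ]
    simp only [zero_mul, map_zero, mul_zero, Finset.sum_const_zero]
  have h1 : (1 : OSLq s) = 0 := by
    have := congrFun h (0, 0)
    rw [theta, if_pos rfl] at this
    exact this
  rw [← map_one (algebraMap ℂ (OSLq s)), ← map_zero (algebraMap ℂ (OSLq s))] at h1
  exact one_ne_zero (algebraMap_slq_injective h1)

theorem spinDetect_thetaInv (hκ : ∀ x, g x = ∑ r, sortedCoords s ε x r *
      algebraMap ℂ (OSLq s) (κ * (Ccheck s r.1.1 r.1.2 * Ccheck s r.2.1 r.2.2)))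
    {μ : ℂ} (h : IsSpinMetric g μ) (c : ℂ) :
    spinDetect h (theta s ε (1, 0)) (algebraMap ℂ (OSLq s) c • btmul (OSLq s) (thetaInv s ε) 1) =
      algebraMap ℂ SpinAlg (c * (((s : ℂ) ^ 2 - ((s : ℂ) ^ 2)⁻¹)⁻¹ * (κ * -(s : ℂ)⁻¹))) := by
  have h1 : ∀ (c : ℂ) z, spinDetect h (theta s ε (1, 0)) (algebraMap ℂ (OSLq s) c • z) =
      algebraMap ℂ SpinAlg c * spinDetect h (theta s ε (1, 0)) z := by
    intro c z
    induction z using bal_induction with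
    | h0 => simp
    | ht m n =>
      rw [smul_btmul, spinDetect_btmul, spinDetect_btmul, ← btmul_balance, op_algebraMap_smul,
        ← algebraMap_smul (OSLq s), ← smul_btmul, g.map_left, smul_eq_mul, map_mul, AlgHom.commutes,
        mul_assoc]
    | ha x y hx hy => rw [smul_add, map_add, map_add, hx, hy, mul_add]
  have h2 : ∀ J, spinDetect h (theta s ε (1, 0)) (btmul (OSLq s) (theta s ε J) 1) =
      algebraMap ℂ SpinAlg (κ * metricMap s (deltaTwo (1, 0) J)) := by
    intro J
    have e : btmul (OSLq s) (theta s ε (1, 0)) (theta s ε J) = vecTwo s ε (deltaTwo (1, 0) J) :=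
      (vecTwo_delta _ J).symm
    rw [spinDetect_btmul, map_one, mul_one, e, metric_vecTwo hκ, AlgHom.commutes]
  rw [thetaInv_tmul_one, h1, h1, map_sub, h1, h2, h2, metricMap_deltaTwo_10, metricMap_deltaTwo_10,
    if_pos rfl, if_neg (by decide), mul_zero, map_zero, mul_zero, sub_zero, ← map_mul, ← map_mul]

theorem isSpinMetric (hq : ∀ n : ℕ, 0 < n → ((s : ℂ) ^ 2) ^ n ≠ 1)
    (hκ : ∀ x, g x = ∑ r, sortedCoords s ε x r *
      algebraMap ℂ (OSLq s) (κ * (Ccheck s r.1.1 r.1.2 * Ccheck s r.2.1 r.2.2))) :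
    IsSpinMetric g (-(κ * ((s : ℂ) ^ 2 + ((s : ℂ) ^ 2)⁻¹))) :=
  pairTwo_spin_of_fixed hq hκ rfl

/-- A multiple of `σ̃` that defines a compatible connection is `±σ̃`. -/
theorem sq_eq_one_of_act (hq : ∀ n : ℕ, 0 < n → ((s : ℂ) ^ 2) ^ n ≠ 1) (hκ0 : κ ≠ 0)
    (hκ : ∀ x, g x = ∑ r, sortedCoords s ε x r *
      algebraMap ℂ (OSLq s) (κ * (Ccheck s r.1.1 r.1.2 * Ccheck s r.2.1 r.2.2)))
    {τ : BimodHom (OSLq s) (GamTwo s ε) (GamTwo s ε)} {c : ℂ} {η η' : ℤˣ}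
    (hτ : ∀ x, τ x = leftLinear s ε (c • flipMatrix s η η') x)
    (h : ∀ x, braiding s ε x = x → pairTwo (act_isBimodPair (σ := braiding s ε) (g := g) τ) x
      (btmul (OSLq s) (thetaInv s ε) 1) = g x • btmul (OSLq s) (thetaInv s ε) 1) : c ^ 2 = 1 := by
  have hs := s.ne_zero
  set d := (s : ℂ) ^ 2 + ((s : ℂ) ^ 2)⁻¹ with hd
  have hd0 : d ≠ 0 := q_add_inv_ne_zero hq
  set x := leftLinear s ε (endoMatrix s (d ^ 2) (-d) (-d) 2) (thetaTwo s ε ((0, 0), (1, 1)))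
  have hx : braiding s ε x = x := by
    rw [braiding, ← leftLinear_mul, braidingMatrix_mul_symmetrizer d hd.symm]
  have hgx : g x = algebraMap ℂ (OSLq s) (d ^ 2 * (κ * (s : ℂ)⁻¹)) := by
    have e : thetaTwo s ε ((0, 0), (1, 1)) = vecTwo s ε (deltaTwo (0, 0) (1, 1)) :=
      (vecTwo_delta _ _).symm
    rw [metric_symmetrizer hd.symm hκ, e, metric_vecTwo hκ, metricMap_deltaTwo_00, if_pos rfl, ← map_mul]
  have e1 := (pairTwo_act_flip hq hκ hτ hx _).symm.trans (h x hx)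
  rw [hgx, algebraMap_commute_smul (s := s)] at e1
  have e2 := algebraMap_smul_cancel (s := s) (mul_ne_zero (pow_ne_zero 2 hd0)
    (mul_ne_zero hκ0 (inv_ne_zero hs))) e1
  have e3 : algebraMap ℂ (OSLq s) (c ^ 2 - 1) • (btmul (OSLq s) (thetaInv s ε) 1 :
      BalTensor (OSLq s) (Gam s ε) (QCl (braiding s ε) g)) = 0 := by
    rw [map_sub, map_one, sub_smul, one_smul, e2, sub_self]
  have e4 := spinDetect_thetaInv hκ (isSpinMetric hq hκ) (c ^ 2 - 1)
  rw [e3, map_zero] at e4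
  have e5 := (map_eq_zero (algebraMap ℂ SpinAlg)).1 e4.symm
  refine sub_eq_zero.1 ((mul_eq_zero.1 e5).resolve_right ?_)
  exact mul_ne_zero (inv_ne_zero (q_sub_inv_ne_zero hq))
    (mul_ne_zero hκ0 (neg_ne_zero.2 (inv_ne_zero hs)))

theorem exists_flip_of_act (hq : ∀ n : ℕ, 0 < n → ((s : ℂ) ^ 2) ^ n ≠ 1) (hκ0 : κ ≠ 0)
    (hκ : ∀ x, g x = ∑ r, sortedCoords s ε x r *
      algebraMap ℂ (OSLq s) (κ * (Ccheck s r.1.1 r.1.2 * Ccheck s r.2.1 r.2.2)))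
    {A B C D : ℂ}
    (h : ∀ x, braiding s ε x = x → pairTwo (act_isBimodPair (σ := braiding s ε) (g := g)
      (endoHom s ε A B C D)) x (btmul (OSLq s) (thetaInv s ε) 1) =
        g x • btmul (OSLq s) (thetaInv s ε) 1) :
    ∃ ν η η' : ℤˣ, endoMatrix s A B C D = ((ν : ℤ) : ℂ) • flipMatrix s η η' := by
  have hμ : -(κ * ((s : ℂ) ^ 2 + ((s : ℂ) ^ 2)⁻¹)) ≠ 0 :=
    neg_ne_zero.2 (mul_ne_zero hκ0 (q_add_inv_ne_zero hq))
  obtain ⟨h00, h11, -, h10⟩ := spinQuad_recoupled hκ0 hκ (isSpinMetric hq hκ)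
    (evalThree_recoupled hq hκ h)
  obtain ⟨e1, e2, e3, e4, e5⟩ := recoupling_equations hμ h00 h11 h10 rfl rfl
  obtain ⟨c, η, η', hc⟩ := exists_smul_flipMatrix hq e1 e2 e3 e4 e5
  have hc2 := sq_eq_one_of_act hq hκ0 hκ (fun x => by rw [endoHom_apply, hc]) h
  rcases sq_eq_one_iff.1 hc2 with rfl | rfl
  · exact ⟨1, η, η', by rw [hc]; simp⟩
  · exact ⟨-1, η, η', by rw [hc]; simp⟩

end Solve


section Main

variable {s : ℂˣ} {ε : ℤˣ}

theorem smul_flipMatrix_eq (c : ℂ) (η η' : ℤˣ) : c • flipMatrix s η η' =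
    endoMatrix s (c * ((s : ℂ) ^ (η : ℤ) * (s : ℂ) ^ (η' : ℤ)))
      (c * -((s : ℂ) ^ (-(η : ℤ)) * (s : ℂ) ^ (η' : ℤ)))
      (c * -((s : ℂ) ^ (η : ℤ) * (s : ℂ) ^ (-(η' : ℤ))))
      (c * ((s : ℂ) ^ (-(η : ℤ)) * (s : ℂ) ^ (-(η' : ℤ)))) := by
  rw [flipMatrix_eq, smul_endoMatrix]

variable (s ε) in
/-- The bimodule homomorphism `ν σ̃_{(η, η')}`. -/
def flipHom (ν η η' : ℤˣ) : BimodHom (OSLq s) (GamTwo s ε) (GamTwo s ε) :=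
  leftLinearHom (((ν : ℤ) : ℂ) • flipMatrix s η η') fun k l => by
    rw [smul_flipMatrix_eq]
    exact endoMatrix_comm _ _ _ _ k l

theorem flipHom_apply (ν η η' : ℤˣ) (x : GamTwo s ε) :
    flipHom s ε ν η η' x = leftLinear s ε (((ν : ℤ) : ℂ) • flipMatrix s η η') x := rfl

theorem flipHom_eq_smul_sigmaTilde (ν η η' : ℤˣ) (x : GamTwo s ε) :
    flipHom s ε ν η η' x = (ν : ℤ) • sigmaTilde s ε η η' x := by
  rw [flipHom_apply, leftLinear_matrix_smul, sigmaTilde, map_intCast, Int.cast_smul_eq_zsmul]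

theorem theta_tmul_thetaInv : btmul (OSLq s) (theta s ε (1, 0)) (thetaInv s ε) =
    algebraMap ℂ (OSLq s) ((s : ℂ) ^ 2 - ((s : ℂ) ^ 2)⁻¹)⁻¹ •
      vecTwo s ε fun i j => deltaTensor (1, 0) i j •
        (deltaTensor (0, 1) - (s : ℂ) ^ 2 • deltaTensor (1, 0)) := by
  have e : (fun i j => deltaTensor (1, 0) i j •
      (deltaTensor (0, 1) - (s : ℂ) ^ 2 • deltaTensor (1, 0))) =
      deltaTwo (1, 0) (0, 1) - (s : ℂ) ^ 2 • deltaTwo (1, 0) (1, 0) := by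
    funext i j
    simp only [Pi.sub_apply, Pi.smul_apply, deltaTwo, smul_sub, smul_comm ((s : ℂ) ^ 2)]
  have h : ∀ (c : ℂ) (y : Gam s ε), btmul (OSLq s) (theta s ε (1, 0)) (algebraMap ℂ (OSLq s) c • y) =
      algebraMap ℂ (OSLq s) c • btmul (OSLq s) (theta s ε (1, 0)) y := fun c y => by
    rw [← btmul_balance, op_algebraMap_smul, ← algebraMap_smul (OSLq s) c, smul_btmul]
  have h2 : ∀ J, btmul (OSLq s) (theta s ε (1, 0)) (theta s ε J) = vecTwo s ε (deltaTwo (1, 0) J) :=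
    fun J => (vecTwo_delta _ J).symm
  rw [thetaInv_eq, h, btmul_sub_right, h, h2, h2, e, map_sub, vecTwo_smul]

/-- An endomorphism of `Γ ⊗ Γ` is almost determined by its value on `θ_{21} ⊗ θ`. -/
theorem endo_coeffs_of_connection_eq (hq : ∀ n : ℕ, 0 < n → ((s : ℂ) ^ 2) ^ n ≠ 1)
    {A B C D A' B' C' D' : ℂ}
    (h : leftLinear s ε (endoMatrix s A B C D)
        (btmul (OSLq s) (theta s ε (1, 0)) (thetaInv s ε)) =
      leftLinear s ε (endoMatrix s A' B' C' D')
        (btmul (OSLq s) (theta s ε (1, 0)) (thetaInv s ε))) : B = B' ∧ C = C' ∧ D = D' := by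
  have hs := s.ne_zero
  rw [theta_tmul_thetaInv, leftLinear_smul, leftLinear_smul] at h
  have h1 := algebraMap_smul_cancel (s := s) (inv_ne_zero (q_sub_inv_ne_zero hq)) h
  rw [leftLinear_vecTwo, leftLinear_vecTwo] at h1
  have h2 := fun p => congrArg (fun x => coords s ε x p) h1
  simp only [coords_vecTwo] at h2
  have h3 := fun p => algebraMap_slq_injective (h2 p)
  obtain ⟨a1, a2, a3, a4, b1, b2, b3, b4, c1, c2, c3, c4, d1, d2, d3, d4⟩ := deltaTensor_values
  have hD := h3 ((0, 1), (1, 0))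
  have hB := h3 ((0, 0), (1, 1))
  have hC := h3 ((1, 1), (0, 0))
  simp only [matOp_endoMatrix_delta, Pi.sub_apply, Pi.smul_apply, smul_eq_mul, a1, a2, a3, a4, b1, b2,
    b3, b4, c1, c2, c3, c4, d1, d2, d3, d4, mul_zero, zero_mul, mul_one, one_mul, sub_zero, zero_sub,
    add_zero, zero_add, neg_inj] at hD hB hC
  subst hD
  have hs2 := inv_ne_zero (pow_ne_zero 2 hs)
  exact ⟨add_right_cancel (mul_left_cancel₀ hs2 hB), add_right_cancel (mul_left_cancel₀ hs2 hC), rfl⟩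

theorem units_eq_of_zpow_sq_eq (hq : ∀ n : ℕ, 0 < n → ((s : ℂ) ^ 2) ^ n ≠ 1) {η η' : ℤˣ}
    (h : ((s : ℂ) ^ (-(η : ℤ))) ^ 2 = ((s : ℂ) ^ (-(η' : ℤ))) ^ 2) : η = η' := by
  have hs := s.ne_zero
  have h4 := hq 2 (by norm_num)
  rcases Int.units_eq_one_or η with rfl | rfl <;> rcases Int.units_eq_one_or η' with rfl | rfl
  · rfl
  · refine absurd ?_ h4
    simp at h
    field_simp at h
    linear_combination -h
  · refine absurd ?_ h4
    simp at h
    field_simp at h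
    linear_combination h
  · rfl

theorem flip_params_eq (hq : ∀ n : ℕ, 0 < n → ((s : ℂ) ^ 2) ^ n ≠ 1) {ν η η' ν₁ η₁ η₁' : ℤˣ}
    (h : flipHom s ε ν η η' (btmul (OSLq s) (theta s ε (1, 0)) (thetaInv s ε)) =
      flipHom s ε ν₁ η₁ η₁' (btmul (OSLq s) (theta s ε (1, 0)) (thetaInv s ε))) :
    ν = ν₁ ∧ η = η₁ ∧ η' = η₁' := by
  rw [flipHom_apply, flipHom_apply, smul_flipMatrix_eq, smul_flipMatrix_eq] at h
  obtain ⟨hB, hC, hD⟩ := endo_coeffs_of_connection_eq hq h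
  have hX : ∀ n : ℤ, (s : ℂ) ^ n ≠ 0 := fun n => zpow_ne_zero n s.ne_zero
  have hν : ∀ ν : ℤˣ, ((ν : ℤ) : ℂ) ≠ 0 := fun ν => Int.cast_ne_zero.2 ν.ne_zero
  have hi : ∀ η : ℤˣ, (s : ℂ) ^ (η : ℤ) * (s : ℂ) ^ (-(η : ℤ)) = 1 := fun η => by
    rw [← zpow_add₀ s.ne_zero, add_neg_cancel, zpow_zero]
  have key : ∀ a b y y₁ Y Y₁ : ℂ, y * Y = 1 → y₁ * Y₁ = 1 → a * y = b * y₁ → a * Y = b * Y₁ →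
      a * b * Y ^ 2 = a * b * Y₁ ^ 2 := by
    intro a b y y₁ Y Y₁ h1 h2 h3 h4
    have h5 : a * Y₁ = b * Y := by
      linear_combination Y * Y₁ * h3 - a * Y₁ * h1 + b * Y * h2
    linear_combination b * Y * h4 - b * Y₁ * h5
  have e' : η' = η₁' := by
    refine units_eq_of_zpow_sq_eq hq (mul_left_cancel₀ (mul_ne_zero (mul_ne_zero (hν ν) (hX (-(η : ℤ))))
      (mul_ne_zero (hν ν₁) (hX (-(η₁ : ℤ))))) ?_)
    exact key _ _ _ _ _ _ (hi η') (hi η₁') (by linear_combination -hB) (by linear_combination hD)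
  have e : η = η₁ := by
    refine units_eq_of_zpow_sq_eq hq (mul_left_cancel₀ (mul_ne_zero (mul_ne_zero (hν ν) (hX (-(η' : ℤ))))
      (mul_ne_zero (hν ν₁) (hX (-(η₁' : ℤ))))) ?_)
    exact key _ _ _ _ _ _ (hi η) (hi η₁) (by linear_combination -hC) (by linear_combination hD)
  subst e e'
  refine ⟨?_, rfl, rfl⟩
  have := mul_right_cancel₀ (mul_ne_zero (hX _) (hX _)) hD
  exact Units.ext (Int.cast_injective this)

/-- The compatible linear left connections on `Γ`. -/
theorem isLinearLeftConnection_and_isCliffordCompatible_iff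
    (hq : ∀ n : ℕ, 0 < n → ((s : ℂ) ^ 2) ^ n ≠ 1)
    {g : BimodHom (OSLq s) (GamTwo s ε) (OSLq s)} (hg : IsBicovariantSigmaMetric g)
    (nabla : Gam s ε →+ GamTwo s ε) :
    (IsLinearLeftConnection (diff s ε) nabla ∧
      IsCliffordCompatible (braiding s ε) g (diff s ε) nabla) ↔
    ∃ ν η η' : ℤˣ, ∀ ρ : Gam s ε, nabla ρ = btmul (OSLq s) (thetaInv s ε) ρ -
      flipHom s ε ν η η' (btmul (OSLq s) ρ (thetaInv s ε)) := by
  obtain ⟨κ, hκ⟩ := exists_metric_form hq g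
  constructor
  · rintro ⟨hn, hc⟩
    obtain ⟨A, B, C, D, h⟩ := exists_endo_of_connection hq hn
    obtain ⟨ν, η, η', hM⟩ := exists_flip_of_act hq (metric_scalar_ne_zero hg hκ) hκ
      (act_of_isCliffordCompatible _ diff_apply (closure_diff_eq_top hq) h hc)
    refine ⟨ν, η, η', fun ρ => ?_⟩
    rw [h, endoHom_apply, hM, flipHom_apply]
  · rintro ⟨ν, η, η', h⟩
    refine ⟨⟨isLeftConnection_of_inner diff_apply _ h, _, isConnectionFlip_of_inner diff_apply _ h⟩,
      isCliffordCompatible_of_act _ diff_apply (fun x hx z => ?_) h⟩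
    have hν : ((ν : ℤ) : ℂ) ^ 2 = 1 := by
      rcases Int.units_eq_one_or ν with rfl | rfl <;> simp
    rw [pairTwo_act_flip hq hκ (flipHom_apply ν η η') hx, hν, map_one, one_smul]

variable (s ε) in
/-- The connection `ρ ↦ θ ⊗ ρ - ν σ̃_{(η, η')}(ρ ⊗ θ)`. -/
def flipConnection (p : ℤˣ × ℤˣ × ℤˣ) : Gam s ε →+ GamTwo s ε :=
  AddMonoidHom.mk' (fun ρ => btmul (OSLq s) (thetaInv s ε) ρ -
    flipHom s ε p.1 p.2.1 p.2.2 (btmul (OSLq s) ρ (thetaInv s ε))) fun ρ ρ' => by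
      rw [btmul_add_left, btmul_add_right, map_add]
      abel

theorem flipConnection_injective (hq : ∀ n : ℕ, 0 < n → ((s : ℂ) ^ 2) ^ n ≠ 1) :
    Function.Injective (flipConnection s ε) := by
  rintro ⟨ν, η, η'⟩ ⟨ν₁, η₁, η₁'⟩ h
  obtain ⟨rfl, rfl, rfl⟩ := flip_params_eq hq (sub_right_injective (DFunLike.congr_fun h (theta s ε (1, 0))))
  rfl

theorem ncard_compatible_connections (hq : ∀ n : ℕ, 0 < n → ((s : ℂ) ^ 2) ^ n ≠ 1)
    {g : BimodHom (OSLq s) (GamTwo s ε) (OSLq s)} (hg : IsBicovariantSigmaMetric g) :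
    {nabla : Gam s ε →+ GamTwo s ε | IsLinearLeftConnection (diff s ε) nabla ∧
      IsCliffordCompatible (braiding s ε) g (diff s ε) nabla}.ncard = 8 := by
  have e : {nabla : Gam s ε →+ GamTwo s ε | IsLinearLeftConnection (diff s ε) nabla ∧
      IsCliffordCompatible (braiding s ε) g (diff s ε) nabla} =
      flipConnection s ε '' Set.univ := by
    ext nabla
    rw [Set.mem_ofPred_eq, isLinearLeftConnection_and_isCliffordCompatible_iff hq hg, Set.image_univ]
    constructor
    · rintro ⟨ν, η, η', h⟩
      exact ⟨(ν, η, η'), AddMonoidHom.ext fun ρ => (h ρ).symm⟩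
    · rintro ⟨⟨ν, η, η'⟩, rfl⟩
      exact ⟨ν, η, η', fun ρ => rfl⟩
  rw [e, Set.ncard_image_of_injective _ (flipConnection_injective hq), Set.ncard_univ,
    Nat.card_prod, Nat.card_prod, Nat.card_eq_fintype_card, Fintype.card_units_int]

end Main
end QClifford

theorem mainTheorem9 (s : ℂˣ) (hq : ∀ n : ℕ, 0 < n → ((s : ℂ) ^ 2) ^ n ≠ 1) (ε : ℤˣ)
    (g : QClifford.BimodHom (QClifford.OSLq s) (QClifford.GamTwo s ε) (QClifford.OSLq s))
    (hg : QClifford.IsBicovariantSigmaMetric g) :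
    {nabla : QClifford.Gam s ε →+ QClifford.GamTwo s ε |
        QClifford.IsLinearLeftConnection (QClifford.diff s ε) nabla ∧
        QClifford.IsCliffordCompatible (QClifford.braiding s ε) g
          (QClifford.diff s ε) nabla}.ncard = 8 ∧
    (∀ nabla : QClifford.Gam s ε →+ QClifford.GamTwo s ε,
      (QClifford.IsLinearLeftConnection (QClifford.diff s ε) nabla ∧
        QClifford.IsCliffordCompatible (QClifford.braiding s ε) g
          (QClifford.diff s ε) nabla) ↔
      ∃ ν η η' : ℤˣ, ∀ ρ : QClifford.Gam s ε,
        nabla ρ = QClifford.btmul (QClifford.OSLq s) (QClifford.thetaInv s ε) ρ -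
          (ν : ℤ) • QClifford.sigmaTilde s ε η η'
            (QClifford.btmul (QClifford.OSLq s) ρ (QClifford.thetaInv s ε))) ∧
    (∀ ν η η' : ℤˣ, ∃ τ : QClifford.BimodHom (QClifford.OSLq s) (QClifford.GamTwo s ε)
        (QClifford.GamTwo s ε),
      (∀ x, τ x = (ν : ℤ) • QClifford.sigmaTilde s ε η η' x) ∧
      ∀ nabla : QClifford.Gam s ε →+ QClifford.GamTwo s ε,
        (∀ ρ : QClifford.Gam s ε,
          nabla ρ = QClifford.btmul (QClifford.OSLq s) (QClifford.thetaInv s ε) ρ -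
            τ (QClifford.btmul (QClifford.OSLq s) ρ (QClifford.thetaInv s ε))) →
        QClifford.IsConnectionFlip (QClifford.diff s ε) nabla τ) := by
  refine ⟨QClifford.ncard_compatible_connections hq hg, fun nabla => ?_, fun ν η η' =>
    ⟨QClifford.flipHom s ε ν η η', QClifford.flipHom_eq_smul_sigmaTilde ν η η', fun nabla h =>
      QClifford.isConnectionFlip_of_inner QClifford.diff_apply _ h⟩⟩
  simp only [QClifford.isLinearLeftConnection_and_isCliffordCompatible_iff hq hg,
    QClifford.flipHom_eq_smul_sigmaTilde]
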